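/- **Setting.** Let $\rho,m\ge 1$ and let $R=R_{(1)}\times\cdots\times R_{(\rho)}$, where each $R_{(j)}$ is a finite commutative local ring (every nonzero finite commutative ring is of this form up to isomorphism). Let $S_{(j)}=R_{(j)}[X]/(g_{(j)})$, with $g_{(j)}$ monic of degree $m$ and irreducible over the residue field, be a Galois extension of $R_{(j)}$ of dimension $m$, and let $S=S_{(1)}\times\cdots\times S_{(\rho)}$. Let $R_{0(j)}$ be a maximal Galois subring of $R_{(j)}$: if $R_{(j)}$ has characteristic $p^{s}$ and residue field of cardinality $p^{d}$, then $R_{0(j)}\cong(\mathbb Z/p^{s})[X]/(h)$ with $h$ monic of degree $d$ and irreducible modulo $p$. For a module $M$ over a ring $A$, $rk_A(M)$ is the least number of generators of $M$ and $frk_A(M)$ is the maximal rank of a free submodule of $M$. Put $\gamma_{(j)}=rk_{R_{0(j)}}(R_{(j)})$ and fix a decomposition $R_{(j)}=R_{0(j)}z_{1}\oplus\cdots\oplus R_{0(j)}z_{\gamma_{(j)}}$. **Code.** Let $0<k<n$ and $\lambda>0$. Let $\mathcal F\subseteq S$ be a free $R$-submodule with basis $f_1,\dots,f_\lambda$, and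 let $H\in S^{(n-k)\times n}$ be a matrix whose row module has free rank $n-k$ over $S$ and whose entries generate the $R$-module $\mathcal F$; $H$ is the parity-check matrix of a low-rank parity-check code over $S$. Let $r\in S^n$ be an arbitrary received word. **Algorithm 1 (local case, $\rho=1$).** Input $H$, $f_1,\dots,f_\lambda$, $r$. Let $s=rH^{T}$. If $s=0$, return $r$. Let $\mathcal S\subseteq S$ be the $R$-module generated by the entries of $s$. If $\mathcal S$ is not free, return "decoding failure". Let $\nu=frk_R(\mathcal S)$. If $\lambda\nmid\nu$, return "decoding failure". Let $t'=\nu/\lambda$ and $\mathcal E'=\bigcap_{i=1}^{\lambda}f_i^{-1}\mathcal S$. If $\mathcal E'$ is not free, or $frk_R(\mathcal E')\ne t'$, or $frk_R(\mathcal E'\mathcal F)\neq\nu$, return "decoding failure". If there is $e'\in S^n$ whose entries generate the $R$-module $\mathcal E'$ and which satisfies $He'^{T}=s^{T}$, return $r-e'$ for such an $e'$ (any one, if there are several); otherwise return "decoding failure". **Algorithm 2 (general case).** Apply Algorithm 1 to the $j$-th components of $H$, of $f_1,\dots,f_\lambda$ and of $r$, for $j=1,\dots,\rho$. If none of these calls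 fails, return the word of $S^n$ whose $j$-th component is the word returned by the $j$-th call, for all $j$; otherwise return "decoding failure". **Complexity measure.** Elements of $S_{(j)}$ are given by their coordinates in $R_{(j)}$ with respect to the powers $1,\theta,\dots,\theta^{m-1}$ of the class $\theta$ of $X$, and the input includes the integers $n,k,m,\lambda,\gamma_{(j)}$, the coefficients of $g_{(j)}$, the elements $z_i$ and generators of their annihilators in $R_{0(j)}$. Operations of cost $1$ are: addition, subtraction, multiplication, inversion of a unit (which returns $0$ on a non-unit) and test for zero in $R_{(j)}$; storing an element of $R_{(j)}$; looking up one of the (precomputed) coordinates $a_i\in R_{0(j)}$ in $a=a_1z_1+\cdots+a_{\gamma_{(j)}}z_{\gamma_{(j)}}$; and, in $R_{0(j)}$, division $a/b$ for $b\mid a$ (which returns $0$ if $b\nmid a$) and a generator of the annihilator of an element. Integer bookkeeping (indices, loops) is not counted. **Theorem.** Algorithm 2 has complexity $$\mathcal O\Bigl(\rho\,\lambda\, m\, n\,\max\{n^2,m^2\}\,\max_{1\le j\le\rho}\gamma_{(j)}^{4}\Bigr)$$ operations in the rings $R_{(j)}$. More precisely, there are one program for the local decoder, independent of the rings and of all parameters,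 and an absolute constant $C$, such that for all data as above, running the program on the $\rho$ components of the input yields a result that Algorithm 2 may return, and the total number of operations is at most $C\,\rho\,\lambda\, m\, n\,\max\{n^2,m^2\}\,\max_{j}\gamma_{(j)}^{4}$. -/

import Mathlib

open Polynomial

/-! ### Rank, free rank, Galois subrings and Galois extensions -/

/-- `rk_R(M)`: the smallest number of elements that generate `M` as an `R`-module. -/
noncomputable def moduleRank (R M : Type*) [CommRing R] [AddCommGroup M] [Module R M] : ℕ :=
  (⊤ : Submodule R M).spanFinrank

/-- `frk_R(M)`: the maximum of the ranks of the free `R`-submodules of `M`. -/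
noncomputable def freeRank (R M : Type*) [CommRing R] [AddCommGroup M] [Module R M] : ℕ :=
  sSup {d | ∃ N : Submodule R M, Module.Free R N ∧ Module.finrank R N = d}

/-- `R₀` is a maximal Galois subring of the finite local ring `R`: if `R` has characteristic `p ^ s`
and residue field of cardinality `p ^ d`, then `R₀` is isomorphic to `(ℤ / p ^ s)[X] / (h)` with
`h` monic of degree `d` and irreducible modulo `p`. (The polynomial is written over `ℤ`.) -/
def IsMaximalGaloisSubring {R : Type*} [CommRing R] [IsLocalRing R] (R₀ : Subring R) : Prop :=
  ∃ (p s d : ℕ) (h : ℤ[X]), p.Prime ∧ CharP R (p ^ s) ∧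
    Nat.card (IsLocalRing.ResidueField R) = p ^ d ∧
    h.Monic ∧ h.natDegree = d ∧ Irreducible (h.map (Int.castRingHom (ZMod p))) ∧
    Nonempty (R₀ ≃+* AdjoinRoot (h.map (Int.castRingHom (ZMod (p ^ s)))))

/-- A maximal Galois subring `R₀` of `R` together with a decomposition
`R = R₀ z₁ ⊕ ⋯ ⊕ R₀ z_γ`, where `γ = rk_{R₀}(R)`. -/
structure GaloisFrame (R : Type*) [CommRing R] [IsLocalRing R] where
  base : Subring R
  isMaximal : IsMaximalGaloisSubring base
  z : Fin (moduleRank base R) → R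
  isInternal : DirectSum.IsInternal fun i => Submodule.span base {z i}

/-- `γ = rk_{R₀}(R)`. -/
noncomputable def GaloisFrame.gamma {R : Type*} [CommRing R] [IsLocalRing R]
    (G : GaloisFrame R) : ℕ :=
  moduleRank G.base R

/-- A Galois extension of dimension `m` of the finite local ring `R`, presented as `R[X] / (g)` with
`g` monic of degree `m` and irreducible over the residue field. -/
structure GaloisExtension (R : Type*) [CommRing R] [IsLocalRing R] (m : ℕ) where
  g : R[X]
  monic : g.Monic
  natDegree_eq : g.natDegree = m
  irreducible : Irreducible (g.map (IsLocalRing.residue R))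

/-- The ring `S = R[X] / (g)` itself. -/
abbrev GaloisExtension.Ext {R : Type*} [CommRing R] [IsLocalRing R] {m : ℕ}
    (E : GaloisExtension R m) : Type _ :=
  AdjoinRoot E.g

/-- The coordinate of `x ∈ S` at `θ ^ c`, for the `R`-basis `1, θ, …, θ ^ (m - 1)` of `S`
(it is `0` for `c ≥ m`). -/
noncomputable def GaloisExtension.coord {R : Type*} [CommRing R] [IsLocalRing R] {m : ℕ}
    (E : GaloisExtension R m) (x : E.Ext) (c : ℕ) : R :=
  (AdjoinRoot.modByMonicHom E.monic x).coeff c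

/-- The element of `S` with given coordinates. -/
noncomputable def GaloisExtension.ofCoord {R : Type*} [CommRing R] [IsLocalRing R] {m : ℕ}
    (E : GaloisExtension R m) (a : ℕ → R) : E.Ext :=
  ∑ c ∈ Finset.range m, AdjoinRoot.of E.g (a c) * AdjoinRoot.root E.g ^ c

/-! ### Low-rank parity-check codes and the decoding algorithms -/

/-- The `R`-submodule `𝓕` of `S` generated by the entries of `H`. -/
def entrySpan (R : Type*) {S ι κ : Type*} [CommRing R] [CommRing S] [Module R S]
    (H : Matrix ι κ S) : Submodule R S :=
  Submodule.span R {x | ∃ i j, H i j = x}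

/-- `H ∈ S^((n-k)×n)` is the parity-check matrix of a low-rank parity-check code with parameters
`k`, `n`, `lam` over `R ⊆ S`: its row module has free rank `n - k`, and its entries generate a free
`R`-module `𝓕` of rank `lam`, of which `f` is a basis. -/
def IsLRPC (R : Type*) {S : Type*} [CommRing R] [CommRing S] [Module R S] {k n lam : ℕ}
    (H : Matrix (Fin (n - k)) (Fin n) S) (f : Fin lam → S) : Prop :=
  0 < k ∧ k < n ∧ 0 < lam ∧
  freeRank S (Submodule.span S (Set.range fun i => H i)) = n - k ∧
  LinearIndependent R f ∧ Submodule.span R (Set.range f) = entrySpan R H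

/-- The support of a vector: the `R`-submodule of `S` generated by its entries. -/
def supp (R : Type*) {S ι : Type*} [CommRing R] [CommRing S] [Module R S] (u : ι → S) :
    Submodule R S :=
  Submodule.span R (Set.range u)

/-- `a⁻¹ N` for a submodule `N` of `S`. -/
noncomputable def invMul {R S : Type*} [CommRing R] [CommRing S] [Algebra R S] (a : S)
    (N : Submodule R S) : Submodule R S :=
  N.map (LinearMap.mulLeft R (Ring.inverse a))

open Classical in
/-- The decoding algorithm over a local ring: the set of the results that it may return on the input
`H`, `f`, `r`, where `none` stands for "decoding failure". The set has exactly one element, except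
that if the erasure equation has several solutions, any of them may be used. -/
noncomputable def localDecoder (R : Type*) {S : Type*} [CommRing R] [CommRing S] [Algebra R S]
    {l n lam : ℕ} (H : Matrix (Fin l) (Fin n) S) (f : Fin lam → S) (r : Fin n → S) :
    Set (Option (Fin n → S)) :=
  let s : Fin l → S := H.mulVec r
  if s = 0 then {some r}
  else
    let Syn : Submodule R S := supp R s
    if ¬ Module.Free R Syn then {none}
    else
      let nu := freeRank R Syn
      if ¬ lam ∣ nu then {none}
      else
        let t := nu / lam
        let E : Submodule R S := ⨅ i, invMul (f i) Syn
        if ¬ Module.Free R E then {none}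
        else if freeRank R E ≠ t ∨ freeRank R (E * entrySpan R H : Submodule R S) ≠ nu then {none}
        else if ∃ e : Fin n → S, supp R e = E ∧ H.mulVec e = s then
          {out | ∃ e : Fin n → S, supp R e = E ∧ H.mulVec e = s ∧ out = some (r - e)}
        else {none}

/-- The decoding algorithm over `S = S₁ × ⋯ × S_ρ`: the local decoder is applied to every component;
if none of these calls fails, the result is the word whose components they return, and otherwise it
is "decoding failure". -/
noncomputable def productDecoder {rho : ℕ} (R S : Fin rho → Type*) [∀ j, CommRing (R j)]
    [∀ j, CommRing (S j)] [∀ j, Algebra (R j) (S j)] {l n lam : ℕ}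
    (H : Matrix (Fin l) (Fin n) (∀ j, S j)) (f : Fin lam → ∀ j, S j) (r : Fin n → ∀ j, S j) :
    Set (Option (Fin n → ∀ j, S j)) :=
  {out |
    (∃ c : Fin n → ∀ j, S j, out = some c ∧
      ∀ j, some (fun i => c i j) ∈
        localDecoder (R j) (H.map fun x => x j) (fun i => f i j) (fun i => r i j)) ∨
    (out = none ∧
      ∃ j, none ∈ localDecoder (R j) (H.map fun x => x j) (fun i => f i j) (fun i => r i j))}

/-! ### Programs over a finite local ring, and the number of ring operations they use

A program has integer arrays `x[i]` and arrays `a[i, j, l]` of elements of `R`, both with names in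
`ℕ`. It is written once and for all: it depends neither on the ring nor on the size of the input. -/

/-- Integer expressions; `sub` and `div` are truncated. -/
inductive IntExp : Type
  | lit (c : ℕ)
  | get (x : ℕ) (i : IntExp)
  | add (a b : IntExp)
  | sub (a b : IntExp)
  | mul (a b : IntExp)
  | div (a b : IntExp)

/-- Ring expressions: array entries, `0`, `1`, and the operations addition, subtraction,
multiplication, inversion of a unit, `R₀`-coordinate, quotient in `R₀`, annihilator in `R₀`. -/
inductive RingExp : Type
  | get (a : ℕ) (i j l : IntExp)
  | zero
  | one
  | add (a b : RingExp)
  | sub (a b : RingExp)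
  | mul (a b : RingExp)
  | inv (a : RingExp)
  | coord (i : IntExp) (a : RingExp)
  | quo (a b : RingExp)
  | ann (a : RingExp)

/-- Programs.
`setInt x i e` is `x[i] := e`; `setRing a i j l e` is `a[i, j, l] := e`;
`testZero x i e` sets `x[i]` to `1` if `e = 0` and to `0` otherwise;
`branch a b P Q` is "if `a ≤ b` then `P` else `Q`";
`loop x e P` runs `P` with `x[0] = 0, 1, …, e - 1`. -/
inductive Prog : Type
  | skip
  | seq (P Q : Prog)
  | setInt (x : ℕ) (i e : IntExp)
  | setRing (a : ℕ) (i j l : IntExp) (e : RingExp)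
  | testZero (x : ℕ) (i : IntExp) (e : RingExp)
  | branch (a b : IntExp) (P Q : Prog)
  | loop (x : ℕ) (e : IntExp) (P : Prog)

/-- A memory state. -/
structure Memory (R : Type*) where
  int : ℕ → ℕ → ℕ
  ring : ℕ → ℕ → ℕ → ℕ → R

def Memory.setInt {R : Type*} (M : Memory R) (x i v : ℕ) : Memory R where
  int := fun x' i' => if x' = x ∧ i' = i then v else M.int x' i'
  ring := M.ring

open Classical in
noncomputable def Memory.setRing {R : Type*} (M : Memory R) (a i j l : ℕ) (v : R) : Memory R where
  int := M.int
  ring := fun a' i' j' l' =>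
    if a' = a ∧ i' = i ∧ j' = j ∧ l' = l then v else M.ring a' i' j' l'

/-- A finite vector, continued by zeros. -/
def pad {α : Type*} [Zero α] {d : ℕ} (v : Fin d → α) (i : ℕ) : α :=
  if h : i < d then v ⟨i, h⟩ else 0

namespace GaloisFrame

variable {R : Type*} [CommRing R] [IsLocalRing R] (G : GaloisFrame R)

/-- Precomputed coordinates: for every `a ∈ R`, elements `a₁, …, a_γ` of `R₀` with
`a = a₁ z₁ + ⋯ + a_γ z_γ`. -/
noncomputable def coords (a : R) : Fin (moduleRank G.base R) → G.base :=
  Classical.epsilon fun c => a = ∑ i, c i • G.z i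

open Classical in
/-- Division in `R₀`: for `a, b ∈ R₀` some `c ∈ R₀` with `a = b c`, if there is one. -/
noncomputable def quo (a b : R) : R :=
  if a ∈ G.base ∧ b ∈ G.base ∧ ∃ c ∈ G.base, a = b * c then
    Classical.epsilon fun c : R => c ∈ G.base ∧ a = b * c
  else 0

/-- A generator of the ideal `{c ∈ R₀ : c a = 0}` of `R₀`. -/
noncomputable def annGen (a : R) : G.base :=
  Classical.epsilon fun d : G.base => ∀ c : G.base, (c : R) * a = 0 ↔ d ∣ c

open Classical in
/-- Annihilators in `R₀`. -/
noncomputable def ann (a : R) : R :=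
  if a ∈ G.base then (G.annGen a : R) else 0

end GaloisFrame

/-- The value of an integer expression. -/
def IntExp.eval (M : ℕ → ℕ → ℕ) : IntExp → ℕ
  | lit c => c
  | get x i => M x (i.eval M)
  | add a b => a.eval M + b.eval M
  | sub a b => a.eval M - b.eval M
  | mul a b => a.eval M * b.eval M
  | div a b => a.eval M / b.eval M

/-- The value of a ring expression. -/
noncomputable def RingExp.eval {R : Type*} [CommRing R] [IsLocalRing R] (G : GaloisFrame R)
    (M : Memory R) : RingExp → R
  | get a i j l => M.ring a (i.eval M.int) (j.eval M.int) (l.eval M.int)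
  | zero => 0
  | one => 1
  | add a b => a.eval G M + b.eval G M
  | sub a b => a.eval G M - b.eval G M
  | mul a b => a.eval G M * b.eval G M
  | inv a => Ring.inverse (a.eval G M)
  | coord i a => pad (fun l => (G.coords (a.eval G M) l : R)) (i.eval M.int)
  | quo a b => G.quo (a.eval G M) (b.eval G M)
  | ann a => G.ann (a.eval G M)

/-- The number of ring operations in a ring expression. -/
def RingExp.ops : RingExp → ℕ
  | get _ _ _ _ => 0
  | zero => 0
  | one => 0
  | add a b => a.ops + b.ops + 1
  | sub a b => a.ops + b.ops + 1
  | mul a b => a.ops + b.ops + 1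
  | inv a => a.ops + 1
  | coord _ a => a.ops + 1
  | quo a b => a.ops + b.ops + 1
  | ann a => a.ops + 1

open Classical in
/-- Execution of a program: the final memory, and the cost. Every ring operation costs `1`; so do
every assignment to a ring array and every test for zero. Integer bookkeeping is free. -/
noncomputable def Prog.run {R : Type*} [CommRing R] [IsLocalRing R] (G : GaloisFrame R) :
    Prog → Memory R → Memory R × ℕ
  | skip, M => (M, 0)
  | seq P Q, M =>
      let A := P.run G M
      let B := Q.run G A.1
      (B.1, A.2 + B.2)
  | setInt x i e, M => (M.setInt x (i.eval M.int) (e.eval M.int), 0)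
  | setRing a i j l e, M =>
      (M.setRing a (i.eval M.int) (j.eval M.int) (l.eval M.int) (e.eval G M), e.ops + 1)
  | testZero x i e, M =>
      (M.setInt x (i.eval M.int) (if e.eval G M = 0 then 1 else 0), e.ops + 1)
  | branch a b P Q, M => if a.eval M.int ≤ b.eval M.int then P.run G M else Q.run G M
  | loop x e P, M =>
      Nat.rec (motive := fun _ => Memory R × ℕ) (M, 0)
        (fun i A =>
          let B := P.run G (A.1.setInt x 0 i)
          (B.1, A.2 + B.2))
        (e.eval M.int)

/-- The memory at the start. Integers: `n, k, m, lam, γ` in `0[0], …, 4[0]`.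
Ring arrays, with elements of `S` given by their coordinates: `0` the polynomial `g`,
`1` the matrix `H`, `2` the basis `f`, `3` the word `r`, `4` the elements `z₁, …, z_γ`,
`5` generators of their annihilators in `R₀`. Everything else is `0`. -/
noncomputable def inputMemory {R : Type*} [CommRing R] [IsLocalRing R] (G : GaloisFrame R)
    {m : ℕ} (E : GaloisExtension R m) {k n lam : ℕ}
    (H : Matrix (Fin (n - k)) (Fin n) E.Ext) (f : Fin lam → E.Ext) (r : Fin n → E.Ext) :
    Memory R where
  int := fun x i =>
    match x, i with
    | 0, 0 => n
    | 1, 0 => k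
    | 2, 0 => m
    | 3, 0 => lam
    | 4, 0 => G.gamma
    | _, _ => 0
  ring := fun a i j l =>
    match a, j with
    | 0, 0 => if i = 0 then E.g.coeff l else 0
    | 1, j => pad (fun i' => pad (fun j' => E.coord (H i' j')) j) i l
    | 2, 0 => pad (fun i' => E.coord (f i')) i l
    | 3, 0 => pad (fun i' => E.coord (r i')) i l
    | 4, 0 => if l = 0 then pad G.z i else 0
    | 5, 0 => if l = 0 then pad (fun i' => (G.annGen (G.z i') : R)) i else 0
    | _, _ => 0

section ProductExecution

variable {rho : ℕ} {R : Fin rho → Type*} [∀ j, CommRing (R j)] [∀ j, IsLocalRing (R j)]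

/-- The execution of `P` on the `j`-th component of the input `H`, `f`, `r`. -/
noncomputable def componentRun (P : Prog) (G : ∀ j, GaloisFrame (R j)) {m : ℕ}
    (E : ∀ j, GaloisExtension (R j) m) {k n lam : ℕ}
    (H : Matrix (Fin (n - k)) (Fin n) (∀ j, (E j).Ext)) (f : Fin lam → ∀ j, (E j).Ext)
    (r : Fin n → ∀ j, (E j).Ext) (j : Fin rho) : Memory (R j) × ℕ :=
  P.run (G j)
    (inputMemory (G j) (E j) (H.map fun x => x j) (fun i => f i j) (fun i => r i j))

open Classical in
/-- The result of running `P` on all components. A run ends with `5[0] = 1` if it is successful, and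
then has the coordinates of the word that it returns in the ring array `6`. -/
noncomputable def productResult (P : Prog) (G : ∀ j, GaloisFrame (R j)) {m : ℕ}
    (E : ∀ j, GaloisExtension (R j) m) {k n lam : ℕ}
    (H : Matrix (Fin (n - k)) (Fin n) (∀ j, (E j).Ext)) (f : Fin lam → ∀ j, (E j).Ext)
    (r : Fin n → ∀ j, (E j).Ext) : Option (Fin n → ∀ j, (E j).Ext) :=
  if ∀ j, (componentRun P G E H f r j).1.int 5 0 = 1 then
    some fun i j => (E j).ofCoord fun c => (componentRun P G E H f r j).1.ring 6 i 0 c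
  else none

/-- The total number of operations, in all the local rings `R j`. -/
noncomputable def productCost (P : Prog) (G : ∀ j, GaloisFrame (R j)) {m : ℕ}
    (E : ∀ j, GaloisExtension (R j) m) {k n lam : ℕ}
    (H : Matrix (Fin (n - k)) (Fin n) (∀ j, (E j).Ext)) (f : Fin lam → ∀ j, (E j).Ext)
    (r : Fin n → ∀ j, (E j).Ext) : ℕ :=
  ∑ j, (componentRun P G E H f r j).2

end ProductExecution

/-!
The decoder consists of linear algebra over a finite local ring `R`, and the point is that the two
forms of elimination that are available there suffice. An element of `S` is handled through its
coordinates, and the coordinates of a product come from the powers of `θ`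
(`GaloisExtension.coord_mul`).

*Elimination with unit pivots* (`Prog.run_eliminate`). In every row a unit entry is used as a pivot;
a row that has none is left without pivot, and its entries stay nonunits. This decides freeness. If
the module generated by the rows is free, then the rows without a pivot, being annihilated by the
socle of `R`, lie in `𝔪` times the module, so that by Nakayama's lemma they vanish
(`IsEliminated.free_span_iff`); the number of pivots is then the rank. Applied to the syndrome, this
treats the module `𝓢`, and additional rows are reduced modulo `𝓢` on the way
(`IsEliminated.sum_smul_mem_iff`). As the `f_b` are units
(`GaloisExtension.isUnit_of_linearIndependent`), `𝓔'` is the kernel of the map that sends `x` to the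
family of the `x f_b` modulo `𝓢`. The kernel of a matrix is found by elimination in the matrix,
extended by an identity matrix: comparing the sizes of socles shows that it is free only if the rows
without a pivot vanish on the left, and then their right parts form a basis `ε`
(`IsEliminated.eq_zero_of_kernel_free`, `IsEliminated.kernel_eq_span`).

*The equation of the error.* The condition on `frk(𝓔'𝓕)` says that the products `ε_a f_b` are
independent (`freeRank_span_eq_iff`), and then `𝓔'𝓕 = 𝓢` because both have the same cardinality
(`eq_of_le_of_finrank_eq`). With `e_j = ∑ Y a j ε_a`, the equation `H e = s` becomes a linear system
over `R` for each row of `Y`, with the same matrix for all rows (`sum_mul_eq_iff`).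

*Elimination over the Galois subring* (`Prog.run_baseEliminate`). Linear systems over `R` cannot be
solved with unit pivots. The subring `R₀` is a chain ring (`IsMaximalGaloisSubring.dvd_total`), and
since `R` is a direct sum of `γ` cyclic `R₀`-modules, there are `γ` linear forms `R → R₀` that
together are injective (`GaloisFrame.form`, `GaloisFrame.eq_zero_of_form`). A system with `n`
unknowns over `R` therefore amounts to one with `γ n` generators over `R₀` and with `γ` linear forms
for every equation. For every form, a generator whose value divides all the other values serves as
the pivot, and is then multiplied by the annihilator of its value (`IsFormReduced.step`). The result
is a particular solution, if there is any, and generators of the solutions of the homogeneous system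
(`solvable_iff`, `mem_of_kernel`).

*The support of the error.* The entries of `e` generate `𝓔'` if and only if the rows of `Y` are
independent over the residue field (`supp_eq_iff`). Solutions with this property are chosen
greedily: the candidates for a row are the particular solution, and its sums with one of the
generators of the homogeneous solutions. If all of them depend on the `a` rows that were chosen
before, then all the solutions of the first `a + 1` systems lie in a space of dimension `a` over the
residue field, so that no error exists (`IsGreedyFailure.not_residuallyIndependent`).

*The cost.* All loops run up to bounds computed from `n`, `k`, `m`, `λ`, `γ`, the free rank `q` of
`𝓔'` and the number of rows without a pivot, so that the cost is at most an expression in these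
numbers (`Prog.run_snd_le_costBound`). Each of its terms is at most a constant times
`λ m n max(n², m²) γ⁴` because `λ ≤ m`, `q ≤ m`, and `q λ ≤ n` when the error is looked for
(`Prog.HasSizes.mul_le_bound`).

Over a product of local rings, the hypotheses on the code pass to the components
(`linearIndependent_component`, `span_eq_entrySpan_component`), and both claims of the theorem
follow from those for the components.
-/

/-! ### Reasoning about programs -/

namespace IntExp

/-- The names of the integer arrays that an expression reads all satisfy `S`. -/
def readsOnly (S : ℕ → Bool) : IntExp → Bool
  | lit _ => true
  | get x i => S x && i.readsOnly S
  | add a b => a.readsOnly S && b.readsOnly S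
  | sub a b => a.readsOnly S && b.readsOnly S
  | mul a b => a.readsOnly S && b.readsOnly S
  | div a b => a.readsOnly S && b.readsOnly S

theorem eval_congr {S : ℕ → Bool} {M M' : ℕ → ℕ → ℕ} (h : ∀ v, S v = true → M v = M' v)
    (e : IntExp) (he : e.readsOnly S = true) : e.eval M = e.eval M' := by
  induction e with
  | lit c => rfl
  | get x i ih =>
    simp only [readsOnly, Bool.and_eq_true] at he
    simp only [eval, h x he.1, ih he.2]
  | _ a b iha ihb =>
    simp only [readsOnly, Bool.and_eq_true] at he
    simp only [eval, iha he.1, ihb he.2]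

instance : Add IntExp := ⟨add⟩
instance : Sub IntExp := ⟨sub⟩
instance : Mul IntExp := ⟨mul⟩
instance : Div IntExp := ⟨div⟩
instance (c : ℕ) : OfNat IntExp c := ⟨lit c⟩

@[simp] theorem eval_ofNat (M : ℕ → ℕ → ℕ) (c : ℕ) :
    eval M (no_index (OfNat.ofNat c : IntExp)) = c := rfl
@[simp] theorem eval_get (M : ℕ → ℕ → ℕ) (x : ℕ) (i : IntExp) :
    eval M (get x i) = M x (i.eval M) := rfl
@[simp] theorem eval_add (M : ℕ → ℕ → ℕ) (a b : IntExp) :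
    eval M (a + b) = a.eval M + b.eval M := rfl
@[simp] theorem eval_sub (M : ℕ → ℕ → ℕ) (a b : IntExp) :
    eval M (a - b) = a.eval M - b.eval M := rfl
@[simp] theorem eval_mul (M : ℕ → ℕ → ℕ) (a b : IntExp) :
    eval M (a * b) = a.eval M * b.eval M := rfl
@[simp] theorem eval_div (M : ℕ → ℕ → ℕ) (a b : IntExp) :
    eval M (a / b) = a.eval M / b.eval M := rfl

/-- The remainder of `a` modulo `b`. -/
def mod (a b : IntExp) : IntExp := a - a / b * b

@[simp] theorem eval_mod (M : ℕ → ℕ → ℕ) (a b : IntExp) :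
    eval M (a.mod b) = a.eval M % b.eval M := by
  simp only [mod, eval_sub, eval_mul, eval_div]
  rw [Nat.mod_eq_sub_div_mul]

end IntExp

/-- The integer variable `x`, which is the entry `x[0]`. -/
abbrev ivar (x : ℕ) : IntExp := IntExp.get x 0

namespace RingExp

instance : Add RingExp := ⟨add⟩
instance : Sub RingExp := ⟨sub⟩
instance : Mul RingExp := ⟨mul⟩
instance : Zero RingExp := ⟨zero⟩
instance : One RingExp := ⟨one⟩

@[simp] theorem ops_get (a : ℕ) (i j l : IntExp) : (get a i j l).ops = 0 := rfl
@[simp] theorem ops_zero : (0 : RingExp).ops = 0 := rfl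
@[simp] theorem ops_one : (1 : RingExp).ops = 0 := rfl
@[simp] theorem ops_add (a b : RingExp) : (a + b).ops = a.ops + b.ops + 1 := rfl
@[simp] theorem ops_sub (a b : RingExp) : (a - b).ops = a.ops + b.ops + 1 := rfl
@[simp] theorem ops_mul (a b : RingExp) : (a * b).ops = a.ops + b.ops + 1 := rfl

variable {R : Type*} [CommRing R] [IsLocalRing R] (G : GaloisFrame R) (M : Memory R)

@[simp] theorem eval_get (a : ℕ) (i j l : IntExp) :
    (get a i j l).eval G M = M.ring a (i.eval M.int) (j.eval M.int) (l.eval M.int) := rfl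
@[simp] theorem eval_zero : (0 : RingExp).eval G M = 0 := rfl
@[simp] theorem eval_one : (1 : RingExp).eval G M = 1 := rfl
@[simp] theorem eval_add (a b : RingExp) : (a + b).eval G M = a.eval G M + b.eval G M := rfl
@[simp] theorem eval_sub (a b : RingExp) : (a - b).eval G M = a.eval G M - b.eval G M := rfl
@[simp] theorem eval_mul (a b : RingExp) : (a * b).eval G M = a.eval G M * b.eval G M := rfl
@[simp] theorem eval_inv (a : RingExp) : (inv a).eval G M = Ring.inverse (a.eval G M) := rfl
@[simp] theorem eval_coord (i : IntExp) (a : RingExp) : (coord i a).eval G M =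
    pad (fun l => (G.coords (a.eval G M) l : R)) (i.eval M.int) := rfl
@[simp] theorem eval_quo (a b : RingExp) :
    (quo a b).eval G M = G.quo (a.eval G M) (b.eval G M) := rfl
@[simp] theorem eval_ann (a : RingExp) : (ann a).eval G M = G.ann (a.eval G M) := rfl

end RingExp

namespace Memory

variable {R : Type*}

theorem setInt_int (M : Memory R) (x i v x' i' : ℕ) :
    (M.setInt x i v).int x' i' = if x' = x ∧ i' = i then v else M.int x' i' := rfl

@[simp] theorem setInt_ring (M : Memory R) (x i v : ℕ) :
    (M.setInt x i v).ring = M.ring := rfl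

@[simp] theorem setRing_int (M : Memory R) (a i j l : ℕ) (v : R) :
    (M.setRing a i j l v).int = M.int := rfl

@[simp] theorem setInt_int_same (M : Memory R) (x i v : ℕ) :
    (M.setInt x i v).int x i = v := by simp [Memory.setInt_int]

theorem setInt_int_ne (M : Memory R) {x i v x' : ℕ} (h : x' ≠ x) :
    (M.setInt x i v).int x' = M.int x' := by
  funext i'; simp [Memory.setInt_int, h]

theorem setRing_ring_same (M : Memory R) (a i j l : ℕ) (v : R) :
    (M.setRing a i j l v).ring a i j l = v := by simp [Memory.setRing]

theorem setRing_ring_of_not (M : Memory R) {a i j l : ℕ} {v : R} {a' i' j' l' : ℕ}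
    (h : ¬ (a' = a ∧ i' = i ∧ j' = j ∧ l' = l)) :
    (M.setRing a i j l v).ring a' i' j' l' = M.ring a' i' j' l' := by
  simp only [Memory.setRing, if_neg h]

theorem setRing_ring_ne (M : Memory R) {a i j l : ℕ} {v : R} {a' : ℕ} (h : a' ≠ a) :
    (M.setRing a i j l v).ring a' = M.ring a' := by
  funext i' j' l'; exact M.setRing_ring_of_not fun h' => h h'.1

end Memory

namespace Prog

/-- Whether a program writes into the integer array `v`. -/
def writesInt (v : ℕ) : Prog → Bool
  | skip => false
  | seq P Q => P.writesInt v || Q.writesInt v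
  | setInt x _ _ => x == v
  | setRing _ _ _ _ _ => false
  | testZero x _ _ => x == v
  | branch _ _ P Q => P.writesInt v || Q.writesInt v
  | loop x _ P => x == v || P.writesInt v

/-- Whether a program writes into the ring array `b`. -/
def writesRing (b : ℕ) : Prog → Bool
  | skip => false
  | seq P Q => P.writesRing b || Q.writesRing b
  | setInt _ _ _ => false
  | setRing a _ _ _ _ => a == b
  | testZero _ _ _ => false
  | branch _ _ P Q => P.writesRing b || Q.writesRing b
  | loop _ _ P => P.writesRing b

/-- The integer arrays in which the sizes of the loops are kept. -/
def sizeName (v : ℕ) : Bool := decide (v < 12) && v != 5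

/-- All the bounds of the loops are computed from sizes, and the program does not write sizes. -/
def static : Prog → Bool
  | skip => true
  | seq P Q => P.static && Q.static
  | setInt x _ _ => !sizeName x
  | setRing _ _ _ _ _ => true
  | testZero x _ _ => !sizeName x
  | branch _ _ P Q => P.static && Q.static
  | loop x e P => !sizeName x && e.readsOnly sizeName && P.static

/-- An upper bound for the cost of a static program. -/
def costBound (s : ℕ → ℕ → ℕ) : Prog → ℕ
  | skip => 0
  | seq P Q => P.costBound s + Q.costBound s
  | setInt _ _ _ => 0
  | setRing _ _ _ _ e => e.ops + 1
  | testZero _ _ e => e.ops + 1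
  | branch _ _ P Q => P.costBound s + Q.costBound s
  | loop _ e P => e.eval s * P.costBound s

variable {R : Type*} [CommRing R] [IsLocalRing R] (G : GaloisFrame R)

@[simp] theorem run_seq_fst (P Q : Prog) (M : Memory R) :
    ((seq P Q).run G M).1 = (Q.run G (P.run G M).1).1 := rfl

@[simp] theorem run_seq_snd (P Q : Prog) (M : Memory R) :
    ((seq P Q).run G M).2 = (P.run G M).2 + (Q.run G (P.run G M).1).2 := rfl

theorem run_setInt (x : ℕ) (i e : IntExp) (M : Memory R) :
    ((setInt x i e).run G M).1 = M.setInt x (i.eval M.int) (e.eval M.int) := rfl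

theorem run_setRing (a : ℕ) (i j l : IntExp) (e : RingExp) (M : Memory R) :
    ((setRing a i j l e).run G M).1 =
      M.setRing a (i.eval M.int) (j.eval M.int) (l.eval M.int) (e.eval G M) := rfl

open Classical in
theorem run_testZero (x : ℕ) (i : IntExp) (e : RingExp) (M : Memory R) :
    ((testZero x i e).run G M).1 =
      M.setInt x (i.eval M.int) (if e.eval G M = 0 then 1 else 0) := rfl

theorem run_branch_pos {a b : IntExp} {P Q : Prog} {M : Memory R}
    (h : a.eval M.int ≤ b.eval M.int) : (branch a b P Q).run G M = P.run G M := by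
  simp only [run, if_pos h]

theorem run_branch_neg {a b : IntExp} {P Q : Prog} {M : Memory R}
    (h : ¬ a.eval M.int ≤ b.eval M.int) : (branch a b P Q).run G M = Q.run G M := by
  simp only [run, if_neg h]

/-- The rule of loop invariants, for the memory and the cost together. -/
theorem run_loop_induction (I : ℕ → Memory R × ℕ → Prop) {x : ℕ} {e : IntExp} {P : Prog}
    {M : Memory R} (h0 : I 0 (M, 0))
    (hs : ∀ i < e.eval M.int, ∀ A : Memory R × ℕ, I i A →
      I (i + 1) ((P.run G (A.1.setInt x 0 i)).1, A.2 + (P.run G (A.1.setInt x 0 i)).2)) :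
    I (e.eval M.int) ((loop x e P).run G M) := by
  simp only [run]
  suffices h : ∀ N ≤ e.eval M.int, I N (Nat.rec (motive := fun _ => Memory R × ℕ) (M, 0)
      (fun i A => ((P.run G (A.1.setInt x 0 i)).1, A.2 + (P.run G (A.1.setInt x 0 i)).2)) N) from
    h _ le_rfl
  intro N
  induction N with
  | zero => exact fun _ => h0
  | succ N ih => exact fun hN => hs N (by omega) _ (ih (by omega))

theorem run_loop_invariant (I : ℕ → Memory R → Prop) {x : ℕ} {e : IntExp} {P : Prog}
    {M : Memory R} (N : ℕ) (hN : e.eval M.int = N) (h0 : I 0 M)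
    (hs : ∀ i < N, ∀ M' : Memory R, I i M' → I (i + 1) (P.run G (M'.setInt x 0 i)).1) :
    I N ((loop x e P).run G M).1 := by
  subst hN
  exact run_loop_induction G (fun i A => I i A.1) h0 fun i hi A hA => hs i hi A.1 hA

theorem run_int (P : Prog) (M : Memory R) {v : ℕ} (h : P.writesInt v = false) :
    (P.run G M).1.int v = M.int v := by
  induction P generalizing M with
  | skip => rfl
  | seq P Q ihP ihQ =>
    simp only [writesInt, Bool.or_eq_false_iff] at h
    rw [run_seq_fst, ihQ _ h.2, ihP _ h.1]
  | setInt x i e =>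
    simp only [writesInt, beq_eq_false_iff_ne] at h
    exact M.setInt_int_ne h.symm
  | setRing a i j l e => rfl
  | testZero x i e =>
    simp only [writesInt, beq_eq_false_iff_ne] at h
    exact M.setInt_int_ne h.symm
  | branch a b P Q ihP ihQ =>
    simp only [writesInt, Bool.or_eq_false_iff] at h
    simp only [run]
    split
    · exact ihP _ h.1
    · exact ihQ _ h.2
  | loop x e P ih =>
    simp only [writesInt, Bool.or_eq_false_iff, beq_eq_false_iff_ne] at h
    refine run_loop_invariant G (fun _ M' => M'.int v = M.int v) _ rfl rfl ?_
    intro i _ M' hM'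
    rw [ih _ h.2, M'.setInt_int_ne h.1.symm, hM']

theorem run_ring (P : Prog) (M : Memory R) {b : ℕ} (h : P.writesRing b = false) :
    (P.run G M).1.ring b = M.ring b := by
  induction P generalizing M with
  | skip => rfl
  | seq P Q ihP ihQ =>
    simp only [writesRing, Bool.or_eq_false_iff] at h
    rw [run_seq_fst, ihQ _ h.2, ihP _ h.1]
  | setInt x i e => rfl
  | setRing a i j l e =>
    simp only [writesRing, beq_eq_false_iff_ne] at h
    exact M.setRing_ring_ne h.symm
  | testZero x i e => rfl
  | branch a b P Q ihP ihQ =>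
    simp only [writesRing, Bool.or_eq_false_iff] at h
    simp only [run]
    split
    · exact ihP _ h.1
    · exact ihQ _ h.2
  | loop x e P ih =>
    simp only [writesRing] at h
    refine run_loop_invariant G (fun _ M' => M'.ring b = M.ring b) _ rfl rfl ?_
    intro i _ M' hM'
    rw [ih _ h, Memory.setInt_ring, hM']

/-- A static program does not change the sizes, and its cost is at most the bound that is computed
from the sizes at the start. -/
theorem run_snd_le_costBound (P : Prog) (hP : P.static = true) {s : ℕ → ℕ → ℕ} (M : Memory R)
    (hM : ∀ v, sizeName v = true → M.int v = s v) :
    (∀ v, sizeName v = true → (P.run G M).1.int v = s v) ∧ (P.run G M).2 ≤ P.costBound s := by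
  induction P generalizing M with
  | skip => exact ⟨hM, le_rfl⟩
  | seq P Q ihP ihQ =>
    simp only [static, Bool.and_eq_true] at hP
    have h1 := ihP hP.1 M hM
    have h2 := ihQ hP.2 _ h1.1
    exact ⟨h2.1, add_le_add h1.2 h2.2⟩
  | setInt x i e =>
    simp only [static, Bool.not_eq_true'] at hP
    refine ⟨fun v hv => ?_, le_rfl⟩
    rw [run_setInt, M.setInt_int_ne (by rintro rfl; simp_all), hM v hv]
  | setRing a i j l e => exact ⟨hM, le_rfl⟩
  | testZero x i e =>
    simp only [static, Bool.not_eq_true'] at hP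
    refine ⟨fun v hv => ?_, le_rfl⟩
    rw [run_testZero, M.setInt_int_ne (by rintro rfl; simp_all), hM v hv]
  | branch a b P Q ihP ihQ =>
    simp only [static, Bool.and_eq_true] at hP
    simp only [run, costBound]
    split
    · exact ⟨(ihP hP.1 M hM).1, (ihP hP.1 M hM).2.trans (Nat.le_add_right _ _)⟩
    · exact ⟨(ihQ hP.2 M hM).1, (ihQ hP.2 M hM).2.trans (Nat.le_add_left _ _)⟩
  | loop x e P ih =>
    simp only [static, Bool.and_eq_true, Bool.not_eq_true'] at hP
    have he : e.eval M.int = e.eval s := IntExp.eval_congr hM e hP.1.2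
    have := run_loop_induction G (x := x) (e := e) (P := P) (M := M)
      (fun i A => (∀ v, sizeName v = true → A.1.int v = s v) ∧ A.2 ≤ i * P.costBound s)
      ⟨hM, by simp⟩ ?_
    · rw [he] at this
      exact this
    · intro i _ A hA
      have h1 : ∀ v, sizeName v = true → (A.1.setInt x 0 i).int v = s v := by
        intro v hv
        rw [A.1.setInt_int_ne (by rintro rfl; simp_all), hA.1 v hv]
      have h2 := ih hP.2 _ h1
      refine ⟨h2.1, ?_⟩
      rw [Nat.succ_mul]
      exact add_le_add hA.2 h2.2

/-! ### Array assignments and searches -/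

/-- The array assignment `a[x + I, J, y + O] := e`, for all `x < n₁` and `y < n₂`. The expressions
refer to `x` and `y` as the variables `30` and `31`. -/
def fill (a : ℕ) (I J O n₁ n₂ : IntExp) (e : RingExp) : Prog :=
  loop 30 n₁ (loop 31 n₂ (setRing a (ivar 30 + I) J (ivar 31 + O) e))

/-- An array assignment has the effect of a simultaneous assignment, if its right hand side does not
use other entries of the slice that is overwritten. -/
theorem run_fill (M : Memory R) {a : ℕ} {I J O n₁ n₂ : IntExp} {e : RingExp}
    (i₀ j₀ o₀ N₁ N₂ : ℕ) (V : ℕ → ℕ → R)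
    (hc : ∀ s : ℕ → ℕ → ℕ, (∀ v, v ≠ 30 → v ≠ 31 → s v = M.int v) →
      I.eval s = i₀ ∧ J.eval s = j₀ ∧ O.eval s = o₀ ∧ n₁.eval s = N₁ ∧ n₂.eval s = N₂)
    (hV : ∀ x < N₁, ∀ y < N₂, ∀ M' : Memory R, (∀ v, v ≠ 30 → v ≠ 31 → M'.int v = M.int v) →
      M'.int 30 0 = x → M'.int 31 0 = y → (∀ b, b ≠ a → M'.ring b = M.ring b) →
      (∀ x' j' l', j' ≠ j₀ ∨ l' < o₀ → M'.ring a x' j' l' = M.ring a x' j' l') →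
      M'.ring a (x + i₀) j₀ (y + o₀) = M.ring a (x + i₀) j₀ (y + o₀) → e.eval G M' = V x y) :
    (∀ x < N₁, ∀ y < N₂,
      ((fill a I J O n₁ n₂ e).run G M).1.ring a (x + i₀) j₀ (y + o₀) = V x y) ∧
    (∀ x' j' l', ¬ (j' = j₀ ∧ i₀ ≤ x' ∧ x' < N₁ + i₀ ∧ o₀ ≤ l' ∧ l' < N₂ + o₀) →
      ((fill a I J O n₁ n₂ e).run G M).1.ring a x' j' l' = M.ring a x' j' l') := by
  -- the entries before position `(X, Y)` in reading order have been assigned, the others not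
  let Inv : ℕ → ℕ → Memory R → Prop := fun X Y M' =>
    (∀ v, v ≠ 30 → v ≠ 31 → M'.int v = M.int v) ∧ (∀ b, b ≠ a → M'.ring b = M.ring b) ∧
    (∀ x < N₁, ∀ y < N₂, (x < X ∨ x = X ∧ y < Y) → M'.ring a (x + i₀) j₀ (y + o₀) = V x y) ∧
    (∀ x' j' l', ¬ (j' = j₀ ∧ i₀ ≤ x' ∧ x' < N₁ + i₀ ∧ o₀ ≤ l' ∧ l' < N₂ + o₀ ∧
        (x' < X + i₀ ∨ x' = X + i₀ ∧ l' < Y + o₀)) →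
      M'.ring a x' j' l' = M.ring a x' j' l')
  have key : Inv N₁ 0 ((fill a I J O n₁ n₂ e).run G M).1 := by
    refine run_loop_invariant G (fun X M' => Inv X 0 M') N₁ (hc _ fun _ _ _ => rfl).2.2.2.1 ?_ ?_
    · exact ⟨fun _ _ _ => rfl, fun _ _ => rfl, fun x _ y _ h => by omega, fun _ _ _ _ => rfl⟩
    · intro X hX M1 h1
      have h2 : Inv X N₂ ((loop 31 n₂ (setRing a (ivar 30 + I) J (ivar 31 + O) e)).run G
          (M1.setInt 30 0 X)).1 ∧ ((loop 31 n₂ (setRing a (ivar 30 + I) J (ivar 31 + O) e)).run G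
          (M1.setInt 30 0 X)).1.int 30 0 = X := by
        refine run_loop_invariant G (fun Y M' => Inv X Y M' ∧ M'.int 30 0 = X) N₂
          (hc _ fun v h30 h31 => ?_).2.2.2.2 ?_ ?_
        · rw [Memory.setInt_int_ne _ h30, h1.1 v h30 h31]
        · refine ⟨⟨fun v h30 h31 => ?_, h1.2.1, h1.2.2.1, h1.2.2.2⟩, by simp⟩
          rw [Memory.setInt_int_ne _ h30, h1.1 v h30 h31]
        · intro Y hY M2 ⟨h2, hX2⟩
          have hs : ∀ v, v ≠ 30 → v ≠ 31 → (M2.setInt 31 0 Y).int v = M.int v := by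
            intro v h30 h31
            rw [Memory.setInt_int_ne _ h31, h2.1 v h30 h31]
          have h30 : (M2.setInt 31 0 Y).int 30 0 = X := by
            rw [Memory.setInt_int_ne _ (by decide), hX2]
          obtain ⟨eI, eJ, eO, -, -⟩ := hc _ hs
          have hval := hV X hX Y hY (M2.setInt 31 0 Y) hs h30 (by simp) h2.2.1
            (fun x' j' l' h => h2.2.2.2 x' j' l' (by omega)) (h2.2.2.2 _ _ _ (by omega))
          rw [run_setRing]
          simp only [IntExp.eval_add, IntExp.eval_get, IntExp.eval_ofNat, eI, eJ, eO, h30, hval,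
            Memory.setInt_int_same]
          refine ⟨⟨hs, ?_, ?_, ?_⟩, h30⟩
          · intro b hb
            rw [Memory.setRing_ring_ne _ hb]
            exact h2.2.1 b hb
          · intro x hx y hy h
            by_cases hxy : x = X ∧ y = Y
            · rw [hxy.1, hxy.2, Memory.setRing_ring_same]
            · rw [Memory.setRing_ring_of_not _ (by omega)]
              exact h2.2.2.1 x hx y hy (by omega)
          · intro x' j' l' h
            rw [Memory.setRing_ring_of_not _ (by omega)]
            exact h2.2.2.2 x' j' l' (by omega)
      obtain ⟨⟨g1, g2, g3, g4⟩, -⟩ := h2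
      exact ⟨g1, g2, fun x hx y hy h => g3 x hx y hy (by omega),
        fun x' j' l' h => g4 x' j' l' (by omega)⟩
  exact ⟨fun x hx y hy => key.2.2.1 x hx y hy (Or.inl hx),
    fun x' j' l' h => key.2.2.2 x' j' l' (by omega)⟩

/-- Repeated addition: `a[x + I, J, y + O] := a[x + I, J, y + O] + e` for all `x < n₁` and `y < n₂`,
for every value `w < N` of the variable `12`. -/
def accumulate (a : ℕ) (N I J O n₁ n₂ : IntExp) (e : RingExp) : Prog :=
  loop 12 N (fill a I J O n₁ n₂ (RingExp.get a (ivar 30 + I) J (ivar 31 + O) + e))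

theorem run_accumulate (M : Memory R) {a : ℕ} {N I J O n₁ n₂ : IntExp} {e : RingExp}
    (N₀ i₀ j₀ o₀ N₁ N₂ : ℕ) (V : ℕ → ℕ → ℕ → R) (hN : N.eval M.int = N₀)
    (hc : ∀ s : ℕ → ℕ → ℕ, (∀ v, v ≠ 12 → v ≠ 30 → v ≠ 31 → s v = M.int v) →
      I.eval s = i₀ ∧ J.eval s = j₀ ∧ O.eval s = o₀ ∧ n₁.eval s = N₁ ∧ n₂.eval s = N₂)
    (hV : ∀ w < N₀, ∀ x < N₁, ∀ y < N₂, ∀ M' : Memory R,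
      (∀ v, v ≠ 12 → v ≠ 30 → v ≠ 31 → M'.int v = M.int v) →
      M'.int 12 0 = w → M'.int 30 0 = x → M'.int 31 0 = y → (∀ b, b ≠ a → M'.ring b = M.ring b) →
      e.eval G M' = V w x y) :
    ∀ x < N₁, ∀ y < N₂,
      ((accumulate a N I J O n₁ n₂ e).run G M).1.ring a (x + i₀) j₀ (y + o₀) =
        M.ring a (x + i₀) j₀ (y + o₀) + ∑ w ∈ Finset.range N₀, V w x y := by
  refine (run_loop_invariant G (fun W M' =>
    (∀ v, v ≠ 12 → v ≠ 30 → v ≠ 31 → M'.int v = M.int v) ∧ (∀ b, b ≠ a → M'.ring b = M.ring b) ∧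
    ∀ x < N₁, ∀ y < N₂, M'.ring a (x + i₀) j₀ (y + o₀) =
      M.ring a (x + i₀) j₀ (y + o₀) + ∑ w ∈ Finset.range W, V w x y) N₀ hN ?_ ?_).2.2
  · exact ⟨fun _ _ _ _ => rfl, fun _ _ => rfl, by simp⟩
  · intro W hW M1 ⟨h1, h2, h3⟩
    have hs : ∀ s : ℕ → ℕ → ℕ, (∀ v, v ≠ 30 → v ≠ 31 → s v = (M1.setInt 12 0 W).int v) →
        ∀ v, v ≠ 12 → v ≠ 30 → v ≠ 31 → s v = M.int v := by
      intro s h v h12 h30 h31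
      rw [h v h30 h31, Memory.setInt_int_ne _ h12, h1 v h12 h30 h31]
    refine ⟨?_, ?_, ?_⟩
    · intro v h12 h30 h31
      rw [run_int G _ _ (by simp [fill, writesInt, h30.symm, h31.symm])]
      exact hs _ (fun _ _ _ => rfl) v h12 h30 h31
    · intro b hb
      rw [run_ring G _ _ (by simp [fill, writesRing, hb.symm])]
      exact h2 b hb
    · have := (run_fill G (M1.setInt 12 0 W) (a := a) (I := I) (J := J) (O := O) (n₁ := n₁)
        (n₂ := n₂) (e := RingExp.get a (ivar 30 + I) J (ivar 31 + O) + e) i₀ j₀ o₀ N₁ N₂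
        (fun x y => M1.ring a (x + i₀) j₀ (y + o₀) + V W x y)
        (fun s h => hc s (hs s h)) ?_).1
      · intro x hx y hy
        rw [this x hx y hy, h3 x hx y hy, Finset.sum_range_succ, add_assoc]
      · intro x hx y hy M' g1 g2 g3 g4 g5 g6
        have hs' := hs _ g1
        obtain ⟨eI, eJ, eO, -, -⟩ := hc _ hs'
        rw [RingExp.eval_add, hV W hW x hx y hy M' hs' _ g2 g3]
        · simp only [RingExp.eval_get, IntExp.eval_add, IntExp.eval_get, IntExp.eval_ofNat, g2, g3,
            eI, eJ, eO]
          rw [g6, Memory.setInt_ring]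
        · intro b hb
          rw [g4 b hb, Memory.setInt_ring, h2 b hb]
        · rw [g1 12 (by decide) (by decide), Memory.setInt_int_same]

/-- Search for a nonzero value of `e`, for `x < n₁` and `y < n₂`, in the variables `30` and `31`.
The variable `33` is `0` at the end if there is none; otherwise `33` and `34` are `x + 1` and `y +
1` for the last one. -/
def search (n₁ n₂ : IntExp) (e : RingExp) : Prog :=
  seq (setInt 33 0 0) (loop 30 n₁ (loop 31 n₂ (seq (testZero 32 0 e)
    (branch (ivar 32) 0 (seq (setInt 33 0 (ivar 30 + 1)) (setInt 34 0 (ivar 31 + 1))) skip))))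

theorem run_search (M : Memory R) {n₁ n₂ : IntExp} {e : RingExp} (N₁ N₂ : ℕ) (V : ℕ → ℕ → R)
    (hc : ∀ s : ℕ → ℕ → ℕ, (∀ v, v < 30 ∨ 34 < v → s v = M.int v) →
      n₁.eval s = N₁ ∧ n₂.eval s = N₂)
    (hV : ∀ x < N₁, ∀ y < N₂, ∀ M' : Memory R, (∀ v, v < 30 ∨ 34 < v → M'.int v = M.int v) →
      M'.int 30 0 = x → M'.int 31 0 = y → M'.ring = M.ring → e.eval G M' = V x y) :
    (((search n₁ n₂ e).run G M).1.int 33 0 = 0 ∧ ∀ x < N₁, ∀ y < N₂, V x y = 0) ∨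
    ∃ x < N₁, ∃ y < N₂, V x y ≠ 0 ∧ ((search n₁ n₂ e).run G M).1.int 33 0 = x + 1 ∧
      ((search n₁ n₂ e).run G M).1.int 34 0 = y + 1 := by
  let Inv : ℕ → ℕ → Memory R → Prop := fun X Y M' =>
    (∀ v, v < 30 ∨ 34 < v → M'.int v = M.int v) ∧ M'.ring = M.ring ∧
    ((M'.int 33 0 = 0 ∧ ∀ x < N₁, ∀ y < N₂, (x < X ∨ x = X ∧ y < Y) → V x y = 0) ∨
      ∃ x < N₁, ∃ y < N₂, V x y ≠ 0 ∧ M'.int 33 0 = x + 1 ∧ M'.int 34 0 = y + 1)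
  have key : Inv N₁ 0 ((search n₁ n₂ e).run G M).1 := by
    have hM0 : ∀ v, v < 30 ∨ 34 < v → (M.setInt 33 0 0).int v = M.int v :=
      fun v hv => M.setInt_int_ne (by omega)
    refine run_loop_invariant G (M := M.setInt 33 0 0) (fun X M' => Inv X 0 M') N₁
      (hc _ hM0).1 ⟨hM0, rfl, Or.inl ⟨by simp, fun x _ y _ h => by omega⟩⟩ ?_
    intro X hX M1 h1
    have hM1 : ∀ v, v < 30 ∨ 34 < v → (M1.setInt 30 0 X).int v = M.int v := by
      intro v hv
      rw [M1.setInt_int_ne (by omega), h1.1 v hv]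
    have h2 := run_loop_invariant G (M := M1.setInt 30 0 X) (x := 31) (e := n₂)
      (P := seq (testZero 32 0 e)
        (branch (ivar 32) 0 (seq (setInt 33 0 (ivar 30 + 1)) (setInt 34 0 (ivar 31 + 1))) skip))
      (fun Y M' => Inv X Y M' ∧ M'.int 30 0 = X) N₂ (hc _ hM1).2 ?_ ?_
    · obtain ⟨⟨g1, g2, g3⟩, -⟩ := h2
      refine ⟨g1, g2, g3.imp_left fun g => ⟨g.1, fun x hx y hy h => g.2 x hx y hy (by omega)⟩⟩
    · refine ⟨⟨hM1, h1.2.1, ?_⟩, by simp⟩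
      rw [M1.setInt_int_ne (by decide), M1.setInt_int_ne (by decide)]
      exact h1.2.2
    · intro Y hY M2 ⟨h2, hX2⟩
      have hM2 : ∀ v, v < 30 ∨ 34 < v → (M2.setInt 31 0 Y).int v = M.int v := by
        intro v hv
        rw [M2.setInt_int_ne (by omega), h2.1 v hv]
      have hval := hV X hX Y hY (M2.setInt 31 0 Y) hM2
        (by rw [M2.setInt_int_ne (by decide), hX2]) (by simp) h2.2.1
      rw [run_seq_fst, run_testZero, hval, IntExp.eval_ofNat]
      by_cases h0 : V X Y = 0
      · rw [if_pos h0, run_branch_neg]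
        · refine ⟨⟨?_, h2.2.1, ?_⟩, ?_⟩
          · intro v hv
            simp only [run]
            rw [Memory.setInt_int_ne _ (by omega), hM2 v hv]
          · simp only [run]
            rw [Memory.setInt_int_ne _ (by decide), Memory.setInt_int_ne _ (by decide),
              Memory.setInt_int_ne _ (by decide), Memory.setInt_int_ne _ (by decide)]
            refine h2.2.2.imp_left fun g => ⟨g.1, fun x hx y hy h => ?_⟩
            by_cases hxy : x = X ∧ y = Y
            · rw [hxy.1, hxy.2, h0]
            · exact g.2 x hx y hy (by omega)
          · simp only [run]
            rw [Memory.setInt_int_ne _ (by decide), Memory.setInt_int_ne _ (by decide), hX2]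
        · simp
      · rw [if_neg h0, run_branch_pos]
        · refine ⟨⟨?_, h2.2.1, Or.inr ⟨X, hX, Y, hY, h0, ?_, ?_⟩⟩, ?_⟩
          · intro v hv
            simp only [run]
            rw [Memory.setInt_int_ne _ (by omega), Memory.setInt_int_ne _ (by omega),
              Memory.setInt_int_ne _ (by omega), hM2 v hv]
          · simp [run, Memory.setInt_int, hX2]
          · simp [run, Memory.setInt_int]
          · simp [run, Memory.setInt_int, hX2]
        · simp
  refine key.2.2.imp_left fun h => ⟨h.1, fun x hx y hy => h.2 x hx y hy (Or.inl hx)⟩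

end Prog

/-! ### Elimination with unit pivots -/

section ElimMath

variable {R : Type*} [CommRing R]

/-- The row `x` of a table, cut off after `W` entries. -/
def rowVec (W : ℕ) (A : ℕ → ℕ → R) (x : ℕ) : Fin W → R := fun y => A x y

/-- The span of the first `N₀` rows of a table. -/
def rowSpan (W N₀ : ℕ) (A : ℕ → ℕ → R) : Submodule R (Fin W → R) :=
  Submodule.span R (rowVec W A '' Set.Iio N₀)

theorem rowVec_mem_rowSpan {W N₀ : ℕ} (A : ℕ → ℕ → R) {x : ℕ} (hx : x < N₀) :
    rowVec W A x ∈ rowSpan W N₀ A :=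
  Submodule.subset_span ⟨x, hx, rfl⟩

/-- The state of the elimination of the table `A₀` after its first `i` rows have been treated:
pivots are searched for in the first `L` of `W` columns and the first `N₀` of `N` rows, and `ns`
lists the `q` rows in which there was none. -/
structure IsEliminated (N₀ N L W : ℕ) (A₀ A : ℕ → ℕ → R) (i q : ℕ) (ns : ℕ → ℕ) : Prop where
  span_eq : rowSpan W N₀ A = rowSpan W N₀ A₀
  extra : ∀ x, N₀ ≤ x → x < N → rowVec W A x - rowVec W A₀ x ∈ rowSpan W N₀ A₀
  le : q ≤ i
  lt : ∀ b < q, ns b < i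
  inj : ∀ b < q, ∀ b' < q, ns b = ns b' → b = b'
  nonunit : ∀ b < q, ∀ c < L, ¬ IsUnit (A (ns b) c)
  pivot : ∀ x < i, (∀ b < q, ns b ≠ x) → ∃ c < L, A x c = 1 ∧ ∀ x' < N, x' ≠ x → A x' c = 0

variable {N₀ N L W : ℕ} {A₀ A A' : ℕ → ℕ → R} {i q : ℕ} {ns : ℕ → ℕ}

/-- A row without a unit entry is left without a pivot. -/
theorem IsEliminated.skip_row (h : IsEliminated N₀ N L W A₀ A i q ns) {ns' : ℕ → ℕ}
    (hns : ∀ b < q, ns' b = ns b) (hq : ns' q = i) (hi : ∀ c < L, ¬ IsUnit (A i c)) :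
    IsEliminated N₀ N L W A₀ A (i + 1) (q + 1) ns' where
  span_eq := h.span_eq
  extra := h.extra
  le := by have := h.le; omega
  lt b hb := by
    rcases Nat.lt_succ_iff_lt_or_eq.1 hb with hb | rfl
    · rw [hns b hb]; have := h.lt b hb; omega
    · omega
  inj b hb b' hb' e := by
    rcases Nat.lt_succ_iff_lt_or_eq.1 hb with hb | rfl <;>
      rcases Nat.lt_succ_iff_lt_or_eq.1 hb' with hb' | rfl
    · exact h.inj b hb b' hb' (by rw [← hns b hb, ← hns b' hb', e])
    · have := h.lt b hb; rw [← hns b hb, e, hq] at this; omega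
    · have := h.lt b' hb'; rw [← hns b' hb', ← e, hq] at this; omega
    · rfl
  nonunit b hb := by
    rcases Nat.lt_succ_iff_lt_or_eq.1 hb with hb | rfl
    · rw [hns b hb]; exact h.nonunit b hb
    · rw [hq]; exact hi
  pivot x hx hn := by
    have hxi : x ≠ i := fun e => hn q (by omega) (by rw [hq, e])
    exact h.pivot x (by omega) fun b hb => by rw [← hns b hb]; exact hn b (by omega)

/-- The row `i` is multiplied by the inverse `v` of its pivot, and the column `c` is cleared in all
other rows; both are done by subtracting one matrix of rank one. A row that has been left without a
pivot keeps nonunit entries: its entry in the column `c` is a nonunit, so that a multiple of the row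
`i` with a nonunit factor is subtracted. -/
theorem IsEliminated.pivot_row [IsLocalRing R] (h : IsEliminated N₀ N L W A₀ A i q ns) (hi : i < N₀)
    (hN : N₀ ≤ N) (hL : L ≤ W) {c : ℕ} (hc : c < L) {v : R} (hv : v * A i c = 1)
    (hA' : ∀ x < N, ∀ y < W, A' x y = A x y - (A x c - if x = i then 1 else 0) * (v * A i y)) :
    IsEliminated N₀ N L W A₀ A' (i + 1) q ns := by
  have hrow_i : rowVec W A' i = v • rowVec W A i := by
    ext y
    simp only [rowVec, Pi.smul_apply, smul_eq_mul]
    rw [hA' i (by omega) y y.2, if_pos rfl]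
    linear_combination (-A i y) * hv
  have hrow : ∀ x < N, x ≠ i → rowVec W A' x = rowVec W A x - (A x c * v) • rowVec W A i := by
    intro x hx hxi
    ext y
    simp only [rowVec, Pi.smul_apply, smul_eq_mul, Pi.sub_apply]
    rw [hA' x hx y y.2, if_neg hxi]
    ring
  have hrow_i' : rowVec W A i = A i c • rowVec W A' i := by
    rw [hrow_i, smul_smul, mul_comm, hv, one_smul]
  have hspan : rowSpan W N₀ A' = rowSpan W N₀ A := by
    apply le_antisymm
    · refine Submodule.span_le.2 ?_
      rintro _ ⟨x, hx, rfl⟩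
      have hx : x < N₀ := hx
      by_cases hxi : x = i
      · rw [hxi, hrow_i]
        exact Submodule.smul_mem _ _ (rowVec_mem_rowSpan A hi)
      · rw [hrow x (by omega) hxi]
        exact Submodule.sub_mem _ (rowVec_mem_rowSpan A hx)
          (Submodule.smul_mem _ _ (rowVec_mem_rowSpan A hi))
    · refine Submodule.span_le.2 ?_
      rintro _ ⟨x, hx, rfl⟩
      have hx : x < N₀ := hx
      by_cases hxi : x = i
      · rw [hxi, hrow_i']
        exact Submodule.smul_mem _ _ (rowVec_mem_rowSpan A' hi)
      · have e : rowVec W A x = rowVec W A' x + (A x c * v) • rowVec W A i := by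
          rw [hrow x (by omega) hxi]; abel
        rw [e, hrow_i']
        exact Submodule.add_mem _ (rowVec_mem_rowSpan A' hx)
          (Submodule.smul_mem _ _ (Submodule.smul_mem _ _ (rowVec_mem_rowSpan A' hi)))
  refine ⟨hspan.trans h.span_eq, ?_, by have := h.le; omega, fun b hb => by
    have := h.lt b hb
    omega,
    h.inj, ?_, ?_⟩
  · intro x hx hxN
    have e : rowVec W A' x - rowVec W A₀ x =
        rowVec W A x - rowVec W A₀ x - (A x c * v) • rowVec W A i := by
      rw [hrow x hxN (by omega)]; abel
    rw [e]
    refine Submodule.sub_mem _ (h.extra x hx hxN) (Submodule.smul_mem _ _ ?_)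
    rw [← h.span_eq]
    exact rowVec_mem_rowSpan A hi
  · intro b hb c' hc'
    have hbi := h.lt b hb
    rw [hA' _ (by omega) c' (by omega), if_neg (by omega), sub_zero]
    -- both entries of the old row are nonunits, and these form an ideal
    have h1 := h.nonunit b hb c' hc'
    have h2 := h.nonunit b hb c hc
    rw [← mem_nonunits_iff, ← IsLocalRing.mem_maximalIdeal] at h1 h2 ⊢
    exact Ideal.sub_mem _ h1 (Ideal.mul_mem_right _ _ h2)
  · intro x hx hn
    by_cases hxi : x = i
    · subst hxi
      refine ⟨c, hc, ?_, ?_⟩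
      · rw [hA' x (by omega) c (by omega), if_pos rfl, hv]; ring
      · intro x' hx' hne
        rw [hA' x' hx' c (by omega), if_neg hne, hv]; ring
    · obtain ⟨c', hc', h1, h2⟩ := h.pivot x (by omega) hn
      have h0 : A i c' = 0 := h2 i (by omega) (Ne.symm hxi)
      refine ⟨c', hc', ?_, ?_⟩
      · rw [hA' x (by omega) c' (by omega), h0, h1]; ring
      · intro x' hx' hne
        rw [hA' x' hx' c' (by omega), h0, h2 x' hx' hne]; ring

theorem IsEliminated.zero (N₀ N L W : ℕ) (A₀ : ℕ → ℕ → R) (ns : ℕ → ℕ) :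
    IsEliminated N₀ N L W A₀ A₀ 0 0 ns where
  span_eq := rfl
  extra x _ _ := by rw [sub_self]; exact Submodule.zero_mem _
  le := le_rfl
  lt b hb := by omega
  inj b hb := by omega
  nonunit b hb := by omega
  pivot x hx := by omega

end ElimMath

namespace Prog

/-- The entry of the identity matrix. It is read from the array `7`, which contains `1` with index
`0` and otherwise zeros; as subtraction is truncated, the index is the distance of `i` and `j`. -/
def delta (i j : IntExp) : RingExp := RingExp.get 7 (i - j + (j - i)) 0 0

/-- Subtraction of a matrix of rank one, from the `N × W` table in the array `20`: the column is in
the array `22`, the row in the array `21`. -/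
def rankOne (N W : IntExp) : Prog :=
  fill 20 0 0 0 N W (RingExp.get 20 (ivar 30) 0 (ivar 31) -
    RingExp.get 22 (ivar 30) 0 0 * RingExp.get 21 0 0 (ivar 31))

/-- Elimination with unit pivots in the table in the array `20`. The list of the rows without a
pivot is in the integer array `37`, and its length in `38`. -/
def eliminate (N₀ N L W : IntExp) : Prog :=
  seq (setInt 38 0 0) (loop 21 N₀
    (seq (search 1 L (RingExp.inv (RingExp.get 20 (ivar 21) 0 (ivar 31))))
      (branch (ivar 33) 0
        (seq (setInt 37 (ivar 38) (ivar 21)) (setInt 38 0 (ivar 38 + 1)))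
        (seq (fill 21 0 0 0 1 W (RingExp.inv (RingExp.get 20 (ivar 21) 0 (ivar 34 - 1)) *
            RingExp.get 20 (ivar 21) 0 (ivar 31)))
          (seq (fill 22 0 0 0 N 1 (RingExp.get 20 (ivar 30) 0 (ivar 34 - 1) -
              delta (ivar 30) (ivar 21)))
            (rankOne N W))))))

variable {R : Type*} [CommRing R] [IsLocalRing R] (G : GaloisFrame R)

theorem eval_delta {M : Memory R} (h : ∀ d, M.ring 7 d 0 0 = if d = 0 then 1 else 0)
    (i j : IntExp) :
    (delta i j).eval G M = if i.eval M.int = j.eval M.int then 1 else 0 := by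
  simp only [delta, RingExp.eval_get, IntExp.eval_add, IntExp.eval_sub, IntExp.eval_ofNat, h]
  congr 1
  simp only [eq_iff_iff]
  omega

theorem run_rankOne (M : Memory R) {N W : IntExp} (N' W' : ℕ)
    (hc : ∀ s : ℕ → ℕ → ℕ, (∀ v < 20, s v = M.int v) → N.eval s = N' ∧ W.eval s = W') :
    ∀ x < N', ∀ y < W', ((rankOne N W).run G M).1.ring 20 x 0 y =
      M.ring 20 x 0 y - M.ring 22 x 0 0 * M.ring 21 0 0 y := by
  refine (run_fill G M 0 0 0 N' W' _ ?_ ?_).1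
  · intro s hs
    have := hc s fun v hv => hs v (by omega) (by omega)
    exact ⟨rfl, rfl, rfl, this.1, this.2⟩
  · intro x hx y hy M' h1 h2 h3 h4 h5 h6
    simp only [RingExp.eval_sub, RingExp.eval_mul, RingExp.eval_get, IntExp.eval_get,
      IntExp.eval_ofNat, h2, h3]
    rw [h4 22 (by decide), h4 21 (by decide)]
    exact congrArg (· - _) h6

theorem ringInverse_ne_zero_iff {a : R} : Ring.inverse a ≠ 0 ↔ IsUnit a := by
  refine ⟨fun h => ?_, fun h h0 => ?_⟩
  · by_contra hu
    exact h (Ring.inverse_non_unit a hu)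
  · have := Ring.inverse_mul_cancel a h
    rw [h0, zero_mul] at this
    exact zero_ne_one this

/-- After the elimination, all main rows have been treated. -/
theorem run_eliminate (M : Memory R) {N₀ N L W : IntExp} (n₀ n l w : ℕ)
    (hc : ∀ s : ℕ → ℕ → ℕ, (∀ v < 20, s v = M.int v) →
      N₀.eval s = n₀ ∧ N.eval s = n ∧ L.eval s = l ∧ W.eval s = w)
    (hn : n₀ ≤ n) (hl : l ≤ w) (h7 : ∀ d, M.ring 7 d 0 0 = if d = 0 then 1 else 0) :
    IsEliminated n₀ n l w (fun x y => M.ring 20 x 0 y)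
      (fun x y => ((eliminate N₀ N L W).run G M).1.ring 20 x 0 y) n₀
      (((eliminate N₀ N L W).run G M).1.int 38 0) (((eliminate N₀ N L W).run G M).1.int 37) := by
  refine (run_loop_invariant G (M := M.setInt 38 0 0) (fun i M' =>
    (∀ v < 20, M'.int v = M.int v) ∧ M'.ring 7 = M.ring 7 ∧
    IsEliminated n₀ n l w (fun x y => M.ring 20 x 0 y) (fun x y => M'.ring 20 x 0 y) i
      (M'.int 38 0) (M'.int 37)) n₀ ?_ ?_ ?_).2.2
  · exact (hc _ fun v hv => M.setInt_int_ne (by omega)).1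
  · refine ⟨fun v hv => M.setInt_int_ne (by omega), rfl, ?_⟩
    rw [Memory.setInt_int_same]
    exact IsEliminated.zero ..
  intro i hi M1 ⟨h1, h2, h3⟩
  set M2 := M1.setInt 21 0 i with hM2
  have i2 : ∀ v < 20, M2.int v = M.int v := fun v hv => by
    rw [hM2, M1.setInt_int_ne (by omega), h1 v hv]
  have hS := run_search G M2 (n₁ := 1) (n₂ := L)
    (e := RingExp.inv (RingExp.get 20 (ivar 21) 0 (ivar 31))) 1 l
    (fun _ y => Ring.inverse (M1.ring 20 i 0 y)) ?_ ?_
  rotate_left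
  · intro s hs
    exact ⟨rfl, (hc s fun v hv => by rw [hs v (by omega), i2 v hv]).2.2.1⟩
  · intro x hx y hy M' g1 g2 g3 g4
    simp [g1, g3, g4, hM2]
  rw [run_seq_fst]
  set M3 := ((search 1 L (RingExp.inv (RingExp.get 20 (ivar 21) 0 (ivar 31)))).run G M2).1 with hM3
  have r3 : M3.ring = M1.ring := funext fun b => run_ring G _ _ rfl
  have i3 : ∀ v, v < 30 → M3.int v = M2.int v := fun v hv =>
    run_int G _ _ (by simp [search, writesInt]; omega)
  have i3' : M3.int 37 = M1.int 37 := run_int G _ _ rfl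
  have i3'' : M3.int 38 = M1.int 38 := run_int G _ _ rfl
  have i321 : M3.int 21 0 = i := by rw [i3 21 (by decide), hM2, Memory.setInt_int_same]
  rcases hS with ⟨h0, hz⟩ | ⟨x, hx, c, hcl, hne, h33, h34⟩
  · -- no unit in this row
    have hb : (ivar 33).eval M3.int ≤ IntExp.eval M3.int 0 := by simp [h0]
    rw [run_branch_pos G hb]
    refine ⟨fun v hv => ?_, ?_, ?_⟩
    · rw [run_int G _ _ (by simp [writesInt]; omega), i3 v (by omega), i2 v hv]
    · rw [run_ring G _ _ (by simp [writesRing]), r3, h2]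
    · have hr : ∀ b, ((seq (setInt 37 (ivar 38) (ivar 21)) (setInt 38 0 (ivar 38 + 1))).run G
          M3).1.ring b = M1.ring b := fun b => by rw [run_ring G _ _ rfl, r3]
      simp only [hr]
      have e38 : ((seq (setInt 37 (ivar 38) (ivar 21)) (setInt 38 0 (ivar 38 + 1))).run G
          M3).1.int 38 0 = M1.int 38 0 + 1 := by
        simp [run_setInt, Memory.setInt_int, i3'']
      have e37 : ((seq (setInt 37 (ivar 38) (ivar 21)) (setInt 38 0 (ivar 38 + 1))).run G
          M3).1.int 37 = fun b => if b = M1.int 38 0 then i else M1.int 37 b := by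
        funext b
        simp [run_setInt, Memory.setInt_int, i3'', i3', i321]
      rw [e38, e37]
      refine h3.skip_row (fun b hb => if_neg hb.ne) (if_pos rfl) fun c hc' hu => ?_
      exact ringInverse_ne_zero_iff.2 hu (hz 0 (by decide) c hc')
  · have hu : IsUnit (M1.ring 20 i 0 c) := ringInverse_ne_zero_iff.1 hne
    have hb : ¬ (ivar 33).eval M3.int ≤ IntExp.eval M3.int 0 := by simp [h33]
    rw [run_branch_neg G hb, run_seq_fst, run_seq_fst]
    have hF1 := (run_fill G M3 (a := 21) (I := 0) (J := 0) (O := 0) (n₁ := 1) (n₂ := W)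
      (e := RingExp.inv (RingExp.get 20 (ivar 21) 0 (ivar 34 - 1)) *
        RingExp.get 20 (ivar 21) 0 (ivar 31)) 0 0 0 1 w
      (fun _ y => Ring.inverse (M1.ring 20 i 0 c) * M1.ring 20 i 0 y) ?_ ?_).1
    rotate_left
    · intro s hs
      exact ⟨rfl, rfl, rfl, rfl, (hc s fun v hv => by
        rw [hs v (by omega) (by omega), i3 v (by omega), i2 v hv]).2.2.2⟩
    · intro x hx y hy M' g1 g2 g3 g4 _ _
      simp [g1, g3, g4, r3, i321, h34]
    set M4 := ((fill 21 0 0 0 1 W (RingExp.inv (RingExp.get 20 (ivar 21) 0 (ivar 34 - 1)) *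
        RingExp.get 20 (ivar 21) 0 (ivar 31))).run G M3).1 with hM4
    have r4 : ∀ b, b ≠ 21 → M4.ring b = M1.ring b := fun b hb => by
      rw [hM4, run_ring G _ _ (by simp [fill, writesRing]; omega), r3]
    have i4 : ∀ v, v ≠ 30 → v ≠ 31 → M4.int v = M3.int v := fun v _ _ =>
      run_int G _ _ (by simp [fill, writesInt]; omega)
    have hF2 := (run_fill G M4 (a := 22) (I := 0) (J := 0) (O := 0) (n₁ := N) (n₂ := 1)
      (e := RingExp.get 20 (ivar 30) 0 (ivar 34 - 1) - delta (ivar 30) (ivar 21)) 0 0 0 n 1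
      (fun x _ => M1.ring 20 x 0 c - if x = i then 1 else 0) ?_ ?_).1
    rotate_left
    · intro s hs
      exact ⟨rfl, rfl, rfl, (hc s fun v hv => by
        rw [hs v (by omega) (by omega), i4 v (by omega) (by omega), i3 v (by omega),
          i2 v hv]).2.1, rfl⟩
    · intro x hx y hy M' g1 g2 g3 g4 _ _
      rw [RingExp.eval_sub, eval_delta G (by rw [g4 7 (by decide), r4 7 (by decide), h2]; exact h7)]
      simp [g1, g2, g4, r4, i4, i321, h34]
    set M5 := ((fill 22 0 0 0 N 1 (RingExp.get 20 (ivar 30) 0 (ivar 34 - 1) -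
      delta (ivar 30) (ivar 21))).run G M4).1 with hM5
    have r5 : ∀ b, b ≠ 21 → b ≠ 22 → M5.ring b = M1.ring b := fun b _ _ => by
      rw [hM5, run_ring G _ _ (by simp [fill, writesRing]; omega), r4 b (by omega)]
    have r5' : M5.ring 21 = M4.ring 21 := run_ring G _ _ rfl
    have i5 : ∀ v, v ≠ 30 → v ≠ 31 → M5.int v = M3.int v := fun v _ _ => by
      rw [hM5, run_int G _ _ (by simp [fill, writesInt]; omega), i4 v (by omega) (by omega)]
    have hcR : ∀ s : ℕ → ℕ → ℕ, (∀ v < 20, s v = M5.int v) → N.eval s = n ∧ W.eval s = w :=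
      fun s hs =>
        have := hc s fun v hv => by
          rw [hs v hv, i5 v (by omega) (by omega), i3 v (by omega), i2 v hv]
        ⟨this.2.1, this.2.2.2⟩
    have hR := run_rankOne G M5 n w hcR
    have ir : ∀ v, v ≠ 30 → v ≠ 31 → ((rankOne N W).run G M5).1.int v = M3.int v := fun v _ _ => by
      rw [run_int G _ _ (by simp [rankOne, fill, writesInt]; omega), i5 v (by omega) (by omega)]
    refine ⟨fun v hv => ?_, ?_, ?_⟩
    · rw [ir v (by omega) (by omega), i3 v (by omega), i2 v hv]
    · rw [run_ring G _ _ (by simp [rankOne, fill, writesRing]), r5 7 (by decide) (by decide), h2]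
    · rw [ir 38 (by decide) (by decide), ir 37 (by decide) (by decide), i3', i3'']
      refine h3.pivot_row hi hn hl hcl (Ring.inverse_mul_cancel _ hu) ?_
      intro x hx y hy
      rw [hR x hx y hy, r5 20 (by decide) (by decide), r5']
      have e1 := hF1 0 (by decide) y hy
      have e2 := hF2 x hx 0 (by decide)
      simp only [add_zero] at e1 e2
      rw [e1, e2]

end Prog

/-! ### Linear algebra over a maximal Galois subring -/

/-- In `B[X] / (g)`, where `g` stays irreducible modulo a nil ideal with quotient field `K`, the
class of a polynomial that is not divisible by `g` over `K` is a unit. -/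
theorem isUnit_adjoinRoot_mk {B K : Type*} [CommRing B] [Field K] (φ : B →+* K)
    (hφ : Function.Surjective φ) (hnil : ∀ x, φ x = 0 → IsNilpotent x) {g F : B[X]}
    (hg : Irreducible (g.map φ)) (hF : ¬ g.map φ ∣ F.map φ) : IsUnit (AdjoinRoot.mk g F) := by
  obtain ⟨a, b, hab⟩ := (hg.coprime_iff_not_dvd).2 hF
  obtain ⟨A, rfl⟩ := Polynomial.map_surjective φ hφ a
  obtain ⟨B', rfl⟩ := Polynomial.map_surjective φ hφ b
  have hn : IsNilpotent (A * g + B' * F - 1) := by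
    rw [Polynomial.isNilpotent_iff]
    intro i
    apply hnil
    rw [← Polynomial.coeff_map]
    simp [hab]
  have h1 := (hn.map (AdjoinRoot.mk g)).isUnit_add_one
  rw [← map_one (AdjoinRoot.mk g), ← map_add, sub_add_cancel, map_add, map_mul, map_mul,
    AdjoinRoot.mk_self, mul_zero, zero_add] at h1
  exact isUnit_of_mul_isUnit_right h1

/-- If every nonunit is divisible by the nilpotent element `p`, then every element is a power of `p`
times a unit, so that divisibility is total. -/
theorem dvd_total_of_pow_eq_zero {A : Type*} [CommRing A] (p : A) (s : ℕ) (hs : p ^ s = 0)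
    (h : ∀ x : A, IsUnit x ∨ p ∣ x) (a b : A) : a ∣ b ∨ b ∣ a := by
  have key : ∀ x : A, ∃ i u, IsUnit u ∧ x = p ^ i * u := by
    intro x
    have : ∀ j, (∃ i u, IsUnit u ∧ x = p ^ i * u) ∨ p ^ j ∣ x := by
      intro j
      induction j with
      | zero => exact Or.inr (by simp)
      | succ j ih =>
        rcases ih with ih | ⟨y, rfl⟩
        · exact Or.inl ih
        · rcases h y with hy | ⟨z, rfl⟩
          · exact Or.inl ⟨j, y, hy, rfl⟩
          · exact Or.inr ⟨z, by ring⟩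
    rcases this s with h | h
    · exact h
    · rw [hs, zero_dvd_iff] at h
      exact ⟨s, 1, isUnit_one, by rw [h, hs, zero_mul]⟩
  obtain ⟨i, u, hu, rfl⟩ := key a
  obtain ⟨j, v, hv, rfl⟩ := key b
  rcases le_total i j with hij | hij
  · exact Or.inl ((hu.mul_right_dvd).2 ((pow_dvd_pow p hij).mul_right v))
  · exact Or.inr ((hv.mul_right_dvd).2 ((pow_dvd_pow p hij).mul_right u))

/-- A Galois ring is a chain ring: of any two elements one divides the other. -/
theorem IsMaximalGaloisSubring.dvd_total {R : Type*} [CommRing R] [IsLocalRing R] {R₀ : Subring R}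
    (h : IsMaximalGaloisSubring R₀) (a b : R₀) : a ∣ b ∨ b ∣ a := by
  obtain ⟨p, s, d, h, hp, hchar, -, hmon, -, hirr, ⟨e⟩⟩ := h
  have : Fact p.Prime := ⟨hp⟩
  have hs : s ≠ 0 := by
    rintro rfl
    rw [pow_zero] at hchar
    exact one_ne_zero (by exact_mod_cast (CharP.cast_eq_zero_iff R 1 1).2 dvd_rfl : (1 : R) = 0)
  let φ : ZMod (p ^ s) →+* ZMod p := ZMod.castHom (dvd_pow_self p hs) (ZMod p)
  have hker : ∀ x, φ x = 0 → (p : ZMod (p ^ s)) ∣ x := by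
    intro x hx
    obtain ⟨n, rfl⟩ := ZMod.intCast_surjective x
    rw [map_intCast, ZMod.intCast_zmod_eq_zero_iff_dvd] at hx
    obtain ⟨c, rfl⟩ := hx
    exact ⟨c, by push_cast; rfl⟩
  have hps : (p : ZMod (p ^ s)) ^ s = 0 := by exact_mod_cast ZMod.natCast_self (p ^ s)
  set g := h.map (Int.castRingHom (ZMod (p ^ s))) with hg
  have hgφ : g.map φ = h.map (Int.castRingHom (ZMod p)) := by
    rw [hg, Polynomial.map_map]
    congr 1
    exact RingHom.ext_int _ _
  have key : ∀ x : AdjoinRoot g, IsUnit x ∨ (p : AdjoinRoot g) ∣ x := by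
    intro x
    obtain ⟨F, rfl⟩ := AdjoinRoot.mk_surjective x
    by_cases hF : g.map φ ∣ F.map φ
    · right
      obtain ⟨Q, hQ⟩ := hF
      obtain ⟨Q, rfl⟩ := Polynomial.map_surjective φ (ZMod.ringHom_surjective φ) Q
      have h0 : C (p : ZMod (p ^ s)) ∣ F - g * Q := by
        rw [Polynomial.C_dvd_iff_dvd_coeff]
        intro i
        apply hker
        rw [← Polynomial.coeff_map]
        simp [hQ]
      have h1 := map_dvd (AdjoinRoot.mk g) h0
      rw [map_sub, map_mul, AdjoinRoot.mk_self, zero_mul, sub_zero] at h1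
      simpa using h1
    · left
      refine isUnit_adjoinRoot_mk φ (ZMod.ringHom_surjective φ) (fun x hx => ?_) (hgφ ▸ hirr) hF
      obtain ⟨y, rfl⟩ := hker x hx
      exact ⟨s, by rw [mul_pow, hps, zero_mul]⟩
  have hps' : (p : AdjoinRoot g) ^ s = 0 := by
    have := congrArg (AdjoinRoot.of g) hps
    simpa using this
  have := dvd_total_of_pow_eq_zero (p : AdjoinRoot g) s hps' key (e a) (e b)
  rwa [map_dvd_iff e, map_dvd_iff e] at this

/-- In a finite chain ring, all ideals are principal. -/
theorem exists_forall_mem_iff_dvd {A : Type*} [CommRing A] [Finite A]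
    (h : ∀ a b : A, a ∣ b ∨ b ∣ a) (I : Ideal A) : ∃ d, ∀ c, c ∈ I ↔ d ∣ c := by
  have key : ∀ s : Finset A, (∀ c ∈ s, c ∈ I) → ∃ d ∈ I, ∀ c ∈ s, d ∣ c := by
    intro s
    classical
    induction s using Finset.induction_on with
    | empty => exact fun _ => ⟨0, I.zero_mem, by simp⟩
    | insert a s _ ih =>
      intro hs
      obtain ⟨d, hd, hds⟩ := ih fun c hc => hs c (Finset.mem_insert_of_mem hc)
      rcases h a d with had | hda
      · refine ⟨a, hs a (Finset.mem_insert_self _ _), fun c hc => ?_⟩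
        rcases Finset.mem_insert.1 hc with rfl | hc
        · exact dvd_rfl
        · exact had.trans (hds c hc)
      · refine ⟨d, hd, fun c hc => ?_⟩
        rcases Finset.mem_insert.1 hc with rfl | hc
        · exact hda
        · exact hds c hc
  obtain ⟨d, hd, hdI⟩ := key (Set.toFinite (I : Set A)).toFinset (by simp)
  exact ⟨d, fun c => ⟨fun hc => hdI c (by simpa using hc), fun hc => I.mem_of_dvd hc hd⟩⟩

/-- The double annihilator property of a finite ring in which `e` generates the annihilator of `d`;
the reason is that `(e)` and `(d)` have complementary cardinalities. -/
theorem mul_eq_zero_iff_dvd_of_annihilator {A : Type*} [CommRing A] [Finite A] {d e : A}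
    (he : ∀ c, c * d = 0 ↔ e ∣ c) (x : A) :
    x * e = 0 ↔ d ∣ x := by
  have hde : d * e = 0 := by rw [mul_comm]; exact (he e).2 dvd_rfl
  refine ⟨fun hx => ?_, fun ⟨y, hy⟩ => by rw [hy, mul_right_comm, hde, zero_mul]⟩
  have hcard : ∀ a : A, Nat.card A =
      Nat.card (AddMonoidHom.mulRight a).range * Nat.card (AddMonoidHom.mulRight a).ker := by
    intro a
    rw [AddSubgroup.card_eq_card_quotient_mul_card_addSubgroup (AddMonoidHom.mulRight a).ker]
    congr 1
    exact Nat.card_congr (QuotientAddGroup.quotientKerEquivRange _).toEquiv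
  have hker : (AddMonoidHom.mulRight d).ker = (AddMonoidHom.mulRight e).range := by
    ext c
    rw [AddMonoidHom.mem_ker, AddMonoidHom.coe_mulRight, he c, AddMonoidHom.mem_range]
    exact ⟨fun ⟨y, hy⟩ => ⟨y, by rw [hy]; exact mul_comm _ _⟩,
      fun ⟨y, hy⟩ => ⟨y, by rw [← hy]; exact mul_comm _ _⟩⟩
  have hle : (AddMonoidHom.mulRight d).range ≤ (AddMonoidHom.mulRight e).ker := by
    rintro _ ⟨y, rfl⟩
    simp [AddMonoidHom.mem_ker, mul_assoc, hde]
  have heq : (AddMonoidHom.mulRight d).range = (AddMonoidHom.mulRight e).ker := by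
    refine AddSubgroup.eq_of_le_of_card_ge hle ?_
    have h1 := hcard d
    have h2 := hcard e
    rw [hker] at h1
    have hpos : 0 < Nat.card (AddMonoidHom.mulRight e).range := Nat.card_pos
    have : Nat.card (AddMonoidHom.mulRight e).range * Nat.card (AddMonoidHom.mulRight e).ker =
        Nat.card (AddMonoidHom.mulRight e).range * Nat.card (AddMonoidHom.mulRight d).range := by
      rw [← h2, h1, mul_comm]
    exact (Nat.eq_of_mul_eq_mul_left hpos this).le
  have : x ∈ (AddMonoidHom.mulRight d).range := by
    rw [heq, AddMonoidHom.mem_ker]; exact hx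
  obtain ⟨y, rfl⟩ := this
  exact dvd_mul_left _ _

namespace GaloisFrame

variable {R : Type*} [CommRing R] [IsLocalRing R] (G : GaloisFrame R)

theorem gamma_pos : 0 < G.gamma := by
  rw [Nat.pos_iff_ne_zero]
  intro h
  have hE : IsEmpty (Fin (moduleRank G.base R)) := by
    rw [show moduleRank G.base R = 0 from h]; infer_instance
  have htop := G.isInternal.submodule_iSup_eq_top
  rw [iSup_of_empty] at htop
  have h1 : (1 : R) ∈ (⊥ : Submodule G.base R) := htop ▸ Submodule.mem_top
  exact one_ne_zero ((Submodule.mem_bot _).1 h1)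

theorem span_z : Submodule.span G.base (Set.range G.z) = ⊤ := by
  rw [Submodule.span_range_eq_iSup]
  exact G.isInternal.submodule_iSup_eq_top

theorem sum_coords (a : R) : a = ∑ i, G.coords a i • G.z i := by
  have h : ∃ c : Fin (moduleRank G.base R) → G.base, a = ∑ i, c i • G.z i := by
    have ha : a ∈ Submodule.span G.base (Set.range G.z) := by rw [G.span_z]; trivial
    obtain ⟨c, hc⟩ := (Submodule.mem_span_range_iff_exists_fun _).1 ha
    exact ⟨c, hc.symm⟩
  exact Classical.epsilon_spec h

theorem smul_z_eq_zero {c : Fin (moduleRank G.base R) → G.base} (h : ∑ i, c i • G.z i = 0)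
    (i : Fin (moduleRank G.base R)) : c i • G.z i = 0 :=
  (iSupIndep_iff_finsetSum_eq_zero_imp_eq_zero _).1 G.isInternal.submodule_iSupIndep Finset.univ
    (fun i => c i • G.z i)
    (fun _ _ => Submodule.smul_mem _ _ (Submodule.mem_span_singleton_self _)) h i
    (Finset.mem_univ i)

theorem coe_ann (a : G.base) : G.ann (a : R) = (G.annGen (a : R) : R) := by
  rw [ann, if_pos a.2]

theorem exists_quo (a b : G.base) : ∃ c : G.base, (c : R) = G.quo a b := by
  unfold quo
  split
  · next h =>
    exact ⟨⟨_, (Classical.epsilon_spec (p := fun c : R => c ∈ G.base ∧ (a : R) = b * c) h.2.2).1⟩,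
      rfl⟩
  · exact ⟨0, rfl⟩

theorem mul_quo {a b : G.base} (h : b ∣ a) : (b : R) * G.quo a b = a := by
  obtain ⟨c, rfl⟩ := h
  have h' : ∃ x : R, x ∈ G.base ∧ ((b * c : G.base) : R) = b * x := ⟨c, c.2, rfl⟩
  unfold quo
  rw [if_pos ⟨(b * c).2, b.2, h'⟩]
  exact (Classical.epsilon_spec (p := fun x : R => x ∈ G.base ∧ ((b * c : G.base) : R) = b * x)
    h').2.symm

theorem mul_quo_eq_iff (a b : G.base) : (a : R) - b * G.quo a b = 0 ↔ b ∣ a := by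
  refine ⟨fun h => ?_, fun h => by rw [G.mul_quo h, sub_self]⟩
  obtain ⟨c, hc⟩ := G.exists_quo a b
  refine ⟨c, Subtype.ext ?_⟩
  rw [Subring.coe_mul, hc]
  exact sub_eq_zero.1 h

variable [Finite R]

theorem annGen_spec (a : R) (c : G.base) : (c : R) * a = 0 ↔ G.annGen a ∣ c := by
  have h : ∃ d : G.base, ∀ c : G.base, (c : R) * a = 0 ↔ d ∣ c := by
    obtain ⟨d, hd⟩ := exists_forall_mem_iff_dvd G.isMaximal.dvd_total
      (LinearMap.ker (LinearMap.toSpanSingleton G.base R a))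
    refine ⟨d, fun c => ?_⟩
    rw [← hd c, LinearMap.mem_ker, LinearMap.toSpanSingleton_apply, Subring.smul_def, smul_eq_mul]
  exact Classical.epsilon_spec (p := fun d : G.base => ∀ c : G.base, (c : R) * a = 0 ↔ d ∣ c) h c

/-- The double annihilator property: a generator of the annihilator of the annihilator of `a` has
the same annihilator in `R₀` as `a`. -/
theorem mul_annGen_annGen (a : R) (x : G.base) :
    x * G.annGen (G.annGen a : R) = 0 ↔ (x : R) * a = 0 := by
  have h : ∀ (d c : G.base), c * d = 0 ↔ G.annGen (d : R) ∣ c := fun d c => by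
    rw [← G.annGen_spec, ← Subring.coe_mul, ZeroMemClass.coe_eq_zero]
  rw [G.annGen_spec, mul_eq_zero_iff_dvd_of_annihilator (h _)]

/-- The `R₀`-linear form `R → R₀` that multiplies the coordinate at `z_q`, which is determined up to
multiples of a generator `d` of the annihilator of `z_q`, by a generator of the annihilator of
`d`. -/
noncomputable def form (q : Fin (moduleRank G.base R)) : R →ₗ[G.base] G.base where
  toFun a := G.coords a q * G.annGen (G.annGen (G.z q) : R)
  map_add' a b := by
    rw [← add_mul, ← sub_eq_zero, ← sub_mul, G.mul_annGen_annGen]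
    refine G.smul_z_eq_zero (c := fun i => G.coords (a + b) i - (G.coords a i + G.coords b i)) ?_ q
    simp only [sub_smul, add_smul, Finset.sum_sub_distrib, Finset.sum_add_distrib,
      ← G.sum_coords, sub_self]
  map_smul' c a := by
    rw [RingHom.id_apply, smul_eq_mul, ← mul_assoc, ← sub_eq_zero, ← sub_mul,
      G.mul_annGen_annGen]
    refine G.smul_z_eq_zero (c := fun i => G.coords (c • a) i - c * G.coords a i) ?_ q
    simp only [sub_smul, mul_smul, Finset.sum_sub_distrib, ← Finset.smul_sum, ← G.sum_coords,
      sub_self]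

theorem form_apply (q : Fin (moduleRank G.base R)) (a : R) :
    (G.form q a : R) = G.coords a q * G.ann (G.annGen (G.z q) : R) := by
  rw [G.coe_ann]; rfl

/-- The forms separate the elements of `R`. -/
theorem eq_zero_of_form {a : R} (h : ∀ q, G.form q a = 0) : a = 0 := by
  rw [G.sum_coords a]
  exact Finset.sum_eq_zero fun q _ => (G.mul_annGen_annGen _ _).1 (h q)

end GaloisFrame

section ReductionMath

variable {A M : Type*} [CommRing A] [AddCommGroup M] [Module A M]

/-- The state of the elimination over a chain ring `A`, after the linear forms `ψ 0, …, ψ (w - 1)`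
have been treated: the first `N₀` rows span the common kernel of these forms on the span of the
original rows, and every other row has been changed by a combination of the original rows, in such a
way that these forms vanish on it if all the forms `ψ 0, …, ψ (T - 1)` can be made to vanish. -/
structure IsFormReduced (N₀ N T : ℕ) (ψ : ℕ → M →ₗ[A] A) (u₀ u : ℕ → M) (w : ℕ) : Prop where
  mem_span : ∀ v, v ∈ Submodule.span A (u '' Set.Iio N₀) ↔
    v ∈ Submodule.span A (u₀ '' Set.Iio N₀) ∧ ∀ w' < w, ψ w' v = 0
  extra : ∀ x, N₀ ≤ x → x < N → u x - u₀ x ∈ Submodule.span A (u₀ '' Set.Iio N₀)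
  solvable : ∀ x, N₀ ≤ x → x < N → ∀ g ∈ Submodule.span A (u₀ '' Set.Iio N₀),
    (∀ w' < T, ψ w' (u₀ x) = ψ w' g) → ∀ w' < w, ψ w' (u x) = 0

variable {N₀ N T : ℕ} {ψ : ℕ → M →ₗ[A] A} {u₀ u u' : ℕ → M} {w : ℕ}

theorem IsFormReduced.zero : IsFormReduced N₀ N T ψ u₀ u₀ 0 where
  mem_span v := by simp
  extra x _ _ := by rw [sub_self]; exact Submodule.zero_mem _
  solvable x _ _ g _ _ w' hw' := by omega

/-- The pivot `u p` is a main row on which the value of the form `ψ w` divides the values on all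
other main rows. Multiples of it are subtracted from the other rows, and then the pivot row is
multiplied by a generator `a` of the annihilator of its value, as the multiples of the pivot row by
elements of the annihilator are those on which the form vanishes. -/
theorem IsFormReduced.step (h : IsFormReduced N₀ N T ψ u₀ u w) (hw : w < T) (hN : N₀ ≤ N) {p : ℕ}
    (hp : p < N₀) (hdvd : ∀ x < N₀, ψ w (u p) ∣ ψ w (u x)) {a : A}
    (ha : ∀ c, c * ψ w (u p) = 0 ↔ a ∣ c) {t : ℕ → A}
    (ht : ∀ x, x ≠ p → ψ w (u p) ∣ ψ w (u x) → t x * ψ w (u p) = ψ w (u x))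
    (hup : u' p = a • u p) (hu : ∀ x < N, x ≠ p → u' x = u x - t x • u p) :
    IsFormReduced N₀ N T ψ u₀ u' (w + 1) := by
  have hmem : ∀ x < N₀, u x ∈ Submodule.span A (u '' Set.Iio N₀) := fun x hx =>
    Submodule.subset_span ⟨x, hx, rfl⟩
  have hmem' : ∀ x < N₀, u' x ∈ Submodule.span A (u' '' Set.Iio N₀) := fun x hx =>
    Submodule.subset_span ⟨x, hx, rfl⟩
  have haw : a * ψ w (u p) = 0 := (ha a).2 dvd_rfl
  have hspan : ∀ v, v ∈ Submodule.span A (u' '' Set.Iio N₀) ↔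
      v ∈ Submodule.span A (u '' Set.Iio N₀) ∧ ψ w v = 0 := by
    intro v
    constructor
    · intro hv
      induction hv using Submodule.span_induction with
      | mem v hv =>
        obtain ⟨x, hx, rfl⟩ := hv
        have hx : x < N₀ := hx
        by_cases hxp : x = p
        · rw [hxp, hup]
          exact ⟨Submodule.smul_mem _ _ (hmem p hp), by rw [map_smul, smul_eq_mul, haw]⟩
        · rw [hu x (by omega) hxp]
          refine ⟨Submodule.sub_mem _ (hmem x hx) (Submodule.smul_mem _ _ (hmem p hp)), ?_⟩
          rw [map_sub, map_smul, smul_eq_mul, ht x hxp (hdvd x hx), sub_self]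
      | zero => exact ⟨Submodule.zero_mem _, map_zero _⟩
      | add v v' _ _ hv hv' =>
        exact ⟨Submodule.add_mem _ hv.1 hv'.1, by rw [map_add, hv.2, hv'.2, add_zero]⟩
      | smul c v _ hv => exact ⟨Submodule.smul_mem _ _ hv.1, by rw [map_smul, hv.2, smul_zero]⟩
    · rintro ⟨hv, hv0⟩
      -- modulo the new rows, every element is a multiple of the pivot row
      have key : ∃ c : A, v - c • u p ∈ Submodule.span A (u' '' Set.Iio N₀) := by
        clear hv0
        induction hv using Submodule.span_induction with
        | mem v hv =>
          obtain ⟨x, hx, rfl⟩ := hv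
          have hx : x < N₀ := hx
          by_cases hxp : x = p
          · exact ⟨1, by rw [hxp, one_smul, sub_self]; exact Submodule.zero_mem _⟩
          · exact ⟨t x, by rw [← hu x (by omega) hxp]; exact hmem' x hx⟩
        | zero => exact ⟨0, by simp⟩
        | add v v' _ _ hv hv' =>
          obtain ⟨c, hc⟩ := hv
          obtain ⟨c', hc'⟩ := hv'
          refine ⟨c + c', ?_⟩
          have := Submodule.add_mem _ hc hc'
          rwa [show v - c • u p + (v' - c' • u p) = v + v' - (c + c') • u p by
            rw [add_smul]; abel] at this
        | smul b v _ hv =>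
          obtain ⟨c, hc⟩ := hv
          refine ⟨b * c, ?_⟩
          have := Submodule.smul_mem _ b hc
          rwa [smul_sub, smul_smul] at this
      obtain ⟨c, hc⟩ := key
      have hz : ∀ v ∈ Submodule.span A (u' '' Set.Iio N₀), ψ w v = 0 := by
        intro v hv
        induction hv using Submodule.span_induction with
        | mem v hv =>
          obtain ⟨x, hx, rfl⟩ := hv
          have hx : x < N₀ := hx
          by_cases hxp : x = p
          · rw [hxp, hup, map_smul, smul_eq_mul, haw]
          · rw [hu x (by omega) hxp, map_sub, map_smul, smul_eq_mul, ht x hxp (hdvd x hx), sub_self]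
        | zero => exact map_zero _
        | add v v' _ _ hv hv' => rw [map_add, hv, hv', add_zero]
        | smul c v _ hv => rw [map_smul, hv, smul_zero]
      have h1 := hz _ hc
      rw [map_sub, hv0, zero_sub, neg_eq_zero, map_smul, smul_eq_mul, ha] at h1
      obtain ⟨b, rfl⟩ := h1
      have h2 : (a * b) • u p ∈ Submodule.span A (u' '' Set.Iio N₀) := by
        rw [mul_comm, mul_smul, ← hup]
        exact Submodule.smul_mem _ _ (hmem' p hp)
      simpa using Submodule.add_mem _ hc h2
  have hup0 : ∀ w' < w, ψ w' (u p) = 0 := ((h.mem_span _).1 (hmem p hp)).2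
  refine ⟨fun v => ?_, fun x hx hxN => ?_, fun x hx hxN g hg hgT w' hw' => ?_⟩
  · rw [hspan, h.mem_span, and_assoc]
    refine and_congr_right fun _ => ⟨fun hv w' hw' => ?_, fun hv =>
      ⟨fun w' hw' => hv w' (by omega), hv w (by omega)⟩⟩
    rcases Nat.lt_succ_iff_lt_or_eq.1 hw' with hw' | rfl
    · exact hv.1 w' hw'
    · exact hv.2
  · rw [hu x hxN (by omega), sub_right_comm]
    exact Submodule.sub_mem _ (h.extra x hx hxN)
      (Submodule.smul_mem _ _ ((h.mem_span _).1 (hmem p hp)).1)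
  · have hold := h.solvable x hx hxN g hg hgT
    have hdx : ψ w (u p) ∣ ψ w (u x) := by
      -- `u x` has the same values under the forms as an element of the span of the rows
      have hval : ∀ w' < T, ψ w' (g + (u x - u₀ x)) = ψ w' (u x) := by
        intro w' hw'
        rw [map_add, map_sub, hgT w' hw']; ring
      have hin : g + (u x - u₀ x) ∈ Submodule.span A (u '' Set.Iio N₀) := by
        rw [h.mem_span]
        refine ⟨Submodule.add_mem _ hg (h.extra x hx hxN), fun w' hw' => ?_⟩
        rw [hval w' (by omega), hold w' hw']
      rw [← hval w hw]
      clear hval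
      generalize g + (u x - u₀ x) = v at hin
      induction hin using Submodule.span_induction with
      | mem v hv =>
        obtain ⟨y, hy, rfl⟩ := hv
        exact hdvd y hy
      | zero => rw [map_zero]; exact dvd_zero _
      | add v v' _ _ hv hv' => rw [map_add]; exact dvd_add hv hv'
      | smul c v _ hv => rw [map_smul]; exact hv.mul_left c
    rw [hu x hxN (by omega), map_sub, map_smul, smul_eq_mul]
    rcases Nat.lt_succ_iff_lt_or_eq.1 hw' with hw' | rfl
    · rw [hold w' hw', hup0 w' hw']; ring
    · rw [ht x (by omega) hdx, sub_self]

end ReductionMath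

namespace GaloisFrame

variable {R : Type*} [CommRing R] [IsLocalRing R] [Finite R] (G : GaloisFrame R)

/-- The linear forms on `R ^ W` that consist of a coordinate of `R ^ W` and a form of the frame;
the form of number `w` belongs to the coordinate `w / γ`, and is `0` if there is no such
coordinate. -/
noncomputable def formAt (W w : ℕ) : (Fin W → R) →ₗ[G.base] G.base :=
  if h : w / G.gamma < W ∧ w % G.gamma < moduleRank G.base R then
    (G.form ⟨w % G.gamma, h.2⟩).comp (LinearMap.proj ⟨w / G.gamma, h.1⟩)
  else 0

theorem formAt_apply {W w : ℕ} (h : w / G.gamma < W) (v : Fin W → R) :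
    G.formAt W w v = G.form ⟨w % G.gamma, Nat.mod_lt _ G.gamma_pos⟩ (v ⟨w / G.gamma, h⟩) := by
  rw [formAt, dif_pos ⟨h, Nat.mod_lt _ G.gamma_pos⟩]
  rfl

/-- The first `L * γ` forms vanish exactly on the vectors with vanishing first `L` coordinates. -/
theorem formAt_eq_zero_iff {W L : ℕ} (hL : L ≤ W) (v : Fin W → R) :
    (∀ w < L * G.gamma, G.formAt W w v = 0) ↔ ∀ (c : ℕ) (hc : c < L), v ⟨c, by omega⟩ = 0 := by
  constructor
  · intro h c hc
    refine G.eq_zero_of_form fun q => ?_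
    have hq : (q : ℕ) < G.gamma := q.2
    have hdiv : (c * G.gamma + q) / G.gamma = c := by
      rw [mul_comm, Nat.mul_add_div G.gamma_pos, Nat.div_eq_of_lt hq, add_zero]
    have hmod : (c * G.gamma + q) % G.gamma = q := by
      rw [mul_comm, Nat.mul_add_mod, Nat.mod_eq_of_lt hq]
    have := h (c * G.gamma + q) (by nlinarith)
    rw [G.formAt_apply (by omega)] at this
    simpa only [hdiv, hmod] using this
  · intro h w hw
    have hw' : w / G.gamma < L := Nat.div_lt_of_lt_mul (by rwa [mul_comm] at hw)
    rw [G.formAt_apply (by omega), h _ hw', map_zero]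

end GaloisFrame

namespace Prog

/-- Search for an entry of the array `23` that divides all others; it is number `23[0]`. -/
def pivotSearch (N₀ : IntExp) : Prog :=
  seq (setInt 23 0 0)
    (loop 24 N₀ (seq (testZero 25 0 (RingExp.get 23 (ivar 24) 0 0 - RingExp.get 23 (ivar 23) 0 0 *
        RingExp.quo (RingExp.get 23 (ivar 24) 0 0) (RingExp.get 23 (ivar 23) 0 0)))
      (branch (ivar 25) 0 (setInt 23 0 (ivar 24)) skip)))

/-- Elimination over the maximal Galois subring in the table in the array `20`, which removes the
entries in the first `L` columns. The form of number `w` is a multiple of the coordinate at `z_q` of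
the entry in the column `w / γ`, for `q = w % γ`. Its values are computed in the array `23`. -/
def baseEliminate (N₀ N L W : IntExp) : Prog :=
  loop 22 (L * ivar 4)
    (seq (fill 23 0 0 0 N 1
        (RingExp.coord ((ivar 22).mod (ivar 4)) (RingExp.get 20 (ivar 30) 0 (ivar 22 / ivar 4)) *
          RingExp.ann (RingExp.get 5 ((ivar 22).mod (ivar 4)) 0 0)))
      (seq (pivotSearch N₀)
        (seq (fill 21 0 0 0 1 W (RingExp.get 20 (ivar 23) 0 (ivar 31)))
          (seq (fill 22 0 0 0 N 1
              (delta (ivar 30) (ivar 23) * (1 - RingExp.ann (RingExp.get 23 (ivar 23) 0 0)) +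
                (1 - delta (ivar 30) (ivar 23)) *
                  RingExp.quo (RingExp.get 23 (ivar 30) 0 0) (RingExp.get 23 (ivar 23) 0 0)))
            (rankOne N W)))))

variable {R : Type*} [CommRing R] [IsLocalRing R] (G : GaloisFrame R)

theorem run_pivotSearch (M : Memory R) {N₀ : IntExp} (n₀ : ℕ) (hn₀ : 0 < n₀)
    (hc : ∀ s : ℕ → ℕ → ℕ, (∀ v < 20, s v = M.int v) → N₀.eval s = n₀) (φ : ℕ → G.base)
    (hφ : ∀ x < n₀, M.ring 23 x 0 0 = φ x) {M' : Memory R}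
    (hM' : M' = ((pivotSearch N₀).run G M).1) :
    M'.int 23 0 < n₀ ∧ ∀ x < n₀, φ (M'.int 23 0) ∣ φ x := by
  rw [hM', pivotSearch, run_seq_fst, run_setInt]
  refine (run_loop_invariant G (fun i M' => (∀ v < 20, M'.int v = M.int v) ∧
    M'.ring = M.ring ∧ M'.int 23 0 < n₀ ∧ ∀ x < i, φ (M'.int 23 0) ∣ φ x) n₀ ?_ ?_ ?_).2.2
  · exact hc _ fun v hv => M.setInt_int_ne (by omega)
  · refine ⟨fun v hv => M.setInt_int_ne (by omega), rfl, by simpa using hn₀, by simp⟩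
  · rintro i hi M1 ⟨h1, h2, h3, h4⟩
    have e23 : (M1.setInt 24 0 i).int 23 0 = M1.int 23 0 := by
      rw [Memory.setInt_int_ne _ (by decide)]
    have hval : (RingExp.get 23 (ivar 24) 0 0 - RingExp.get 23 (ivar 23) 0 0 *
        RingExp.quo (RingExp.get 23 (ivar 24) 0 0) (RingExp.get 23 (ivar 23) 0 0)).eval G
          (M1.setInt 24 0 i) = (φ i : R) - φ (M1.int 23 0) * G.quo (φ i) (φ (M1.int 23 0)) := by
      simp [e23, h2, hφ i hi, hφ _ h3]
    rw [run_seq_fst, run_testZero, hval, G.mul_quo_eq_iff, IntExp.eval_ofNat]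
    by_cases hd : φ (M1.int 23 0) ∣ φ i
    · rw [if_pos hd]
      have hb : ¬ (ivar 25).eval ((M1.setInt 24 0 i).setInt 25 0 1).int ≤
        IntExp.eval ((M1.setInt 24 0 i).setInt 25 0 1).int 0 := by simp
      rw [run_branch_neg G hb]
      have e : ((skip.run G ((M1.setInt 24 0 i).setInt 25 0 1)).1).int 23 0 = M1.int 23 0 := by
        simp only [run]
        rw [Memory.setInt_int_ne _ (by decide), e23]
      refine ⟨fun v hv => ?_, h2, ?_, ?_⟩
      · simp only [run]
        rw [Memory.setInt_int_ne _ (by omega), Memory.setInt_int_ne _ (by omega), h1 v hv]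
      · rw [e]; exact h3
      · rw [e]
        intro x hx
        rcases Nat.lt_succ_iff_lt_or_eq.1 hx with hx | rfl
        · exact h4 x hx
        · exact hd
    · rw [if_neg hd]
      have hb : (ivar 25).eval ((M1.setInt 24 0 i).setInt 25 0 0).int ≤
        IntExp.eval ((M1.setInt 24 0 i).setInt 25 0 0).int 0 := by simp
      rw [run_branch_pos G hb, run_setInt]
      have e : (((M1.setInt 24 0 i).setInt 25 0 0).setInt 23
          (IntExp.eval ((M1.setInt 24 0 i).setInt 25 0 0).int 0)
          ((ivar 24).eval ((M1.setInt 24 0 i).setInt 25 0 0).int)).int 23 0 = i := by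
        simp [Memory.setInt_int]
      refine ⟨fun v hv => ?_, h2, ?_, ?_⟩
      · rw [Memory.setInt_int_ne _ (by omega), Memory.setInt_int_ne _ (by omega),
          Memory.setInt_int_ne _ (by omega), h1 v hv]
      · rw [e]; exact hi
      · rw [e]
        intro x hx
        rcases Nat.lt_succ_iff_lt_or_eq.1 hx with hx | rfl
        · exact ((G.isMaximal.dvd_total _ _).resolve_left hd).trans (h4 x hx)
        · exact dvd_rfl

/-- After the elimination, all forms at the first `l` columns have been treated. -/
theorem run_baseEliminate [Finite R] (M : Memory R) {N₀ N L W : IntExp} (n₀ n l w : ℕ)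
    (hc : ∀ s : ℕ → ℕ → ℕ, (∀ v < 20, s v = M.int v) →
      N₀.eval s = n₀ ∧ N.eval s = n ∧ L.eval s = l ∧ W.eval s = w)
    (hn₀ : 0 < n₀) (hn : n₀ ≤ n) (hl : l ≤ w)
    (h7 : ∀ d, M.ring 7 d 0 0 = if d = 0 then 1 else 0) (h4 : M.int 4 0 = G.gamma)
    (h5 : ∀ q, M.ring 5 q 0 0 = pad (fun i => (G.annGen (G.z i) : R)) q) :
    IsFormReduced n₀ n (l * G.gamma) (G.formAt w) (rowVec w fun x y => M.ring 20 x 0 y)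
      (rowVec w fun x y => ((baseEliminate N₀ N L W).run G M).1.ring 20 x 0 y) (l * G.gamma) := by
  refine (run_loop_invariant G (fun i M' =>
    (∀ v < 20, M'.int v = M.int v) ∧ (∀ b < 20, M'.ring b = M.ring b) ∧
    IsFormReduced n₀ n (l * G.gamma) (G.formAt w) (rowVec w fun x y => M.ring 20 x 0 y)
      (rowVec w fun x y => M'.ring 20 x 0 y) i) (l * G.gamma) ?_ ?_ ?_).2.2
  · rw [IntExp.eval_mul, (hc _ fun _ _ => rfl).2.2.1]
    simp [h4]
  · exact ⟨fun _ _ => rfl, fun _ _ => rfl, IsFormReduced.zero⟩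
  intro i hi M1 ⟨h1, h2, h3⟩
  have hil : i / G.gamma < l := Nat.div_lt_of_lt_mul (by rwa [mul_comm] at hi)
  have him : i % G.gamma < moduleRank G.base R := Nat.mod_lt _ G.gamma_pos
  set M2 := M1.setInt 22 0 i with hM2
  have i2 : ∀ v < 20, M2.int v = M.int v := fun v hv => by
    rw [hM2, M1.setInt_int_ne (by omega), h1 v hv]
  have hψ : ∀ x, G.formAt w i (rowVec w (fun x y => M1.ring 20 x 0 y) x) =
      G.form ⟨i % G.gamma, him⟩ (M1.ring 20 x 0 (i / G.gamma)) := fun x => by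
    rw [G.formAt_apply (by omega)]; rfl
  simp only [run_seq_fst]
  -- the values of the form
  set φ : ℕ → G.base := fun x => G.form ⟨i % G.gamma, him⟩ (M1.ring 20 x 0 (i / G.gamma)) with hφ
  set Q3 := (fill 23 0 0 0 N 1
        (RingExp.coord ((ivar 22).mod (ivar 4)) (RingExp.get 20 (ivar 30) 0 (ivar 22 / ivar 4)) *
          RingExp.ann (RingExp.get 5 ((ivar 22).mod (ivar 4)) 0 0))) with hQ3
  set M3 := (Q3.run G M2).1 with hM3
  have f3 : ∀ x < n, M3.ring 23 x 0 0 = φ x := by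
    intro x hx
    have := (run_fill G M2 (a := 23) (I := 0) (J := 0) (O := 0) (n₁ := N) (n₂ := 1)
      (e := RingExp.coord ((ivar 22).mod (ivar 4)) (RingExp.get 20 (ivar 30) 0 (ivar 22 / ivar 4)) *
          RingExp.ann (RingExp.get 5 ((ivar 22).mod (ivar 4)) 0 0)) 0 0 0 n 1
      (fun x _ => (φ x : R)) ?_ ?_).1 x hx 0 (by decide)
    · simpa using this
    · intro s hs
      exact ⟨rfl, rfl, rfl, (hc s fun v hv => by rw [hs v (by omega) (by omega), i2 v hv]).2.1, rfl⟩
    · intro x hx y hy M' g1 g2 g3 g4 _ _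
      have e4 : M'.int 4 0 = G.gamma := by
        rw [g1 4 (by decide) (by decide), i2 4 (by decide), h4]
      have e22 : M'.int 22 0 = i := by
        rw [g1 22 (by decide) (by decide), hM2, Memory.setInt_int_same]
      have e5 : M'.ring 5 (i % G.gamma) 0 0 = (G.annGen (G.z ⟨i % G.gamma, him⟩) : R) := by
        rw [g4 5 (by decide), hM2, Memory.setInt_ring, h2 5 (by decide), h5, pad, dif_pos him]
      have e20 : M'.ring 20 = M1.ring 20 := by rw [g4 20 (by decide)]; rfl
      simp only [RingExp.eval_mul, RingExp.eval_coord, RingExp.eval_ann, RingExp.eval_get,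
        IntExp.eval_mod, IntExp.eval_get, IntExp.eval_div, IntExp.eval_ofNat, e4, e22, g2, e5, e20]
      rw [pad, dif_pos him, hφ]
      exact (G.form_apply _ _).symm
  have i3 : ∀ v, v ≠ 30 → v ≠ 31 → M3.int v = M2.int v := fun v _ _ =>
    run_int G _ _ (by simp [hQ3, fill, writesInt]; omega)
  have r3 : ∀ b, b ≠ 23 → M3.ring b = M1.ring b := fun b hb => by
    rw [hM3, run_ring G _ _ (by simp [hQ3, fill, writesRing]; omega)]; rfl
  -- the pivot
  set Q4 := pivotSearch N₀ with hQ4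
  obtain ⟨hp, hdvd⟩ := run_pivotSearch G M3 (N₀ := N₀) n₀ hn₀
    (fun s hs => (hc s fun v hv => by
      rw [hs v hv, i3 v (by omega) (by omega), i2 v hv]).1) φ (fun x hx => f3 x (by omega)) rfl
  rw [← hQ4] at hp hdvd
  set M4 := (Q4.run G M3).1 with hM4
  have i4 : ∀ v < 20, M4.int v = M.int v := fun v hv => by
    rw [hM4, run_int G _ _ (by simp [hQ4, pivotSearch, writesInt]; omega), i3 v (by omega)
      (by omega), i2 v hv]
  have r4 : M4.ring = M3.ring := funext fun b => run_ring G _ _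
    (by simp [hQ4, pivotSearch, writesRing])
  generalize hpe : M4.int 23 0 = p at hp hdvd
  -- the pivot row
  have hF5 := (run_fill G M4 (a := 21) (I := 0) (J := 0) (O := 0) (n₁ := 1) (n₂ := W)
    (e := RingExp.get 20 (ivar 23) 0 (ivar 31)) 0 0 0 1 w
    (fun _ y => M1.ring 20 p 0 y) ?_ ?_).1 0 (by decide)
  rotate_left
  · intro s hs
    exact ⟨rfl, rfl, rfl, rfl, (hc s fun v hv => by
      rw [hs v (by omega) (by omega), i4 v hv]).2.2.2⟩
  · intro x hx y hy M' g1 g2 g3 g4 _ _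
    simp [g1, g3, g4, r4, r3, hpe]
  set Q5 := fill 21 0 0 0 1 W (RingExp.get 20 (ivar 23) 0 (ivar 31)) with hQ5
  set M5 := (Q5.run G M4).1 with hM5
  have i5 : ∀ v, v ≠ 30 → v ≠ 31 → M5.int v = M4.int v := fun v _ _ =>
    run_int G _ _ (by simp [hQ5, fill, writesInt]; omega)
  have r5 : ∀ b, b ≠ 21 → M5.ring b = M3.ring b := fun b hb => by
    rw [hM5, run_ring G _ _ (by simp [hQ5, fill, writesRing]; omega), r4]
  -- the column of multipliers
  obtain ⟨t, ht⟩ : ∃ t : ℕ → G.base, ∀ x, (t x : R) = G.quo (φ x) (φ p) :=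
    ⟨fun x => (G.exists_quo (φ x) (φ p)).choose, fun x => (G.exists_quo _ _).choose_spec⟩
  have hF6 := (run_fill G M5 (a := 22) (I := 0) (J := 0) (O := 0) (n₁ := N) (n₂ := 1)
    (e := delta (ivar 30) (ivar 23) * (1 - RingExp.ann (RingExp.get 23 (ivar 23) 0 0)) +
                (1 - delta (ivar 30) (ivar 23)) *
                  RingExp.quo (RingExp.get 23 (ivar 30) 0 0) (RingExp.get 23 (ivar 23) 0 0))
    0 0 0 n 1
    (fun x _ => if x = p then 1 - (G.annGen (φ p : R) : R) else t x) ?_ ?_).1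
  rotate_left
  · intro s hs
    exact ⟨rfl, rfl, rfl, (hc s fun v hv => by
      rw [hs v (by omega) (by omega), i5 v (by omega) (by omega), i4 v hv]).2.1, rfl⟩
  · intro x hx y hy M' g1 g2 g3 g4 _ _
    have e23 : M'.int 23 0 = p := by
      rw [g1 23 (by decide) (by decide), i5 23 (by decide) (by decide), hpe]
    have hr : M'.ring 23 = M3.ring 23 := by rw [g4 23 (by decide), r5 23 (by decide)]
    have hd : (delta (ivar 30) (ivar 23)).eval G M' = if x = p then 1 else 0 := by
      rw [eval_delta G (by
        rw [g4 7 (by decide), r5 7 (by decide), r3 7 (by decide), h2 7 (by decide)]; exact h7)]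
      simp [g2, e23]
    rw [RingExp.eval_add, RingExp.eval_mul, RingExp.eval_mul, RingExp.eval_sub, RingExp.eval_sub,
      hd]
    simp only [RingExp.eval_one, RingExp.eval_ann, RingExp.eval_quo, RingExp.eval_get,
      IntExp.eval_get, IntExp.eval_ofNat, e23, g2, hr, f3 x hx, f3 p (by omega), G.coe_ann, ht]
    split <;> ring
  set Q6 := fill 22 0 0 0 N 1
              (delta (ivar 30) (ivar 23) * (1 - RingExp.ann (RingExp.get 23 (ivar 23) 0 0)) +
                (1 - delta (ivar 30) (ivar 23)) *
                  RingExp.quo (RingExp.get 23 (ivar 30) 0 0) (RingExp.get 23 (ivar 23) 0 0))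
    with hQ6
  set M6 := (Q6.run G M5).1 with hM6
  have i6 : ∀ v < 20, M6.int v = M.int v := fun v hv => by
    rw [hM6, run_int G _ _ (by simp [hQ6, fill, writesInt]; omega), i5 v (by omega) (by omega),
      i4 v hv]
  have r6 : ∀ b, b ≠ 22 → M6.ring b = M5.ring b := fun b hb =>
    run_ring G _ _ (by simp [hQ6, fill, writesRing]; omega)
  have hR := run_rankOne G M6 (N := N) (W := W) n w fun s hs =>
    have := hc s fun v hv => by rw [hs v hv, i6 v hv]
    ⟨this.2.1, this.2.2.2⟩
  have hA : ∀ x < n, ∀ y < w, ((rankOne N W).run G M6).1.ring 20 x 0 y =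
      M1.ring 20 x 0 y - (if x = p then 1 - (G.annGen (φ p : R) : R) else t x) *
        M1.ring 20 p 0 y := by
    intro x hx y hy
    have e5 := hF5 y hy
    have e6 := hF6 x hx 0 (by decide)
    simp only [add_zero] at e5 e6
    rw [hR x hx y hy, e6, r6 20 (by decide), r6 21 (by decide), r5 20 (by decide),
      r3 20 (by decide), e5]
  refine ⟨fun v hv => ?_, fun b hb => ?_, ?_⟩
  · rw [run_int G _ _ (by simp [rankOne, fill, writesInt]; omega), i6 v hv]
  · rw [run_ring G _ _ (by simp [rankOne, fill, writesRing]; omega), r6 b (by omega),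
      r5 b (by omega), r3 b (by omega), h2 b hb]
  · refine h3.step hi hn hp (a := G.annGen (φ p : R)) (t := t) ?_ ?_ ?_ ?_ ?_
    · intro x hx
      rw [hψ, hψ]
      exact hdvd x hx
    · intro c
      rw [hψ, ← G.annGen_spec, ← Subring.coe_mul, ZeroMemClass.coe_eq_zero]
    · intro x hx hd
      rw [hψ, hψ] at hd ⊢
      apply Subtype.ext
      rw [Subring.coe_mul, ht, mul_comm]
      exact G.mul_quo hd
    · ext y
      have := hA p (by omega) y y.2
      rw [if_pos rfl] at this
      simp only [rowVec, Pi.smul_apply, Subring.smul_def, smul_eq_mul]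
      rw [this]; ring
    · intro x hx hxp
      ext y
      have := hA x hx y y.2
      rw [if_neg hxp] at this
      simp only [rowVec, Pi.smul_apply, Pi.sub_apply, Subring.smul_def, smul_eq_mul]
      exact this

end Prog

/-! ### Free modules over a finite local ring -/

section FreeRank

variable {R : Type*} [CommRing R] [IsLocalRing R] [Finite R]

theorem isNilpotent_of_not_isUnit {a : R} (ha : ¬ IsUnit a) : IsNilpotent a := by
  have h1 : a ∈ IsLocalRing.maximalIdeal R := (IsLocalRing.mem_maximalIdeal a).2 ha
  rw [← IsLocalRing.jacobson_eq_maximalIdeal ⊥ bot_ne_top] at h1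
  obtain ⟨n, hn⟩ := IsArtinianRing.isNilpotent_jacobson_bot (R := R)
  exact ⟨n, by simpa [hn] using Ideal.pow_mem_pow h1 n⟩

variable (R) in
/-- The socle of a finite local ring is not zero. -/
theorem exists_socle_element : ∃ σ : R, σ ≠ 0 ∧ ∀ a : R, ¬ IsUnit a → σ * a = 0 := by
  have hnil : IsNilpotent (IsLocalRing.maximalIdeal R) := by
    rw [← IsLocalRing.jacobson_eq_maximalIdeal ⊥ bot_ne_top]
    exact IsArtinianRing.isNilpotent_jacobson_bot
  classical
  have hex : ∃ n, IsLocalRing.maximalIdeal R ^ n = ⊥ := hnil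
  have hspec := Nat.find_spec hex
  have hpos : Nat.find hex ≠ 0 := by
    intro h
    rw [h, pow_zero, Ideal.one_eq_top] at hspec
    exact top_ne_bot hspec
  obtain ⟨n, hn⟩ := Nat.exists_eq_succ_of_ne_zero hpos
  have hne : IsLocalRing.maximalIdeal R ^ n ≠ ⊥ := Nat.find_min hex (by omega)
  obtain ⟨σ, hσ, hσ0⟩ := Submodule.exists_mem_ne_zero_of_ne_bot hne
  refine ⟨σ, hσ0, fun a ha => ?_⟩
  have : σ * a ∈ IsLocalRing.maximalIdeal R ^ (n + 1) := by
    rw [pow_succ]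
    exact Ideal.mul_mem_mul hσ ((IsLocalRing.mem_maximalIdeal a).2 ha)
  rw [hn] at hspec
  rwa [hspec, Submodule.mem_bot] at this

theorem not_isUnit_of_mul_eq_zero {R : Type*} [CommRing R] {σ a : R} (hσ : σ ≠ 0) (h : σ * a = 0) :
    ¬ IsUnit a :=
  fun ha => hσ ((ha.mul_left_eq_zero).1 h)

variable {M : Type*} [AddCommGroup M] [Module R M] [Finite M]

theorem bddAbove_freeRank :
    BddAbove {d | ∃ N : Submodule R M, Module.Free R N ∧ Module.finrank R N = d} := by
  refine ⟨Module.finrank R M, ?_⟩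
  rintro d ⟨N, -, rfl⟩
  exact LinearMap.finrank_le_finrank_of_injective N.injective_subtype

theorem freeRank_eq_finrank [Module.Free R M] : freeRank R M = Module.finrank R M := by
  apply le_antisymm
  · refine csSup_le ⟨0, ⊥, inferInstance, by simp⟩ ?_
    rintro d ⟨N, -, rfl⟩
    exact LinearMap.finrank_le_finrank_of_injective N.injective_subtype
  · refine le_csSup bddAbove_freeRank ⟨⊤, ?_, finrank_top R M⟩
    exact Module.Free.of_equiv (Submodule.topEquiv (R := R) (M := M)).symm

theorem card_eq_pow_finrank' [Module.Free R M] :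
    Nat.card M = Nat.card R ^ Module.finrank R M := by
  have e := (Module.finBasis R M).equivFun
  rw [Nat.card_congr e.toEquiv, Nat.card_fun, Nat.card_fin]

/-- A family of `d` elements is independent if its span is as large as the free module of rank `d`.
-/
theorem linearIndependent_of_card_le {R M : Type*} [CommRing R] [Finite R] [AddCommGroup M]
    [Module R M] {d : ℕ} {v : Fin d → M}
    (h : Nat.card R ^ d ≤ Nat.card (Submodule.span R (Set.range v))) : LinearIndependent R v := by
  rw [← Fintype.range_linearCombination] at h
  have hs := (Fintype.linearCombination R v).surjective_rangeRestrict
  have hb := hs.bijective_of_nat_card_le (by rwa [Nat.card_fun, Nat.card_fin])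
  rw [linearIndependent_iff_injective_fintypeLinearCombination]
  intro x y hxy
  exact hb.1 (Subtype.ext hxy)

theorem finrank_span_eq {R M ι : Type*} [CommRing R] [Nontrivial R] [AddCommGroup M] [Module R M]
    [Fintype ι] {v : ι → M} (hv : LinearIndependent R v) :
    Module.finrank R (Submodule.span R (Set.range v)) = Fintype.card ι :=
  Module.finrank_eq_card_basis (Module.Basis.span hv)

/-- A module with `d` generators has free rank `d` only if the generators are independent. -/
theorem freeRank_span_eq_iff {d : ℕ} {v : Fin d → M} :
    freeRank R (Submodule.span R (Set.range v)) = d ↔ LinearIndependent R v := by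
  constructor
  · intro h
    have hmem := Nat.sSup_mem (s := {d | ∃ N : Submodule R (Submodule.span R (Set.range v)),
      Module.Free R N ∧ Module.finrank R N = d}) ⟨0, ⊥, inferInstance, by simp⟩ bddAbove_freeRank
    obtain ⟨N, hN, hd⟩ := hmem
    apply linearIndependent_of_card_le
    have hd' : Module.finrank R N = d := hd.trans h
    have hcard := card_eq_pow_finrank' (R := R) (M := N)
    rw [hd'] at hcard
    rw [← hcard]
    exact Nat.card_le_card_of_injective _ N.injective_subtype
  · intro h
    have : Module.Free R (Submodule.span R (Set.range v)) :=
      Module.Free.of_basis (Module.Basis.span h)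
    rw [freeRank_eq_finrank, finrank_span_eq h, Fintype.card_fin]

/-- Over a finite local ring, a generating family with as many elements as a basis is independent.
-/
theorem LinearIndependent.of_span_eq {d : ℕ} {v v' : Fin d → M} (hv : LinearIndependent R v)
    (h : Submodule.span R (Set.range v') = Submodule.span R (Set.range v)) :
    LinearIndependent R v' := by
  rw [← freeRank_span_eq_iff, h, freeRank_span_eq_iff]
  exact hv

/-- The socle of a module: the elements that are annihilated by all nonunits. -/
def socleSet (R : Type*) [CommRing R] (M : Type*) [AddCommGroup M] [Module R M] : Set M :=
  {x | ∀ a : R, ¬ IsUnit a → a • x = 0}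

/-- The rank of a free module is bounded below by the size of its socle. -/
theorem le_finrank_of_socle [Module.Free R M] {q : ℕ} (F : (Fin q → socleSet R R) → socleSet R M)
    (hF : Function.Injective F) : q ≤ Module.finrank R M := by
  obtain ⟨σ, hσ, hσs⟩ := exists_socle_element R
  have h1 : 1 < Nat.card (socleSet R R) := by
    rw [Finite.one_lt_card_iff_nontrivial]
    refine ⟨⟨0, fun a _ => smul_zero a⟩, ⟨σ, fun a ha => ?_⟩, fun h => hσ
      (congrArg Subtype.val h).symm⟩
    rw [smul_eq_mul, mul_comm]; exact hσs a ha
  let b := Module.finBasis R M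
  have hmem : ∀ (x : socleSet R M) (i : Fin (Module.finrank R M)),
      b.repr x i ∈ socleSet R R := fun x i a ha => by
    rw [← Finsupp.smul_apply, ← map_smul, x.2 a ha, map_zero, Finsupp.zero_apply]
  have h2 : Nat.card (socleSet R M) ≤ Nat.card (Fin (Module.finrank R M) → socleSet R R) := by
    refine Nat.card_le_card_of_injective (fun x i => ⟨b.repr x i, hmem x i⟩) fun x y hxy => ?_
    apply Subtype.ext
    apply b.repr.injective
    ext i
    exact congrArg Subtype.val (congrFun hxy i)
  have h3 := Nat.card_le_card_of_injective F hF
  rw [Nat.card_fun, Nat.card_fin] at h2 h3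
  exact (Nat.pow_le_pow_iff_right h1).1 (h3.trans h2)

/-- An element of a free module that is annihilated by a nonzero socle element is a combination with
nonunit coefficients. -/
theorem mem_maximalIdeal_smul_top_of_smul_eq_zero [Module.Free R M] {σ : R} (hσ : σ ≠ 0) {x : M}
    (hx : σ • x = 0) : x ∈ IsLocalRing.maximalIdeal R • (⊤ : Submodule R M) := by
  let b := Module.finBasis R M
  rw [← b.sum_repr x]
  refine Submodule.sum_mem _ fun i _ => Submodule.smul_mem_smul ?_ trivial
  rw [IsLocalRing.mem_maximalIdeal]
  refine not_isUnit_of_mul_eq_zero hσ ?_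
  rw [← smul_eq_mul, ← Finsupp.smul_apply, ← map_smul, hx, map_zero, Finsupp.zero_apply]

end FreeRank

/-! ### What an eliminated table says about its rows -/

section Consequences

variable {R : Type*} [CommRing R] {W N₀ N L q : ℕ} {A₀ A : ℕ → ℕ → R} {ns : ℕ → ℕ}

theorem rowSpan_eq (W N₀ : ℕ) (A : ℕ → ℕ → R) :
    rowSpan W N₀ A = Submodule.span R (Set.range fun i : Fin N₀ => rowVec W A i) := by
  rw [rowSpan]
  congr 1
  ext v
  constructor
  · rintro ⟨x, hx, rfl⟩
    exact ⟨⟨x, hx⟩, rfl⟩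
  · rintro ⟨x, rfl⟩
    exact ⟨x, x.2, rfl⟩

theorem mem_rowSpan_iff {v : Fin W → R} :
    v ∈ rowSpan W N₀ A ↔ ∃ d : Fin N₀ → R, v = ∑ x, d x • rowVec W A x := by
  rw [rowSpan_eq, Submodule.mem_span_range_iff_exists_fun]
  exact exists_congr fun d => eq_comm

/-- A vector that vanishes at the column of every pivot of an eliminated table. -/
def VanishesAtPivots (N₀ N L q : ℕ) (A : ℕ → ℕ → R) (ns : ℕ → ℕ) (v : Fin W → R) : Prop :=
  ∀ x < N₀, (∀ b < q, ns b ≠ x) → ∀ (c : ℕ) (hc : c < W), c < L → A x c = 1 →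
    (∀ x' < N, x' ≠ x → A x' c = 0) → v ⟨c, hc⟩ = 0

theorem rowVec_vanishesAtPivots {x : ℕ} (hx : x < N) (h : N₀ ≤ x ∨ ∃ b < q, ns b = x) :
    VanishesAtPivots N₀ N L q A ns (rowVec W A x) := by
  intro y hy hn c hc hcL h1 h0
  refine h0 x hx ?_
  rintro rfl
  rcases h with h | ⟨b, hb, h⟩
  · omega
  · exact hn b hb h

namespace IsEliminated

theorem coeff_eq (h : IsEliminated N₀ N L W A₀ A N₀ q ns) (hN : N₀ ≤ N) (hL : L ≤ W)
    (d : Fin N₀ → R) (x : Fin N₀) (hx : ∀ b < q, ns b ≠ x) :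
    ∃ (c : ℕ) (hc : c < W), c < L ∧ A x c = 1 ∧ (∀ x' < N, x' ≠ x → A x' c = 0) ∧
      (∑ y, d y • rowVec W A y) ⟨c, hc⟩ = d x := by
  obtain ⟨c, hc, h1, h0⟩ := h.pivot x x.2 hx
  refine ⟨c, by omega, hc, h1, h0, ?_⟩
  rw [Finset.sum_apply, Finset.sum_eq_single x]
  · simp [rowVec, h1]
  · intro y _ hyx
    simp [rowVec, h0 y (by omega) fun e => hyx (Fin.ext e)]
  · simp

/-- The rows without a pivot, as an embedding. -/
def nsFin (h : IsEliminated N₀ N L W A₀ A N₀ q ns) : Fin q ↪ Fin N₀ where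
  toFun b := ⟨ns b, h.lt b b.2⟩
  inj' b b' e := Fin.ext (h.inj b b.2 b' b'.2 (congrArg Fin.val e))

theorem sum_eq_sum_nsFin (h : IsEliminated N₀ N L W A₀ A N₀ q ns) {M : Type*} [AddCommMonoid M]
    (F : Fin N₀ → M) (hF : ∀ x : Fin N₀, (∀ b < q, ns b ≠ x) → F x = 0) :
    ∑ x, F x = ∑ b, F (h.nsFin b) := by
  classical
  rw [← Finset.sum_map Finset.univ h.nsFin F]
  refine (Finset.sum_subset (Finset.subset_univ _) fun x _ hx => hF x fun b hb e => hx ?_).symm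
  exact Finset.mem_map.2 ⟨⟨b, hb⟩, Finset.mem_univ _, Fin.ext e⟩

/-- An element of the span that vanishes at the pivots is a combination of the rows without a
pivot. -/
theorem exists_of_vanishesAtPivots (h : IsEliminated N₀ N L W A₀ A N₀ q ns) (hN : N₀ ≤ N)
    (hL : L ≤ W) {v : Fin W → R} (hv : v ∈ rowSpan W N₀ A)
    (h0 : VanishesAtPivots N₀ N L q A ns v) :
    ∃ d : Fin q → R, v = ∑ b, d b • rowVec W A (ns b) := by
  obtain ⟨d, rfl⟩ := mem_rowSpan_iff.1 hv
  refine ⟨fun b => d (h.nsFin b), h.sum_eq_sum_nsFin _ fun x hx => ?_⟩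
  obtain ⟨c, hc, hcL, h1, h2, h3⟩ := h.coeff_eq hN hL d x hx
  rw [← h3, h0 x x.2 hx c hc hcL h1 h2, zero_smul]

end IsEliminated

/-! ### The module generated by the syndrome -/

variable {S : Type*} [AddCommGroup S] [Module R S] {m : ℕ}

theorem rowSpan_eq_map (κ : S ≃ₗ[R] (Fin m → R)) {s : Fin N₀ → S}
    (hA₀ : ∀ (x : Fin N₀) (c : Fin m), A₀ x c = κ (s x) c) :
    rowSpan m N₀ A₀ = (Submodule.span R (Set.range s)).map κ.toLinearMap := by
  rw [rowSpan_eq, Submodule.map_span, ← Set.range_comp]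
  congr 2
  funext x
  funext c
  exact hA₀ x c

section Syndrome

variable (κ : S ≃ₗ[R] (Fin m → R)) {s : Fin N₀ → S}

/-- The rows with a pivot. -/
abbrev PivotRow (N₀ q : ℕ) (ns : ℕ → ℕ) : Type := {x : Fin N₀ // ∀ b < q, ns b ≠ x}

theorem IsEliminated.card_pivotRow (h : IsEliminated N₀ N L W A₀ A N₀ q ns) :
    Nat.card (PivotRow N₀ q ns) = N₀ - q := by
  classical
  have h1 : Nat.card {x : Fin N₀ // ¬ ∀ b < q, ns b ≠ x} = q := by
    have e : Fin q ≃ {x : Fin N₀ // ¬ ∀ b < q, ns b ≠ x} :=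
      Equiv.ofBijective (fun b => ⟨h.nsFin b, fun hb => hb b b.2 rfl⟩)
        ⟨fun b b' hb => h.nsFin.injective (congrArg Subtype.val hb), fun ⟨x, hx⟩ => by
          push Not at hx
          obtain ⟨b, hb, e⟩ := hx
          exact ⟨⟨b, hb⟩, Subtype.ext (Fin.ext e)⟩⟩
    rw [← Nat.card_congr e, Nat.card_fin]
  have h2 : Nat.card (PivotRow N₀ q ns) + Nat.card {x : Fin N₀ // ¬ ∀ b < q, ns b ≠ x} = N₀ := by
    rw [← Nat.card_sum, Nat.card_congr (Equiv.sumCompl _), Nat.card_fin]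
  omega

theorem IsEliminated.linearIndependent_pivotRow (h : IsEliminated N₀ N L W A₀ A N₀ q ns)
    (hN : N₀ ≤ N) (hL : L ≤ W) :
    LinearIndependent R fun x : PivotRow N₀ q ns => rowVec W A x.1 := by
  classical
  rw [Fintype.linearIndependent_iff]
  intro g hg x
  obtain ⟨c, hc, h1, h0⟩ := h.pivot x.1 x.1.2 x.2
  have := congrFun hg ⟨c, by omega⟩
  rw [Finset.sum_apply, Finset.sum_eq_single x] at this
  · simpa [rowVec, h1] using this
  · intro y _ hyx
    simp [rowVec, h0 y.1 (by omega) fun e => hyx (Subtype.ext (Fin.ext e))]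
  · simp

theorem IsEliminated.rowSpan_eq_span_pivotRow (h : IsEliminated N₀ N L W A₀ A N₀ q ns)
    (hz : ∀ b < q, ∀ c < W, A (ns b) c = 0) :
    rowSpan W N₀ A₀ =
      Submodule.span R (Set.range fun x : PivotRow N₀ q ns => rowVec W A x.1) := by
  rw [← h.span_eq]
  apply le_antisymm
  · rw [rowSpan_eq]
    refine Submodule.span_le.2 ?_
    rintro _ ⟨x, rfl⟩
    by_cases hx : ∀ b < q, ns b ≠ x
    · exact Submodule.subset_span ⟨⟨x, hx⟩, rfl⟩
    · push Not at hx
      obtain ⟨b, hb, e⟩ := hx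
      have : rowVec W A x = 0 := by
        funext c
        rw [← e]
        exact hz b hb c c.2
      simp only [this]
      exact Submodule.zero_mem _
  · refine Submodule.span_le.2 ?_
    rintro _ ⟨x, rfl⟩
    exact rowVec_mem_rowSpan A x.1.2

theorem IsEliminated.finrank_span (h : IsEliminated N₀ N m m A₀ A N₀ q ns) [Nontrivial R]
    (hN : N₀ ≤ N) (hA₀ : ∀ (x : Fin N₀) (c : Fin m), A₀ x c = κ (s x) c)
    (hz : ∀ b < q, ∀ c < m, A (ns b) c = 0) :
    Module.Free R (Submodule.span R (Set.range s)) ∧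
      Module.finrank R (Submodule.span R (Set.range s)) = N₀ - q := by
  classical
  have e1 : Submodule.span R (Set.range s) ≃ₗ[R] rowSpan m N₀ A₀ := by
    rw [rowSpan_eq_map κ hA₀]
    exact κ.submoduleMap _
  have hli := h.linearIndependent_pivotRow hN le_rfl
  have e2 := h.rowSpan_eq_span_pivotRow hz
  have hfree : Module.Free R (rowSpan m N₀ A₀) := by
    rw [e2]; exact Module.Free.of_basis (Module.Basis.span hli)
  refine ⟨Module.Free.of_equiv e1.symm, ?_⟩
  rw [e1.finrank_eq, e2, finrank_span_eq hli, ← Nat.card_eq_fintype_card, h.card_pivotRow]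

/-- If the module generated by the rows is free, then nothing is left in the rows without a pivot:
such a row `v` has nonunit entries, so it is annihilated by the socle, and therefore lies in `𝔪`
times the module. By Nakayama's lemma the rows with a pivot generate the module. -/
theorem IsEliminated.eq_zero_of_free [IsLocalRing R] [Finite R]
    (h : IsEliminated N₀ N m m A₀ A N₀ q ns) (hN : N₀ ≤ N)
    (hfree : Module.Free R (rowSpan m N₀ A₀)) :
    ∀ b < q, ∀ c < m, A (ns b) c = 0 := by
  obtain ⟨σ, hσ, hσs⟩ := exists_socle_element R
  rw [← h.span_eq] at hfree
  set P := Submodule.span R (Set.range fun x : PivotRow N₀ q ns => rowVec m A x.1) with hP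
  have hns : ∀ b < q, rowVec m A (ns b) ∈ IsLocalRing.maximalIdeal R • rowSpan m N₀ A := by
    intro b hb
    have hmem := rowVec_mem_rowSpan (W := m) A (h.lt b hb)
    have h0 : σ • (⟨rowVec m A (ns b), hmem⟩ : rowSpan m N₀ A) = 0 := by
      apply Subtype.ext
      funext c
      exact hσs _ (h.nonunit b hb c c.2)
    have := Submodule.mem_map_of_mem (f := (rowSpan m N₀ A).subtype)
      (mem_maximalIdeal_smul_top_of_smul_eq_zero hσ h0)
    rw [Submodule.map_smul'', Submodule.map_subtype_top] at this
    exact this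
  have hle : rowSpan m N₀ A ≤ P ⊔ IsLocalRing.maximalIdeal R • rowSpan m N₀ A := by
    conv_lhs => rw [rowSpan_eq]
    refine Submodule.span_le.2 ?_
    rintro _ ⟨x, rfl⟩
    by_cases hx : ∀ b < q, ns b ≠ x
    · exact Submodule.mem_sup_left (Submodule.subset_span ⟨⟨x, hx⟩, rfl⟩)
    · push Not at hx
      obtain ⟨b, hb, e⟩ := hx
      simp only [← e]
      exact Submodule.mem_sup_right (hns b hb)
  have hle' : rowSpan m N₀ A ≤ P :=
    Submodule.le_of_le_smul_of_le_jacobson_bot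
      (Submodule.fg_span ((Set.finite_Iio N₀).image _))
      (IsLocalRing.maximalIdeal_le_jacobson ⊥) hle
  intro b hb c hc
  have h1 := hle' (rowVec_mem_rowSpan (W := m) A (h.lt b hb))
  classical
  obtain ⟨g, hg⟩ := (Submodule.mem_span_range_iff_exists_fun _).1 h1
  have hg0 : ∀ x, g x = 0 := by
    intro x
    obtain ⟨c', hc', e1, e0⟩ := h.pivot x.1 x.1.2 x.2
    have := congrFun hg ⟨c', by omega⟩
    rw [Finset.sum_apply, Finset.sum_eq_single x] at this
    · simp only [rowVec, Pi.smul_apply, e1, smul_eq_mul, mul_one] at this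
      rw [this]
      exact e0 _ (by have := h.lt b hb; omega) (x.2 b hb)
    · intro y _ hyx
      simp [rowVec, e0 y.1 (by omega) fun e => hyx (Subtype.ext (Fin.ext e))]
    · simp
  have h2 : rowVec m A (ns b) = 0 := by
    rw [← hg]
    exact Finset.sum_eq_zero fun x _ => by rw [hg0, zero_smul]
  exact congrFun h2 ⟨c, hc⟩

/-- Elimination decides whether the module generated by the rows is free. -/
theorem IsEliminated.free_span_iff [IsLocalRing R] [Finite R]
    (h : IsEliminated N₀ N m m A₀ A N₀ q ns) (hN : N₀ ≤ N)
    (hA₀ : ∀ (x : Fin N₀) (c : Fin m), A₀ x c = κ (s x) c) :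
    Module.Free R (Submodule.span R (Set.range s)) ↔ ∀ b < q, ∀ c < m, A (ns b) c = 0 := by
  refine ⟨fun hfree => h.eq_zero_of_free hN ?_, fun hz => (h.finrank_span κ hN hA₀ hz).1⟩
  rw [rowSpan_eq_map κ hA₀]
  exact Module.Free.of_equiv (κ.submoduleMap _)

/-- The additional rows have been reduced modulo the module generated by the main rows. -/
theorem IsEliminated.sum_smul_mem_iff (h : IsEliminated N₀ N m m A₀ A N₀ q ns) (hN : N₀ ≤ N)
    (hA₀ : ∀ (x : Fin N₀) (c : Fin m), A₀ x c = κ (s x) c)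
    (hz : ∀ b < q, ∀ c < m, A (ns b) c = 0) {ι : Type*} [Fintype ι] (x : ι → ℕ)
    (hx : ∀ i, N₀ ≤ x i ∧ x i < N) (t : ι → S) (ht : ∀ i (c : Fin m), A₀ (x i) c = κ (t i) c)
    (g : ι → R) :
    ∑ i, g i • t i ∈ Submodule.span R (Set.range s) ↔
      ∀ c : Fin m, ∑ i, g i * A (x i) c = 0 := by
  have hmap : ∑ i, g i • t i ∈ Submodule.span R (Set.range s) ↔
      κ (∑ i, g i • t i) ∈ rowSpan m N₀ A₀ := by
    rw [rowSpan_eq_map κ hA₀]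
    exact ⟨fun hx => Submodule.mem_map_of_mem hx,
      fun ⟨y, hy, e⟩ => by rwa [← κ.injective e]⟩
  have hdiff : ∑ i, g i • rowVec m A (x i) - κ (∑ i, g i • t i) ∈ rowSpan m N₀ A₀ := by
    rw [map_sum, ← Finset.sum_sub_distrib]
    refine Submodule.sum_mem _ fun i _ => ?_
    have e : rowVec m A₀ (x i) = κ (t i) := funext fun c => ht i c
    rw [map_smul, ← smul_sub, ← e]
    exact Submodule.smul_mem _ _ (h.extra _ (hx i).1 (hx i).2)
  have hsum : ∀ c : Fin m, (∑ i, g i • rowVec m A (x i)) c = ∑ i, g i * A (x i) c := fun c => by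
    rw [Finset.sum_apply]; rfl
  rw [hmap]
  constructor
  · intro hmem c
    have h1 := Submodule.add_mem _ hdiff hmem
    rw [sub_add_cancel, ← h.span_eq] at h1
    obtain ⟨d, hd⟩ := h.exists_of_vanishesAtPivots hN le_rfl h1 (by
      intro y hy hn c hc hcL h1 h0
      rw [Finset.sum_apply]
      refine Finset.sum_eq_zero fun i _ => ?_
      rw [Pi.smul_apply, rowVec_vanishesAtPivots (hx i).2 (Or.inl (hx i).1) y hy hn c hc hcL h1 h0,
        smul_zero])
    rw [← hsum, hd, Finset.sum_apply]
    exact Finset.sum_eq_zero fun b _ => by simp [rowVec, hz b b.2 c c.2]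
  · intro h0
    have e : ∑ i, g i • rowVec m A (x i) = 0 := funext fun c => by rw [hsum, h0]; rfl
    rw [e, zero_sub] at hdiff
    exact (Submodule.neg_mem_iff _).1 hdiff

end Syndrome
end Consequences

section Kernel

variable {R : Type*} [CommRing R] {S : Type*} [AddCommGroup S] [Module R S] {m L q : ℕ}
  {A₀ A : ℕ → ℕ → R} {ns : ℕ → ℕ}

/-! ### The kernel of a matrix -/

section

variable (hδ : ∀ (x : ℕ) (y : Fin m), x < m → A₀ x (L + y) = if x = y then 1 else 0)
include hδ

theorem linearIndependent_rowVec_of_identity :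
    LinearIndependent R fun x : Fin m => rowVec (L + m) A₀ x := by
  rw [Fintype.linearIndependent_iff]
  intro g hg x
  have := congrFun hg ⟨L + x, by omega⟩
  rw [Finset.sum_apply, Finset.sum_eq_single x] at this
  · simpa [rowVec, hδ x x x.2] using this
  · intro y _ hyx
    have : ¬ (y : ℕ) = x := fun e => hyx (Fin.ext e)
    simp [rowVec, hδ y x y.2, this]
  · simp

/-- The right part of an element of the span of the rows `(v_x, e_x)` is the list of its
coefficients. -/
theorem apply_eq_of_mem_rowSpan {v : Fin (L + m) → R} (hv : v ∈ rowSpan (L + m) m A₀) (c : ℕ)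
    (hc : c < L) : v ⟨c, by omega⟩ = ∑ u : Fin m, v ⟨L + u, by omega⟩ * A₀ u c := by
  obtain ⟨d, rfl⟩ := mem_rowSpan_iff.1 hv
  have hd : ∀ u : Fin m, (∑ x, d x • rowVec (L + m) A₀ x) ⟨L + u, by omega⟩ = d u := by
    intro u
    rw [Finset.sum_apply, Finset.sum_eq_single u]
    · simp [rowVec, hδ u u u.2]
    · intro y _ hyx
      have : ¬ (y : ℕ) = u := fun e => hyx (Fin.ext e)
      simp [rowVec, hδ y u y.2, this]
    · simp
  simp only [hd]
  rw [Finset.sum_apply]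
  rfl

variable [IsLocalRing R] [Finite R]

theorem IsEliminated.linearIndependent_rowVec {N L' : ℕ}
    (h : IsEliminated m N L' (L + m) A₀ A m q ns) :
    LinearIndependent R fun x : Fin m => rowVec (L + m) A x := by
  refine (linearIndependent_rowVec_of_identity hδ).of_span_eq ?_
  rw [← rowSpan_eq, ← rowSpan_eq, h.span_eq]

variable (h : IsEliminated m m L (L + m) A₀ A m q ns) (κ : S ≃ₗ[R] (Fin m → R))
  {E : Submodule R S} (hE : ∀ x, x ∈ E ↔ ∀ c < L, ∑ u : Fin m, κ x u * A₀ u c = 0)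
include h hE

omit [IsLocalRing R] [Finite R] in
/-- A combination of the right parts of the rows without a pivot lies in the kernel if and only if
the same combination of the left parts vanishes. -/
theorem IsEliminated.sum_smul_mem_kernel_iff (g : Fin q → R) :
    ∑ b, g b • κ.symm (fun u => A (ns b) (L + u)) ∈ E ↔
      ∀ c < L, ∑ b, g b * A (ns b) c = 0 := by
  rw [hE]
  refine forall_congr' fun c => forall_congr' fun hc => ?_
  have hb : ∀ b : Fin q, A (ns b) c = ∑ u : Fin m, A (ns b) (L + u) * A₀ u c := by
    intro b
    have hmem := rowVec_mem_rowSpan (W := L + m) A (h.lt b b.2)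
    rw [h.span_eq] at hmem
    exact apply_eq_of_mem_rowSpan hδ hmem c hc
  have : ∑ u : Fin m, κ (∑ b, g b • κ.symm (fun u => A (ns b) (L + u))) u * A₀ u c =
      ∑ b, g b * A (ns b) c := by
    simp only [map_sum, map_smul, LinearEquiv.apply_symm_apply, Finset.sum_apply, Pi.smul_apply,
      smul_eq_mul, Finset.sum_mul, hb, Finset.mul_sum]
    rw [Finset.sum_comm]
    refine Finset.sum_congr rfl fun _ _ => Finset.sum_congr rfl fun _ _ => by ring
  rw [this]

omit hE in
/-- The right parts of the rows without a pivot are independent: the rows are, and a row is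
determined by its right part. -/
theorem IsEliminated.linearIndependent_kernel :
    LinearIndependent R fun b : Fin q => κ.symm fun u => A (ns b) (L + u) := by
  have hli : LinearIndependent R fun b : Fin q => rowVec (L + m) A (ns b) :=
    (h.linearIndependent_rowVec hδ).comp h.nsFin h.nsFin.injective
  rw [Fintype.linearIndependent_iff] at hli ⊢
  intro g hg
  refine hli g (funext fun c => ?_)
  have hR : ∀ u : Fin m, ∑ b, g b * A (ns b) (L + u) = 0 := by
    intro u
    have := congrArg κ hg
    simp only [map_sum, map_smul, LinearEquiv.apply_symm_apply, map_zero] at this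
    have := congrFun this u
    rw [Finset.sum_apply] at this
    exact this
  rw [Finset.sum_apply]
  by_cases hc : (c : ℕ) < L
  · have hmem : ∑ b : Fin q, g b • rowVec (L + m) A (ns b) ∈ rowSpan (L + m) m A₀ := by
      rw [← h.span_eq]
      exact Submodule.sum_mem _ fun b _ => Submodule.smul_mem _ _
        (rowVec_mem_rowSpan A (h.lt b b.2))
    have := apply_eq_of_mem_rowSpan hδ hmem c hc
    rw [Finset.sum_apply] at this
    refine this.trans (Finset.sum_eq_zero fun u _ => ?_)
    rw [Finset.sum_apply]
    have e : ∑ b : Fin q, (g b • rowVec (L + m) A (ns b)) ⟨L + u, by omega⟩ = 0 := hR u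
    rw [e, zero_mul]
  · have := hR ⟨c - L, by omega⟩
    have e : L + (c - L) = (c : ℕ) := by omega
    simp only [e] at this
    exact this

omit [IsLocalRing R] [Finite R] in
/-- The row `(0, x)` of an element `x` of the kernel vanishes at all pivots, so that it is a
combination of the rows without a pivot. -/
theorem IsEliminated.kernel_le_span :
    E ≤ Submodule.span R (Set.range fun b : Fin q => κ.symm fun u => A (ns b) (L + u)) := by
  intro x hx
  let v : Fin (L + m) → R := fun c => if hc : L ≤ c then κ x ⟨c - L, by omega⟩ else 0
  have hvR : ∀ u : Fin m, v ⟨L + u, by omega⟩ = κ x u := fun u => by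
    simp [v]
  have hv : v ∈ rowSpan (L + m) m A₀ := by
    rw [mem_rowSpan_iff]
    refine ⟨fun u => κ x u, funext fun c => ?_⟩
    rw [Finset.sum_apply]
    by_cases hc : L ≤ (c : ℕ)
    · have e : ∀ y : Fin m, A₀ y c = if (y : ℕ) = c - L then 1 else 0 := fun y => by
        have := hδ y ⟨c - L, by omega⟩ y.2
        rwa [show L + ((⟨c - L, by omega⟩ : Fin m) : ℕ) = c by simp; omega] at this
      rw [Finset.sum_eq_single ⟨c - L, by omega⟩]
      · have e1 : A₀ (c - L) c = 1 := by simpa using e ⟨c - L, by omega⟩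
        simp [v, dif_pos hc, rowVec, e1]
      · intro y _ hy
        have hy' : ¬ (y : ℕ) = c - L := fun e' => hy (Fin.ext e')
        simp [rowVec, e, hy']
      · simp
    · simp only [v, dif_neg hc]
      exact ((hE x).1 hx c (by omega)).symm
  rw [← h.span_eq] at hv
  obtain ⟨d, hd⟩ := h.exists_of_vanishesAtPivots le_rfl (by omega) hv (by
    intro y hy hn c hc hcL h1 h0
    simp only [v]
    rw [dif_neg (by simp; omega)])
  have hx' : x = ∑ b, d b • κ.symm (fun u => A (ns b) (L + u)) := by
    apply κ.injective
    funext u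
    rw [← hvR, hd]
    simp only [map_sum, map_smul, LinearEquiv.apply_symm_apply, Finset.sum_apply, Pi.smul_apply]
    rfl
  rw [hx']
  exact Submodule.sum_mem _ fun b _ => Submodule.smul_mem _ _ (Submodule.subset_span ⟨b, rfl⟩)

omit [IsLocalRing R] [Finite R] in
/-- The kernel is generated by the right parts of the rows without a pivot, if their left parts
vanish. -/
theorem IsEliminated.kernel_eq_span (hz : ∀ b < q, ∀ c < L, A (ns b) c = 0) :
    E = Submodule.span R (Set.range fun b : Fin q => κ.symm fun u => A (ns b) (L + u)) := by
  refine (h.kernel_le_span hδ κ hE).antisymm (Submodule.span_le.2 ?_)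
  rintro _ ⟨b, rfl⟩
  have := (h.sum_smul_mem_kernel_iff hδ κ hE (Pi.single b 1)).2 fun c hc => by
    refine Finset.sum_eq_zero fun b' _ => ?_
    rw [hz b' b'.2 c hc, mul_zero]
  simpa [Pi.single_apply] using this

/-- If the kernel is free, then the rows without a pivot have vanishing left parts. The left parts
have nonunit entries, so that the kernel contains the socle of the free module of rank `q` generated
by the right parts. Its rank is therefore at least `q`, and as it is contained in this free module,
it is equal to it. -/
theorem IsEliminated.eq_zero_of_kernel_free [Finite S] (hfree : Module.Free R E) :
    ∀ b < q, ∀ c < L, A (ns b) c = 0 := by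
  have hli := h.linearIndependent_kernel hδ κ
  have hle := h.kernel_le_span hδ κ hE
  set ε : Fin q → S := fun b => κ.symm fun u => A (ns b) (L + u) with hε
  have hmem : ∀ τ : Fin q → socleSet R R, ∑ b, (τ b : R) • ε b ∈ E := by
    intro τ
    rw [hε, h.sum_smul_mem_kernel_iff hδ κ hE]
    intro c hc
    refine Finset.sum_eq_zero fun b _ => ?_
    rw [mul_comm]
    exact (τ b).2 _ (h.nonunit b b.2 c hc)
  have hq : q ≤ Module.finrank R E := by
    refine le_finrank_of_socle (R := R) (M := E) (fun τ => ⟨⟨∑ b, (τ b : R) • ε b, hmem τ⟩, ?_⟩) ?_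
    · intro a ha
      apply Subtype.ext
      change a • ∑ b, (τ b : R) • ε b = 0
      rw [Finset.smul_sum]
      refine Finset.sum_eq_zero fun b _ => ?_
      rw [smul_smul, ← smul_eq_mul, (τ b).2 a ha, zero_smul]
    · intro τ τ' hττ
      have e : ∑ b, (τ b : R) • ε b = ∑ b, (τ' b : R) • ε b :=
        congrArg (fun x : socleSet R E => ((x : E) : S)) hττ
      have := (linearIndependent_iff_injective_fintypeLinearCombination.1 hli) e
      exact funext fun b => Subtype.ext (congrFun this b)
  have hspan : E = Submodule.span R (Set.range ε) := by
    apply SetLike.coe_injective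
    refine Set.eq_of_subset_of_ncard_le hle ?_ (Set.toFinite _)
    have hfree' : Module.Free R (Submodule.span R (Set.range ε)) :=
      Module.Free.of_basis (Module.Basis.span hli)
    have h1 := card_eq_pow_finrank' (R := R) (M := E)
    have h2 := card_eq_pow_finrank' (R := R) (M := Submodule.span R (Set.range ε))
    rw [finrank_span_eq hli, Fintype.card_fin] at h2
    have h3 : Nat.card (Submodule.span R (Set.range ε)) ≤ Nat.card E := by
      rw [h1, h2]
      exact Nat.pow_le_pow_right Nat.card_pos hq
    exact h3
  intro b hb c hc
  have hb' : ∑ b', (Pi.single (⟨b, hb⟩ : Fin q) (1 : R) : Fin q → R) b' • ε b' ∈ E := by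
    rw [hspan]
    exact Submodule.sum_mem _ fun b _ => Submodule.smul_mem _ _ (Submodule.subset_span ⟨b, rfl⟩)
  have := (h.sum_smul_mem_kernel_iff hδ κ hE _).1 hb' c hc
  simpa [Pi.single_apply] using this

end

/-! ### Coordinates with respect to an independent family -/

section Coordinates

variable [IsLocalRing R] [Finite R] (κ : S ≃ₗ[R] (Fin L → R)) {Nx : ℕ} {x : Fin m → S}
  (h : IsEliminated m (m + Nx) L (L + m) A₀ A m q ns)
  (hδ : ∀ (b : ℕ) (y : Fin m), b < m → A₀ b (L + y) = if b = y then 1 else 0)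
  (hx : ∀ (b : Fin m) (c : Fin L), A₀ b c = κ (x b) c)
include h hδ hx

omit h [IsLocalRing R] [Finite R] in
theorem apply_eq_coord_of_mem_rowSpan {v : Fin (L + m) → R} (hv : v ∈ rowSpan (L + m) m A₀)
    (c : Fin L) : v ⟨c, by omega⟩ = κ (∑ u : Fin m, v ⟨L + u, by omega⟩ • x u) c := by
  rw [apply_eq_of_mem_rowSpan hδ hv c c.2]
  simp only [map_sum, map_smul, Finset.sum_apply, Pi.smul_apply, smul_eq_mul, ← hx]

/-- A family is independent if and only if all its rows get a pivot. -/
theorem IsEliminated.eq_zero_iff_linearIndependent : q = 0 ↔ LinearIndependent R x := by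
  have hA := h.linearIndependent_rowVec hδ
  have hA₀ := linearIndependent_rowVec_of_identity hδ
  constructor
  · rintro rfl
    rw [Fintype.linearIndependent_iff]
    intro g hg
    have hmem : ∑ b, g b • rowVec (L + m) A₀ b ∈ rowSpan (L + m) m A := by
      rw [h.span_eq, mem_rowSpan_iff]
      exact ⟨g, rfl⟩
    have h0 : ∀ c : Fin L, (∑ b, g b • rowVec (L + m) A₀ b) ⟨c, by omega⟩ = 0 := by
      intro c
      have := congrFun (congrArg κ hg) c
      simp only [map_sum, map_smul, map_zero, Finset.sum_apply, Pi.smul_apply, ← hx] at this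
      rw [Finset.sum_apply]
      exact this
    obtain ⟨d, hd⟩ := h.exists_of_vanishesAtPivots (by omega) (by omega) hmem
      fun y _ _ c _ hcL _ _ => h0 ⟨c, hcL⟩
    have hd' : ∑ b, g b • rowVec (L + m) A₀ b = 0 := hd.trans (Fin.sum_univ_zero _)
    exact Fintype.linearIndependent_iff.1 hA₀ g hd'
  · intro hli
    by_contra hq
    obtain ⟨σ, hσ, hσs⟩ := exists_socle_element R
    have hlt := h.lt 0 (by omega)
    have hmem : rowVec (L + m) A (ns 0) ∈ rowSpan (L + m) m A₀ := by
      rw [← h.span_eq]; exact rowVec_mem_rowSpan A hlt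
    have h1 : ∑ u : Fin m, (σ * A (ns 0) (L + u)) • x u = 0 := by
      apply κ.injective
      funext c
      have := apply_eq_coord_of_mem_rowSpan κ hδ hx hmem c
      simp only [mul_smul, ← Finset.smul_sum, map_smul, Pi.smul_apply, map_zero, Pi.zero_apply]
      have e : A (ns 0) c = κ (∑ u : Fin m, A (ns 0) (L + u) • x u) c := this
      rw [← e]
      exact hσs _ (h.nonunit 0 (by omega) c c.2)
    have h2 := Fintype.linearIndependent_iff.1 hli _ h1
    have h3 : σ • rowVec (L + m) A (ns 0) = 0 := by
      funext c
      by_cases hc : (c : ℕ) < L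
      · exact hσs _ (h.nonunit 0 (by omega) c hc)
      · have := h2 ⟨c - L, by omega⟩
        have e : L + (c - L) = (c : ℕ) := by omega
        simp only [e] at this
        exact this
    have h4 := Fintype.linearIndependent_iff.1 hA (Pi.single ⟨ns 0, hlt⟩ σ) (by
      rw [Finset.sum_eq_single ⟨ns 0, hlt⟩]
      · simpa using h3
      · intro b _ hb; rw [Pi.single_eq_of_ne hb, zero_smul]
      · simp) ⟨ns 0, hlt⟩
    rw [Pi.single_eq_same] at h4
    exact hσ h4

omit [IsLocalRing R] [Finite R] in
/-- The coordinates of an element of the span are computed in its additional row. -/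
theorem IsEliminated.eq_neg_sum (hq : q = 0) {i : ℕ} (hi : i < Nx) {t : S}
    (ht : ∀ c : Fin L, A₀ (m + i) c = κ t c) (ht0 : ∀ y : Fin m, A₀ (m + i) (L + y) = 0)
    (hmem : t ∈ Submodule.span R (Set.range x)) :
    t = -∑ b : Fin m, A (m + i) (L + b) • x b := by
  subst hq
  obtain ⟨g, hg⟩ := (Submodule.mem_span_range_iff_exists_fun _).1 hmem
  set u := rowVec (L + m) A (m + i)
  set u₀ := rowVec (L + m) A₀ (m + i)
  have h1 : u - u₀ ∈ rowSpan (L + m) m A₀ := h.extra _ (by omega) (by omega)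
  have h2 : u - u₀ + ∑ b, g b • rowVec (L + m) A₀ b ∈ rowSpan (L + m) m A := by
    rw [h.span_eq]
    exact Submodule.add_mem _ h1 (mem_rowSpan_iff.2 ⟨g, rfl⟩)
  have h3 : ∀ c : Fin L, (u - u₀ + ∑ b, g b • rowVec (L + m) A₀ b) ⟨c, by omega⟩ =
      u ⟨c, by omega⟩ := by
    intro c
    have e1 : u₀ ⟨c, by omega⟩ = κ t c := ht c
    have e2 : (∑ b, g b • rowVec (L + m) A₀ b) ⟨c, by omega⟩ = κ t c := by
      rw [← hg, Finset.sum_apply]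
      simp only [map_sum, map_smul, Finset.sum_apply, Pi.smul_apply, ← hx]
      rfl
    rw [Pi.add_apply, Pi.sub_apply, e1, e2, sub_add_cancel]
  obtain ⟨d, hd⟩ := h.exists_of_vanishesAtPivots (by omega) (by omega) h2 (by
    intro y hy hn c hc hcL e1 e0
    rw [h3 ⟨c, hcL⟩]
    exact rowVec_vanishesAtPivots (by omega) (Or.inl (by omega)) y hy hn c hc hcL e1 e0)
  replace hd := hd.trans (Fin.sum_univ_zero _)
  apply κ.injective
  funext c
  have h4 := apply_eq_coord_of_mem_rowSpan κ hδ hx h1 c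
  have e1 : (u - u₀) ⟨c, by omega⟩ = -κ t c := by
    have := h3 c
    rw [hd] at this
    rw [Pi.sub_apply, ← this, Pi.zero_apply, zero_sub]
    exact congrArg Neg.neg (ht c)
  have e2 : ∀ b : Fin m, (u - u₀) ⟨L + b, by omega⟩ = A (m + i) (L + b) := by
    intro b
    rw [Pi.sub_apply]
    have : u₀ ⟨L + b, by omega⟩ = 0 := ht0 b
    rw [this, sub_zero]
    rfl
  simp only [e1, e2] at h4
  rw [map_neg, Pi.neg_apply, ← h4, neg_neg]

end Coordinates

end Kernel

/-! ### Independence modulo the maximal ideal -/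

section Residual

variable {R : Type*} [CommRing R] [IsLocalRing R]

/-- The first `a` rows of a table, cut off after `n` entries, are independent over the residue
field. -/
def ResiduallyIndependent (n a : ℕ) (Y : ℕ → ℕ → R) : Prop :=
  ∀ d : Fin a → R, (∀ j < n, ∑ b, d b * Y b j ∈ IsLocalRing.maximalIdeal R) →
    ∀ b, d b ∈ IsLocalRing.maximalIdeal R

variable {n a : ℕ} {Y : ℕ → ℕ → R}

theorem ResiduallyIndependent.of_dual
    (h : ∀ a₀ : Fin a, ∃ e : Fin n → R, ∀ b : Fin a,
      ∑ j : Fin n, e j * Y b j = if b = a₀ then 1 else 0) :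
    ResiduallyIndependent n a Y := by
  intro d hd a₀
  obtain ⟨e, he⟩ := h a₀
  have : d a₀ = ∑ j : Fin n, e j * ∑ b, d b * Y b j := by
    calc d a₀ = ∑ b, d b * ∑ j : Fin n, e j * Y b j := by simp [he]
      _ = ∑ j : Fin n, e j * ∑ b, d b * Y b j := by
        simp only [Finset.mul_sum]
        rw [Finset.sum_comm]
        exact Finset.sum_congr rfl fun _ _ => Finset.sum_congr rfl fun _ _ => by ring
  rw [this]
  exact Ideal.sum_mem _ fun j _ => Ideal.mul_mem_left _ _ (hd j j.2)

theorem residue_eq_zero_iff_mem {x : R} :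
    IsLocalRing.residue R x = 0 ↔ x ∈ IsLocalRing.maximalIdeal R :=
  Ideal.Quotient.eq_zero_iff_mem

/-- A matrix with rows that are independent over the residue field has a right inverse: one over the
residue field is lifted, and corrected by a matrix that is invertible because it is the identity
modulo `𝔪`. -/
theorem ResiduallyIndependent.exists_dual (h : ResiduallyIndependent n a Y) (a₀ : Fin a) :
    ∃ e : Fin n → R, ∀ b : Fin a, ∑ j : Fin n, e j * Y b j = if b = a₀ then 1 else 0 := by
  classical
  let k := IsLocalRing.ResidueField R
  let π := IsLocalRing.residue R
  let F : (Fin a → k) →ₗ[k] (Fin n → k) :=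
    Fintype.linearCombination k (fun b j => π (Y b j))
  have hF : LinearMap.ker F = ⊥ := by
    rw [LinearMap.ker_eq_bot']
    intro c hc
    choose d hd using fun b => IsLocalRing.residue_surjective (c b)
    funext b
    rw [← hd b, Pi.zero_apply, residue_eq_zero_iff_mem]
    refine h d (fun j hj => ?_) b
    rw [← residue_eq_zero_iff_mem, map_sum]
    have := congrFun hc ⟨j, hj⟩
    simp only [F, Fintype.linearCombination_apply, Finset.sum_apply, Pi.smul_apply, smul_eq_mul,
      ← hd] at this
    simpa [π] using this
  obtain ⟨g, hg⟩ := F.exists_leftInverse_of_injective hF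
  choose B hB using fun (j : Fin n) (b : Fin a) =>
    IsLocalRing.residue_surjective (g (Pi.single j 1) b)
  let T : Matrix (Fin a) (Fin a) R := fun b b' => ∑ j : Fin n, Y b j * B j b'
  have hT : T.map π = 1 := by
    ext b b'
    have h1 : g (F (Pi.single b 1)) b' = (1 : Matrix (Fin a) (Fin a) k) b b' := by
      have := LinearMap.congr_fun hg (Pi.single b 1)
      rw [LinearMap.comp_apply] at this
      rw [this, LinearMap.id_apply, Matrix.one_apply, Pi.single_apply]
      simp only [eq_comm]
    have h2 : F (Pi.single b 1) = ∑ j : Fin n, π (Y b j) • Pi.single j (1 : k) := by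
      funext j
      simp [F, Fintype.linearCombination_apply_single, Finset.sum_apply, Pi.single_apply]
    rw [← h1, h2, map_sum, Finset.sum_apply, Matrix.map_apply, map_sum]
    refine Finset.sum_congr rfl fun j _ => ?_
    rw [map_smul, Pi.smul_apply, smul_eq_mul, ← hB, map_mul]
  have hdet : IsUnit T.det := by
    refine isUnit_of_map_unit (IsLocalRing.residue R) _ ?_
    have : IsLocalRing.residue R T.det = (T.map π).det := RingHom.map_det π T
    rw [this, hT, Matrix.det_one]
    exact isUnit_one
  refine ⟨fun j => ∑ b', B j b' * T⁻¹ b' a₀, fun b => ?_⟩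
  have h3 := congrFun (congrFun (Matrix.mul_nonsing_inv T hdet) b) a₀
  rw [Matrix.mul_apply, Matrix.one_apply] at h3
  rw [← h3]
  simp only [T, Finset.sum_mul]
  rw [Finset.sum_comm]
  exact Finset.sum_congr rfl fun _ _ => Finset.sum_congr rfl fun _ _ => by ring

/-- The Steinitz exchange bound over the residue field. -/
theorem ResiduallyIndependent.not_of_span (h : ResiduallyIndependent n (a + 1) Y)
    {Y' : ℕ → ℕ → R} (g : Fin (a + 1) → Fin a → R)
    (hg : ∀ i : Fin (a + 1), ∀ j < n,
      Y i j - ∑ b, g i b * Y' b j ∈ IsLocalRing.maximalIdeal R) : False := by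
  let k := IsLocalRing.ResidueField R
  let π := IsLocalRing.residue R
  let F : (Fin (a + 1) → k) →ₗ[k] (Fin a → k) :=
    Fintype.linearCombination k (fun i b => π (g i b))
  have hF : LinearMap.ker F ≠ ⊥ := LinearMap.ker_ne_bot_of_finrank_lt (by simp)
  obtain ⟨c, hc, hc0⟩ := Submodule.exists_mem_ne_zero_of_ne_bot hF
  choose d hd using fun b => IsLocalRing.residue_surjective (c b)
  refine hc0 (funext fun i => ?_)
  rw [← hd i, Pi.zero_apply, residue_eq_zero_iff_mem]
  refine h d (fun j hj => ?_) i
  have h1 : ∀ b, ∑ i, d i * g i b ∈ IsLocalRing.maximalIdeal R := by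
    intro b
    rw [← residue_eq_zero_iff_mem, map_sum]
    have := congrFun (LinearMap.mem_ker.1 hc) b
    simp only [F, Fintype.linearCombination_apply, Finset.sum_apply, Pi.smul_apply, smul_eq_mul,
      ← hd] at this
    simpa [π] using this
  have h2 : ∑ i, d i * Y i j = ∑ i, d i * (Y i j - ∑ b, g i b * Y' b j) +
      ∑ b, (∑ i, d i * g i b) * Y' b j := by
    simp only [mul_sub, Finset.sum_sub_distrib, Finset.mul_sum, Finset.sum_mul]
    rw [Finset.sum_comm (s := (Finset.univ : Finset (Fin a)))]
    simp only [mul_assoc, sub_add_cancel]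
  rw [h2]
  exact Ideal.add_mem _ (Ideal.sum_mem _ fun i _ => Ideal.mul_mem_left _ _ (hg i j hj))
    (Ideal.sum_mem _ fun b _ => Ideal.mul_mem_right _ _ (h1 b))

variable {q N p : ℕ} {A₀ A : ℕ → ℕ → R} {ns : ℕ → ℕ}
  (h : IsEliminated q N n n A₀ A q p ns) (hN : q ≤ N) (haq : a ≤ q)
  (hY : ∀ b < a, ∀ j < n, A₀ b j = Y b j) (hY0 : ∀ b, a ≤ b → b < q → ∀ j < n, A₀ b j = 0)
include h haq hY hY0

omit [IsLocalRing R] in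
omit h in
theorem sum_fin_eq_of_zero_rows (d : Fin q → R) {j : ℕ} (hj : j < n) :
    ∑ b, d b * A₀ b j = ∑ b : Fin a, d (Fin.castLE haq b) * Y b j := by
  classical
  rw [← Finset.sum_subset (Finset.subset_univ (Finset.univ.map (Fin.castLEEmb haq)))]
  · rw [Finset.sum_map]
    exact Finset.sum_congr rfl fun b _ => by rw [← hY b b.2 j hj]; rfl
  · intro b _ hb
    have hab : a ≤ b := by
      by_contra hlt
      exact hb (Finset.mem_map.2 ⟨⟨b, by omega⟩, Finset.mem_univ _, Fin.ext rfl⟩)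
    rw [hY0 b hab b.2 j hj, mul_zero]

omit hY0 in
/-- A row that keeps a unit entry can be adjoined to the independent rows. -/
theorem ResiduallyIndependent.succ (hI : ResiduallyIndependent n a Y) {x : ℕ} (hx : q ≤ x)
    (hxN : x < N) (hv : ∀ j < n, A₀ x j = Y a j) {c : ℕ} (hc : c < n) (hu : IsUnit (A x c))
    (hN : q ≤ N) : ResiduallyIndependent n (a + 1) Y := by
  intro d hd
  have hlast : d (Fin.last a) ∈ IsLocalRing.maximalIdeal R := by
    by_contra hda
    have hda : IsUnit (d (Fin.last a)) := by
      by_contra hnu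
      exact hda ((IsLocalRing.mem_maximalIdeal _).2 hnu)
    -- the combination of the rows, in terms of the reduced additional row
    have hg : ∃ g ∈ rowSpan n q A, ∀ j : Fin n,
        d (Fin.last a) * A x j + g j ∈ IsLocalRing.maximalIdeal R := by
      refine ⟨∑ b : Fin a, d b.castSucc • rowVec n A₀ b -
        d (Fin.last a) • (rowVec n A x - rowVec n A₀ x), ?_, fun j => ?_⟩
      · rw [h.span_eq]
        exact Submodule.sub_mem _ (Submodule.sum_mem _ fun b _ => Submodule.smul_mem _ _
          (rowVec_mem_rowSpan A₀ (by omega))) (Submodule.smul_mem _ _ (h.extra x hx hxN))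
      · have h1 := hd j j.2
        rw [Fin.sum_univ_castSucc] at h1
        convert h1 using 1
        rw [Pi.sub_apply, Finset.sum_apply]
        simp only [Pi.smul_apply, Pi.sub_apply, rowVec, smul_eq_mul, Fin.val_castSucc, Fin.val_last]
        rw [hv j j.2, Finset.sum_congr rfl fun b _ => by rw [hY (b : Fin a) b.2 j j.2]]
        ring
    obtain ⟨g, hg, hgj⟩ := hg
    obtain ⟨e, rfl⟩ := mem_rowSpan_iff.1 hg
    have hgm : ∀ j : Fin n, (∑ y, e y • rowVec n A y) j ∈ IsLocalRing.maximalIdeal R := by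
      intro j
      rw [Finset.sum_apply]
      refine Ideal.sum_mem _ fun y _ => ?_
      rw [Pi.smul_apply, smul_eq_mul]
      by_cases hy : ∀ b < p, ns b ≠ y
      · obtain ⟨c', hc', -, h1, h0, he⟩ := h.coeff_eq hN le_rfl e y hy
        have h2 := hgj ⟨c', hc'⟩
        rw [h0 x hxN (by omega), mul_zero, zero_add, he] at h2
        exact Ideal.mul_mem_right _ _ h2
      · push Not at hy
        obtain ⟨b, hb, hby⟩ := hy
        refine Ideal.mul_mem_left _ _ ?_
        rw [IsLocalRing.mem_maximalIdeal, ← hby]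
        exact h.nonunit b hb j j.2
    have h3 := (Ideal.add_mem_iff_left _ (hgm ⟨c, hc⟩)).1 (hgj ⟨c, hc⟩)
    exact (IsLocalRing.mem_maximalIdeal _).1 h3 (hda.mul hu)
  have hrest := hI (fun b => d b.castSucc) fun j hj => by
    have h1 := hd j hj
    rw [Fin.sum_univ_castSucc] at h1
    exact (Ideal.add_mem_iff_left _ (Ideal.mul_mem_right _ _ hlast)).1 h1
  intro b
  induction b using Fin.lastCases with
  | last => exact hlast
  | cast b => exact hrest b

/-- A row without a unit entry depends on the others modulo `𝔪`. -/
theorem IsEliminated.exists_sub_mem {x : ℕ} (hx : q ≤ x) (hxN : x < N)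
    (hu : ∀ c < n, ¬ IsUnit (A x c)) :
    ∃ g : Fin a → R, ∀ j < n, A₀ x j - ∑ b, g b * Y b j ∈ IsLocalRing.maximalIdeal R := by
  obtain ⟨d, hd⟩ := mem_rowSpan_iff.1 (h.extra x hx hxN)
  refine ⟨fun b => -d (Fin.castLE haq b), fun j hj => ?_⟩
  have h1 := congrFun hd ⟨j, hj⟩
  rw [Finset.sum_apply] at h1
  have h2 : A x j - A₀ x j = ∑ b, d b * A₀ b j := h1
  rw [sum_fin_eq_of_zero_rows haq hY hY0 d hj] at h2
  have h3 : A₀ x j - ∑ b : Fin a, -d (Fin.castLE haq b) * Y b j = A x j := by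
    simp only [neg_mul, Finset.sum_neg_distrib, sub_neg_eq_add]
    rw [← h2]; ring
  rw [h3, IsLocalRing.mem_maximalIdeal]
  exact hu j hj

end Residual

/-! ### Linear systems over the ring -/

section System

variable {R : Type*} [CommRing R] [IsLocalRing R] [Finite R] (G : GaloisFrame R) {n L q : ℕ}

/-- The vector `(h x, x)`, for a matrix `h` with `L` rows. -/
def graphMap (n L : ℕ) (h : ℕ → ℕ → R) : (Fin n → R) →ₗ[R] (Fin (L + n) → R) where
  toFun x c := if hc : (c : ℕ) < L then ∑ j : Fin n, h c j * x j else x ⟨c - L, by omega⟩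
  map_add' x y := by
    funext c
    simp only [Pi.add_apply]
    split
    · simp only [mul_add, Finset.sum_add_distrib]
    · rfl
  map_smul' r x := by
    funext c
    simp only [Pi.smul_apply, smul_eq_mul, RingHom.id_apply]
    split
    · rw [Finset.mul_sum]
      exact Finset.sum_congr rfl fun _ _ => by ring
    · rfl

omit [IsLocalRing R] [Finite R] in
theorem graphMap_left (h : ℕ → ℕ → R) (x : Fin n → R) {c : ℕ} (hc : c < L) :
    graphMap n L h x ⟨c, by omega⟩ = ∑ j : Fin n, h c j * x j := dif_pos hc

omit [IsLocalRing R] [Finite R] in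
theorem graphMap_right (h : ℕ → ℕ → R) (x : Fin n → R) (j : Fin n) :
    graphMap n L h x ⟨L + j, by omega⟩ = x j := by
  simp [graphMap]

variable {h : ℕ → ℕ → R} {A₀ A : ℕ → ℕ → R}
  (hL : ∀ x < n * G.gamma, ∀ c < L, A₀ x c = pad G.z (x % G.gamma) * h c (x / G.gamma))
  (hR : ∀ x < n * G.gamma, ∀ j < n, A₀ x (L + j) =
    pad G.z (x % G.gamma) * if x / G.gamma = j then 1 else 0)
include hL hR

omit [Finite R] in
/-- The rows span the graph of the matrix `h`, over `R₀`: the row `j * γ + l` of the table is the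
point of the graph over `z_l` times the unit vector `e_j`. -/
theorem mem_span_graph_iff (v : Fin (L + n) → R) :
    v ∈ Submodule.span G.base (rowVec (L + n) A₀ '' Set.Iio (n * G.gamma)) ↔
      ∃ x, v = graphMap n L h x := by
  have hrow : ∀ x (hx : x < n * G.gamma), rowVec (L + n) A₀ x = graphMap n L h
      (Pi.single ⟨x / G.gamma, Nat.div_lt_of_lt_mul (by rwa [mul_comm] at hx)⟩
        (pad G.z (x % G.gamma))) := by
    intro x hx
    funext c
    by_cases hc : (c : ℕ) < L
    · refine (hL x hx c hc).trans ?_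
      refine Eq.trans ?_ (graphMap_left h _ hc).symm
      simp [Pi.single_apply, mul_comm]
    · have e : L + (c - L) = (c : ℕ) := by omega
      have h1 := hR x hx (c - L) (by omega)
      rw [e] at h1
      refine h1.trans ?_
      have h2 := graphMap_right (L := L) h (Pi.single ⟨x / G.gamma,
        Nat.div_lt_of_lt_mul (by rwa [mul_comm] at hx)⟩ (pad G.z (x % G.gamma))) ⟨c - L, by omega⟩
      simp only [e] at h2
      refine Eq.trans ?_ h2.symm
      rw [Pi.single_apply]
      simp only [Fin.mk.injEq, mul_ite, mul_one, mul_zero]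
      simp only [eq_comm]
  constructor
  · intro hv
    induction hv using Submodule.span_induction with
    | mem v hv =>
      obtain ⟨x, hx, rfl⟩ := hv
      exact ⟨_, hrow x hx⟩
    | zero => exact ⟨0, (map_zero _).symm⟩
    | add v v' _ _ hv hv' =>
      obtain ⟨x, rfl⟩ := hv
      obtain ⟨x', rfl⟩ := hv'
      exact ⟨x + x', (map_add _ _ _).symm⟩
    | smul c v _ hv =>
      obtain ⟨x, rfl⟩ := hv
      exact ⟨(c : R) • x, ((graphMap n L h).map_smul (c : R) x).symm⟩
  · rintro ⟨x, rfl⟩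
    have hx : x = ∑ j, ∑ l, (G.coords (x j) l : R) • Pi.single j (G.z l) := by
      funext j
      simp only [Finset.sum_apply, Pi.smul_apply, Pi.single_apply, smul_eq_mul, mul_ite, mul_zero]
      rw [Finset.sum_eq_single j]
      · simpa [Subring.smul_def] using G.sum_coords (x j)
      · intro j' _ hj'
        simp [hj'.symm]
      · simp
    rw [hx, map_sum]
    refine Submodule.sum_mem _ fun j _ => ?_
    rw [map_sum]
    refine Submodule.sum_mem _ fun l _ => ?_
    rw [map_smul]
    refine Submodule.smul_mem _ (G.coords (x j) l) (Submodule.subset_span ⟨j * G.gamma + l, ?_, ?_⟩)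
    · have h1 : (j : ℕ) < n := j.2
      have h2 : (l : ℕ) < G.gamma := l.2
      have : (j + 1) * G.gamma ≤ n * G.gamma := Nat.mul_le_mul_right _ h1
      rw [Set.mem_Iio]
      linarith
    · have h2 : (l : ℕ) < G.gamma := l.2
      have hdiv : (j * G.gamma + l) / G.gamma = j := by
        rw [mul_comm, Nat.mul_add_div G.gamma_pos, Nat.div_eq_of_lt h2, add_zero]
      have hmod : (j * G.gamma + l) % G.gamma = l := by
        rw [mul_comm, Nat.mul_add_mod, Nat.mod_eq_of_lt h2]
      rw [hrow]
      · congr 1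
        simp only [hdiv, hmod]
        congr 1
        exact dif_pos l.2
      · have h1 : (j : ℕ) < n := j.2
        have : (j + 1) * G.gamma ≤ n * G.gamma := Nat.mul_le_mul_right _ h1
        linarith

variable {N : ℕ} (hA : IsFormReduced (n * G.gamma) N (L * G.gamma) (G.formAt (L + n))
  (rowVec (L + n) A₀) (rowVec (L + n) A) (L * G.gamma))
include hA

/-- The main rows end up with solutions of the homogeneous system. -/
theorem sum_kernel_eq_zero {x : ℕ} (hx : x < n * G.gamma) {c : ℕ} (hc : c < L) :
    ∑ j : Fin n, h c j * A x (L + j) = 0 := by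
  have h1 := (hA.mem_span (rowVec (L + n) A x)).1 (Submodule.subset_span ⟨x, hx, rfl⟩)
  obtain ⟨y, hy⟩ := (mem_span_graph_iff G hL hR _).1 h1.1
  have h2 := (G.formAt_eq_zero_iff (Nat.le_add_right L n) _).1 h1.2 c hc
  rw [hy, graphMap_left h y hc] at h2
  rw [← h2]
  refine Finset.sum_congr rfl fun j _ => ?_
  rw [← graphMap_right (L := L) h y j, ← hy]
  rfl

/-- The solutions of the homogeneous system are generated by those in the main rows. -/
theorem mem_of_kernel (K : Submodule R (Fin n → R))
    (hK : ∀ x < n * G.gamma, (fun j : Fin n => A x (L + j)) ∈ K) {y : Fin n → R}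
    (hy : ∀ c < L, ∑ j : Fin n, h c j * y j = 0) : y ∈ K := by
  have h1 : graphMap n L h y ∈
      Submodule.span G.base (rowVec (L + n) A '' Set.Iio (n * G.gamma)) := by
    rw [hA.mem_span]
    refine ⟨(mem_span_graph_iff G hL hR _).2 ⟨y, rfl⟩, ?_⟩
    rw [G.formAt_eq_zero_iff (Nat.le_add_right L n)]
    intro c hc
    rw [graphMap_left h y hc, hy c hc]
  have h2 : ∀ v ∈ Submodule.span G.base (rowVec (L + n) A '' Set.Iio (n * G.gamma)),
      (fun j : Fin n => v ⟨L + j, by omega⟩) ∈ K := by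
    intro v hv
    induction hv using Submodule.span_induction with
    | mem v hv =>
      obtain ⟨x, hx, rfl⟩ := hv
      exact hK x hx
    | zero => exact K.zero_mem
    | add v v' _ _ hv hv' => exact K.add_mem hv hv'
    | smul c v _ hv => exact K.smul_mem (c : R) hv
  have h3 := h2 _ h1
  simp only [graphMap_right] at h3
  exact h3

/-- An additional row decides whether its system can be solved, and ends up with a solution. -/
theorem solvable_iff {x : ℕ} (hx : n * G.gamma ≤ x) (hxN : x < N)
    (h0 : ∀ j < n, A₀ x (L + j) = 0) :
    ((∃ y : Fin n → R, ∀ c < L, ∑ j : Fin n, h c j * y j = A₀ x c) ↔ ∀ c < L, A x c = 0) ∧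
      ((∀ c < L, A x c = 0) → ∀ c < L, ∑ j : Fin n, h c j * -A x (L + j) = A₀ x c) := by
  have hsol : (∀ c < L, A x c = 0) → ∀ c < L, ∑ j : Fin n, h c j * -A x (L + j) = A₀ x c := by
    intro hz c hc
    obtain ⟨y, hy⟩ := (mem_span_graph_iff G hL hR _).1 (hA.extra x hx hxN)
    have hyj : ∀ j : Fin n, y j = A x (L + j) := fun j => by
      rw [← graphMap_right (L := L) h y j, ← hy, Pi.sub_apply]
      change A x (L + j) - A₀ x (L + j) = _
      rw [h0 j j.2, sub_zero]
    have h1 := congrFun hy ⟨c, by omega⟩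
    rw [graphMap_left h y hc, Pi.sub_apply] at h1
    change A x c - A₀ x c = _ at h1
    rw [hz c hc, zero_sub] at h1
    simp only [mul_neg, Finset.sum_neg_distrib, ← hyj, ← h1, neg_neg]
  refine ⟨⟨?_, fun hz => ⟨_, hsol hz⟩⟩, hsol⟩
  rintro ⟨y, hy⟩
  have h1 := hA.solvable x hx hxN _ ((mem_span_graph_iff G hL hR _).2 ⟨y, rfl⟩) ?_
  · exact (G.formAt_eq_zero_iff (Nat.le_add_right L n) _).1 h1
  · intro w hw
    have hw' : w / G.gamma < L := Nat.div_lt_of_lt_mul (by rwa [mul_comm] at hw)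
    rw [G.formAt_apply (by omega), G.formAt_apply (by omega), graphMap_left h y hw', hy _ hw']
    rfl

end System

/-! ### Coordinates in a Galois extension -/

namespace GaloisExtension

variable {R : Type*} [CommRing R] [IsLocalRing R] {m : ℕ} (E : GaloisExtension R m)

theorem degree_g : E.g.degree = m := by
  rw [Polynomial.degree_eq_natDegree E.monic.ne_zero, E.natDegree_eq]

/-- The polynomial of degree less than `m` that represents `x`. -/
noncomputable abbrev repr (x : E.Ext) : R[X] := AdjoinRoot.modByMonicHom E.monic x

theorem mk_repr (x : E.Ext) : AdjoinRoot.mk E.g (E.repr x) = x :=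
  AdjoinRoot.mk_leftInverse E.monic x

theorem degree_repr_lt (x : E.Ext) : (E.repr x).degree < m := by
  obtain ⟨p, rfl⟩ := AdjoinRoot.mk_surjective x
  rw [repr, AdjoinRoot.modByMonicHom_mk, ← E.degree_g]
  exact Polynomial.degree_modByMonic_lt _ E.monic

theorem repr_mk {p : R[X]} (hp : p.degree < m) : E.repr (AdjoinRoot.mk E.g p) = p := by
  rw [repr, AdjoinRoot.modByMonicHom_mk]
  exact (Polynomial.modByMonic_eq_self_iff E.monic).2 (by rwa [E.degree_g])

theorem coord_of_le (x : E.Ext) {c : ℕ} (hc : m ≤ c) : E.coord x c = 0 :=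
  Polynomial.coeff_eq_zero_of_degree_lt
    ((E.degree_repr_lt x).trans_le (by exact_mod_cast hc))

theorem ofCoord_eq_mk (a : ℕ → R) :
    E.ofCoord a = AdjoinRoot.mk E.g (∑ c ∈ Finset.range m, C (a c) * X ^ c) := by
  simp [ofCoord]

theorem coord_ofCoord (a : ℕ → R) {c : ℕ} (hc : c < m) : E.coord (E.ofCoord a) c = a c := by
  rw [ofCoord_eq_mk, coord]
  change (E.repr _).coeff c = a c
  rw [repr_mk]
  · simp [Polynomial.finsetSum_coeff, Polynomial.coeff_C_mul, Polynomial.coeff_X_pow, hc]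
  · rw [Polynomial.degree_lt_iff_coeff_zero]
    intro c hc
    simp [Polynomial.finsetSum_coeff, Polynomial.coeff_C_mul, Polynomial.coeff_X_pow, hc]

theorem ofCoord_coord (x : E.Ext) : E.ofCoord (E.coord x) = x := by
  rw [ofCoord_eq_mk]
  have h : ∑ c ∈ Finset.range m, C (E.coord x c) * X ^ c = E.repr x := by
    ext c
    simp only [Polynomial.finsetSum_coeff, Polynomial.coeff_C_mul, Polynomial.coeff_X_pow, mul_ite,
      mul_one, mul_zero, Finset.sum_ite_eq, Finset.mem_range]
    split
    · rfl
    · exact (E.coord_of_le x (by omega)).symm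
  rw [h, E.mk_repr]

/-- The coordinates with respect to `1, θ, …, θ ^ (m - 1)`, as a linear equivalence. -/
noncomputable def coordEquiv : E.Ext ≃ₗ[R] (Fin m → R) where
  toFun x c := E.coord x c
  map_add' x y := by funext c; simp [coord]
  map_smul' r x := by funext c; simp [coord]
  invFun a := E.ofCoord (pad a)
  left_inv x := by
    conv_rhs => rw [← E.ofCoord_coord x]
    refine Finset.sum_congr rfl fun c hc => ?_
    rw [pad, dif_pos (Finset.mem_range.1 hc)]
  right_inv a := by
    funext c
    exact (E.coord_ofCoord _ c.2).trans (dif_pos c.2)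

theorem coordEquiv_apply (x : E.Ext) (c : Fin m) : E.coordEquiv x c = E.coord x c := rfl

theorem coordEquiv_symm (a : ℕ → R) : E.coordEquiv.symm (fun c => a c) = E.ofCoord a := by
  apply E.coordEquiv.injective
  rw [LinearEquiv.apply_symm_apply]
  funext c
  rw [coordEquiv_apply, E.coord_ofCoord _ c.2]

theorem coord_sum_smul {ι : Type*} (s : Finset ι) (a : ι → R) (x : ι → E.Ext) (c : ℕ) :
    E.coord (∑ i ∈ s, a i • x i) c = ∑ i ∈ s, a i * E.coord (x i) c := by
  simp [coord, Polynomial.finsetSum_coeff]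

theorem coord_sub (x y : E.Ext) (c : ℕ) : E.coord (x - y) c = E.coord x c - E.coord y c := by
  simp [coord]

instance [Finite R] : Finite E.Ext := Finite.of_equiv _ E.coordEquiv.symm.toEquiv

theorem finrank_ext : Module.finrank R E.Ext = m := by
  rw [E.coordEquiv.finrank_eq, Module.finrank_fin_fun]

/-- The class `θ` of `X`. -/
noncomputable abbrev theta : E.Ext := AdjoinRoot.root E.g

/-- Multiplication by `θ` shifts the coordinates and subtracts a multiple of the polynomial `g`. -/
theorem coord_theta_mul (x : E.Ext) (hm : 0 < m) (l : ℕ) : E.coord (E.theta * x) l =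
    (if l = 0 then 0 else E.coord x (l - 1)) - E.coord x (m - 1) * E.g.coeff l := by
  have hd : (X * E.repr x - C (E.coord x (m - 1)) * E.g).degree < (m : WithBot ℕ) := by
    rw [Polynomial.degree_lt_iff_coeff_zero]
    intro c hc
    obtain ⟨c, rfl⟩ : ∃ c', c = c' + 1 := ⟨c - 1, by omega⟩
    rw [Polynomial.coeff_sub, Polynomial.coeff_X_mul, Polynomial.coeff_C_mul]
    rcases hc.eq_or_lt with hc | hc
    · have h1 : E.g.coeff (c + 1) = 1 := by
        have := E.monic.coeff_natDegree
        rw [E.natDegree_eq] at this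
        rwa [← hc]
      have h2 : m - 1 = c := by omega
      rw [h1, mul_one, h2, coord, sub_self]
    · rw [Polynomial.coeff_eq_zero_of_natDegree_lt (p := E.g) (by rw [E.natDegree_eq]; omega),
        mul_zero, sub_zero]
      exact E.coord_of_le x (by omega)
  have h1 : E.theta * x =
      AdjoinRoot.mk E.g (X * E.repr x - C (E.coord x (m - 1)) * E.g) := by
    rw [map_sub, map_mul, map_mul, AdjoinRoot.mk_self, mul_zero, sub_zero, E.mk_repr,
      AdjoinRoot.mk_X]
  rw [h1, coord]
  change (E.repr _).coeff l = _
  rw [E.repr_mk hd, Polynomial.coeff_sub, Polynomial.coeff_C_mul]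
  congr 1
  rcases l with _ | l
  · simp
  · simp [coord]

theorem eq_sum_smul_theta (x : E.Ext) : x = ∑ u ∈ Finset.range m, E.coord x u • E.theta ^ u := by
  conv_lhs => rw [← E.ofCoord_coord x]
  exact Finset.sum_congr rfl fun u _ => (Algebra.smul_def _ _).symm

theorem mul_eq_sum (x y : E.Ext) :
    x * y = ∑ u ∈ Finset.range m, E.coord x u • (E.theta ^ u * y) := by
  conv_lhs => rw [E.eq_sum_smul_theta x, Finset.sum_mul]
  exact Finset.sum_congr rfl fun u _ => smul_mul_assoc _ _ _

theorem coord_mul (x y : E.Ext) (l : ℕ) :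
    E.coord (x * y) l = ∑ u ∈ Finset.range m, E.coord x u * E.coord (E.theta ^ u * y) l := by
  rw [E.mul_eq_sum, coord_sum_smul]

/-- An element that is not annihilated by any nonzero scalar is a unit: if all its coordinates were
nonunits, then the socle of `R` would annihilate it. -/
theorem isUnit_of_smul_ne_zero [Finite R] {x : E.Ext} (hx : ∀ σ : R, σ • x = 0 → σ = 0) :
    IsUnit x := by
  rw [← E.mk_repr x]
  refine isUnit_adjoinRoot_mk (IsLocalRing.residue R) IsLocalRing.residue_surjective
    (fun a ha => isNilpotent_of_not_isUnit
      ((IsLocalRing.mem_maximalIdeal a).1 (residue_eq_zero_iff_mem.1 ha))) E.irreducible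
        fun hd => ?_
  obtain ⟨σ, hσ, hσs⟩ := exists_socle_element R
  have h0 : (E.repr x).map (IsLocalRing.residue R) = 0 := by
    refine Polynomial.eq_zero_of_dvd_of_degree_lt hd ?_
    rw [E.monic.degree_map, E.degree_g]
    exact Polynomial.degree_map_le.trans_lt (E.degree_repr_lt x)
  refine hσ (hx σ (E.coordEquiv.injective ?_))
  rw [map_smul, map_zero]
  funext c
  refine hσs _ ((IsLocalRing.mem_maximalIdeal _).1 (residue_eq_zero_iff_mem.1 ?_))
  have := congrArg (fun p => p.coeff c) h0
  simp only [Polynomial.coeff_map, Polynomial.coeff_zero] at this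
  exact this

theorem isUnit_of_linearIndependent [Finite R] {lam : ℕ} {f : Fin lam → E.Ext}
    (hf : LinearIndependent R f) (b : Fin lam) : IsUnit (f b) := by
  refine E.isUnit_of_smul_ne_zero fun σ hσ => ?_
  have := Fintype.linearIndependent_iff.1 hf (Pi.single b σ)
    (by simpa [Pi.single_apply] using hσ) b
  simpa using this

theorem card_le_of_linearIndependent {lam : ℕ} {f : Fin lam → E.Ext}
    (hf : LinearIndependent R f) : lam ≤ m := by
  have : Module.Finite R E.Ext := Module.Finite.equiv E.coordEquiv.symm
  have h := hf.fintype_card_le_finrank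
  rwa [E.finrank_ext, Fintype.card_fin] at h

end GaloisExtension

theorem mem_invMul_iff {R S : Type*} [CommRing R] [CommRing S] [Algebra R S] {a : S}
    (ha : IsUnit a) (N : Submodule R S) (x : S) : x ∈ invMul a N ↔ a * x ∈ N := by
  constructor
  · rintro ⟨y, hy, rfl⟩
    rw [LinearMap.mulLeft_apply, ← mul_assoc, Ring.mul_inverse_cancel a ha, one_mul]
    exact hy
  · intro h
    exact ⟨a * x, h, by rw [LinearMap.mulLeft_apply, ← mul_assoc, Ring.inverse_mul_cancel a ha,
      one_mul]⟩

/-! ### Assignments and searches with independent right hand sides -/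

namespace IntExp

/-- Whether an expression is the literal `0`. -/
def isZero : IntExp → Bool
  | lit c => c == 0
  | _ => false

/-- The integer arrays that an expression reads satisfy `S`, except that it may read the loop
variables `12`, `30` and `31`. -/
def safe (S : ℕ → Bool) : IntExp → Bool
  | lit _ => true
  | get x i => (S x || ((x == 12 || x == 30 || x == 31) && i.isZero)) && i.safe S
  | add a b => a.safe S && b.safe S
  | sub a b => a.safe S && b.safe S
  | mul a b => a.safe S && b.safe S
  | div a b => a.safe S && b.safe S

theorem readsOnly_mono {S S' : ℕ → Bool} (h : ∀ v, S v = true → S' v = true) (e : IntExp)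
    (he : e.readsOnly S = true) : e.readsOnly S' = true := by
  induction e with
  | lit c => rfl
  | get x i ih =>
    simp only [readsOnly, Bool.and_eq_true] at he ⊢
    exact ⟨h x he.1, ih he.2⟩
  | _ a b iha ihb =>
    simp only [readsOnly, Bool.and_eq_true] at he ⊢
    exact ⟨iha he.1, ihb he.2⟩

theorem safe_mono {S S' : ℕ → Bool} (h : ∀ v, S v = true → S' v = true) (e : IntExp)
    (he : e.safe S = true) : e.safe S' = true := by
  induction e with
  | lit c => rfl
  | get x i ih =>
    simp only [safe, Bool.and_eq_true, Bool.or_eq_true] at he ⊢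
    exact ⟨he.1.imp_left (h x), ih he.2⟩
  | _ a b iha ihb =>
    simp only [safe, Bool.and_eq_true] at he ⊢
    exact ⟨iha he.1, ihb he.2⟩

theorem safe_of_readsOnly {S : ℕ → Bool} (e : IntExp) (he : e.readsOnly S = true) :
    e.safe S = true := by
  induction e with
  | lit c => rfl
  | get x i ih =>
    simp only [readsOnly, safe, Bool.and_eq_true, Bool.or_eq_true] at he ⊢
    exact ⟨Or.inl he.1, ih he.2⟩
  | _ a b iha ihb =>
    simp only [readsOnly, safe, Bool.and_eq_true] at he ⊢
    exact ⟨iha he.1, ihb he.2⟩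

theorem eval_of_isZero {M : ℕ → ℕ → ℕ} {e : IntExp} (h : e.isZero = true) : e.eval M = 0 := by
  cases e <;> simp_all [isZero, eval]

theorem eval_congr_of_safe {S : ℕ → Bool} {M M' : ℕ → ℕ → ℕ} (h : ∀ v, S v = true → M v = M' v)
    (h12 : M 12 0 = M' 12 0) (h30 : M 30 0 = M' 30 0) (h31 : M 31 0 = M' 31 0)
    (e : IntExp) (he : e.safe S = true) : e.eval M = e.eval M' := by
  induction e with
  | lit c => rfl
  | get x i ih =>
    simp only [safe, Bool.and_eq_true, Bool.or_eq_true, beq_iff_eq] at he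
    simp only [eval, ← ih he.2]
    rcases he.1 with h1 | ⟨h1, h2⟩
    · rw [h x h1]
    · rw [eval_of_isZero h2]
      rcases h1 with (rfl | rfl) | rfl <;> assumption
  | _ a b iha ihb =>
    simp only [safe, Bool.and_eq_true] at he
    simp only [eval, iha he.1, ihb he.2]

end IntExp

namespace RingExp

/-- The integer arrays that an expression reads satisfy `S`, with the exception of loop variables,
and the ring arrays that it reads satisfy `T`. -/
def safe (S T : ℕ → Bool) : RingExp → Bool
  | get a i j l => T a && i.safe S && j.safe S && l.safe S
  | zero => true
  | one => true
  | add a b => a.safe S T && b.safe S T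
  | sub a b => a.safe S T && b.safe S T
  | mul a b => a.safe S T && b.safe S T
  | inv a => a.safe S T
  | coord i a => i.safe S && a.safe S T
  | quo a b => a.safe S T && b.safe S T
  | ann a => a.safe S T

theorem safe_mono {S S' T T' : ℕ → Bool} (h : ∀ v, S v = true → S' v = true)
    (hT : ∀ b, T b = true → T' b = true) (e : RingExp) (he : e.safe S T = true) :
    e.safe S' T' = true := by
  induction e with
  | get a i j l =>
    simp only [safe, Bool.and_eq_true] at he ⊢
    exact ⟨⟨⟨hT a he.1.1.1, i.safe_mono h he.1.1.2⟩, j.safe_mono h he.1.2⟩, l.safe_mono h he.2⟩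
  | zero => rfl
  | one => rfl
  | coord i a ih =>
    simp only [safe, Bool.and_eq_true] at he ⊢
    exact ⟨i.safe_mono h he.1, ih he.2⟩
  | inv a ih => exact ih he
  | ann a ih => exact ih he
  | _ a b iha ihb =>
    simp only [safe, Bool.and_eq_true] at he ⊢
    exact ⟨iha he.1, ihb he.2⟩

theorem eval_congr_of_safe {R : Type*} [CommRing R] [IsLocalRing R] (G : GaloisFrame R)
    {S T : ℕ → Bool} {M M' : Memory R} (h : ∀ v, S v = true → M.int v = M'.int v)
    (h12 : M.int 12 0 = M'.int 12 0) (h30 : M.int 30 0 = M'.int 30 0)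
    (h31 : M.int 31 0 = M'.int 31 0) (hr : ∀ b, T b = true → M.ring b = M'.ring b)
    (e : RingExp) (he : e.safe S T = true) : e.eval G M = e.eval G M' := by
  have hi := fun e he => IntExp.eval_congr_of_safe h h12 h30 h31 e he
  induction e with
  | get a i j l =>
    simp only [safe, Bool.and_eq_true] at he
    simp only [eval, hr a he.1.1.1, hi i he.1.1.2, hi j he.1.2, hi l he.2]
  | zero => rfl
  | one => rfl
  | coord i a ih =>
    simp only [safe, Bool.and_eq_true] at he
    simp only [eval, hi i he.1, ih he.2]
  | inv a ih => simp only [eval, ih he]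
  | ann a ih => simp only [eval, ih he]
  | _ a b iha ihb =>
    simp only [safe, Bool.and_eq_true] at he
    simp only [eval, iha he.1, ihb he.2]

end RingExp

namespace Memory

variable {R : Type*} (M : Memory R)

/-- The memory with the loop variables `30` and `31` set to `x` and `y`. -/
def at' (x y : ℕ) : Memory R := (M.setInt 30 0 x).setInt 31 0 y

/-- The memory with the loop variables `12`, `30` and `31` set to `w`, `x` and `y`. -/
def at3 (w x y : ℕ) : Memory R := (M.setInt 12 0 w).at' x y

@[simp] theorem at_ring (x y : ℕ) : (M.at' x y).ring = M.ring := rfl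
@[simp] theorem at_int_30 (x y : ℕ) : (M.at' x y).int 30 0 = x := by simp [at', setInt_int]
@[simp] theorem at_int_31 (x y : ℕ) : (M.at' x y).int 31 0 = y := by simp [at']
theorem at_int (x y : ℕ) {v : ℕ} (h0 : v ≠ 30) (h1 : v ≠ 31) :
    (M.at' x y).int v = M.int v := by
  rw [at', setInt_int_ne _ h1, setInt_int_ne _ h0]
@[simp] theorem at3_ring (w x y : ℕ) : (M.at3 w x y).ring = M.ring := rfl
@[simp] theorem at3_int_30 (w x y : ℕ) : (M.at3 w x y).int 30 0 = x := at_int_30 _ x y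
@[simp] theorem at3_int_31 (w x y : ℕ) : (M.at3 w x y).int 31 0 = y := at_int_31 _ x y
@[simp] theorem at3_int_12 (w x y : ℕ) : (M.at3 w x y).int 12 0 = w := by
  simp [at3, at_int]
theorem at3_int (w x y : ℕ) {v : ℕ} (h : v ≠ 12) (h0 : v ≠ 30) (h1 : v ≠ 31) :
    (M.at3 w x y).int v = M.int v := by
  rw [at3, at_int _ _ _ h0 h1, setInt_int_ne _ h]

end Memory

namespace Prog

variable {R : Type*} [CommRing R] [IsLocalRing R] (G : GaloisFrame R)

/-- An array assignment whose right hand side does not read the array that is assigned. -/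
theorem run_fill_of_safe {M : Memory R} {a : ℕ} {I J O n₁ n₂ : IntExp} {e : RingExp}
    (hs : ((I.readsOnly fun v => v != 30 && v != 31) && (J.readsOnly fun v => v != 30 && v != 31) &&
      (O.readsOnly fun v => v != 30 && v != 31) && (n₁.readsOnly fun v => v != 30 && v != 31) &&
      (n₂.readsOnly fun v => v != 30 && v != 31) &&
      (e.safe (fun v => v != 30 && v != 31) fun b => b != a)) = true)
    {i₀ j₀ o₀ N₁ N₂ : ℕ} (hI : I.eval M.int = i₀) (hJ : J.eval M.int = j₀)
    (hO : O.eval M.int = o₀) (h₁ : n₁.eval M.int = N₁) (h₂ : n₂.eval M.int = N₂) :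
    (∀ x < N₁, ∀ y < N₂, ((fill a I J O n₁ n₂ e).run G M).1.ring a (x + i₀) j₀ (y + o₀) =
      e.eval G (M.at' x y)) ∧
    (∀ x' j' l', ¬ (j' = j₀ ∧ i₀ ≤ x' ∧ x' < N₁ + i₀ ∧ o₀ ≤ l' ∧ l' < N₂ + o₀) →
      ((fill a I J O n₁ n₂ e).run G M).1.ring a x' j' l' = M.ring a x' j' l') := by
  simp only [Bool.and_eq_true] at hs
  obtain ⟨⟨⟨⟨⟨sI, sJ⟩, sO⟩, s₁⟩, s₂⟩, se⟩ := hs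
  refine run_fill G M i₀ j₀ o₀ N₁ N₂ _ ?_ ?_
  · intro s h
    have h' : ∀ v, (v != 30 && v != 31) = true → s v = M.int v := fun v hv => by
      simp only [Bool.and_eq_true, bne_iff_ne] at hv
      exact h v hv.1 hv.2
    exact ⟨(IntExp.eval_congr h' _ sI).trans hI, (IntExp.eval_congr h' _ sJ).trans hJ,
      (IntExp.eval_congr h' _ sO).trans hO, (IntExp.eval_congr h' _ s₁).trans h₁,
      (IntExp.eval_congr h' _ s₂).trans h₂⟩
  · intro x _ y _ M' g1 g2 g3 g4 _ _
    refine RingExp.eval_congr_of_safe G (fun v hv => ?_) ?_ ?_ ?_ (fun b hb => ?_) _ se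
    · simp only [Bool.and_eq_true, bne_iff_ne] at hv
      rw [M.at_int _ _ hv.1 hv.2, g1 v hv.1 hv.2]
    · rw [M.at_int _ _ (by decide) (by decide), g1 _ (by decide) (by decide)]
    · rw [M.at_int_30, g2]
    · rw [M.at_int_31, g3]
    · exact g4 b (by simpa using hb)

theorem run_accumulate_of_safe {M : Memory R} {a : ℕ} {N n₁ n₂ : IntExp} {e : RingExp}
    (hs : ((n₁.readsOnly fun v => v != 12 && v != 30 && v != 31) &&
      (n₂.readsOnly fun v => v != 12 && v != 30 && v != 31) &&
      (e.safe (fun v => v != 12 && v != 30 && v != 31) fun b => b != a)) = true)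
    {N₀ N₁ N₂ : ℕ} (hN : N.eval M.int = N₀) (h₁ : n₁.eval M.int = N₁) (h₂ : n₂.eval M.int = N₂)
    {x y : ℕ} (hx : x < N₁) (hy : y < N₂) :
    ((accumulate a N 0 0 0 n₁ n₂ e).run G M).1.ring a x 0 y =
      M.ring a x 0 y + ∑ w ∈ Finset.range N₀, e.eval G (M.at3 w x y) := by
  simp only [Bool.and_eq_true] at hs
  obtain ⟨⟨s₁, s₂⟩, se⟩ := hs
  refine run_accumulate G M N₀ 0 0 0 N₁ N₂ (fun w x y => e.eval G (M.at3 w x y)) hN ?_ ?_ x hx y hy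
  · intro s h
    have h' : ∀ v, (v != 12 && v != 30 && v != 31) = true → s v = M.int v := fun v hv => by
      simp only [Bool.and_eq_true, bne_iff_ne] at hv
      exact h v hv.1.1 hv.1.2 hv.2
    exact ⟨rfl, rfl, rfl, (IntExp.eval_congr h' _ s₁).trans h₁, (IntExp.eval_congr h' _ s₂).trans
      h₂⟩
  · intro w _ x _ y _ M' g1 g2 g3 g4 g5
    refine RingExp.eval_congr_of_safe G (fun v hv => ?_) ?_ ?_ ?_ (fun b hb => ?_) _ se
    · simp only [Bool.and_eq_true, bne_iff_ne] at hv
      rw [M.at3_int _ _ _ hv.1.1 hv.1.2 hv.2, g1 v hv.1.1 hv.1.2 hv.2]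
    · rw [M.at3_int_12, g2]
    · rw [M.at3_int_30, g3]
    · rw [M.at3_int_31, g4]
    · exact g5 b (by simpa using hb)

theorem run_search_of_safe {M : Memory R} {n₁ n₂ : IntExp} {e : RingExp}
    (hs : ((n₁.readsOnly fun v => decide (v < 30) || decide (34 < v)) &&
      (n₂.readsOnly fun v => decide (v < 30) || decide (34 < v)) &&
      (e.safe (fun v => decide (v < 30) || decide (34 < v)) fun _ => true)) = true)
    {N₁ N₂ : ℕ} (h₁ : n₁.eval M.int = N₁) (h₂ : n₂.eval M.int = N₂) :
    (((search n₁ n₂ e).run G M).1.int 33 0 = 0 ∧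
      ∀ x < N₁, ∀ y < N₂, e.eval G (M.at' x y) = 0) ∨
    ∃ x < N₁, ∃ y < N₂, e.eval G (M.at' x y) ≠ 0 ∧
      ((search n₁ n₂ e).run G M).1.int 33 0 = x + 1 := by
  simp only [Bool.and_eq_true] at hs
  obtain ⟨⟨s₁, s₂⟩, se⟩ := hs
  refine (run_search G M N₁ N₂ (fun x y => e.eval G (M.at' x y)) ?_ ?_).imp_right ?_
  · intro s h
    have h' : ∀ v, (decide (v < 30) || decide (34 < v)) = true → s v = M.int v := fun v hv => by
      simp only [Bool.or_eq_true, decide_eq_true_eq] at hv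
      exact h v hv
    exact ⟨(IntExp.eval_congr h' _ s₁).trans h₁, (IntExp.eval_congr h' _ s₂).trans h₂⟩
  · intro x _ y _ M' g1 g2 g3 g4
    refine RingExp.eval_congr_of_safe G (fun v hv => ?_) ?_ ?_ ?_ (fun b _ => by rw [g4]; rfl) _ se
    · simp only [Bool.or_eq_true, decide_eq_true_eq] at hv
      rw [M.at_int _ _ (by omega) (by omega), g1 v hv]
    · rw [M.at_int _ _ (by decide) (by decide), g1 _ (by decide)]
    · rw [M.at_int_30, g2]
    · rw [M.at_int_31, g3]
  · rintro ⟨x, hx, y, hy, h0, h1, -⟩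
    exact ⟨x, hx, y, hy, h0, h1⟩

end Prog

/-! ### The program -/

namespace Prog

/-- The powers `θ ^ u`, for `u < m`, times the `N` elements of `S` in the array `src`. The
coordinate of number `l` is stored with index `l + 1`, so that multiplication by `θ` can be written
as a shift. -/
def powers (src dst : ℕ) (N : IntExp) : Prog :=
  seq (fill dst 0 0 1 N (ivar 2) (RingExp.get src (ivar 30) 0 (ivar 31)))
    (loop 12 (ivar 2 - 1) (fill dst 0 (ivar 12 + 1) 1 N (ivar 2)
      (RingExp.get dst (ivar 30) (ivar 12) (ivar 31) -
        RingExp.get dst (ivar 30) (ivar 12) (ivar 2) * RingExp.get 0 0 0 (ivar 31))))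

/-- The multiples of `r` and `f` by powers of `θ`, in the arrays `8` and `9`, and the syndrome, in
the array `10`. -/
def syndrome : Prog :=
  seq (setRing 7 0 0 0 1) (seq (powers 3 8 (ivar 0)) (seq (powers 2 9 (ivar 3))
    (accumulate 10 (ivar 0 * ivar 2) 0 0 0 (ivar 0 - ivar 1) (ivar 2)
      (RingExp.get 1 (ivar 30) (ivar 12 / ivar 2) ((ivar 12).mod (ivar 2)) *
        RingExp.get 8 (ivar 12 / ivar 2) ((ivar 12).mod (ivar 2)) (ivar 31 + 1)))))

/-- Elimination in the matrix of the syndrome, which also reduces the products `θ ^ u f_b` modulo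
the module generated by the syndrome. -/
def reduceSyndrome : Prog :=
  seq (fill 20 0 0 0 (ivar 0 - ivar 1) (ivar 2) (RingExp.get 10 (ivar 30) 0 (ivar 31)))
    (seq (fill 20 (ivar 0 - ivar 1) 0 0 (ivar 3 * ivar 2) (ivar 2)
      (RingExp.get 9 (ivar 30 / ivar 2) ((ivar 30).mod (ivar 2)) (ivar 31 + 1)))
    (eliminate (ivar 0 - ivar 1) (ivar 0 - ivar 1 + ivar 3 * ivar 2) (ivar 2) (ivar 2)))

/-- Search for a nonzero entry in the first `L` columns of the rows without a pivot, the number of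
which is `N`. -/
def searchRest (N L : IntExp) : Prog :=
  search N L (RingExp.get 20 (IntExp.get 37 (ivar 30)) 0 (ivar 31))

/-- Elimination in the matrix of the linear map that sends `x` to the family of the `x f_b` modulo
the module generated by the syndrome. -/
def reduceSupport : Prog :=
  seq (fill 11 0 0 0 (ivar 3 * ivar 2) (ivar 2)
      (RingExp.get 20 (ivar 30 + (ivar 0 - ivar 1)) 0 (ivar 31)))
    (seq (fill 20 0 0 0 (ivar 2) (ivar 3 * ivar 2)
      (RingExp.get 11 (ivar 31 / ivar 2 * ivar 2 + ivar 30) 0 ((ivar 31).mod (ivar 2))))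
    (seq (fill 20 0 0 (ivar 3 * ivar 2) (ivar 2) (ivar 2) (delta (ivar 30) (ivar 31)))
    (eliminate (ivar 2) (ivar 2) (ivar 3 * ivar 2) (ivar 3 * ivar 2 + ivar 2))))

/-- A basis of the support of the error, in the array `12`, and its products with `f`, in the array
`15`. -/
def products : Prog :=
  seq (fill 12 0 0 0 (ivar 11) (ivar 2)
      (RingExp.get 20 (IntExp.get 37 (ivar 30)) 0 (ivar 31 + ivar 3 * ivar 2)))
    (accumulate 15 (ivar 2) 0 0 0 (ivar 11 * ivar 3) (ivar 2)
      (RingExp.get 12 (ivar 30 / ivar 3) 0 (ivar 12) *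
        RingExp.get 9 ((ivar 30).mod (ivar 3)) (ivar 12) (ivar 31 + 1)))

/-- The coordinates of `N` elements `t` with respect to `N₀` elements `x`, up to the sign. -/
def coordinates (N₀ N : IntExp) (x t : RingExp) (out : ℕ) : Prog :=
  seq (fill 20 0 0 0 N₀ (ivar 2) x)
    (seq (fill 20 N₀ 0 0 N (ivar 2) t)
    (seq (fill 20 0 0 (ivar 2) (N₀ + N) N₀ (delta (ivar 30) (ivar 31)))
    (seq (eliminate N₀ (N₀ + N) (ivar 2) (ivar 2 + N₀))
    (fill out 0 0 0 N N₀ (RingExp.get 20 (ivar 30 + N₀) 0 (ivar 31 + ivar 2))))))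

/-- The coordinates of the entries of `H` with respect to `f`, up to the sign, in the array `13`. -/
def checkCoordinates : Prog :=
  coordinates (ivar 3) ((ivar 0 - ivar 1) * ivar 0) (RingExp.get 2 (ivar 30) 0 (ivar 31))
    (RingExp.get 1 (ivar 30 / ivar 0) ((ivar 30).mod (ivar 0)) (ivar 31)) 13

/-- The coordinates of the syndrome with respect to the products, up to the sign, in the array
`14`. -/
def syndromeCoordinates : Prog :=
  coordinates (ivar 11 * ivar 3) (ivar 0 - ivar 1) (RingExp.get 15 (ivar 30) 0 (ivar 31))
    (RingExp.get 10 (ivar 30) 0 (ivar 31)) 14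

/-- Elimination over the maximal Galois subring in the linear system for the coordinates of the
error. -/
def solveSystem : Prog :=
  seq (fill 20 0 0 0 (ivar 0 * ivar 4) ((ivar 0 - ivar 1) * ivar 3)
      (RingExp.get 4 ((ivar 30).mod (ivar 4)) 0 0 *
        RingExp.get 13 (ivar 31 / ivar 3 * ivar 0 + ivar 30 / ivar 4) 0 ((ivar 31).mod (ivar 3))))
    (seq (fill 20 0 0 ((ivar 0 - ivar 1) * ivar 3) (ivar 0 * ivar 4) (ivar 0)
      (RingExp.get 4 ((ivar 30).mod (ivar 4)) 0 0 * delta (ivar 30 / ivar 4) (ivar 31)))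
    (seq (fill 20 (ivar 0 * ivar 4) 0 0 (ivar 11) ((ivar 0 - ivar 1) * ivar 3)
      (RingExp.get 14 (ivar 31 / ivar 3) 0 (ivar 30 * ivar 3 + (ivar 31).mod (ivar 3))))
    (seq (fill 20 (ivar 0 * ivar 4) 0 ((ivar 0 - ivar 1) * ivar 3) (ivar 11) (ivar 0) 0)
    (seq (baseEliminate (ivar 0 * ivar 4) (ivar 0 * ivar 4 + ivar 11) ((ivar 0 - ivar 1) * ivar 3)
      ((ivar 0 - ivar 1) * ivar 3 + ivar 0))
    (search (ivar 11) ((ivar 0 - ivar 1) * ivar 3)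
      (RingExp.get 20 (ivar 30 + ivar 0 * ivar 4) 0 (ivar 31)))))))

/-- The choice of one row of coordinates of the error: the candidates are reduced modulo the rows
that have been chosen before, and one that keeps a unit entry is taken. If there is none, the flag
`13` is set. -/
def chooseRow : Prog :=
  seq (fill 20 0 0 0 (ivar 11) (ivar 0) (RingExp.get 18 (ivar 30) 0 (ivar 31)))
    (seq (fill 20 (ivar 11) 0 0 (ivar 0 * ivar 4 + 1) (ivar 0)
      (RingExp.get 17 (ivar 12) 0 (ivar 31) + RingExp.get 16 (ivar 30) 0 (ivar 31)))
    (seq (eliminate (ivar 11) (ivar 11 + (ivar 0 * ivar 4 + 1)) (ivar 0) (ivar 0))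
    (seq (search (ivar 0 * ivar 4 + 1) (ivar 0)
      (RingExp.inv (RingExp.get 20 (ivar 30 + ivar 11) 0 (ivar 31))))
    (branch (ivar 33) 0 (setInt 13 0 1)
      (fill 18 (ivar 12) 0 0 1 (ivar 0)
        (RingExp.get 17 (ivar 12) 0 (ivar 31) + RingExp.get 16 (ivar 33 - 1) 0 (ivar 31)))))))

/-- Solutions of the linear system for which the entries of the error generate the module that they
should generate. The array `16` contains the generators of the solutions of the homogeneous system,
followed by a row that has never been written and is therefore zero; the array `17` contains the
particular solutions, and the array `18` the rows that are chosen. -/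
def chooseSolution : Prog :=
  seq (fill 16 0 0 0 (ivar 0 * ivar 4) (ivar 0)
      (RingExp.get 20 (ivar 30) 0 (ivar 31 + (ivar 0 - ivar 1) * ivar 3)))
    (seq (fill 17 0 0 0 (ivar 11) (ivar 0)
      (0 - RingExp.get 20 (ivar 30 + ivar 0 * ivar 4) 0 (ivar 31 + (ivar 0 - ivar 1) * ivar 3)))
    (loop 12 (ivar 11) chooseRow))

/-- The word that is returned. -/
def output : Prog :=
  seq (fill 6 0 0 0 (ivar 0) (ivar 2) (RingExp.get 3 (ivar 30) 0 (ivar 31)))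
    (seq (accumulate 6 (ivar 11) 0 0 0 (ivar 0) (ivar 2)
      (0 - RingExp.get 18 (ivar 12) 0 (ivar 30) * RingExp.get 12 (ivar 12) 0 (ivar 31)))
    (setInt 5 0 1))

/-- The part of the decoder that looks for an error with given support. -/
def findError : Prog :=
  seq products (seq checkCoordinates (seq syndromeCoordinates
    (branch (ivar 38) 0
      (seq solveSystem (branch (ivar 33) 0
        (seq chooseSolution (branch (ivar 13) 0 output skip)) skip)) skip)))

/-- The part of the decoder that computes the support of the error. -/
def findSupport : Prog :=
  seq reduceSupport (seq (setInt 11 0 (ivar 38)) (seq (searchRest (ivar 11) (ivar 3 * ivar 2))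
    (branch (ivar 33) 0
      (branch (ivar 11 * ivar 3) (ivar 0 - ivar 1 - ivar 10)
        (branch (ivar 0 - ivar 1 - ivar 10) (ivar 11 * ivar 3) findError skip) skip) skip)))

/-- The decoder. -/
def decoder : Prog :=
  seq syndrome (seq reduceSyndrome (seq (setInt 10 0 (ivar 38))
    (seq (searchRest (ivar 10) (ivar 2)) (branch (ivar 33) 0 findSupport skip))))

end Prog

/-! ### The syndrome and the module that it generates -/

section Stage

variable {R : Type*} [CommRing R] [IsLocalRing R] (G : GaloisFrame R) {m : ℕ}
  (E : GaloisExtension R m) (n k lam : ℕ) (H : ℕ → ℕ → E.Ext) (f r : ℕ → E.Ext)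

/-- The memory contains the input; the finite families have been continued to families that are
indexed by `ℕ`. -/
structure IsInput (M : Memory R) : Prop where
  int0 : M.int 0 0 = n
  int1 : M.int 1 0 = k
  int2 : M.int 2 0 = m
  int3 : M.int 3 0 = lam
  int4 : M.int 4 0 = G.gamma
  ring0 : ∀ l, M.ring 0 0 0 l = E.g.coeff l
  ring1 : ∀ i j c, M.ring 1 i j c = E.coord (H i j) c
  ring2 : ∀ i c, M.ring 2 i 0 c = E.coord (f i) c
  ring3 : ∀ i c, M.ring 3 i 0 c = E.coord (r i) c
  ring4 : ∀ i, M.ring 4 i 0 0 = pad G.z i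
  ring5 : ∀ i, M.ring 5 i 0 0 = pad (fun i' => (G.annGen (G.z i') : R)) i

variable {E n k lam H f r}

theorem IsInput.run {M : Memory R} (h : IsInput G E n k lam H f r M) (P : Prog)
    (hP : ((List.range 5).all (fun v => !P.writesInt v) &&
      (List.range 6).all fun v => !P.writesRing v) = true) :
    IsInput G E n k lam H f r (P.run G M).1 := by
  simp only [Bool.and_eq_true, List.all_eq_true, List.mem_range, Bool.not_eq_true'] at hP
  have hi : ∀ v < 5, (P.run G M).1.int v = M.int v := fun v hv =>
    Prog.run_int G _ _ (hP.1 v hv)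
  have hr : ∀ v < 6, (P.run G M).1.ring v = M.ring v := fun v hv =>
    Prog.run_ring G _ _ (hP.2 v hv)
  constructor
  · rw [hi 0 (by decide), h.int0]
  · rw [hi 1 (by decide), h.int1]
  · rw [hi 2 (by decide), h.int2]
  · rw [hi 3 (by decide), h.int3]
  · rw [hi 4 (by decide), h.int4]
  · rw [hr 0 (by decide)]; exact h.ring0
  · rw [hr 1 (by decide)]; exact h.ring1
  · rw [hr 2 (by decide)]; exact h.ring2
  · rw [hr 3 (by decide)]; exact h.ring3
  · rw [hr 4 (by decide)]; exact h.ring4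
  · rw [hr 5 (by decide)]; exact h.ring5

namespace Prog

/-- Multiplication by `θ` is repeated `m - 1` times. The coordinate with index `0` has to be zero at
the start, as it is what is shifted into the constant coefficient. -/
theorem run_powers {M : Memory R} {src dst : ℕ} {N : IntExp} (N₀ : ℕ) (v : ℕ → E.Ext)
    (hs : src ≠ dst) (h0 : dst ≠ 0) (hm : 0 < m) (hN : N.eval M.int = N₀)
    (hNs : (N.readsOnly fun v => v != 12 && v != 30 && v != 31) = true)
    (h2 : M.int 2 0 = m) (hg : ∀ l, M.ring 0 0 0 l = E.g.coeff l)
    (hv : ∀ x < N₀, ∀ l < m, M.ring src x 0 l = E.coord (v x) l)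
    (hz : ∀ x j, M.ring dst x j 0 = 0) :
    ∀ x < N₀, ∀ u < m, ∀ l < m,
      ((powers src dst N).run G M).1.ring dst x u (l + 1) = E.coord (E.theta ^ u * v x) l := by
  set P1 := fill dst 0 0 1 N (ivar 2) (RingExp.get src (ivar 30) 0 (ivar 31)) with hP1
  have hNc : ∀ s : ℕ → ℕ → ℕ, (∀ v, v ≠ 12 → v ≠ 30 → v ≠ 31 → s v = M.int v) →
      N.eval s = N₀ := fun s h => by
    rw [← hN]
    refine IntExp.eval_congr (fun v hv => ?_) N hNs
    simp only [Bool.and_eq_true, bne_iff_ne] at hv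
    exact h v hv.1.1 hv.1.2 hv.2
  have hfill := run_fill G M (a := dst) (I := 0) (J := 0) (O := 1) (n₁ := N) (n₂ := ivar 2)
    (e := RingExp.get src (ivar 30) 0 (ivar 31)) 0 0 1 N₀ m (fun x y => E.coord (v x) y)
    (fun s h => ⟨rfl, rfl, rfl, hNc s fun v _ h30 h31 => h v h30 h31, by
      rw [IntExp.eval_get, h 2 (by decide) (by decide)]; exact h2⟩)
    (fun x hx y hy M' g1 g2 g3 g4 _ _ => by
      simp only [RingExp.eval_get, IntExp.eval_get, IntExp.eval_ofNat, g2, g3, g4 src hs,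
        hv x hx y hy])
  rw [← hP1] at hfill
  have hfin := run_loop_invariant G (M := (P1.run G M).1) (x := 12) (e := ivar 2 - 1)
    (P := fill dst 0 (ivar 12 + 1) 1 N (ivar 2)
      (RingExp.get dst (ivar 30) (ivar 12) (ivar 31) -
        RingExp.get dst (ivar 30) (ivar 12) (ivar 2) * RingExp.get 0 0 0 (ivar 31)))
    (fun U M' => (∀ v, v ≠ 12 → v ≠ 30 → v ≠ 31 → M'.int v = M.int v) ∧
      M'.ring 0 = M.ring 0 ∧ (∀ x j, M'.ring dst x j 0 = 0) ∧
      ∀ x < N₀, ∀ u ≤ U, ∀ l < m, M'.ring dst x u (l + 1) = E.coord (E.theta ^ u * v x) l)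
    (m - 1) ?_ ?_ ?_
  · intro x hx u hu l hl
    exact hfin.2.2.2 x hx u (by omega) l hl
  · simp only [IntExp.eval_sub, IntExp.eval_get, IntExp.eval_ofNat]
    rw [run_int G _ _ rfl, h2]
  · refine ⟨fun v h12 h30 h31 => ?_, ?_, fun x j => ?_, fun x hx u hu l hl => ?_⟩
    · exact run_int G _ _ (by simp [P1, fill, writesInt, h30.symm, h31.symm])
    · exact run_ring G _ _ (by simp [P1, fill, writesRing, h0])
    · rw [hfill.2 x j 0 (by omega), hz]
    · obtain rfl : u = 0 := by omega
      rw [pow_zero, one_mul]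
      exact hfill.1 x hx l hl
  · rintro U hU M1 ⟨h1, h2', h3, h4⟩
    have hs1 : ∀ s : ℕ → ℕ → ℕ, (∀ v, v ≠ 30 → v ≠ 31 → s v = (M1.setInt 12 0 U).int v) →
        ∀ v, v ≠ 12 → v ≠ 30 → v ≠ 31 → s v = M.int v := by
      intro s h v h12 h30 h31
      rw [h v h30 h31, Memory.setInt_int_ne _ h12, h1 v h12 h30 h31]
    have hs12 : ∀ s : ℕ → ℕ → ℕ, (∀ v, v ≠ 30 → v ≠ 31 → s v = (M1.setInt 12 0 U).int v) →
        s 12 0 = U := fun s h => by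
      rw [h 12 (by decide) (by decide), Memory.setInt_int_same]
    have hs2 : ∀ s : ℕ → ℕ → ℕ, (∀ v, v ≠ 30 → v ≠ 31 → s v = (M1.setInt 12 0 U).int v) →
        s 2 0 = m := fun s h => by
      rw [hs1 s h 2 (by decide) (by decide) (by decide), h2]
    have hf := run_fill G (M1.setInt 12 0 U) (a := dst) (I := 0) (J := ivar 12 + 1) (O := 1)
      (n₁ := N) (n₂ := ivar 2) (e := RingExp.get dst (ivar 30) (ivar 12) (ivar 31) -
        RingExp.get dst (ivar 30) (ivar 12) (ivar 2) * RingExp.get 0 0 0 (ivar 31))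
      0 (U + 1) 1 N₀ m (fun x y => E.coord (E.theta ^ (U + 1) * v x) y) ?_ ?_
    · refine ⟨fun v h12 h30 h31 => ?_, ?_, fun x j => ?_, fun x hx u hu l hl => ?_⟩
      · rw [run_int G _ _ (by simp [fill, writesInt, h30.symm, h31.symm])]
        exact hs1 _ (fun _ _ _ => rfl) v h12 h30 h31
      · rw [run_ring G _ _ (by simp [fill, writesRing, h0])]
        exact h2'
      · rw [hf.2 x j 0 (by omega), Memory.setInt_ring, h3]
      · rcases hu.eq_or_lt with rfl | hu
        · exact hf.1 x hx l hl
        · rw [hf.2 x u (l + 1) (by omega), Memory.setInt_ring]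
          exact h4 x hx u (by omega) l hl
    · intro s h
      refine ⟨rfl, ?_, rfl, hNc s (hs1 s h), hs2 s h⟩
      simp [hs12 s h]
    · intro x hx y hy M' g1 g2 g3 g4 g5 _
      have e1 : ∀ j, M'.ring dst x U j = M1.ring dst x U j := fun j =>
        g5 x U j (Or.inl (by omega))
      have e2 : M'.ring 0 0 0 y = E.g.coeff y := by
        rw [g4 0 h0.symm, Memory.setInt_ring, h2', hg]
      simp only [RingExp.eval_sub, RingExp.eval_mul, RingExp.eval_get, IntExp.eval_get,
        IntExp.eval_ofNat, g2, g3, hs12 _ g1, hs2 _ g1, e1, e2]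
      rw [pow_succ', mul_assoc, E.coord_theta_mul _ hm]
      have e3 : M1.ring dst x U m = E.coord (E.theta ^ U * v x) (m - 1) := by
        have := h4 x hx U le_rfl (m - 1) (by omega)
        rwa [Nat.sub_add_cancel hm] at this
      rw [e3]
      congr 1
      rcases y with _ | y
      · simp [h3]
      · simp only [Nat.add_eq_zero_iff, one_ne_zero, and_false, if_false, Nat.add_sub_cancel]
        exact h4 x hx U le_rfl y (by omega)

variable (hm : 0 < m)

/-- The entries of the syndrome. -/
noncomputable def syn (E : GaloisExtension R m) (n : ℕ) (H : ℕ → ℕ → E.Ext) (r : ℕ → E.Ext)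
    (i : ℕ) : E.Ext :=
  ∑ j ∈ Finset.range n, H i j * r j

theorem sum_range_mul {M : Type*} [AddCommMonoid M] (F : ℕ → ℕ → M) (a b : ℕ) (hb : 0 < b) :
    ∑ w ∈ Finset.range (a * b), F (w / b) (w % b) =
      ∑ i ∈ Finset.range a, ∑ j ∈ Finset.range b, F i j := by
  induction a with
  | zero => simp
  | succ a ih =>
    rw [Nat.succ_mul, Finset.sum_range_add, ih, Finset.sum_range_succ]
    congr 1
    refine Finset.sum_congr rfl fun j hj => ?_
    have hj := Finset.mem_range.1 hj
    rw [mul_comm a b, Nat.mul_add_div hb, Nat.div_eq_of_lt hj, add_zero, Nat.mul_add_mod,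
      Nat.mod_eq_of_lt hj]

include hm in
theorem run_syndrome {M : Memory R} (h : IsInput G E n k lam H f r M)
    (h7 : ∀ d, M.ring 7 d 0 0 = 0) (h8 : M.ring 8 = 0) (h9 : M.ring 9 = 0) (h10 : M.ring 10 = 0)
    {M' : Memory R} (hM' : M' = (syndrome.run G M).1) :
    (∀ d, M'.ring 7 d 0 0 = if d = 0 then 1 else 0) ∧
    (∀ x < lam, ∀ u < m, ∀ l < m, M'.ring 9 x u (l + 1) = E.coord (E.theta ^ u * f x) l) ∧
    ∀ i < n - k, ∀ c < m, M'.ring 10 i 0 c = E.coord (syn E n H r i) c := by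
  subst hM'
  rw [syndrome, run_seq_fst, run_seq_fst, run_seq_fst]
  set M1 := ((setRing 7 0 0 0 1).run G M).1 with hM1
  have i1 := h.run G (setRing 7 0 0 0 1) (by decide)
  rw [← hM1] at i1
  set M2 := ((powers 3 8 (ivar 0)).run G M1).1 with hM2
  have i2 := i1.run G (powers 3 8 (ivar 0)) (by decide)
  rw [← hM2] at i2
  set M3 := ((powers 2 9 (ivar 3)).run G M2).1 with hM3
  have i3 := i2.run G (powers 2 9 (ivar 3)) (by decide)
  rw [← hM3] at i3
  have p8 := run_powers G (M := M1) (src := 3) (dst := 8) (N := ivar 0) n r (by decide) (by decide)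
    hm i1.int0 rfl i1.int2 i1.ring0 (fun x _ l _ => i1.ring3 x l)
    (fun x j => by rw [hM1, run_ring G _ _ rfl, h8]; rfl)
  have p9 := run_powers G (M := M2) (src := 2) (dst := 9) (N := ivar 3) lam f (by decide)
    (by decide)
    hm i2.int3 rfl i2.int2 i2.ring0 (fun x _ l _ => i2.ring2 x l)
    (fun x j => by rw [hM2, run_ring G _ _ rfl, hM1, run_ring G _ _ rfl, h9]; rfl)
  refine ⟨fun d => ?_, fun x hx u hu l hl => ?_, fun i hi c hc => ?_⟩
  · rw [run_ring G _ _ rfl, hM3, run_ring G _ _ rfl, hM2, run_ring G _ _ rfl, hM1, run_setRing]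
    split
    · subst d; exact Memory.setRing_ring_same ..
    · rw [Memory.setRing_ring_of_not _ (by rintro ⟨-, h, -⟩; exact absurd h ‹_›), h7]
  · rw [run_ring G _ _ rfl]
    exact p9 x hx u hu l hl
  · rw [run_accumulate_of_safe G (N₀ := n * m) (N₁ := n - k) (N₂ := m) rfl
      (by simp [i3.int0, i3.int2])
      (by simp [i3.int0, i3.int1]) (by simp [i3.int2]) hi hc]
    have e10 : M3.ring 10 i 0 c = 0 := by
      rw [hM3, run_ring G _ _ rfl, hM2, run_ring G _ _ rfl, hM1, run_ring G _ _ rfl, h10]; rfl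
    rw [e10, zero_add, syn]
    have hsum := E.coord_sum_smul (Finset.range n) (fun _ => 1) (fun j => H i j * r j) c
    simp only [one_smul, one_mul] at hsum
    rw [hsum, Finset.sum_congr rfl fun j _ => E.coord_mul (H i j) (r j) c]
    rw [← sum_range_mul (fun j u => E.coord (H i j) u * E.coord (E.theta ^ u * r j) c) n m hm]
    refine Finset.sum_congr rfl fun w hw => ?_
    have hw := Finset.mem_range.1 hw
    have e8 : M3.ring 8 = M2.ring 8 := run_ring G _ _ rfl
    have e2 : (M3.at3 w i c).int 2 0 = m := by
      rw [Memory.at3_int _ _ _ _ (by decide) (by decide) (by decide), i3.int2]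
    simp only [RingExp.eval_mul, RingExp.eval_get, IntExp.eval_get, IntExp.eval_div,
      IntExp.eval_mod, IntExp.eval_add, IntExp.eval_ofNat, Memory.at3_ring, Memory.at3_int_12,
      Memory.at3_int_30, Memory.at3_int_31, e2, i3.ring1, e8]
    rw [p8 _ (Nat.div_lt_of_lt_mul (by rwa [mul_comm] at hw)) _ (Nat.mod_lt _ hm) _ hc]

end Prog
end Stage

section Stage

variable {R : Type*} [CommRing R] [IsLocalRing R] (G : GaloisFrame R) {m : ℕ}
  {E : GaloisExtension R m} {n k lam : ℕ} {H : ℕ → ℕ → E.Ext} {f r : ℕ → E.Ext}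

namespace Prog

/-- The eliminated table `A₀` has the syndrome in its main rows, and the products `θ ^ u f_b` in the
additional ones. -/
theorem run_reduceSyndrome {M : Memory R} (h : IsInput G E n k lam H f r M) (hm : 0 < m)
    (h7 : ∀ d, M.ring 7 d 0 0 = if d = 0 then 1 else 0)
    (h9 : ∀ x < lam, ∀ u < m, ∀ l < m, M.ring 9 x u (l + 1) = E.coord (E.theta ^ u * f x) l)
    {s : ℕ → E.Ext} (h10 : ∀ i < n - k, ∀ c < m, M.ring 10 i 0 c = E.coord (s i) c)
    {M' : Memory R} (hM' : M' = (reduceSyndrome.run G M).1) :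
    ∃ A₀, IsEliminated (n - k) (n - k + lam * m) m m A₀ (fun x y => M'.ring 20 x 0 y) (n - k)
        (M'.int 38 0) (M'.int 37) ∧
      (∀ x < n - k, ∀ c < m, A₀ x c = E.coord (s x) c) ∧
      ∀ b < lam, ∀ u < m, ∀ c < m, A₀ (b * m + u + (n - k)) c = E.coord (E.theta ^ u * f b) c := by
  subst hM'
  rw [reduceSyndrome, run_seq_fst, run_seq_fst]
  set P1 := fill 20 0 0 0 (ivar 0 - ivar 1) (ivar 2) (RingExp.get 10 (ivar 30) 0 (ivar 31)) with hP1
  set M1 := (P1.run G M).1 with hM1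
  have i1 := h.run G P1 (by decide)
  rw [← hM1] at i1
  have f1 := run_fill_of_safe G (M := M) (a := 20) (I := 0) (J := 0) (O := 0)
    (n₁ := ivar 0 - ivar 1)
    (n₂ := ivar 2) (e := RingExp.get 10 (ivar 30) 0 (ivar 31)) rfl (rfl : _ = 0) (rfl : _ = 0)
    (rfl : _ = 0)
    (by simp [h.int0, h.int1] : _ = n - k) (by simp [h.int2] : _ = m)
  rw [← hP1, ← hM1] at f1
  set P2 := fill 20 (ivar 0 - ivar 1) 0 0 (ivar 3 * ivar 2) (ivar 2)
      (RingExp.get 9 (ivar 30 / ivar 2) ((ivar 30).mod (ivar 2)) (ivar 31 + 1)) with hP2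
  set M2 := (P2.run G M1).1 with hM2
  have i2 := i1.run G P2 (by decide)
  rw [← hM2] at i2
  have f2 := run_fill_of_safe G (M := M1) (a := 20) (I := ivar 0 - ivar 1) (J := 0) (O := 0)
    (n₁ := ivar 3 * ivar 2) (n₂ := ivar 2)
    (e := RingExp.get 9 (ivar 30 / ivar 2) ((ivar 30).mod (ivar 2)) (ivar 31 + 1)) rfl
    (by simp [i1.int0, i1.int1] : _ = n - k) (rfl : _ = 0) (rfl : _ = 0)
    (by simp [i1.int2, i1.int3] : _ = lam * m) (by simp [i1.int2] : _ = m)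
  rw [← hP2, ← hM2] at f2
  have e7 : M2.ring 7 = M.ring 7 := by rw [hM2, run_ring G _ _ rfl, hM1, run_ring G _ _ rfl]
  have e9 : M1.ring 9 = M.ring 9 := run_ring G _ _ rfl
  refine ⟨fun x y => M2.ring 20 x 0 y, ?_, ?_, ?_⟩
  · refine run_eliminate G M2 _ _ _ _ (fun s hs => ?_) (Nat.le_add_right _ _) le_rfl
      fun d => by rw [e7, h7]
    simp [hs, i2.int0, i2.int1, i2.int2, i2.int3]
  · intro x hx c hc
    have g1 := f1.1 x hx c hc
    simp only [add_zero] at g1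
    change M2.ring 20 x 0 c = _
    rw [f2.2 x 0 c (by omega), g1]
    simp [h10 x hx c hc]
  · intro b hb u hu c hc
    have hx : b * m + u < lam * m := by
      have : (b + 1) * m ≤ lam * m := Nat.mul_le_mul_right _ hb
      linarith
    have g2 := f2.1 (b * m + u) hx c hc
    have hdiv : (b * m + u) / m = b := by
      rw [mul_comm, Nat.mul_add_div hm, Nat.div_eq_of_lt hu, add_zero]
    have hmod : (b * m + u) % m = u := by rw [mul_comm, Nat.mul_add_mod, Nat.mod_eq_of_lt hu]
    change M2.ring 20 _ 0 c = _
    simp only [add_zero] at g2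
    rw [g2]
    have e2 : (M1.at' (b * m + u) c).int 2 0 = m := by
      rw [Memory.at_int _ _ _ (by decide) (by decide), i1.int2]
    simp only [RingExp.eval_get, IntExp.eval_get, IntExp.eval_div, IntExp.eval_mod, IntExp.eval_add,
      IntExp.eval_ofNat, Memory.at_ring, Memory.at_int_30, Memory.at_int_31, e2, hdiv, hmod, e9]
    exact h9 b hb u hu c hc

/-- The search fails if and only if nothing is left in the rows without a pivot. -/
theorem run_searchRest {M : Memory R} {N L : IntExp} {q l : ℕ}
    (hs : ((N.readsOnly fun v => decide (v < 30) || decide (34 < v)) &&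
      (L.readsOnly fun v => decide (v < 30) || decide (34 < v))) = true)
    (hN : N.eval M.int = q) (hL : L.eval M.int = l) :
    ((searchRest N L).run G M).1.int 33 0 = 0 ↔
      ∀ b < q, ∀ c < l, M.ring 20 (M.int 37 b) 0 c = 0 := by
  have h := run_search_of_safe G (M := M) (n₁ := N) (n₂ := L)
    (e := RingExp.get 20 (IntExp.get 37 (ivar 30)) 0 (ivar 31))
    (by rw [hs]; rfl) hN hL
  simp only [RingExp.eval_get, IntExp.eval_get, IntExp.eval_ofNat, Memory.at_ring, Memory.at_int_30,
    Memory.at_int_31, Memory.at_int _ _ _ (show 37 ≠ 30 by decide) (by decide)] at h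
  rcases h with ⟨h0, hz⟩ | ⟨x, hx, y, hy, h0, h1⟩
  · exact ⟨fun _ => hz, fun _ => h0⟩
  · refine ⟨fun h => ?_, fun h => absurd (h x hx y hy) h0⟩
    rw [searchRest] at h
    omega

/-- The eliminated table `A₀` consists of the matrix of the map that sends `x` to the family of the
reduced products `x f_b`, and of an identity matrix to its right. -/
theorem run_reduceSupport {M : Memory R} (h : IsInput G E n k lam H f r M) (hm : 0 < m)
    (h7 : ∀ d, M.ring 7 d 0 0 = if d = 0 then 1 else 0)
    {M' : Memory R} (hM' : M' = (reduceSupport.run G M).1) :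
    ∃ A₀, IsEliminated m m (lam * m) (lam * m + m) A₀ (fun x y => M'.ring 20 x 0 y) m
        (M'.int 38 0) (M'.int 37) ∧
      (∀ u < m, ∀ c < lam * m, A₀ u c = M.ring 20 (c / m * m + u + (n - k)) 0 (c % m)) ∧
      ∀ (u : ℕ) (y : Fin m), u < m → A₀ u (lam * m + y) = if u = y then 1 else 0 := by
  subst hM'
  rw [reduceSupport, run_seq_fst, run_seq_fst, run_seq_fst]
  set P1 := fill 11 0 0 0 (ivar 3 * ivar 2) (ivar 2)
      (RingExp.get 20 (ivar 30 + (ivar 0 - ivar 1)) 0 (ivar 31)) with hP1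
  set M1 := (P1.run G M).1 with hM1
  have i1 := h.run G P1 (by decide)
  rw [← hM1] at i1
  have f1 := run_fill_of_safe G (M := M) (a := 11) (I := 0) (J := 0) (O := 0)
    (n₁ := ivar 3 * ivar 2)
    (n₂ := ivar 2) (e := RingExp.get 20 (ivar 30 + (ivar 0 - ivar 1)) 0 (ivar 31)) rfl (rfl : _ = 0)
    (rfl : _ = 0) (rfl : _ = 0)
    (by simp [h.int2, h.int3] : _ = lam * m) (by simp [h.int2] : _ = m)
  rw [← hP1, ← hM1] at f1
  set P2 := fill 20 0 0 0 (ivar 2) (ivar 3 * ivar 2)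
      (RingExp.get 11 (ivar 31 / ivar 2 * ivar 2 + ivar 30) 0 ((ivar 31).mod (ivar 2))) with hP2
  set M2 := (P2.run G M1).1 with hM2
  have i2 := i1.run G P2 (by decide)
  rw [← hM2] at i2
  have f2 := run_fill_of_safe G (M := M1) (a := 20) (I := 0) (J := 0) (O := 0)
    (n₁ := ivar 2) (n₂ := ivar 3 * ivar 2)
    (e := RingExp.get 11 (ivar 31 / ivar 2 * ivar 2 + ivar 30) 0 ((ivar 31).mod (ivar 2))) rfl
    (rfl : _ = 0) (rfl : _ = 0) (rfl : _ = 0) (by simp [i1.int2] : _ = m)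
    (by simp [i1.int2, i1.int3] : _ = lam * m)
  rw [← hP2, ← hM2] at f2
  set P3 := fill 20 0 0 (ivar 3 * ivar 2) (ivar 2) (ivar 2) (delta (ivar 30) (ivar 31)) with hP3
  set M3 := (P3.run G M2).1 with hM3
  have i3 := i2.run G P3 (by decide)
  rw [← hM3] at i3
  have f3 := run_fill_of_safe G (M := M2) (a := 20) (I := 0) (J := 0) (O := ivar 3 * ivar 2)
    (n₁ := ivar 2) (n₂ := ivar 2) (e := delta (ivar 30) (ivar 31)) rfl
    (rfl : _ = 0) (rfl : _ = 0) (by simp [i2.int2, i2.int3] : _ = lam * m)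
    (by simp [i2.int2] : _ = m)
    (by simp [i2.int2] : _ = m)
  rw [← hP3, ← hM3] at f3
  have e7' : M2.ring 7 = M.ring 7 := by rw [hM2, run_ring G _ _ rfl, hM1, run_ring G _ _ rfl]
  have e7 : M3.ring 7 = M.ring 7 := by rw [hM3, run_ring G _ _ rfl, e7']
  refine ⟨fun x y => M3.ring 20 x 0 y, ?_, ?_, ?_⟩
  · refine run_eliminate G M3 _ _ _ _ (fun s hs => ?_) le_rfl (Nat.le_add_right _ _)
      fun d => by rw [e7, h7]
    simp [hs, i3.int2, i3.int3]
  · intro u hu c hc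
    have hcm : c / m < lam := Nat.div_lt_of_lt_mul (by rwa [mul_comm] at hc)
    have hx : c / m * m + u < lam * m := by
      have : (c / m + 1) * m ≤ lam * m := Nat.mul_le_mul_right _ hcm
      linarith
    have g1 := f1.1 (c / m * m + u) hx (c % m) (Nat.mod_lt _ hm)
    have g2 := f2.1 u hu c hc
    simp only [add_zero] at g1 g2
    change M3.ring 20 u 0 c = _
    rw [f3.2 u 0 c (by omega), g2]
    have e2 : (M1.at' u c).int 2 0 = m := by
      rw [Memory.at_int _ _ _ (by decide) (by decide), i1.int2]
    simp only [RingExp.eval_get, IntExp.eval_get, IntExp.eval_div, IntExp.eval_mod, IntExp.eval_add,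
      IntExp.eval_mul, IntExp.eval_ofNat, Memory.at_ring, Memory.at_int_30, Memory.at_int_31, e2]
    rw [g1]
    have e0 : ∀ x y, (M.at' x y).int 0 0 = n ∧ (M.at' x y).int 1 0 = k := fun x y => by
      rw [Memory.at_int _ _ _ (by decide) (by decide), Memory.at_int _ _ _ (by decide) (by decide)]
      exact ⟨h.int0, h.int1⟩
    simp only [RingExp.eval_get, IntExp.eval_get, IntExp.eval_sub, IntExp.eval_add,
      IntExp.eval_ofNat, Memory.at_ring, Memory.at_int_30, Memory.at_int_31, e0]
  · intro u y hu
    have g3 := f3.1 u hu y y.2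
    simp only [add_zero] at g3
    change M3.ring 20 u 0 _ = _
    rw [add_comm, g3, eval_delta G (fun d => by rw [Memory.at_ring, e7', h7])]
    simp

/-- The program `coordinates` computes the coordinates of elements of the module generated by an
independent family. -/
theorem run_coordinates [Finite R] {M : Memory R} (h2 : M.int 2 0 = m)
    (h7 : ∀ d, M.ring 7 d 0 0 = if d = 0 then 1 else 0) {N₀ N : IntExp} {n₀ n₁ : ℕ}
    {ex et : RingExp} {out : ℕ} (x t : ℕ → E.Ext)
    (hs : ((N₀.readsOnly fun v => decide (v < 12)) && (N.readsOnly fun v => decide (v < 12)) &&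
      (ex.safe (fun v => decide (v < 12)) fun b => decide (b < 20)) &&
      (et.safe (fun v => decide (v < 12)) fun b => decide (b < 20)) && decide (7 < out) &&
      decide (out < 20)) = true)
    (hN₀ : N₀.eval M.int = n₀) (hN : N.eval M.int = n₁)
    (hx : ∀ i < n₀, ∀ c < m, ex.eval G (M.at' i c) = E.coord (x i) c)
    (ht : ∀ i < n₁, ∀ c < m, et.eval G (M.at' i c) = E.coord (t i) c)
    {M' : Memory R} (hM' : M' = ((coordinates N₀ N ex et out).run G M).1) :
    (M'.int 38 0 = 0 ↔ LinearIndependent R fun b : Fin n₀ => x b) ∧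
    (M'.int 38 0 = 0 → ∀ i < n₁,
      t i ∈ Submodule.span R (Set.range fun b : Fin n₀ => x b) →
        t i = -∑ b : Fin n₀, M'.ring out i 0 b • x b) := by
  simp only [Bool.and_eq_true, decide_eq_true_eq] at hs
  obtain ⟨⟨⟨⟨⟨s₀, s₁⟩, sx⟩, st⟩, o7⟩, o20⟩ := hs
  have hs30 : ∀ v, decide (v < 12) = true → (v != 30 && v != 31) = true := fun v hv => by
    simp only [decide_eq_true_eq] at hv
    simp only [Bool.and_eq_true, bne_iff_ne]
    omega
  have hN₀' : ∀ s : ℕ → ℕ → ℕ, (∀ v < 12, s v = M.int v) → N₀.eval s = n₀ := fun s h =>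
    (IntExp.eval_congr (fun v hv => h v (by simpa using hv)) _ s₀).trans hN₀
  have hN' : ∀ s : ℕ → ℕ → ℕ, (∀ v < 12, s v = M.int v) → N.eval s = n₁ := fun s h =>
    (IntExp.eval_congr (fun v hv => h v (by simpa using hv)) _ s₁).trans hN
  have hat : ∀ {M₁ : Memory R} {e : RingExp} (x y : ℕ), (∀ v < 20, M₁.int v = M.int v) →
      (∀ b < 20, M₁.ring b = M.ring b) →
      (e.safe (fun v => decide (v < 12)) fun b => decide (b < 20)) = true →
      e.eval G (M₁.at' x y) = e.eval G (M.at' x y) := by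
    intro M₁ e x y hi hr he
    refine RingExp.eval_congr_of_safe G (fun v hv => ?_) ?_ ?_ ?_ (fun b hb => ?_) _ he
    · simp only [decide_eq_true_eq] at hv
      rw [Memory.at_int _ _ _ (by omega) (by omega), Memory.at_int _ _ _ (by omega) (by omega),
        hi v (by omega)]
    · rw [Memory.at_int _ _ _ (by decide) (by decide), Memory.at_int _ _ _ (by decide) (by decide),
        hi 12 (by decide)]
    · simp
    · simp
    · simp only [decide_eq_true_eq] at hb
      exact hr b hb
  have r₀ := N₀.readsOnly_mono hs30 s₀
  have r₁ := N.readsOnly_mono hs30 s₁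
  have rx := ex.safe_mono (T' := fun b => b != 20) hs30 (by simp; omega) sx
  have rt := et.safe_mono (T' := fun b => b != 20) hs30 (by simp; omega) st
  subst hM'
  rw [coordinates, run_seq_fst, run_seq_fst, run_seq_fst, run_seq_fst]
  set P1 := fill 20 0 0 0 N₀ (ivar 2) ex with hP1
  set M1 := (P1.run G M).1 with hM1
  have i1 : ∀ v < 20, M1.int v = M.int v := fun v hv =>
    run_int G _ _ (by simp [P1, fill, writesInt]; omega)
  have j1 : ∀ b < 20, M1.ring b = M.ring b := fun v hv =>
    run_ring G _ _ (by simp [P1, fill, writesRing]; omega)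
  have f1 := run_fill_of_safe G (M := M) (a := 20) (I := 0) (J := 0) (O := 0) (n₁ := N₀)
    (n₂ := ivar 2) (e := ex) (by rw [r₀, rx]; rfl) (rfl : _ = 0) (rfl : _ = 0) (rfl : _ = 0) hN₀
    (h2 : _ = m)
  rw [← hP1, ← hM1] at f1
  set P2 := fill 20 N₀ 0 0 N (ivar 2) et with hP2
  set M2 := (P2.run G M1).1 with hM2
  have i2 : ∀ v < 20, M2.int v = M.int v := fun v hv => by
    rw [hM2, run_int G _ _ (by simp [P2, fill, writesInt]; omega), i1 v hv]
  have j2 : ∀ b < 20, M2.ring b = M.ring b := fun v hv => by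
    rw [hM2, run_ring G _ _ (by simp [P2, fill, writesRing]; omega), j1 v hv]
  have f2 := run_fill_of_safe G (M := M1) (a := 20) (I := N₀) (J := 0) (O := 0) (n₁ := N)
    (n₂ := ivar 2) (e := et) (by rw [r₀, r₁, rt]; rfl)
    (hN₀' _ fun v hv => i1 v (by omega)) (rfl : _ = 0) (rfl : _ = 0)
    (hN' _ fun v hv => i1 v (by omega))
    (by rw [IntExp.eval_get, i1 2 (by decide)]; exact h2 : _ = m)
  rw [← hP2, ← hM2] at f2
  set P3 := fill 20 0 0 (ivar 2) (N₀ + N) N₀ (delta (ivar 30) (ivar 31)) with hP3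
  set M3 := (P3.run G M2).1 with hM3
  have i3 : ∀ v < 20, M3.int v = M.int v := fun v hv => by
    rw [hM3, run_int G _ _ (by simp [P3, fill, writesInt]; omega), i2 v hv]
  have j3 : ∀ b < 20, M3.ring b = M.ring b := fun v hv => by
    rw [hM3, run_ring G _ _ (by simp [P3, fill, writesRing]; omega), j2 v hv]
  have rN : (N₀ + N).readsOnly (fun v => v != 30 && v != 31) = true := by
    change (N₀.readsOnly _ && N.readsOnly _) = true
    rw [r₀, r₁]; rfl
  have f3 := run_fill_of_safe G (M := M2) (a := 20) (I := 0) (J := 0) (O := ivar 2) (n₁ := N₀ + N)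
    (n₂ := N₀) (e := delta (ivar 30) (ivar 31)) (by rw [r₀, rN]; rfl) (rfl : _ = 0) (rfl : _ = 0)
    (by rw [IntExp.eval_get, i2 2 (by decide)]; exact h2 : _ = m)
    (by rw [IntExp.eval_add, hN₀' _ fun v hv => i2 v (by omega), hN' _ fun v hv => i2 v (by omega)])
    (hN₀' _ fun v hv => i2 v (by omega))
  rw [← hP3, ← hM3] at f3
  set P4 := eliminate N₀ (N₀ + N) (ivar 2) (ivar 2 + N₀) with hP4
  set M4 := (P4.run G M3).1 with hM4
  have i4 : ∀ v < 20, M4.int v = M.int v := fun v hv => by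
    rw [hM4, run_int G _ _ (by simp [P4, eliminate, rankOne, search, fill, writesInt]; omega),
      i3 v hv]
  have h4 := run_eliminate G M3 (N₀ := N₀) (N := N₀ + N) (L := ivar 2) (W := ivar 2 + N₀)
    n₀ (n₀ + n₁) m (m + n₀) (fun s hs => by
      have hs' : ∀ v < 12, s v = M.int v := fun v hv => by rw [hs v (by omega), i3 v (by omega)]
      rw [IntExp.eval_add, IntExp.eval_add, hN₀' s hs', hN' s hs', IntExp.eval_get,
        hs' 2 (by decide), IntExp.eval_ofNat, h2]
      exact ⟨rfl, rfl, rfl, rfl⟩) (Nat.le_add_right _ _) (Nat.le_add_right _ _)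
    (fun d => by rw [j3 7 (by decide), h7])
  rw [← hP4, ← hM4] at h4
  have f5 := run_fill_of_safe G (M := M4) (a := out) (I := 0) (J := 0) (O := 0) (n₁ := N)
    (n₂ := N₀) (e := RingExp.get 20 (ivar 30 + N₀) 0 (ivar 31 + ivar 2))
    (by
      rw [r₀, r₁]
      change (true && true && true && true && true &&
        (20 != out && (true && N₀.safe fun v => v != 30 && v != 31) && true && true)) = true
      rw [IntExp.safe_of_readsOnly _ r₀]
      simp
      omega)
    (rfl : _ = 0) (rfl : _ = 0) (rfl : _ = 0) (hN' _ fun v hv => i4 v (by omega))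
    (hN₀' _ fun v hv => i4 v (by omega))
  have hδ : ∀ (b : ℕ) (y : Fin n₀), b < n₀ + n₁ →
      M3.ring 20 b 0 (m + y) = if b = y then 1 else 0 := fun b y hb => by
    have g := f3.1 b hb y y.2
    rw [add_comm m, ← add_zero b, g, eval_delta G (fun d => by
      rw [Memory.at_ring, j2 7 (by decide), h7])]
    simp
  have hxA : ∀ (b : Fin n₀) (c : Fin m), M3.ring 20 b 0 c = E.coordEquiv (x b) c := by
    intro b c
    have g := f1.1 b b.2 c c.2
    simp only [add_zero] at g
    rw [f3.2 b 0 c (by omega), f2.2 b 0 c (by omega), g, hx b b.2 c c.2, E.coordEquiv_apply]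
  rw [run_int G _ _ (by simp [fill, writesInt] : _ = false)]
  refine ⟨h4.eq_zero_iff_linearIndependent E.coordEquiv (fun b y hb => hδ b y (by omega)) hxA,
    fun h38 i hi hmem => ?_⟩
  have htA : ∀ c : Fin m, M3.ring 20 (n₀ + i) 0 c = E.coordEquiv (t i) c := by
    intro c
    have g := f2.1 i hi c c.2
    simp only [add_zero] at g
    rw [f3.2 _ 0 c (by omega), add_comm n₀, g, hat i c (fun v hv => i1 v (by omega)) j1 st,
      ht i hi c c.2, E.coordEquiv_apply]
  have key := h4.eq_neg_sum E.coordEquiv (fun b y hb => hδ b y (by omega)) hxA h38 hi htA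
    (fun y => by rw [hδ _ y (by omega), if_neg (by omega)]) hmem
  rw [key]
  refine congrArg Neg.neg (Finset.sum_congr rfl fun b _ => ?_)
  have g := f5.1 i hi b b.2
  simp only [add_zero] at g
  rw [g]
  have e2 : (M4.at' i b).int 2 0 = m := by
    rw [Memory.at_int _ _ _ (by decide) (by decide), i4 2 (by decide), h2]
  have e0 : N₀.eval (M4.at' i b).int = n₀ := hN₀' _ fun v hv => by
    rw [Memory.at_int _ _ _ (by omega) (by omega), i4 v (by omega)]
  simp only [RingExp.eval_get, IntExp.eval_get, IntExp.eval_add, IntExp.eval_ofNat, Memory.at_ring,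
    Memory.at_int_30, Memory.at_int_31, e2, e0]
  rw [add_comm i, add_comm (b : ℕ)]

end Prog
end Stage

/-! ### The linear system for the error -/

section Stage

variable {R : Type*} [CommRing R] [IsLocalRing R] (G : GaloisFrame R) {m : ℕ}
  {E : GaloisExtension R m} {n k lam : ℕ} {H : ℕ → ℕ → E.Ext} {f r : ℕ → E.Ext}

namespace Prog

/-- The array `12` contains the right parts `ε` of the rows without a pivot, and the array `15` the
products `ε_a f_b`, with the number `a * lam + b`. -/
theorem run_products {M : Memory R} (h : IsInput G E n k lam H f r M) {q : ℕ}
    (h11 : M.int 11 0 = q) (hlam : 0 < lam)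
    (h9 : ∀ x < lam, ∀ u < m, ∀ l < m, M.ring 9 x u (l + 1) = E.coord (E.theta ^ u * f x) l)
    (h15 : M.ring 15 = 0) {ε : ℕ → E.Ext}
    (hε : ∀ a < q, ∀ c < m, M.ring 20 (M.int 37 a) 0 (c + lam * m) = E.coord (ε a) c)
    {M' : Memory R} (hM' : M' = (products.run G M).1) :
    (∀ a < q, ∀ c < m, M'.ring 12 a 0 c = E.coord (ε a) c) ∧
    ∀ v < q * lam, ∀ c < m, M'.ring 15 v 0 c = E.coord (ε (v / lam) * f (v % lam)) c := by
  subst hM'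
  rw [products, run_seq_fst]
  set P1 := fill 12 0 0 0 (ivar 11) (ivar 2)
      (RingExp.get 20 (IntExp.get 37 (ivar 30)) 0 (ivar 31 + ivar 3 * ivar 2)) with hP1
  set M1 := (P1.run G M).1 with hM1
  have i1 := h.run G P1 (by decide)
  rw [← hM1] at i1
  have f1 := run_fill_of_safe G (M := M) (a := 12) (I := 0) (J := 0) (O := 0) (n₁ := ivar 11)
    (n₂ := ivar 2)
    (e := RingExp.get 20 (IntExp.get 37 (ivar 30)) 0 (ivar 31 + ivar 3 * ivar 2)) rfl
    (rfl : _ = 0) (rfl : _ = 0) (rfl : _ = 0) h11 (by simp [h.int2] : _ = m)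
  rw [← hP1, ← hM1] at f1
  have e11 : M1.int 11 0 = q := by rw [hM1, run_int G _ _ rfl, h11]
  have g1 : ∀ a < q, ∀ c < m, M1.ring 12 a 0 c = E.coord (ε a) c := by
    intro a ha c hc
    have g := f1.1 a ha c hc
    simp only [add_zero] at g
    rw [g, ← hε a ha c hc]
    have e37 : (M.at' a c).int 37 = M.int 37 := Memory.at_int _ _ _ (by decide) (by decide)
    have e2 : (M.at' a c).int 2 0 = m := by
      rw [Memory.at_int _ _ _ (by decide) (by decide), h.int2]
    have e3 : (M.at' a c).int 3 0 = lam := by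
      rw [Memory.at_int _ _ _ (by decide) (by decide), h.int3]
    simp only [RingExp.eval_get, IntExp.eval_get, IntExp.eval_add, IntExp.eval_mul,
      IntExp.eval_ofNat, Memory.at_ring, Memory.at_int_30, Memory.at_int_31, e2, e3, e37]
  refine ⟨fun a ha c hc => ?_, fun v hv c hc => ?_⟩
  · rw [run_ring G _ _ rfl]
    exact g1 a ha c hc
  · rw [run_accumulate_of_safe G (N₀ := m) (N₁ := q * lam) (N₂ := m) rfl (by simp [i1.int2])
      (by simp [e11, i1.int3]) (by simp [i1.int2]) hv hc]
    have e15 : M1.ring 15 v 0 c = 0 := by rw [hM1, run_ring G _ _ rfl, h15]; rfl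
    rw [e15, zero_add, E.coord_mul]
    refine Finset.sum_congr rfl fun w hw => ?_
    have hw := Finset.mem_range.1 hw
    have e3 : (M1.at3 w v c).int 3 0 = lam := by
      rw [Memory.at3_int _ _ _ _ (by decide) (by decide) (by decide), i1.int3]
    have e9 : M1.ring 9 = M.ring 9 := run_ring G _ _ rfl
    simp only [RingExp.eval_mul, RingExp.eval_get, IntExp.eval_get, IntExp.eval_div,
      IntExp.eval_mod, IntExp.eval_add, IntExp.eval_ofNat, Memory.at3_ring, Memory.at3_int_12,
      Memory.at3_int_30, Memory.at3_int_31, e3, e9]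
    rw [g1 _ (Nat.div_lt_of_lt_mul (by rwa [mul_comm] at hv)) _ hw,
      h9 _ (Nat.mod_lt _ hlam) _ hw _ hc]

/-- The linear system is solved. -/
theorem run_solveSystem [Finite R] {M : Memory R} (h : IsInput G E n k lam H f r M) {q L : ℕ}
    (hn : 0 < n) (hL : (n - k) * lam = L) (h11 : M.int 11 0 = q)
    (h7 : ∀ d, M.ring 7 d 0 0 = if d = 0 then 1 else 0) {h₀ : ℕ → ℕ → R}
    (hh : ∀ c < L, ∀ j < n, M.ring 13 (c / lam * n + j) 0 (c % lam) = h₀ c j) {t : ℕ → ℕ → R}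
    (ht : ∀ a < q, ∀ c < L, M.ring 14 (c / lam) 0 (a * lam + c % lam) = t a c)
    {M' : Memory R} (hM' : M' = (solveSystem.run G M).1) :
    (M'.int 33 0 = 0 ↔ ∀ a < q, ∃ y : Fin n → R, ∀ c < L, ∑ j : Fin n, h₀ c j * y j = t a c) ∧
    (M'.int 33 0 = 0 → ∀ a < q, ∀ c < L,
      ∑ j : Fin n, h₀ c j * -M'.ring 20 (n * G.gamma + a) 0 (L + j) = t a c) ∧
    (∀ x < n * G.gamma, ∀ c < L, ∑ j : Fin n, h₀ c j * M'.ring 20 x 0 (L + j) = 0) ∧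
    ∀ K : Submodule R (Fin n → R),
      (∀ x < n * G.gamma, (fun j : Fin n => M'.ring 20 x 0 (L + j)) ∈ K) →
      ∀ y : Fin n → R, (∀ c < L, ∑ j : Fin n, h₀ c j * y j = 0) → y ∈ K := by
  subst hM'
  rw [solveSystem, run_seq_fst, run_seq_fst, run_seq_fst, run_seq_fst, run_seq_fst]
  set P1 := fill 20 0 0 0 (ivar 0 * ivar 4) ((ivar 0 - ivar 1) * ivar 3)
      (RingExp.get 4 ((ivar 30).mod (ivar 4)) 0 0 *
        RingExp.get 13 (ivar 31 / ivar 3 * ivar 0 + ivar 30 / ivar 4) 0 ((ivar 31).mod (ivar 3)))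
    with hP1
  set M1 := (P1.run G M).1 with hM1
  have i1 := h.run G P1 (by decide)
  rw [← hM1] at i1
  have f1 := run_fill_of_safe G (M := M) (a := 20) (I := 0) (J := 0) (O := 0)
    (n₁ := ivar 0 * ivar 4) (n₂ := (ivar 0 - ivar 1) * ivar 3)
    (e := RingExp.get 4 ((ivar 30).mod (ivar 4)) 0 0 *
        RingExp.get 13 (ivar 31 / ivar 3 * ivar 0 + ivar 30 / ivar 4) 0 ((ivar 31).mod (ivar 3)))
    rfl (rfl : _ = 0) (rfl : _ = 0) (rfl : _ = 0) (by simp [h.int0, h.int4] : _ = n * G.gamma)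
    (by simp [h.int0, h.int1, h.int3, hL] : _ = L)
  rw [← hP1, ← hM1] at f1
  set P2 := fill 20 0 0 ((ivar 0 - ivar 1) * ivar 3) (ivar 0 * ivar 4) (ivar 0)
      (RingExp.get 4 ((ivar 30).mod (ivar 4)) 0 0 * delta (ivar 30 / ivar 4) (ivar 31)) with hP2
  set M2 := (P2.run G M1).1 with hM2
  have i2 := i1.run G P2 (by decide)
  rw [← hM2] at i2
  have f2 := run_fill_of_safe G (M := M1) (a := 20) (I := 0) (J := 0)
    (O := (ivar 0 - ivar 1) * ivar 3) (n₁ := ivar 0 * ivar 4) (n₂ := ivar 0)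
    (e := RingExp.get 4 ((ivar 30).mod (ivar 4)) 0 0 * delta (ivar 30 / ivar 4) (ivar 31))
    rfl (rfl : _ = 0) (rfl : _ = 0) (by simp [i1.int0, i1.int1, i1.int3, hL] : _ = L)
    (by simp [i1.int0, i1.int4] : _ = n * G.gamma) i1.int0
  rw [← hP2, ← hM2] at f2
  set P3 := fill 20 (ivar 0 * ivar 4) 0 0 (ivar 11) ((ivar 0 - ivar 1) * ivar 3)
      (RingExp.get 14 (ivar 31 / ivar 3) 0 (ivar 30 * ivar 3 + (ivar 31).mod (ivar 3))) with hP3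
  set M3 := (P3.run G M2).1 with hM3
  have i3 := i2.run G P3 (by decide)
  rw [← hM3] at i3
  have k2 : M2.int 11 0 = q := by rw [hM2, run_int G _ _ rfl, hM1, run_int G _ _ rfl, h11]
  have f3 := run_fill_of_safe G (M := M2) (a := 20) (I := ivar 0 * ivar 4) (J := 0) (O := 0)
    (n₁ := ivar 11) (n₂ := (ivar 0 - ivar 1) * ivar 3)
    (e := RingExp.get 14 (ivar 31 / ivar 3) 0 (ivar 30 * ivar 3 + (ivar 31).mod (ivar 3)))
    rfl (by simp [i2.int0, i2.int4] : _ = n * G.gamma) (rfl : _ = 0) (rfl : _ = 0) k2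
    (by simp [i2.int0, i2.int1, i2.int3, hL] : _ = L)
  rw [← hP3, ← hM3] at f3
  set P4 := fill 20 (ivar 0 * ivar 4) 0 ((ivar 0 - ivar 1) * ivar 3) (ivar 11) (ivar 0) 0 with hP4
  set M4 := (P4.run G M3).1 with hM4
  have i4 := i3.run G P4 (by decide)
  rw [← hM4] at i4
  have k3 : M3.int 11 0 = q := by rw [hM3, run_int G _ _ rfl, k2]
  have f4 := run_fill_of_safe G (M := M3) (a := 20) (I := ivar 0 * ivar 4) (J := 0)
    (O := (ivar 0 - ivar 1) * ivar 3) (n₁ := ivar 11) (n₂ := ivar 0) (e := 0)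
    rfl (by simp [i3.int0, i3.int4] : _ = n * G.gamma) (rfl : _ = 0)
    (by simp [i3.int0, i3.int1, i3.int3, hL] : _ = L) k3 i3.int0
  rw [← hP4, ← hM4] at f4
  have k4 : M4.int 11 0 = q := by rw [hM4, run_int G _ _ rfl, k3]
  have e71 : M1.ring 7 = M.ring 7 := run_ring G _ _ rfl
  have e74 : M4.ring 7 = M.ring 7 := by
    rw [hM4, run_ring G _ _ rfl, hM3, run_ring G _ _ rfl, hM2, run_ring G _ _ rfl, e71]
  -- the table before the elimination
  have tL : ∀ x < n * G.gamma, ∀ c < L, M4.ring 20 x 0 c =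
      pad G.z (x % G.gamma) * h₀ c (x / G.gamma) := by
    intro x hx c hc
    have hxn : x / G.gamma < n := Nat.div_lt_of_lt_mul (by rwa [mul_comm] at hx)
    have g := f1.1 x hx c hc
    simp only [add_zero] at g
    rw [f4.2 x 0 c (by omega), f3.2 x 0 c (by omega), f2.2 x 0 c (by omega), g, ← hh c hc _ hxn]
    have e3 : (M.at' x c).int 3 0 = lam := by
      rw [Memory.at_int _ _ _ (by decide) (by decide), h.int3]
    have e4 : (M.at' x c).int 4 0 = G.gamma := by
      rw [Memory.at_int _ _ _ (by decide) (by decide), h.int4]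
    have e0 : (M.at' x c).int 0 0 = n := by
      rw [Memory.at_int _ _ _ (by decide) (by decide), h.int0]
    simp only [RingExp.eval_mul, RingExp.eval_get, IntExp.eval_get, IntExp.eval_add,
      IntExp.eval_mul, IntExp.eval_div, IntExp.eval_mod, IntExp.eval_ofNat, Memory.at_ring,
      Memory.at_int_30, Memory.at_int_31, e0, e3, e4, h.ring4]
  have tR : ∀ x < n * G.gamma, ∀ j < n, M4.ring 20 x 0 (L + j) =
      pad G.z (x % G.gamma) * if x / G.gamma = j then 1 else 0 := by
    intro x hx j hj
    have g := f2.1 x hx j hj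
    simp only [add_zero] at g
    rw [f4.2 x 0 _ (by omega), f3.2 x 0 _ (by omega), add_comm L, g, RingExp.eval_mul,
      eval_delta G (fun d => by rw [Memory.at_ring, e71, h7])]
    have e4 : (M1.at' x j).int 4 0 = G.gamma := by
      rw [Memory.at_int _ _ _ (by decide) (by decide), i1.int4]
    simp only [RingExp.eval_get, IntExp.eval_get, IntExp.eval_div, IntExp.eval_mod,
      IntExp.eval_ofNat, Memory.at_ring, Memory.at_int_30, Memory.at_int_31, e4, i1.ring4]
  have tX : ∀ a < q, ∀ c < L, M4.ring 20 (n * G.gamma + a) 0 c = t a c := by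
    intro a ha c hc
    have g := f3.1 a ha c hc
    simp only [add_zero] at g
    rw [f4.2 _ 0 c (by omega), add_comm (n * _), g, ← ht a ha c hc]
    have e14 : M2.ring 14 = M.ring 14 := by
      rw [hM2, run_ring G _ _ rfl, hM1, run_ring G _ _ rfl]
    have e3 : (M2.at' a c).int 3 0 = lam := by
      rw [Memory.at_int _ _ _ (by decide) (by decide), i2.int3]
    simp only [RingExp.eval_get, IntExp.eval_get, IntExp.eval_add,
      IntExp.eval_mul, IntExp.eval_div, IntExp.eval_mod, IntExp.eval_ofNat, Memory.at_ring,
      Memory.at_int_30, Memory.at_int_31, e3, e14]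
  have t0 : ∀ a < q, ∀ j < n, M4.ring 20 (n * G.gamma + a) 0 (L + j) = 0 := by
    intro a ha j hj
    have g := f4.1 a ha j hj
    rw [add_comm L, add_comm (n * _), g]
    rfl
  have hred := run_baseEliminate G M4 (N₀ := ivar 0 * ivar 4) (N := ivar 0 * ivar 4 + ivar 11)
    (L := (ivar 0 - ivar 1) * ivar 3) (W := (ivar 0 - ivar 1) * ivar 3 + ivar 0)
    (n * G.gamma) (n * G.gamma + q) L (L + n)
    (fun s hs => by simp [hs, i4.int0, i4.int1, i4.int3, i4.int4, k4, hL])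
    (Nat.mul_pos hn G.gamma_pos) (Nat.le_add_right _ _) (Nat.le_add_right _ _)
    (fun d => by rw [e74, h7]) i4.int4 i4.ring5
  set P5 := baseEliminate (ivar 0 * ivar 4) (ivar 0 * ivar 4 + ivar 11) ((ivar 0 - ivar 1) * ivar 3)
      ((ivar 0 - ivar 1) * ivar 3 + ivar 0) with hP5
  set M5 := (P5.run G M4).1 with hM5
  have i5 := i4.run G P5 (by decide)
  rw [← hM5] at i5
  have k5 : M5.int 11 0 = q := by rw [hM5, run_int G _ _ rfl, k4]
  have f6 := run_search_of_safe G (M := M5) (n₁ := ivar 11) (n₂ := (ivar 0 - ivar 1) * ivar 3)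
    (e := RingExp.get 20 (ivar 30 + ivar 0 * ivar 4) 0 (ivar 31)) rfl k5
    (by simp [i5.int0, i5.int1, i5.int3, hL] : _ = L)
  have e6 : ∀ x y, (RingExp.get 20 (ivar 30 + ivar 0 * ivar 4) 0 (ivar 31)).eval G (M5.at' x y) =
      M5.ring 20 (n * G.gamma + x) 0 y := by
    intro x y
    have e4 : (M5.at' x y).int 4 0 = G.gamma := by
      rw [Memory.at_int _ _ _ (by decide) (by decide), i5.int4]
    have e0 : (M5.at' x y).int 0 0 = n := by
      rw [Memory.at_int _ _ _ (by decide) (by decide), i5.int0]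
    simp only [RingExp.eval_get, IntExp.eval_get, IntExp.eval_add, IntExp.eval_mul,
      IntExp.eval_ofNat, Memory.at_ring, Memory.at_int_30, Memory.at_int_31, e0, e4]
    rw [add_comm x]
  simp only [e6] at f6
  rw [run_ring G (search _ _ _) _ rfl]
  set M6 := ((search (ivar 11) ((ivar 0 - ivar 1) * ivar 3)
      (RingExp.get 20 (ivar 30 + ivar 0 * ivar 4) 0 (ivar 31))).run G M5).1
  have f6' : M6.int 33 0 = 0 ↔ ∀ x < q, ∀ y < L, M5.ring 20 (n * G.gamma + x) 0 y = 0 := by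
    rcases f6 with ⟨h0, hz⟩ | ⟨x, hx, y, hy, h0, h1⟩
    · exact ⟨fun _ => hz, fun _ => h0⟩
    · exact ⟨fun h => by omega, fun h => absurd (h x hx y hy) h0⟩
  have hsol := fun a (ha : a < q) => solvable_iff G tL tR hred (Nat.le_add_right (n * G.gamma) a)
    (by omega) (t0 a ha)
  refine ⟨?_, ?_, fun x hx c hc => sum_kernel_eq_zero G tL tR hred hx hc,
    fun K hK y hy => mem_of_kernel G tL tR hred K hK hy⟩
  · rw [f6']
    refine forall_congr' fun a => forall_congr' fun ha => ?_
    rw [← (hsol a ha).1]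
    refine exists_congr fun y => forall_congr' fun c => forall_congr' fun hc => ?_
    rw [tX a ha c hc]
  · intro h0 a ha c hc
    rw [(hsol a ha).2 (f6'.1 h0 a ha) c hc, tX a ha c hc]

end Prog
end Stage

/-! ### The choice of a solution -/

section Stage

variable {R : Type*} [CommRing R] [IsLocalRing R] (G : GaloisFrame R) {m : ℕ}
  {E : GaloisExtension R m} {n k lam : ℕ} {H : ℕ → ℕ → E.Ext} {f r : ℕ → E.Ext}

/-- The rows that a greedy choice has found: they come from the lists of candidates, and are
independent over the residue field. -/
def IsGreedyChoice (n N a : ℕ) (cand : ℕ → ℕ → ℕ → R) (Y : ℕ → ℕ → R) : Prop :=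
  ResiduallyIndependent n a Y ∧ ∀ b < a, ∃ c < N, ∀ j < n, Y b j = cand b c j

/-- A greedy choice cannot be continued: all candidates for the next row are combinations of the
rows that have been chosen, over the residue field. -/
def IsGreedyFailure (n N a : ℕ) (cand : ℕ → ℕ → ℕ → R) (Y : ℕ → ℕ → R) : Prop :=
  (∀ b < a, ∃ c < N, ∀ j < n, Y b j = cand b c j) ∧
    ∀ c < N, ∃ g : Fin a → R, ∀ j < n,
      cand a c j - ∑ b, g b * Y b j ∈ IsLocalRing.maximalIdeal R

namespace Prog

/-- Either a row is added to the greedy choice, or the flag `13` is set because there is none. -/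
theorem run_chooseRow {M : Memory R} {q N a : ℕ} (h0 : M.int 0 0 = n)
    (hN : n * M.int 4 0 + 1 = N) (h11 : M.int 11 0 = q) (h12 : M.int 12 0 = a) (ha : a < q)
    (h7 : ∀ d, M.ring 7 d 0 0 = if d = 0 then 1 else 0) {cand : ℕ → ℕ → ℕ → R}
    (hc : ∀ c < N, ∀ j < n, M.ring 17 a 0 j + M.ring 16 c 0 j = cand a c j)
    (hY : IsGreedyChoice n N a cand fun b j => M.ring 18 b 0 j)
    (hY0 : ∀ b, a ≤ b → ∀ j, M.ring 18 b 0 j = 0)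
    {M' : Memory R} (hM' : M' = (chooseRow.run G M).1) :
    (M'.int 13 = M.int 13 ∧ IsGreedyChoice n N (a + 1) cand (fun b j => M'.ring 18 b 0 j) ∧
      ∀ b, a + 1 ≤ b → ∀ j, M'.ring 18 b 0 j = 0) ∨
    (M'.int 13 0 ≠ 0 ∧ IsGreedyFailure n N a cand fun b j => M.ring 18 b 0 j) := by
  subst hM'
  rw [chooseRow, run_seq_fst, run_seq_fst, run_seq_fst, run_seq_fst]
  set P1 := fill 20 0 0 0 (ivar 11) (ivar 0) (RingExp.get 18 (ivar 30) 0 (ivar 31)) with hP1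
  set M1 := (P1.run G M).1 with hM1
  have i1 : ∀ v < 20, M1.int v = M.int v := fun v hv =>
    run_int G _ _ (by simp [P1, fill, writesInt]; omega)
  have j1 : ∀ b < 20, M1.ring b = M.ring b := fun v hv =>
    run_ring G _ _ (by simp [P1, fill, writesRing]; omega)
  have f1 := run_fill_of_safe G (M := M) (a := 20) (I := 0) (J := 0) (O := 0) (n₁ := ivar 11)
    (n₂ := ivar 0) (e := RingExp.get 18 (ivar 30) 0 (ivar 31)) rfl (rfl : _ = 0) (rfl : _ = 0)
    (rfl : _ = 0) h11 h0
  rw [← hP1, ← hM1] at f1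
  set P2 := fill 20 (ivar 11) 0 0 (ivar 0 * ivar 4 + 1) (ivar 0)
      (RingExp.get 17 (ivar 12) 0 (ivar 31) + RingExp.get 16 (ivar 30) 0 (ivar 31)) with hP2
  set M2 := (P2.run G M1).1 with hM2
  have i2 : ∀ v < 20, M2.int v = M.int v := fun v hv => by
    rw [hM2, run_int G _ _ (by simp [P2, fill, writesInt]; omega), i1 v hv]
  have j2 : ∀ b < 20, M2.ring b = M.ring b := fun v hv => by
    rw [hM2, run_ring G _ _ (by simp [P2, fill, writesRing]; omega), j1 v hv]
  have f2 := run_fill_of_safe G (M := M1) (a := 20) (I := ivar 11) (J := 0) (O := 0)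
    (n₁ := ivar 0 * ivar 4 + 1) (n₂ := ivar 0)
    (e := RingExp.get 17 (ivar 12) 0 (ivar 31) + RingExp.get 16 (ivar 30) 0 (ivar 31)) rfl
    (by simp [i1, h11] : _ = q) (rfl : _ = 0) (rfl : _ = 0) (by simp [i1, h0, hN] : _ = N)
    (by simp [i1, h0] : _ = n)
  rw [← hP2, ← hM2] at f2
  set P3 := eliminate (ivar 11) (ivar 11 + (ivar 0 * ivar 4 + 1)) (ivar 0) (ivar 0) with hP3
  set M3 := (P3.run G M2).1 with hM3
  have i3 : ∀ v < 20, M3.int v = M.int v := fun v hv => by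
    rw [hM3, run_int G _ _ (by simp [P3, eliminate, rankOne, search, fill, writesInt]; omega),
      i2 v hv]
  have j3 : ∀ b < 20, M3.ring b = M.ring b := fun v hv => by
    rw [hM3, run_ring G _ _ (by simp [P3, eliminate, rankOne, search, fill, writesRing]; omega),
      j2 v hv]
  have h3 := run_eliminate G M2 (N₀ := ivar 11) (N := ivar 11 + (ivar 0 * ivar 4 + 1)) (L := ivar 0)
    (W := ivar 0) q (q + N) n n (fun s hs => by
      simp [hs, i2, h0, h11, hN]) (Nat.le_add_right _ _) le_rfl
    (fun d => by rw [j2 7 (by decide), h7])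
  rw [← hP3, ← hM3] at h3
  have tY : ∀ b < q, ∀ j < n, M2.ring 20 b 0 j = M.ring 18 b 0 j := by
    intro b hb j hj
    have g := f1.1 b hb j hj
    simp only [add_zero] at g
    rw [f2.2 b 0 j (by omega), g]
    simp
  have tC : ∀ c < N, ∀ j < n, M2.ring 20 (q + c) 0 j = cand a c j := by
    intro c hcN j hj
    have g := f2.1 c hcN j hj
    simp only [add_zero] at g
    rw [add_comm q, g, ← hc c hcN j hj]
    have e12 : (M1.at' c j).int 12 0 = a := by
      rw [Memory.at_int _ _ _ (by decide) (by decide), i1 12 (by decide), h12]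
    simp only [RingExp.eval_get, RingExp.eval_add, IntExp.eval_get,
      IntExp.eval_ofNat, Memory.at_ring, Memory.at_int_30, Memory.at_int_31, e12,
      j1 16 (by decide), j1 17 (by decide)]
  have f4 := run_search_of_safe G (M := M3) (n₁ := ivar 0 * ivar 4 + 1) (n₂ := ivar 0)
    (e := RingExp.inv (RingExp.get 20 (ivar 30 + ivar 11) 0 (ivar 31))) rfl
    (by simp [i3, h0, hN] : _ = N) (by simp [i3, h0] : _ = n)
  have e4 : ∀ x y, (RingExp.inv (RingExp.get 20 (ivar 30 + ivar 11) 0 (ivar 31))).eval G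
      (M3.at' x y) = Ring.inverse (M3.ring 20 (q + x) 0 y) := by
    intro x y
    have e11 : (M3.at' x y).int 11 0 = q := by
      rw [Memory.at_int _ _ _ (by decide) (by decide), i3 11 (by decide), h11]
    simp only [RingExp.eval_inv, RingExp.eval_get, IntExp.eval_get, IntExp.eval_add,
      IntExp.eval_ofNat, Memory.at_ring, Memory.at_int_30, Memory.at_int_31, e11]
    rw [add_comm x]
  simp only [e4, ringInverse_ne_zero_iff] at f4
  set P4 := search (ivar 0 * ivar 4 + 1) (ivar 0)
      (RingExp.inv (RingExp.get 20 (ivar 30 + ivar 11) 0 (ivar 31))) with hP4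
  set M4 := (P4.run G M3).1 with hM4
  have i4 : ∀ v < 20, M4.int v = M.int v := fun v hv => by
    rw [hM4, run_int G _ _ (by simp [P4, search, writesInt]; omega), i3 v hv]
  have j4 : ∀ b < 20, M4.ring b = M.ring b := fun v hv => by
    rw [hM4, run_ring G _ _ (by simp [P4, search, writesRing]), j3 v hv]
  rcases f4 with ⟨h33, hz⟩ | ⟨x, hx, y, hy, hu, h33⟩
  · have hb : (ivar 33).eval M4.int ≤ IntExp.eval M4.int 0 := by simp [h33]
    rw [run_branch_pos G hb]
    refine Or.inr ⟨by simp [run_setInt], hY.2, fun c hcN => ?_⟩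
    obtain ⟨g, hg⟩ := h3.exists_sub_mem (a := a) (Y := fun b j => M.ring 18 b 0 j) ha.le
      (fun b hb j hj => tY b (by omega) j hj)
      (fun b hb hbq j hj => (tY b hbq j hj).trans (hY0 b hb j)) (Nat.le_add_right q c) (by omega)
      (fun j hj hu => ringInverse_ne_zero_iff.2 hu (hz c hcN j hj))
    exact ⟨g, fun j hj => by rw [← tC c hcN j hj]; exact hg j hj⟩
  · have hb : ¬ (ivar 33).eval M4.int ≤ IntExp.eval M4.int 0 := by simp [h33]
    rw [run_branch_neg G hb]
    have f5 := run_fill_of_safe G (M := M4) (a := 18) (I := ivar 12) (J := 0) (O := 0) (n₁ := 1)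
      (n₂ := ivar 0)
      (e := RingExp.get 17 (ivar 12) 0 (ivar 31) + RingExp.get 16 (ivar 33 - 1) 0 (ivar 31)) rfl
      (by simp [i4, h12] : _ = a) (rfl : _ = 0) (rfl : _ = 0) (rfl : _ = 1)
      (by simp [i4, h0] : _ = n)
    set M5 := ((fill 18 (ivar 12) 0 0 1 (ivar 0)
        (RingExp.get 17 (ivar 12) 0 (ivar 31) + RingExp.get 16 (ivar 33 - 1) 0 (ivar 31))).run G
          M4).1 with hM5
    have n1 : ∀ b j, b ≠ a → M5.ring 18 b 0 j = M.ring 18 b 0 j := fun b j hb => by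
      rw [f5.2 b 0 j (by omega), j4 18 (by decide)]
    have n2 : ∀ j < n, M5.ring 18 a 0 j = cand a x j := by
      intro j hj
      have g := f5.1 0 zero_lt_one j hj
      simp only [add_zero, zero_add] at g
      rw [g, ← hc x hx j hj]
      have e12 : (M4.at' 0 j).int 12 0 = a := by
        rw [Memory.at_int _ _ _ (by decide) (by decide), i4 12 (by decide), h12]
      have e33 : (M4.at' 0 j).int 33 0 = x + 1 := by
        rw [Memory.at_int _ _ _ (by decide) (by decide), h33]
      simp only [RingExp.eval_get, RingExp.eval_add, IntExp.eval_get, IntExp.eval_sub,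
        IntExp.eval_ofNat, Memory.at_ring, Memory.at_int_31, e12, e33,
        j4 16 (by decide), j4 17 (by decide), Nat.add_sub_cancel]
    have hI : ResiduallyIndependent n a fun b j => M5.ring 18 b 0 j := by
      intro d hd
      refine hY.1 d fun j hj => ?_
      have e : ∑ b : Fin a, d b * M.ring 18 b 0 j = ∑ b : Fin a, d b * M5.ring 18 b 0 j :=
        Finset.sum_congr rfl fun b _ => by rw [n1 b j (by omega)]
      change ∑ b : Fin a, d b * M.ring 18 b 0 j ∈ _
      rw [e]
      exact hd j hj
    refine Or.inl ⟨?_, ⟨?_, ?_⟩, fun b hb j => (n1 b j (by omega)).trans (hY0 b (by omega) j)⟩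
    · rw [run_int G _ _ rfl, i4 13 (by decide)]
    · refine ResiduallyIndependent.succ h3 ha.le
        (fun b hb j hj => (tY b (by omega) j hj).trans (n1 b j (by omega)).symm) hI
        (Nat.le_add_right q x) (by omega) (fun j hj => ?_) hy hu (Nat.le_add_right _ _)
      exact (tC x hx j hj).trans (n2 j hj).symm
    · intro b hb
      rcases Nat.lt_succ_iff_lt_or_eq.1 hb with hb | rfl
      · obtain ⟨c, hcN, e⟩ := hY.2 b hb
        exact ⟨c, hcN, fun j hj => (n1 b j (by omega)).trans (e j hj)⟩
      · exact ⟨x, hx, n2⟩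

/-- The candidates for a row are a particular solution, and its sums with one of the generators of
the homogeneous solutions; the flag `13` tells whether the greedy choice has failed at some row. -/
theorem run_chooseSolution {M : Memory R} (h : IsInput G E n k lam H f r M) {q L : ℕ}
    (hL : (n - k) * lam = L) (h11 : M.int 11 0 = q) (h13 : M.int 13 0 = 0)
    (h7 : ∀ d, M.ring 7 d 0 0 = if d = 0 then 1 else 0) (h16 : M.ring 16 = 0) (h18 : M.ring 18 = 0)
    {cand : ℕ → ℕ → ℕ → R}
    (hcand : ∀ a < q, ∀ c < n * G.gamma + 1, ∀ j < n, cand a c j =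
      -M.ring 20 (n * G.gamma + a) 0 (L + j) +
        if c < n * G.gamma then M.ring 20 c 0 (L + j) else 0)
    {M' : Memory R} (hM' : M' = (chooseSolution.run G M).1) :
    (M'.int 13 0 = 0 ∧
      IsGreedyChoice n (n * G.gamma + 1) q cand fun b j => M'.ring 18 b 0 j) ∨
    (M'.int 13 0 ≠ 0 ∧ ∃ a < q, ∃ Y, IsGreedyFailure n (n * G.gamma + 1) a cand Y) := by
  subst hM'
  rw [chooseSolution, run_seq_fst, run_seq_fst]
  set P1 := fill 16 0 0 0 (ivar 0 * ivar 4) (ivar 0)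
      (RingExp.get 20 (ivar 30) 0 (ivar 31 + (ivar 0 - ivar 1) * ivar 3)) with hP1
  set M1 := (P1.run G M).1 with hM1
  have i1 := h.run G P1 (by decide)
  rw [← hM1] at i1
  have f1 := run_fill_of_safe G (M := M) (a := 16) (I := 0) (J := 0) (O := 0)
    (n₁ := ivar 0 * ivar 4) (n₂ := ivar 0)
    (e := RingExp.get 20 (ivar 30) 0 (ivar 31 + (ivar 0 - ivar 1) * ivar 3)) rfl
    (rfl : _ = 0) (rfl : _ = 0) (rfl : _ = 0) (by simp [h.int0, h.int4] : _ = n * G.gamma) h.int0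
  rw [← hP1, ← hM1] at f1
  set P2 := fill 17 0 0 0 (ivar 11) (ivar 0)
      (0 - RingExp.get 20 (ivar 30 + ivar 0 * ivar 4) 0 (ivar 31 + (ivar 0 - ivar 1) * ivar 3))
    with hP2
  set M2 := (P2.run G M1).1 with hM2
  have i2 := i1.run G P2 (by decide)
  rw [← hM2] at i2
  have k1 : M1.int 11 0 = q := by rw [hM1, run_int G _ _ rfl, h11]
  have f2 := run_fill_of_safe G (M := M1) (a := 17) (I := 0) (J := 0) (O := 0)
    (n₁ := ivar 11) (n₂ := ivar 0)
    (e := 0 - RingExp.get 20 (ivar 30 + ivar 0 * ivar 4) 0 (ivar 31 + (ivar 0 - ivar 1) * ivar 3))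
    rfl (rfl : _ = 0) (rfl : _ = 0) (rfl : _ = 0) k1 i1.int0
  rw [← hP2, ← hM2] at f2
  have e0 : ∀ M₀ : Memory R, IsInput G E n k lam H f r M₀ → ∀ x y,
      (M₀.at' x y).int 0 0 = n ∧ (M₀.at' x y).int 1 0 = k ∧ (M₀.at' x y).int 3 0 = lam ∧
        (M₀.at' x y).int 4 0 = G.gamma := fun M₀ h₀ x y => by
    rw [Memory.at_int _ _ _ (by decide) (by decide), Memory.at_int _ _ _ (by decide) (by decide),
      Memory.at_int _ _ _ (by decide) (by decide), Memory.at_int _ _ _ (by decide) (by decide)]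
    exact ⟨h₀.int0, h₀.int1, h₀.int3, h₀.int4⟩
  have hc : ∀ a < q, ∀ c < n * G.gamma + 1, ∀ j < n,
      M2.ring 17 a 0 j + M2.ring 16 c 0 j = cand a c j := by
    intro a ha c hcN j hj
    have g2 := f2.1 a ha j hj
    simp only [add_zero] at g2
    have e16 : M2.ring 16 = M1.ring 16 := run_ring G _ _ rfl
    have e20 : M1.ring 20 = M.ring 20 := run_ring G _ _ rfl
    rw [hcand a ha c hcN j hj, g2, e16]
    congr 1
    · simp only [RingExp.eval_get, RingExp.eval_sub, RingExp.eval_zero, IntExp.eval_get,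
        IntExp.eval_add, IntExp.eval_sub, IntExp.eval_mul, IntExp.eval_ofNat, Memory.at_ring,
        Memory.at_int_30, Memory.at_int_31, e0 M1 i1, e20, hL, zero_sub]
      rw [add_comm a, add_comm j]
    · split
      · have g1 := f1.1 c ‹_› j hj
        simp only [add_zero] at g1
        rw [g1]
        simp only [RingExp.eval_get, IntExp.eval_get,
          IntExp.eval_add, IntExp.eval_sub, IntExp.eval_mul, IntExp.eval_ofNat, Memory.at_ring,
          Memory.at_int_30, Memory.at_int_31, e0 M h, hL]
        rw [add_comm j]
      · rw [f1.2 c 0 j (by omega), h16]; rfl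
  have fin := run_loop_invariant G (M := M2) (x := 12) (e := ivar 11) (P := chooseRow)
    (fun a M' => (∀ v < 12, M'.int v = M2.int v) ∧
      (∀ b < 18, M'.ring b = M2.ring b) ∧
      ((M'.int 13 0 = 0 ∧
        IsGreedyChoice n (n * G.gamma + 1) a cand (fun b j => M'.ring 18 b 0 j) ∧
        ∀ b, a ≤ b → ∀ j, M'.ring 18 b 0 j = 0) ∨
      (M'.int 13 0 ≠ 0 ∧ ∃ a < q, ∃ Y, IsGreedyFailure n (n * G.gamma + 1) a cand Y)))
    q ?_ ?_ ?_
  · exact fin.2.2.imp_left fun g => ⟨g.1, g.2.1⟩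
  · rw [IntExp.eval_get, hM2, run_int G _ _ rfl]; exact k1
  · refine ⟨fun _ _ => rfl, fun _ _ => rfl, Or.inl ⟨?_, ⟨fun d _ b => b.elim0,
      fun b hb => by omega⟩,
      fun b _ j => ?_⟩⟩
    · rw [hM2, run_int G _ _ rfl, hM1, run_int G _ _ rfl, h13]
    · rw [hM2, run_ring G _ _ rfl, hM1, run_ring G _ _ rfl, h18]; rfl
  · rintro a ha M3 ⟨h1, h2, h3⟩
    have ii : ∀ v < 12, ((chooseRow.run G (M3.setInt 12 0 a)).1).int v = M2.int v := by
      intro v hv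
      rw [run_int G _ _ (by
        simp [chooseRow, eliminate, rankOne, search, fill, writesInt]; omega),
        Memory.setInt_int_ne _ (by omega), h1 v hv]
    have jj : ∀ b < 18, ((chooseRow.run G (M3.setInt 12 0 a)).1).ring b = M2.ring b := by
      intro b hb
      rw [run_ring G _ _ (by
        simp [chooseRow, eliminate, rankOne, search, fill, writesRing]; omega),
        Memory.setInt_ring, h2 b hb]
    refine ⟨ii, jj, ?_⟩
    rcases h3 with ⟨g1, g2, g3⟩ | ⟨g1, g2⟩
    · have s := run_chooseRow G (M := M3.setInt 12 0 a) (n := n) (q := q) (N := n * G.gamma + 1)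
        (a := a) (cand := cand)
        (by rw [Memory.setInt_int_ne _ (by decide), h1 0 (by decide), i2.int0])
        (by rw [Memory.setInt_int_ne _ (by decide), h1 4 (by decide), i2.int4])
        (by rw [Memory.setInt_int_ne _ (by decide), h1 11 (by decide), hM2, run_int G _ _ rfl, k1])
        (by simp) ha
        (fun d => by
          rw [Memory.setInt_ring, h2 7 (by decide), hM2, run_ring G _ _ rfl, hM1,
            run_ring G _ _ rfl, h7])
        (fun c hcN j hj => by
          rw [Memory.setInt_ring, h2 16 (by decide), h2 17 (by decide)]; exact hc a ha c hcN j hj)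
        g2 g3 rfl
      rcases s with ⟨s1, s2, s3⟩ | ⟨s1, s2⟩
      · refine Or.inl ⟨?_, s2, s3⟩
        rw [s1, Memory.setInt_int_ne _ (by decide), g1]
      · exact Or.inr ⟨s1, a, ha, _, s2⟩
    · refine Or.inr ⟨?_, g2⟩
      have e13 : ∀ M₀ : Memory R, M₀.int 13 0 ≠ 0 → (chooseRow.run G M₀).1.int 13 0 ≠ 0 := by
        intro M₀ hM₀
        rw [chooseRow, run_seq_fst, run_seq_fst, run_seq_fst, run_seq_fst]
        simp only [run]
        split
        · simp
        · rw [run_int G (fill 18 _ _ _ _ _ _) _ rfl, run_int G (search _ _ _) _ rfl,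
            run_int G (eliminate _ _ _ _) _ rfl, run_int G (fill 20 _ _ _ _ _ _) _ rfl,
            run_int G (fill 20 _ _ _ _ _ _) _ rfl]
          exact hM₀
      exact e13 _ (by rw [Memory.setInt_int_ne _ (by decide)]; exact g1)

theorem run_output {M : Memory R} (h : IsInput G E n k lam H f r M) {q : ℕ}
    (h11 : M.int 11 0 = q) {ε : ℕ → E.Ext}
    (h12 : ∀ a < q, ∀ c < m, M.ring 12 a 0 c = E.coord (ε a) c)
    {M' : Memory R} (hM' : M' = (output.run G M).1) :
    M'.int 5 0 = 1 ∧ ∀ i < n, (E.ofCoord fun c => M'.ring 6 i 0 c) =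
      r i - ∑ a : Fin q, M.ring 18 a 0 i • ε a := by
  subst hM'
  rw [output, run_seq_fst, run_seq_fst]
  set P1 := fill 6 0 0 0 (ivar 0) (ivar 2) (RingExp.get 3 (ivar 30) 0 (ivar 31)) with hP1
  set M1 := (P1.run G M).1 with hM1
  have i1 := h.run G P1 (by decide)
  rw [← hM1] at i1
  have f1 := run_fill_of_safe G (M := M) (a := 6) (I := 0) (J := 0) (O := 0)
    (n₁ := ivar 0) (n₂ := ivar 2) (e := RingExp.get 3 (ivar 30) 0 (ivar 31)) rfl
    (rfl : _ = 0) (rfl : _ = 0) (rfl : _ = 0) h.int0 h.int2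
  rw [← hP1, ← hM1] at f1
  refine ⟨by simp [run_setInt], fun i hi => ?_⟩
  apply E.coordEquiv.injective
  funext c
  have k1 : M1.int 11 0 = q := by rw [hM1, run_int G _ _ rfl, h11]
  have f2 := run_accumulate_of_safe G (M := M1) (a := 6) (N := ivar 11) (n₁ := ivar 0)
    (n₂ := ivar 2)
    (e := 0 - RingExp.get 18 (ivar 12) 0 (ivar 30) * RingExp.get 12 (ivar 12) 0 (ivar 31)) rfl
    k1 i1.int0 i1.int2 hi c.2
  rw [E.coordEquiv_apply, E.coordEquiv_apply, E.coord_ofCoord _ c.2,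
    run_ring G (setInt _ _ _) _ rfl, f2, E.coord_sub, E.coord_sum_smul, sub_eq_add_neg,
    ← Finset.sum_neg_distrib, Finset.sum_range]
  congr 1
  · have g := f1.1 i hi c c.2
    simp only [add_zero] at g
    rw [g]
    simp [h.ring3]
  · refine Finset.sum_congr rfl fun a _ => ?_
    have e12 : M1.ring 12 = M.ring 12 := run_ring G _ _ rfl
    have e18 : M1.ring 18 = M.ring 18 := run_ring G _ _ rfl
    simp only [RingExp.eval_get, RingExp.eval_sub, RingExp.eval_mul, RingExp.eval_zero,
      IntExp.eval_get, IntExp.eval_ofNat, Memory.at3_ring, Memory.at3_int_12, Memory.at3_int_30,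
      Memory.at3_int_31, e12, e18, h12 a a.2 c c.2, zero_sub]

end Prog
end Stage

/-! ### Errors with given support -/

/-- The conditions under which the decoder returns `r - e`. -/
structure IsDecodingError (R : Type*) {S : Type*} [CommRing R] [CommRing S] [Algebra R S]
    {l n lam : ℕ} (H : Matrix (Fin l) (Fin n) S) (f : Fin lam → S) (r e : Fin n → S) : Prop where
  free_syn : Module.Free R (supp R (H.mulVec r))
  dvd : lam ∣ freeRank R (supp R (H.mulVec r))
  free_supp : Module.Free R (⨅ i, invMul (f i) (supp R (H.mulVec r)) : Submodule R S)
  rank_supp : freeRank R (⨅ i, invMul (f i) (supp R (H.mulVec r)) : Submodule R S) =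
    freeRank R (supp R (H.mulVec r)) / lam
  rank_mul : freeRank R ((⨅ i, invMul (f i) (supp R (H.mulVec r))) * entrySpan R H :
    Submodule R S) = freeRank R (supp R (H.mulVec r))
  supp_eq : supp R e = ⨅ i, invMul (f i) (supp R (H.mulVec r))
  mulVec_eq : H.mulVec e = H.mulVec r

section Decoder

variable {R S : Type*} [CommRing R] [CommRing S] [Algebra R S] {l n lam : ℕ}
  {H : Matrix (Fin l) (Fin n) S} {f : Fin lam → S} {r : Fin n → S}

theorem supp_zero (ι : Type*) : supp R (0 : ι → S) = ⊥ := by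
  rw [supp, Submodule.span_eq_bot]
  rintro _ ⟨i, rfl⟩
  rfl

theorem iInf_invMul_bot (hlam : 0 < lam) (hf : ∀ i, IsUnit (f i)) :
    (⨅ i, invMul (f i) (⊥ : Submodule R S)) = ⊥ := by
  rw [eq_bot_iff]
  intro x hx
  have := (mem_invMul_iff (hf ⟨0, hlam⟩) _ x).1 ((Submodule.mem_iInf _).1 hx _)
  rw [Submodule.mem_bot] at this
  exact (hf ⟨0, hlam⟩).mul_right_eq_zero.1 this

theorem IsDecodingError.some_mem (hlam : 0 < lam) (hf : ∀ i, IsUnit (f i)) {e : Fin n → S}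
    (h : IsDecodingError R H f r e) : some (r - e) ∈ localDecoder R H f r := by
  unfold localDecoder
  by_cases hs : H.mulVec r = 0
  · -- the support of the error is the zero module, so that the decoder may return `r - e = r`
    have he : e = 0 := by
      have h1 := h.supp_eq
      rw [hs, supp_zero, iInf_invMul_bot hlam hf, supp, Submodule.span_eq_bot] at h1
      exact funext fun i => h1 _ ⟨i, rfl⟩
    simp only [hs, if_true, he, sub_zero]
    exact rfl
  · have hfree := h.free_syn
    have hfree' := h.free_supp
    simp only [hs, if_false]
    rw [if_neg (not_not.2 h.free_syn), if_neg (not_not.2 h.dvd), if_neg (not_not.2 h.free_supp),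
      if_neg (not_or.2 ⟨not_not.2 h.rank_supp, not_not.2 h.rank_mul⟩),
      if_pos ⟨e, h.supp_eq, h.mulVec_eq⟩]
    exact ⟨e, h.supp_eq, h.mulVec_eq, rfl⟩

/-- If there is no error to be subtracted, then the decoder may fail. This includes that the
syndrome is not zero: otherwise the zero vector would be such an error. -/
theorem none_mem_of_forall_not_isDecodingError [IsLocalRing R] [Finite R] [Finite S]
    (hlam : 0 < lam)
    (hf : ∀ i, IsUnit (f i)) (h : ∀ e, ¬ IsDecodingError R H f r e) :
    none ∈ localDecoder R H f r := by
  unfold localDecoder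
  by_cases hs : H.mulVec r = 0
  · exfalso
    have hE := iInf_invMul_bot (R := R) hlam hf
    have h0 : freeRank R (⊥ : Submodule R S) = 0 := by
      rw [freeRank_eq_finrank, finrank_bot]
    refine h 0 ⟨?_, ?_, ?_, ?_, ?_, ?_, ?_⟩
    all_goals try rw [hs, supp_zero]
    all_goals try rw [hE]
    · infer_instance
    · rw [h0]; exact dvd_zero _
    · infer_instance
    · rw [h0, Nat.zero_div]
    · rw [Submodule.bot_mul]
    · rw [supp_zero, hE]
    · rw [hs, Matrix.mulVec_zero]
  · simp only [hs, if_false]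
    by_contra hno
    apply hno
    split
    · rfl
    split
    · rfl
    split
    · rfl
    split
    · rfl
    split
    · rename_i h1 h2 h3 h4 h5
      obtain ⟨e, he1, he2⟩ := h5
      rw [not_or, not_not, not_not] at h4
      exact (h e ⟨not_not.1 h1, not_not.1 h2, not_not.1 h3, h4.1, h4.2, he1, he2⟩).elim
    · rfl

end Decoder

section Products

variable {R S : Type*} [CommRing R] [CommRing S] [Algebra R S] {q lam : ℕ} {ε f : ℕ → S}

theorem span_mul_span_range (hlam : 0 < lam) :
    Submodule.span R (Set.range fun a : Fin q => ε a) *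
      Submodule.span R (Set.range fun b : Fin lam => f b) =
    Submodule.span R (Set.range fun v : Fin (q * lam) => ε (v / lam) * f (v % lam)) := by
  rw [Submodule.span_mul_span]
  congr 1
  ext x
  rw [Set.mem_mul]
  constructor
  · rintro ⟨_, ⟨a, rfl⟩, _, ⟨b, rfl⟩, rfl⟩
    have h : a * lam + b < q * lam := by
      have : (a + 1) * lam ≤ q * lam := Nat.mul_le_mul_right _ a.2
      have := b.2
      linarith
    refine ⟨⟨a * lam + b, h⟩, ?_⟩
    simp only
    rw [mul_comm (a : ℕ), Nat.mul_add_div hlam, Nat.div_eq_of_lt b.2, add_zero, Nat.mul_add_mod,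
      Nat.mod_eq_of_lt b.2]
  · rintro ⟨v, rfl⟩
    exact ⟨_, ⟨⟨v / lam, Nat.div_lt_of_lt_mul (v.2.trans_eq (mul_comm _ _))⟩, rfl⟩, _,
      ⟨⟨v % lam, Nat.mod_lt _ hlam⟩, rfl⟩, rfl⟩

/-- Free modules of the same rank are equal if one of them contains the other. -/
theorem eq_of_le_of_finrank_eq [IsLocalRing R] [Finite S] [Finite R] {N N' : Submodule R S}
    [Module.Free R N] [Module.Free R N'] (hle : N ≤ N')
    (h : Module.finrank R N = Module.finrank R N') : N = N' := by
  have h1 : Nat.card N = Nat.card N' := by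
    rw [card_eq_pow_finrank' (R := R) (M := N), card_eq_pow_finrank' (R := R) (M := N'), h]
  refine SetLike.coe_injective (Set.eq_of_subset_of_ncard_le hle ?_ (Set.toFinite _))
  rw [← Nat.card_coe_set_eq, ← Nat.card_coe_set_eq]
  exact h1.ge

variable {n l : ℕ} {H : ℕ → ℕ → S} {s : ℕ → S} {C D Y : ℕ → ℕ → R}

/-- The equation of the error, in coordinates. -/
theorem sum_mul_eq_iff (hlam : 0 < lam)
    (hx : LinearIndependent R fun v : Fin (q * lam) => ε (v / lam) * f (v % lam))
    (hH : ∀ i < l, ∀ j < n, H i j = -∑ b : Fin lam, C (i * n + j) b • f b)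
    (hs : ∀ i < l, s i = -∑ v : Fin (q * lam), D i v • (ε (v / lam) * f (v % lam))) :
    (∀ i < l, ∑ j : Fin n, H i j * ∑ a : Fin q, Y a j • ε a = s i) ↔
      ∀ a < q, ∀ c < l * lam, ∑ j : Fin n, C (c / lam * n + j) (c % lam) * Y a j =
        D (c / lam) (a * lam + c % lam) := by
  have h1 : ∀ i < l, ∑ j : Fin n, H i j * ∑ a : Fin q, Y a j • ε a =
      -∑ v : Fin (q * lam), (∑ j : Fin n, C (i * n + j) (v % lam) * Y (v / lam) j) •
        (ε (v / lam) * f (v % lam)) := by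
    intro i hi
    rw [← Finset.sum_range fun v => (∑ j : Fin n, C (i * n + j) (v % lam) * Y (v / lam) j) •
        (ε (v / lam) * f (v % lam)),
      Prog.sum_range_mul (fun a b => (∑ j : Fin n, C (i * n + j) b * Y a j) • (ε a * f b)) q lam
        hlam,
      Finset.sum_range, ← Finset.sum_neg_distrib]
    simp only [Finset.mul_sum]
    rw [Finset.sum_comm]
    refine Finset.sum_congr rfl fun a _ => ?_
    rw [Finset.sum_range]
    simp only [Finset.sum_smul]
    rw [Finset.sum_comm, ← Finset.sum_neg_distrib]
    refine Finset.sum_congr rfl fun j _ => ?_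
    rw [hH i hi j j.2, neg_mul, Finset.sum_mul]
    refine congrArg Neg.neg (Finset.sum_congr rfl fun b _ => ?_)
    simp only [Algebra.smul_def, map_mul]
    ring
  have h2 : (∀ i < l, ∑ j : Fin n, H i j * ∑ a : Fin q, Y a j • ε a = s i) ↔
      ∀ i < l, ∀ v : Fin (q * lam),
        ∑ j : Fin n, C (i * n + j) (v % lam) * Y (v / lam) j = D i v := by
    refine forall_congr' fun i => forall_congr' fun hi => ?_
    rw [h1 i hi, hs i hi, neg_inj]
    constructor
    · intro h v
      have h3 : ∑ v : Fin (q * lam), ((∑ j : Fin n, C (i * n + j) (v % lam) * Y (v / lam) j) -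
          D i v) • (ε (v / lam) * f (v % lam)) = 0 := by
        simp only [sub_smul, Finset.sum_sub_distrib, h, sub_self]
      exact sub_eq_zero.1 (Fintype.linearIndependent_iff.1 hx _ h3 v)
    · intro h
      exact Finset.sum_congr rfl fun v _ => by rw [h v]
  rw [h2]
  constructor
  · intro h a ha c hc
    have hb := Nat.mod_lt c hlam
    have hv : a * lam + c % lam < q * lam := by
      have : (a + 1) * lam ≤ q * lam := Nat.mul_le_mul_right _ ha
      linarith
    have h3 := h (c / lam) (Nat.div_lt_of_lt_mul (by rwa [mul_comm] at hc)) ⟨_, hv⟩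
    simp only at h3
    rwa [mul_comm a, Nat.mul_add_div hlam, Nat.div_eq_of_lt hb, add_zero, Nat.mul_add_mod,
      Nat.mod_mod, mul_comm lam] at h3
  · intro h i hi v
    have hb := Nat.mod_lt v hlam
    have hc : i * lam + v % lam < l * lam := by
      have : (i + 1) * lam ≤ l * lam := Nat.mul_le_mul_right _ hi
      linarith
    have h3 := h (v / lam) (Nat.div_lt_of_lt_mul (v.2.trans_eq (mul_comm _ _))) _ hc
    have h4 : (i * lam + v % lam) / lam = i := by
      rw [mul_comm, Nat.mul_add_div hlam, Nat.div_eq_of_lt hb, add_zero]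
    have h5 : (i * lam + v % lam) % lam = v % lam := by
      rw [mul_comm, Nat.mul_add_mod, Nat.mod_mod]
    rw [h4, h5, Nat.div_add_mod'] at h3
    exact h3

/-- The entries of a combination of an independent family generate the same module as the family if
and only if the rows of coefficients are independent over the residue field. -/
theorem supp_eq_iff [IsLocalRing R] (hε : LinearIndependent R fun a : Fin q => ε a) :
    supp R (fun j : Fin n => ∑ a : Fin q, Y a j • ε a) =
      Submodule.span R (Set.range fun a : Fin q => ε a) ↔ ResiduallyIndependent n q Y := by
  have hsum : ∀ d : Fin n → R, ∑ j, d j • ∑ a : Fin q, Y a j • ε a =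
      ∑ a : Fin q, (∑ j, d j * Y a j) • ε a := by
    intro d
    simp only [Finset.smul_sum, Finset.sum_smul, smul_smul]
    rw [Finset.sum_comm]
  constructor
  · intro h
    refine ResiduallyIndependent.of_dual fun a₀ => ?_
    have hmem : ε a₀ ∈ supp R (fun j : Fin n => ∑ a : Fin q, Y a j • ε a) := by
      rw [h]; exact Submodule.subset_span ⟨a₀, rfl⟩
    obtain ⟨d, hd⟩ := (Submodule.mem_span_range_iff_exists_fun _).1 hmem
    refine ⟨d, fun b => ?_⟩
    rw [hsum] at hd
    have h0 : ∑ a : Fin q, ((∑ j, d j * Y a j) - if a = a₀ then 1 else 0) • ε a = 0 := by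
      simp [sub_smul, Finset.sum_sub_distrib, hd]
    exact sub_eq_zero.1 (Fintype.linearIndependent_iff.1 hε _ h0 b)
  · intro h
    apply le_antisymm
    · refine Submodule.span_le.2 ?_
      rintro _ ⟨j, rfl⟩
      exact Submodule.sum_mem _ fun a _ => Submodule.smul_mem _ _ (Submodule.subset_span ⟨a, rfl⟩)
    · refine Submodule.span_le.2 ?_
      rintro _ ⟨a₀, rfl⟩
      obtain ⟨d, hd⟩ := h.exists_dual a₀
      have h1 := hsum d
      simp only [hd, ite_smul, one_smul, zero_smul, Finset.sum_ite_eq', Finset.mem_univ,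
        if_true] at h1
      change ε a₀ ∈ _
      rw [← h1]
      exact Submodule.sum_mem _ fun j _ => Submodule.smul_mem _ _ (Submodule.subset_span ⟨j, rfl⟩)

end Products

section Greedy

variable {R : Type*} [CommRing R] [IsLocalRing R] {n q : ℕ}

theorem ResiduallyIndependent.mono {a : ℕ} {Y : ℕ → ℕ → R} (h : ResiduallyIndependent n q Y)
    (ha : a ≤ q) : ResiduallyIndependent n a Y := by
  classical
  intro d hd b
  have h1 := h (fun b => if hb : (b : ℕ) < a then d ⟨b, hb⟩ else 0) (fun j hj => ?_)
    (Fin.castLE ha b)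
  · simpa using h1
  · convert hd j hj using 1
    rw [← Finset.sum_subset (Finset.subset_univ (Finset.univ.map (Fin.castLEEmb ha)))]
    · rw [Finset.sum_map]
      exact Finset.sum_congr rfl fun b _ => by simp
    · intro b _ hb
      have hab : ¬ (b : ℕ) < a := fun hlt =>
        hb (Finset.mem_map.2 ⟨⟨b, hlt⟩, Finset.mem_univ _, Fin.ext rfl⟩)
      simp [hab]

/-- The vectors that are combinations of the first `a` rows over the residue field. -/
def residualSpan (n a : ℕ) (Y : ℕ → ℕ → R) : Submodule R (Fin n → R) where
  carrier := {y | ∃ g : Fin a → R, ∀ j, y j - ∑ b, g b * Y b j ∈ IsLocalRing.maximalIdeal R}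
  zero_mem' := ⟨0, fun j => by simp⟩
  add_mem' := by
    rintro y y' ⟨g, hg⟩ ⟨g', hg'⟩
    refine ⟨g + g', fun j => ?_⟩
    convert Ideal.add_mem _ (hg j) (hg' j) using 1
    simp only [Pi.add_apply, add_mul, Finset.sum_add_distrib]
    ring
  smul_mem' := by
    rintro c y ⟨g, hg⟩
    refine ⟨c • g, fun j => ?_⟩
    convert Ideal.mul_mem_left _ c (hg j) using 1
    simp only [Pi.smul_apply, smul_eq_mul, mul_assoc, ← Finset.mul_sum]
    ring

/-- If a greedy choice of solutions of linear systems cannot be continued, then there is no choice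
of solutions that are independent over the residue field: the solutions of the first `a + 1` systems
lie in a space of dimension `a`. -/
theorem IsGreedyFailure.not_residuallyIndependent {L N a : ℕ} {h : ℕ → ℕ → R} {t : ℕ → ℕ → R}
    {cand : ℕ → ℕ → ℕ → R} {Y₀ : ℕ → ℕ → R} (hF : IsGreedyFailure n (N + 1) a cand Y₀) (ha : a < q)
    {X κ : ℕ → ℕ → R} (hcand : ∀ b < q, ∀ c < N + 1, ∀ j < n, cand b c j =
      X b j + if c < N then κ c j else 0)
    (hX : ∀ b < q, ∀ c < L, ∑ j : Fin n, h c j * X b j = t b c)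
    (hK : ∀ K : Submodule R (Fin n → R), (∀ x < N, (fun j : Fin n => κ x j) ∈ K) →
      ∀ y : Fin n → R, (∀ c < L, ∑ j : Fin n, h c j * y j = 0) → y ∈ K)
    {Y : ℕ → ℕ → R} (hY : ∀ b < q, ∀ c < L, ∑ j : Fin n, h c j * Y b j = t b c) :
    ¬ ResiduallyIndependent n q Y := by
  intro hI
  set V := residualSpan n a Y₀ with hV
  have hc : ∀ c < N + 1, (fun j : Fin n => cand a c j) ∈ V := fun c hcN => by
    obtain ⟨g, hg⟩ := hF.2 c hcN
    exact ⟨g, fun j => hg j j.2⟩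
  have hXa : (fun j : Fin n => X a j) ∈ V := by
    convert hc N (Nat.lt_succ_self N) using 2 with j
    rw [hcand a ha N (Nat.lt_succ_self N) j j.2, if_neg (lt_irrefl N), add_zero]
  have hκ : ∀ x < N, (fun j : Fin n => κ x j) ∈ V := by
    intro x hx
    convert V.sub_mem (hc x (by omega)) hXa using 1
    funext j
    rw [Pi.sub_apply, hcand a ha x (by omega) j j.2, if_pos hx, add_sub_cancel_left]
  have hY₀ : ∀ b < a, (fun j : Fin n => Y₀ b j) ∈ V := fun b hb =>
    ⟨Pi.single ⟨b, hb⟩ 1, fun j => by simp [Pi.single_apply]⟩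
  have hXb : ∀ b ≤ a, (fun j : Fin n => X b j) ∈ V := by
    intro b hb
    rcases hb.eq_or_lt with rfl | hb
    · exact hXa
    · obtain ⟨c, hcN, e⟩ := hF.1 b hb
      by_cases hcN' : c < N
      · convert V.sub_mem (hY₀ b hb) (hκ c hcN') using 1
        funext j
        rw [Pi.sub_apply, e j j.2, hcand b (by omega) c hcN j j.2, if_pos hcN',
          add_sub_cancel_right]
      · convert hY₀ b hb using 2 with j
        rw [e j j.2, hcand b (by omega) c hcN j j.2, if_neg hcN', add_zero]
  have hYb : ∀ b : Fin (a + 1), (fun j : Fin n => Y b j) ∈ V := by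
    intro b
    have h1 := hK V hκ (fun j => Y b j - X b j) fun c hc => by
      simp only [mul_sub, Finset.sum_sub_distrib]
      rw [hY b (by omega) c hc, hX b (by omega) c hc, sub_self]
    convert V.add_mem h1 (hXb b (by omega)) using 1
    funext j
    simp
  choose g hg using hYb
  exact (hI.mono (by omega : a + 1 ≤ q)).not_of_span g fun i j hj => hg i ⟨j, hj⟩

end Greedy

/-! ### The search for an error -/

section Stage

variable {R : Type*} [CommRing R] [IsLocalRing R] (G : GaloisFrame R) {m : ℕ}
  {E : GaloisExtension R m} {n k lam : ℕ} {H : ℕ → ℕ → E.Ext} {f r : ℕ → E.Ext}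

namespace Prog

/-- The search for an error with support generated by `ε`. -/
theorem run_findError [Finite R] {M : Memory R} (h : IsInput G E n k lam H f r M) (hlam : 0 < lam)
    (hn : 0 < n) {q : ℕ} (h11 : M.int 11 0 = q) (h5 : M.int 5 0 = 0) (h13 : M.int 13 0 = 0)
    (h7 : ∀ d, M.ring 7 d 0 0 = if d = 0 then 1 else 0)
    (h9 : ∀ x < lam, ∀ u < m, ∀ l < m, M.ring 9 x u (l + 1) = E.coord (E.theta ^ u * f x) l)
    {s : ℕ → E.Ext} (h10 : ∀ i < n - k, ∀ c < m, M.ring 10 i 0 c = E.coord (s i) c)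
    (h15 : M.ring 15 = 0) (h16 : M.ring 16 = 0) (h18 : M.ring 18 = 0) {ε : ℕ → E.Ext}
    (hε : ∀ a < q, ∀ c < m, M.ring 20 (M.int 37 a) 0 (c + lam * m) = E.coord (ε a) c)
    (hf : LinearIndependent R fun b : Fin lam => f b)
    (hH : ∀ i < n - k, ∀ j < n, H i j ∈ Submodule.span R (Set.range fun b : Fin lam => f b))
    (hs : LinearIndependent R (fun v : Fin (q * lam) => ε (v / lam) * f (v % lam)) →
      ∀ i < n - k,
        s i ∈ Submodule.span R (Set.range fun v : Fin (q * lam) => ε (v / lam) * f (v % lam)))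
    {M' : Memory R} (hM' : M' = (findError.run G M).1) :
    (M'.int 5 0 = 1 ∧ ∃ Y : ℕ → ℕ → R,
      LinearIndependent R (fun v : Fin (q * lam) => ε (v / lam) * f (v % lam)) ∧
      ResiduallyIndependent n q Y ∧
      (∀ i < n - k, ∑ j : Fin n, H i j * ∑ a : Fin q, Y a j • ε a = s i) ∧
      ∀ i < n, (E.ofCoord fun c => M'.ring 6 i 0 c) = r i - ∑ a : Fin q, Y a i • ε a) ∨
    (M'.int 5 0 = 0 ∧
      (LinearIndependent R (fun v : Fin (q * lam) => ε (v / lam) * f (v % lam)) →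
        ∀ Y : ℕ → ℕ → R, ResiduallyIndependent n q Y →
        ¬ ∀ i < n - k, ∑ j : Fin n, H i j * ∑ a : Fin q, Y a j • ε a = s i)) := by
  replace hM' := hM'.symm
  subst hM'
  rw [findError, run_seq_fst, run_seq_fst, run_seq_fst]
  obtain ⟨M1, hM1⟩ : ∃ M', M' = (products.run G M).1 := ⟨_, rfl⟩
  rw [← hM1]
  have i1 := h.run G products (by decide)
  rw [← hM1] at i1
  obtain ⟨p12, p15⟩ := run_products G h h11 hlam h9 h15 hε hM1
  have n1 : ∀ v, products.writesInt v = false → M1.int v = M.int v :=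
    fun v hv => by rw [hM1]; exact run_int G products M hv
  have r1 : ∀ v, products.writesRing v = false → M1.ring v = M.ring v :=
    fun v hv => by rw [hM1]; exact run_ring G products M hv
  -- the coordinates of the entries of `H`
  obtain ⟨M2, hM2⟩ : ∃ M', M' = (checkCoordinates.run G M1).1 := ⟨_, rfl⟩
  rw [← hM2]
  have i2 := i1.run G checkCoordinates (by decide)
  rw [← hM2] at i2
  have n2 : ∀ v, checkCoordinates.writesInt v = false → M2.int v = M1.int v :=
    fun v hv => by rw [hM2]; exact run_int G checkCoordinates M1 hv
  have r2 : ∀ v, checkCoordinates.writesRing v = false → M2.ring v = M1.ring v :=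
    fun v hv => by rw [hM2]; exact run_ring G checkCoordinates M1 hv
  obtain ⟨c1, c2⟩ := run_coordinates G (M := M1) (N₀ := ivar 3) (N := (ivar 0 - ivar 1) * ivar 0)
    (n₀ := lam) (n₁ := (n - k) * n) (ex := RingExp.get 2 (ivar 30) 0 (ivar 31))
    (et := RingExp.get 1 (ivar 30 / ivar 0) ((ivar 30).mod (ivar 0)) (ivar 31)) (out := 13)
    i1.int2 (fun d => by rw [r1 7 rfl, h7]) f (fun i => H (i / n) (i % n)) rfl i1.int3
    (by simp [i1.int0, i1.int1]) (fun i _ c _ => by simp [i1.ring2])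
    (fun i _ c _ => by
      have e0 : (M1.at' i c).int 0 0 = n := by
        rw [Memory.at_int _ _ _ (by decide) (by decide), i1.int0]
      simp only [RingExp.eval_get, IntExp.eval_get, IntExp.eval_div, IntExp.eval_mod,
        IntExp.eval_ofNat, Memory.at_ring, Memory.at_int_30, Memory.at_int_31, e0, i1.ring1]) hM2
  replace c2 := c2 (c1.2 hf)
  -- the coordinates of the syndrome
  obtain ⟨M3, hM3⟩ : ∃ M', M' = (syndromeCoordinates.run G M2).1 := ⟨_, rfl⟩
  rw [← hM3]
  have i3 := i2.run G syndromeCoordinates (by decide)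
  rw [← hM3] at i3
  have n3 : ∀ v, syndromeCoordinates.writesInt v = false → M3.int v = M2.int v :=
    fun v hv => by rw [hM3]; exact run_int G syndromeCoordinates M2 hv
  have r3 : ∀ v, syndromeCoordinates.writesRing v = false → M3.ring v = M2.ring v :=
    fun v hv => by rw [hM3]; exact run_ring G syndromeCoordinates M2 hv
  have q7 : ∀ d, M2.ring 7 d 0 0 = if d = 0 then 1 else 0 := fun d => by
    rw [r2 7 rfl, r1 7 rfl, h7]
  have q11 : M2.int 11 0 = q := by rw [n2 11 rfl, n1 11 rfl, h11]
  have q15 : M2.ring 15 = M1.ring 15 := r2 15 rfl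
  have q10 : M2.ring 10 = M.ring 10 := by rw [r2 10 rfl, r1 10 rfl]
  have qx : ∀ v < q * lam, ∀ c < m,
      (RingExp.get 15 (ivar 30) 0 (ivar 31)).eval G (M2.at' v c) =
        E.coord (ε (v / lam) * f (v % lam)) c := fun v hv c hc => by
    simp [q15, p15 v hv c hc]
  have qt : ∀ i < n - k, ∀ c < m,
      (RingExp.get 10 (ivar 30) 0 (ivar 31)).eval G (M2.at' i c) = E.coord (s i) c :=
    fun i hi c hc => by simp [q10, h10 i hi c hc]
  obtain ⟨d1, d2⟩ := run_coordinates G (M := M2) (N₀ := ivar 11 * ivar 3) (N := ivar 0 - ivar 1)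
    (n₀ := q * lam) (n₁ := n - k) (ex := RingExp.get 15 (ivar 30) 0 (ivar 31))
    (et := RingExp.get 10 (ivar 30) 0 (ivar 31)) (out := 14)
    i2.int2 q7 (fun v => ε (v / lam) * f (v % lam)) s rfl
    (by simp [i2.int3, q11]) (by simp [i2.int0, i2.int1]) qx qt hM3
  have e5 : M3.int 5 0 = 0 := by rw [n3 5 rfl, n2 5 rfl, n1 5 rfl, h5]
  by_cases h38 : M3.int 38 0 = 0
  swap
  · have hb : ¬ (ivar 38).eval M3.int ≤ IntExp.eval M3.int 0 := by simpa using h38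
    rw [run_branch_neg G hb]
    exact Or.inr ⟨e5, fun hli => absurd (d1.2 hli) h38⟩
  have hx := d1.1 h38
  have hb : (ivar 38).eval M3.int ≤ IntExp.eval M3.int 0 := by simp [h38]
  rw [run_branch_pos G hb, run_seq_fst]
  have heq := fun Y : ℕ → ℕ → R => sum_mul_eq_iff (n := n) (l := n - k) (H := H) (s := s) (Y := Y)
    (C := fun x b => M3.ring 13 x 0 b) (D := fun i v => M3.ring 14 i 0 v) hlam hx
    (fun i hi j hj => by
      have hij : i * n + j < (n - k) * n := by
        have : (i + 1) * n ≤ (n - k) * n := Nat.mul_le_mul_right _ hi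
        linarith
      have e1 : (i * n + j) / n = i := by
        rw [mul_comm, Nat.mul_add_div hn, Nat.div_eq_of_lt hj, add_zero]
      have e2 : (i * n + j) % n = j := by rw [mul_comm, Nat.mul_add_mod, Nat.mod_eq_of_lt hj]
      have := c2 (i * n + j) hij (by simp only [e1, e2]; exact hH i hi j hj)
      simp only [e1, e2] at this
      rw [r3 13 rfl]
      exact this)
    (fun i hi => d2 h38 i hi (hs hx i hi))
  -- the linear system
  obtain ⟨M4, hM4⟩ : ∃ M', M' = (solveSystem.run G M3).1 := ⟨_, rfl⟩
  rw [← hM4]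
  have i4 := i3.run G solveSystem (by decide)
  rw [← hM4] at i4
  have n4 : ∀ v, solveSystem.writesInt v = false → M4.int v = M3.int v :=
    fun v hv => by rw [hM4]; exact run_int G solveSystem M3 hv
  have r4 : ∀ v, solveSystem.writesRing v = false → M4.ring v = M3.ring v :=
    fun v hv => by rw [hM4]; exact run_ring G solveSystem M3 hv
  have e11 : M3.int 11 0 = q := by rw [n3 11 rfl, n2 11 rfl, n1 11 rfl, h11]
  have e7 : ∀ d, M3.ring 7 d 0 0 = if d = 0 then 1 else 0 := fun d => by
    rw [r3 7 rfl, r2 7 rfl, r1 7 rfl, h7]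
  obtain ⟨s1, s2, s3, s4⟩ := run_solveSystem G i3 (q := q) (L := (n - k) * lam) hn rfl e11 e7
    (h₀ := fun c j => M3.ring 13 (c / lam * n + j) 0 (c % lam)) (fun _ _ _ _ => rfl)
    (t := fun a c => M3.ring 14 (c / lam) 0 (a * lam + c % lam)) (fun _ _ _ _ => rfl) hM4
  by_cases h33 : M4.int 33 0 = 0
  swap
  · have hb : ¬ (ivar 33).eval M4.int ≤ IntExp.eval M4.int 0 := by simpa using h33
    rw [run_branch_neg G hb]
    refine Or.inr ⟨by rw [run, n4 5 rfl, e5], fun _ Y _ hY => h33 (s1.2 fun a ha => ?_)⟩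
    exact ⟨fun j => Y a j, (heq Y).1 hY a ha⟩
  have hb : (ivar 33).eval M4.int ≤ IntExp.eval M4.int 0 := by simp [h33]
  rw [run_branch_pos G hb, run_seq_fst]
  replace s2 := s2 h33
  -- the choice of a solution
  obtain ⟨M5, hM5⟩ : ∃ M', M' = (chooseSolution.run G M4).1 := ⟨_, rfl⟩
  rw [← hM5]
  have i5 := i4.run G chooseSolution (by decide)
  rw [← hM5] at i5
  have n5 : ∀ v, chooseSolution.writesInt v = false → M5.int v = M4.int v :=
    fun v hv => by rw [hM5]; exact run_int G chooseSolution M4 hv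
  have r5 : ∀ v, chooseSolution.writesRing v = false → M5.ring v = M4.ring v :=
    fun v hv => by rw [hM5]; exact run_ring G chooseSolution M4 hv
  have g := run_chooseSolution G i4 (q := q) (L := (n - k) * lam) rfl (by rw [n4 11 rfl, e11])
    (by rw [n4 13 rfl, n3 13 rfl, n2 13 rfl, n1 13 rfl, h13]) (fun d => by rw [r4 7 rfl, e7])
    (by rw [r4 16 rfl, r3 16 rfl, r2 16 rfl, r1 16 rfl, h16])
    (by rw [r4 18 rfl, r3 18 rfl, r2 18 rfl, r1 18 rfl, h18])
    (cand := fun a c j => -M4.ring 20 (n * G.gamma + a) 0 ((n - k) * lam + j) +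
        if c < n * G.gamma then M4.ring 20 c 0 ((n - k) * lam + j) else 0)
    (fun _ _ _ _ _ _ => rfl) hM5
  rcases g with ⟨g1, g2⟩ | ⟨g1, a, ha, Y₀, g2⟩
  swap
  · have hb : ¬ (ivar 13).eval M5.int ≤ IntExp.eval M5.int 0 := by simpa using g1
    rw [run_branch_neg G hb]
    refine Or.inr ⟨by rw [run, n5 5 rfl, n4 5 rfl, e5], fun _ Y hI hY => ?_⟩
    exact g2.not_residuallyIndependent ha (L := (n - k) * lam)
      (h := fun c j => M3.ring 13 (c / lam * n + j) 0 (c % lam))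
      (t := fun a c => M3.ring 14 (c / lam) 0 (a * lam + c % lam))
      (X := fun b j => -M4.ring 20 (n * G.gamma + b) 0 ((n - k) * lam + j))
      (κ := fun c j => M4.ring 20 c 0 ((n - k) * lam + j)) (fun _ _ _ _ _ _ => rfl) s2 s4
      ((heq Y).1 hY) hI
  have hb : (ivar 13).eval M5.int ≤ IntExp.eval M5.int 0 := by simp [g1]
  rw [run_branch_pos G hb]
  obtain ⟨M6, hM6⟩ : ∃ M', M' = (output.run G M5).1 := ⟨_, rfl⟩
  rw [← hM6]
  obtain ⟨o1, o2⟩ := run_output G i5 (q := q) (by rw [n5 11 rfl, n4 11 rfl, e11]) (ε := ε)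
    (fun a ha c hc => by
      rw [r5 12 rfl, r4 12 rfl, r3 12 rfl, r2 12 rfl, p12 a ha c hc]) hM6
  have hY := (heq fun b j => M5.ring 18 b 0 j).2
  refine Or.inl ⟨o1, fun b j => M5.ring 18 b 0 j, hx, g2.1, hY fun a ha c hc => ?_, o2⟩
  clear hY
  obtain ⟨c', hc', e⟩ := g2.2 a ha
  have e' : ∀ j : Fin n, M5.ring 18 a 0 j = -M4.ring 20 (n * G.gamma + a) 0 ((n - k) * lam + j) +
      if c' < n * G.gamma then M4.ring 20 c' 0 ((n - k) * lam + j) else 0 := fun j => e j j.2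
  simp only [e', mul_add, Finset.sum_add_distrib]
  rw [s2 a ha c hc]
  split
  · rw [s3 c' ‹_› c hc, add_zero]
  · simp

end Prog
end Stage

/-! ### Correctness of the program -/

section Stage

variable {R : Type*} [CommRing R] [IsLocalRing R] (G : GaloisFrame R) {m : ℕ}
  {E : GaloisExtension R m} {n k lam : ℕ} {H : ℕ → ℕ → E.Ext} {f r : ℕ → E.Ext}

/-- The matrix with the entries `H i j`. -/
def ofEntries {S : Type*} (l n : ℕ) (H : ℕ → ℕ → S) : Matrix (Fin l) (Fin n) S :=
  Matrix.of fun i j => H i j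

theorem ofEntries_mulVec {l : ℕ} (e : ℕ → E.Ext) :
    (ofEntries l n H).mulVec (fun j => e j) = fun i : Fin l => ∑ j : Fin n, H i j * e j := rfl

/-- The module `𝓔'` of the decoder. -/
noncomputable def errorSupport (R : Type*) {S : Type*} [CommRing R] [CommRing S] [Algebra R S]
    (l n lam : ℕ) (H : ℕ → ℕ → S) (f r : ℕ → S) : Submodule R S :=
  ⨅ i : Fin lam, invMul (f i) (supp R ((ofEntries l n H).mulVec fun j : Fin n => r j))

namespace Prog

theorem mulVec_eq_syn :
    (ofEntries (n - k) n H).mulVec (fun j => r j) = fun i : Fin (n - k) => syn E n H r i := by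
  rw [ofEntries_mulVec]
  funext i
  rw [syn, Finset.sum_range]

/-- What the program has to achieve, for the memory `M'` at the end. -/
def IsCorrect (E : GaloisExtension R m) (n k lam : ℕ) (H : ℕ → ℕ → E.Ext) (f r : ℕ → E.Ext)
    (M' : Memory R) : Prop :=
  (M'.int 5 0 = 1 ∧ ∃ e, IsDecodingError R (ofEntries (n - k) n H) (fun b : Fin lam => f b)
      (fun j => r j) e ∧ ∀ i : Fin n, (E.ofCoord fun c => M'.ring 6 i 0 c) = r i - e i) ∨
    (M'.int 5 0 = 0 ∧ ∀ e, ¬ IsDecodingError R (ofEntries (n - k) n H) (fun b : Fin lam => f b)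
      (fun j => r j) e)

/-- The second part of the decoder, for a syndrome that generates a free module of rank `q * lam`
and an error support with basis `ε`. -/
theorem isCorrect_findError [Finite R] {M : Memory R} (h : IsInput G E n k lam H f r M)
    (hlam : 0 < lam) (hn : 0 < n) {q : ℕ} (h11 : M.int 11 0 = q) (h5 : M.int 5 0 = 0)
    (h13 : M.int 13 0 = 0) (h7 : ∀ d, M.ring 7 d 0 0 = if d = 0 then 1 else 0)
    (h9 : ∀ x < lam, ∀ u < m, ∀ l < m, M.ring 9 x u (l + 1) = E.coord (E.theta ^ u * f x) l)
    (h10 : ∀ i < n - k, ∀ c < m, M.ring 10 i 0 c = E.coord (syn E n H r i) c)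
    (h15 : M.ring 15 = 0) (h16 : M.ring 16 = 0) (h18 : M.ring 18 = 0) {ε : ℕ → E.Ext}
    (hε : ∀ a < q, ∀ c < m, M.ring 20 (M.int 37 a) 0 (c + lam * m) = E.coord (ε a) c)
    (hεi : LinearIndependent R fun a : Fin q => ε a)
    (hT : errorSupport R (n - k) n lam H f r = Submodule.span R (Set.range fun a : Fin q => ε a))
    (hf : LinearIndependent R fun b : Fin lam => f b)
    (hspan : Submodule.span R (Set.range fun b : Fin lam => f b) =
      entrySpan R (ofEntries (n - k) n H))
    (hfree : Module.Free R (supp R fun i : Fin (n - k) => syn E n H r i))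
    (hrank : freeRank R (supp R fun i : Fin (n - k) => syn E n H r i) = q * lam)
    {M' : Memory R} (hM' : M' = (findError.run G M).1) : IsCorrect E n k lam H f r M' := by
  have hunit := E.isUnit_of_linearIndependent hf
  have hprod := span_mul_span_range (R := R) (q := q) (ε := ε) (f := f) hlam
  rw [← hT, hspan] at hprod
  have hle : errorSupport R (n - k) n lam H f r * entrySpan R (ofEntries (n - k) n H) ≤
      supp R fun i : Fin (n - k) => syn E n H r i := by
    rw [← hspan, Submodule.mul_le]
    intro x hx y hy
    induction hy using Submodule.span_induction with
    | mem y hy =>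
      obtain ⟨b, rfl⟩ := hy
      have := (mem_invMul_iff (hunit b) _ x).1 ((Submodule.mem_iInf _).1 hx b)
      rw [mulVec_eq_syn] at this
      rwa [mul_comm]
    | zero => rw [mul_zero]; exact Submodule.zero_mem _
    | add y z _ _ hy hz => rw [mul_add]; exact Submodule.add_mem _ hy hz
    | smul a y _ hy => rw [mul_smul_comm]; exact Submodule.smul_mem _ _ hy
  have hli : freeRank R (errorSupport R (n - k) n lam H f r *
      entrySpan R (ofEntries (n - k) n H) : Submodule R E.Ext) = q * lam ↔
      LinearIndependent R fun v : Fin (q * lam) => ε (v / lam) * f (v % lam) := by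
    rw [hprod]
    exact freeRank_span_eq_iff
  have hTfree : Module.Free R (errorSupport R (n - k) n lam H f r) := by
    rw [hT]; exact Module.Free.of_basis (Module.Basis.span hεi)
  have hTrank : freeRank R (errorSupport R (n - k) n lam H f r) = q := by
    rw [hT]; exact freeRank_span_eq_iff.2 hεi
  have hEi : ∀ i < n - k, ∀ j < n, H i j ∈ Submodule.span R (Set.range fun b : Fin lam => f b) := by
    intro i hi j hj
    rw [hspan]
    exact Submodule.subset_span ⟨⟨i, hi⟩, ⟨j, hj⟩, rfl⟩
  have hs : LinearIndependent R (fun v : Fin (q * lam) => ε (v / lam) * f (v % lam)) →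
      ∀ i < n - k, syn E n H r i ∈
        Submodule.span R (Set.range fun v : Fin (q * lam) => ε (v / lam) * f (v % lam)) := by
    intro hx i hi
    have hPfree : Module.Free R (errorSupport R (n - k) n lam H f r *
        entrySpan R (ofEntries (n - k) n H) : Submodule R E.Ext) := by
      rw [hprod]; exact Module.Free.of_basis (Module.Basis.span hx)
    have heq := eq_of_le_of_finrank_eq hle (by
      rw [← freeRank_eq_finrank, ← freeRank_eq_finrank, hrank]; exact hli.2 hx)
    rw [← hprod, heq]
    exact Submodule.subset_span ⟨⟨i, hi⟩, rfl⟩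
  have key := run_findError G h hlam hn h11 h5 h13 h7 h9 h10 h15 h16 h18 hε hf hEi hs hM'
  have hsupp : ∀ Y : ℕ → ℕ → R, supp R (fun j : Fin n => ∑ a : Fin q, Y a j • ε a) =
      errorSupport R (n - k) n lam H f r ↔ ResiduallyIndependent n q Y := fun Y => by
    rw [hT]; exact supp_eq_iff hεi
  rcases key with ⟨k1, Y, k2, k3, k4, k5⟩ | ⟨k1, k2⟩
  · refine Or.inl ⟨k1, fun j => ∑ a : Fin q, Y a j • ε a, ⟨?_, ?_, hTfree, ?_, ?_, ?_, ?_⟩,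
      fun i => k5 i i.2⟩
    · rwa [mulVec_eq_syn]
    · rw [mulVec_eq_syn, hrank]; exact dvd_mul_left _ _
    · rw [mulVec_eq_syn, hrank, Nat.mul_div_cancel _ hlam]
      rw [← mulVec_eq_syn]; exact hTrank
    · rw [mulVec_eq_syn, hrank]
      rw [← mulVec_eq_syn]; exact hli.2 k2
    · exact (hsupp Y).2 k3
    · rw [mulVec_eq_syn]
      funext i
      exact k4 i i.2
  · refine Or.inr ⟨k1, fun e he => ?_⟩
    have e1 : supp R e = errorSupport R (n - k) n lam H f r := he.supp_eq
    have e2 : ∀ j : Fin n, ∃ y : Fin q → R, ∑ a, y a • ε a = e j := fun j => by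
      have : e j ∈ supp R e := Submodule.subset_span ⟨j, rfl⟩
      rw [e1, hT] at this
      exact (Submodule.mem_span_range_iff_exists_fun _).1 this
    choose y hy using e2
    let Y : ℕ → ℕ → R := fun a j =>
      if ha : a < q then if hj : j < n then y ⟨j, hj⟩ ⟨a, ha⟩ else 0 else 0
    have hYe : (fun j : Fin n => ∑ a : Fin q, Y a j • ε a) = e := by
      funext j
      rw [← hy j]
      exact Finset.sum_congr rfl fun a _ => by simp [Y]
    have hx := he.rank_mul
    rw [mulVec_eq_syn, hrank, ← mulVec_eq_syn] at hx
    refine k2 (hli.1 hx) Y ((hsupp Y).1 (by rw [hYe]; exact e1)) fun i hi => ?_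
    have e3 := congrFun he.mulVec_eq ⟨i, hi⟩
    rw [mulVec_eq_syn, ← hYe] at e3
    exact e3

end Prog
end Stage

section Stage

variable {R : Type*} [CommRing R] [IsLocalRing R] (G : GaloisFrame R) {m : ℕ}
  {E : GaloisExtension R m} {n k lam : ℕ} {H : ℕ → ℕ → E.Ext} {f r : ℕ → E.Ext}

namespace Prog

/-- The part of the decoder after the reduction of the syndrome, where the module that it generates
has been found to be free, and the products `θ ^ u f_b` have been reduced modulo this module. -/
theorem isCorrect_findSupport [Finite R] {M : Memory R} (h : IsInput G E n k lam H f r M)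
    (hm : 0 < m) (hlam : 0 < lam) (hn : 0 < n) {q₁ : ℕ} (h10' : M.int 10 0 = q₁)
    (h5 : M.int 5 0 = 0)
    (h13 : M.int 13 0 = 0) (h7 : ∀ d, M.ring 7 d 0 0 = if d = 0 then 1 else 0)
    (h9 : ∀ x < lam, ∀ u < m, ∀ l < m, M.ring 9 x u (l + 1) = E.coord (E.theta ^ u * f x) l)
    (h10 : ∀ i < n - k, ∀ c < m, M.ring 10 i 0 c = E.coord (syn E n H r i) c)
    (h15 : M.ring 15 = 0) (h16 : M.ring 16 = 0) (h18 : M.ring 18 = 0)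
    (hf : LinearIndependent R fun b : Fin lam => f b)
    (hspan : Submodule.span R (Set.range fun b : Fin lam => f b) =
      entrySpan R (ofEntries (n - k) n H))
    (hfree : Module.Free R (supp R fun i : Fin (n - k) => syn E n H r i))
    (hrank : freeRank R (supp R fun i : Fin (n - k) => syn E n H r i) = n - k - q₁)
    (hmem : ∀ b < lam, ∀ x : E.Ext, f b * x ∈ supp R (fun i : Fin (n - k) => syn E n H r i) ↔
      ∀ c < m, ∑ u : Fin m, E.coord x u * M.ring 20 (b * m + u + (n - k)) 0 c = 0)
    {M' : Memory R} (hM' : M' = (findSupport.run G M).1) : IsCorrect E n k lam H f r M' := by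
  have hunit := E.isUnit_of_linearIndependent hf
  replace hM' := hM'.symm
  subst hM'
  rw [findSupport, run_seq_fst, run_seq_fst, run_seq_fst]
  obtain ⟨M1, hM1⟩ : ∃ M', M' = (reduceSupport.run G M).1 := ⟨_, rfl⟩
  rw [← hM1]
  have i1 := h.run G reduceSupport (by decide)
  rw [← hM1] at i1
  have n1 : ∀ v, reduceSupport.writesInt v = false → M1.int v = M.int v :=
    fun v hv => by rw [hM1]; exact run_int G _ _ hv
  have r1 : ∀ v, reduceSupport.writesRing v = false → M1.ring v = M.ring v :=
    fun v hv => by rw [hM1]; exact run_ring G _ _ hv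
  obtain ⟨A₀, hE, hA, hδ⟩ := run_reduceSupport G h hm h7 hM1
  obtain ⟨q, hq⟩ : ∃ q, q = M1.int 38 0 := ⟨_, rfl⟩
  rw [← hq] at hE
  have hT : ∀ x, x ∈ errorSupport R (n - k) n lam H f r ↔
      ∀ c < lam * m, ∑ u : Fin m, E.coordEquiv x u * A₀ u c = 0 := by
    intro x
    have e : x ∈ errorSupport R (n - k) n lam H f r ↔ ∀ b < lam, ∀ c < m,
        ∑ u : Fin m, E.coord x u * M.ring 20 (b * m + u + (n - k)) 0 c = 0 := by
      rw [errorSupport, Submodule.mem_iInf]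
      rw [mulVec_eq_syn]
      exact ⟨fun hx b hb => (hmem b hb x).1 ((mem_invMul_iff (hunit ⟨b, hb⟩) _ x).1 (hx ⟨b, hb⟩)),
        fun hx b => (mem_invMul_iff (hunit b) _ x).2 ((hmem b b.2 x).2 (hx b b.2))⟩
    rw [e]
    constructor
    · intro hx c hc
      rw [← hx (c / m) (Nat.div_lt_of_lt_mul (by rwa [mul_comm] at hc)) (c % m) (Nat.mod_lt _ hm)]
      exact Finset.sum_congr rfl fun u _ => by rw [hA u u.2 c hc, E.coordEquiv_apply]
    · intro hx b hb c hc
      have hbc : b * m + c < lam * m := by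
        have : (b + 1) * m ≤ lam * m := Nat.mul_le_mul_right _ hb
        linarith
      have e1 : (b * m + c) / m = b := by
        rw [mul_comm, Nat.mul_add_div hm, Nat.div_eq_of_lt hc, add_zero]
      have e2 : (b * m + c) % m = c := by rw [mul_comm, Nat.mul_add_mod, Nat.mod_eq_of_lt hc]
      rw [← hx (b * m + c) hbc]
      exact Finset.sum_congr rfl fun u _ => by rw [hA u u.2 _ hbc, e1, e2, E.coordEquiv_apply]
  obtain ⟨M2, hM2⟩ : ∃ M', M' = ((setInt 11 0 (ivar 38)).run G M1).1 := ⟨_, rfl⟩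
  rw [← hM2]
  have i2 := i1.run G (setInt 11 0 (ivar 38)) (by decide)
  rw [← hM2] at i2
  have e2 : M2 = M1.setInt 11 0 q := by rw [hM2, hq]; rfl
  obtain ⟨M3, hM3⟩ : ∃ M', M' = ((searchRest (ivar 11) (ivar 3 * ivar 2)).run G M2).1 := ⟨_, rfl⟩
  rw [← hM3]
  have i3 := i2.run G (searchRest (ivar 11) (ivar 3 * ivar 2)) (by decide)
  rw [← hM3] at i3
  have n3 : ∀ v, (searchRest (ivar 11) (ivar 3 * ivar 2)).writesInt v = false →
      v ≠ 11 → M3.int v = M1.int v := fun v hv h11 => by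
    rw [hM3, run_int G _ _ hv, e2]
    exact Memory.setInt_int_ne _ h11
  have r3 : ∀ v, M3.ring v = M1.ring v := fun v => by
    rw [hM3, run_ring G _ _ rfl, e2, Memory.setInt_ring]
  have q2 : M2.int 11 0 = q := by rw [e2, Memory.setInt_int_same]
  have q3 : M3.int 11 0 = q := by rw [hM3, run_int G _ _ rfl, q2]
  have hsr := run_searchRest G (M := M2) (N := ivar 11) (L := ivar 3 * ivar 2) (q := q)
    (l := lam * m) rfl q2 (by simp [i2.int2, i2.int3])
  rw [← hM3] at hsr
  have hsr' : M3.int 33 0 = 0 ↔ ∀ b < q, ∀ c < lam * m, M1.ring 20 (M1.int 37 b) 0 c = 0 := by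
    rw [hsr, e2]
    rfl
  have e5 : M3.int 5 0 = 0 := by rw [n3 5 rfl (by decide), n1 5 rfl, h5]
  by_cases h33 : M3.int 33 0 = 0
  swap
  · have hb : ¬ (ivar 33).eval M3.int ≤ IntExp.eval M3.int 0 := by simpa using h33
    rw [run_branch_neg G hb]
    exact Or.inr ⟨e5, fun e he =>
      h33 (hsr'.2 (hE.eq_zero_of_kernel_free hδ E.coordEquiv hT he.free_supp))⟩
  have hb : (ivar 33).eval M3.int ≤ IntExp.eval M3.int 0 := by simp [h33]
  rw [run_branch_pos G hb]
  have hz := hsr'.1 h33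
  obtain ⟨ε, hε⟩ : ∃ ε : ℕ → E.Ext, ε = fun a => E.ofCoord fun c =>
    M1.ring 20 (M1.int 37 a) 0 (lam * m + c) := ⟨_, rfl⟩
  have hsymm : (fun b : Fin q => E.coordEquiv.symm fun u : Fin m =>
      M1.ring 20 (M1.int 37 b) 0 (lam * m + u)) = fun b : Fin q => ε b := by
    funext b
    rw [hε]
    exact E.coordEquiv_symm fun u => M1.ring 20 (M1.int 37 b) 0 (lam * m + u)
  have hεi := hE.linearIndependent_kernel hδ E.coordEquiv
  have hεT := hE.kernel_eq_span hδ E.coordEquiv hT hz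
  rw [hsymm] at hεi hεT
  have hTrank : freeRank R (errorSupport R (n - k) n lam H f r) = q := by
    rw [hεT]; exact freeRank_span_eq_iff.2 hεi
  have hno : q * lam ≠ n - k - q₁ → ∀ e, ¬ IsDecodingError R (ofEntries (n - k) n H)
      (fun b : Fin lam => f b) (fun j => r j) e := fun hne e he => hne (by
    have d1 := he.dvd
    have d2 : freeRank R (errorSupport R (n - k) n lam H f r) = _ := he.rank_supp
    rw [mulVec_eq_syn, hrank] at d1 d2
    rw [← hTrank, d2, Nat.div_mul_cancel d1])
  have q10 : M3.int 10 0 = q₁ := by rw [n3 10 rfl (by decide), n1 10 rfl, h10']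
  by_cases hle₁ : q * lam ≤ n - k - q₁
  swap
  · have hb : ¬ (ivar 11 * ivar 3).eval M3.int ≤ (ivar 0 - ivar 1 - ivar 10).eval M3.int := by
      simpa [q3, i3.int0, i3.int1, i3.int3, q10] using hle₁
    rw [run_branch_neg G hb]
    exact Or.inr ⟨e5, hno fun e => hle₁ e.le⟩
  have hb : (ivar 11 * ivar 3).eval M3.int ≤ (ivar 0 - ivar 1 - ivar 10).eval M3.int := by
    simpa [q3, i3.int0, i3.int1, i3.int3, q10] using hle₁
  rw [run_branch_pos G hb]
  by_cases hle₂ : n - k - q₁ ≤ q * lam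
  swap
  · have hb : ¬ (ivar 0 - ivar 1 - ivar 10).eval M3.int ≤ (ivar 11 * ivar 3).eval M3.int := by
      simpa [q3, i3.int0, i3.int1, i3.int3, q10] using hle₂
    rw [run_branch_neg G hb]
    exact Or.inr ⟨e5, hno fun e => hle₂ e.ge⟩
  have hb : (ivar 0 - ivar 1 - ivar 10).eval M3.int ≤ (ivar 11 * ivar 3).eval M3.int := by
    simpa [q3, i3.int0, i3.int1, i3.int3, q10] using hle₂
  rw [run_branch_pos G hb]
  refine isCorrect_findError G i3 hlam hn q3 e5 ?_ ?_ ?_ ?_ ?_ ?_ ?_ (ε := ε) ?_ hεi hεT hf hspan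
    hfree (hrank.trans (le_antisymm hle₂ hle₁)) rfl
  · rw [n3 13 rfl (by decide), n1 13 rfl, h13]
  · intro d; rw [r3, r1 7 rfl, h7]
  · intro x hx u hu l hl; rw [r3, r1 9 rfl, h9 x hx u hu l hl]
  · intro i hi c hc; rw [r3, r1 10 rfl, h10 i hi c hc]
  · rw [r3, r1 15 rfl, h15]
  · rw [r3, r1 16 rfl, h16]
  · rw [r3, r1 18 rfl, h18]
  · intro a ha c hc
    rw [r3, n3 37 rfl (by decide), hε, E.coord_ofCoord _ hc, add_comm]

theorem isCorrect_decoder [Finite R] {M : Memory R} (h : IsInput G E n k lam H f r M)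
    (hm : 0 < m) (hlam : 0 < lam) (hn : 0 < n) (h5 : M.int 5 0 = 0) (h13 : M.int 13 0 = 0)
    (h0 : ∀ b, 5 < b → M.ring b = 0)
    (hf : LinearIndependent R fun b : Fin lam => f b)
    (hspan : Submodule.span R (Set.range fun b : Fin lam => f b) =
      entrySpan R (ofEntries (n - k) n H))
    {M' : Memory R} (hM' : M' = (decoder.run G M).1) : IsCorrect E n k lam H f r M' := by
  replace hM' := hM'.symm
  subst hM'
  rw [decoder, run_seq_fst, run_seq_fst, run_seq_fst, run_seq_fst]
  obtain ⟨M1, hM1⟩ : ∃ M', M' = (syndrome.run G M).1 := ⟨_, rfl⟩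
  rw [← hM1]
  have i1 := h.run G syndrome (by decide)
  rw [← hM1] at i1
  have n1 : ∀ v, syndrome.writesInt v = false → M1.int v = M.int v :=
    fun v hv => by rw [hM1]; exact run_int G _ _ hv
  have r1 : ∀ v, syndrome.writesRing v = false → M1.ring v = M.ring v :=
    fun v hv => by rw [hM1]; exact run_ring G _ _ hv
  obtain ⟨s7, s9, s10⟩ := run_syndrome G hm h (fun d => by rw [h0 7 (by decide)]; rfl)
    (h0 8 (by decide)) (h0 9 (by decide)) (h0 10 (by decide)) hM1
  obtain ⟨M2, hM2⟩ : ∃ M', M' = (reduceSyndrome.run G M1).1 := ⟨_, rfl⟩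
  rw [← hM2]
  have i2 := i1.run G reduceSyndrome (by decide)
  rw [← hM2] at i2
  have n2 : ∀ v, reduceSyndrome.writesInt v = false → M2.int v = M1.int v :=
    fun v hv => by rw [hM2]; exact run_int G _ _ hv
  have r2 : ∀ v, reduceSyndrome.writesRing v = false → M2.ring v = M1.ring v :=
    fun v hv => by rw [hM2]; exact run_ring G _ _ hv
  obtain ⟨A₀, hE, hA, hx⟩ := run_reduceSyndrome G i1 hm s7 s9 s10 hM2
  obtain ⟨q, hq⟩ : ∃ q, q = M2.int 38 0 := ⟨_, rfl⟩
  rw [← hq] at hE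
  have hA' : ∀ (x : Fin (n - k)) (c : Fin m), A₀ x c = E.coordEquiv (syn E n H r x) c :=
    fun x c => hA x x.2 c c.2
  obtain ⟨M3, hM3⟩ : ∃ M', M' = ((setInt 10 0 (ivar 38)).run G M2).1 := ⟨_, rfl⟩
  rw [← hM3]
  have i3 := i2.run G (setInt 10 0 (ivar 38)) (by decide)
  rw [← hM3] at i3
  have e3 : M3 = M2.setInt 10 0 q := by rw [hM3, hq]; rfl
  obtain ⟨M4, hM4⟩ : ∃ M', M' = ((searchRest (ivar 10) (ivar 2)).run G M3).1 := ⟨_, rfl⟩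
  rw [← hM4]
  have i4 := i3.run G (searchRest (ivar 10) (ivar 2)) (by decide)
  rw [← hM4] at i4
  have n4 : ∀ v, (searchRest (ivar 10) (ivar 2)).writesInt v = false →
      v ≠ 10 → M4.int v = M2.int v := fun v hv h11 => by
    rw [hM4, run_int G _ _ hv, e3]
    exact Memory.setInt_int_ne _ h11
  have r4 : ∀ v, M4.ring v = M2.ring v := fun v => by
    rw [hM4, run_ring G _ _ rfl, e3, Memory.setInt_ring]
  have q3 : M3.int 10 0 = q := by rw [e3, Memory.setInt_int_same]
  have q4 : M4.int 10 0 = q := by rw [hM4, run_int G _ _ rfl, q3]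
  have hsr := run_searchRest G (M := M3) (N := ivar 10) (L := ivar 2) (q := q)
    (l := m) rfl q3 (by simp [i3.int2])
  rw [← hM4] at hsr
  have hsr' : M4.int 33 0 = 0 ↔ ∀ b < q, ∀ c < m, M2.ring 20 (M2.int 37 b) 0 c = 0 := by
    rw [hsr, e3]
    rfl
  have e5 : M4.int 5 0 = 0 := by rw [n4 5 rfl (by decide), n2 5 rfl, n1 5 rfl, h5]
  have hN : n - k ≤ n - k + lam * m := Nat.le_add_right _ _
  have hfr := hE.free_span_iff E.coordEquiv hN hA'
  by_cases h33 : M4.int 33 0 = 0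
  swap
  · have hb : ¬ (ivar 33).eval M4.int ≤ IntExp.eval M4.int 0 := by simpa using h33
    rw [run_branch_neg G hb]
    refine Or.inr ⟨e5, fun e he => h33 (hsr'.2 (hfr.1 ?_))⟩
    have := he.free_syn
    rw [mulVec_eq_syn] at this
    exact this
  have hb : (ivar 33).eval M4.int ≤ IntExp.eval M4.int 0 := by simp [h33]
  rw [run_branch_pos G hb]
  have hz := hsr'.1 h33
  have hfree : Module.Free R (supp R fun i : Fin (n - k) => syn E n H r i) := hfr.2 hz
  refine isCorrect_findSupport G i4 hm hlam hn q4 e5 ?_ ?_ ?_ ?_ ?_ ?_ ?_ hf hspan hfree ?_ ?_ rfl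
  · rw [n4 13 rfl (by decide), n2 13 rfl, n1 13 rfl, h13]
  · intro d; rw [r4, r2 7 rfl, s7]
  · intro x hx u hu l hl; rw [r4, r2 9 rfl, s9 x hx u hu l hl]
  · intro i hi c hc; rw [r4, r2 10 rfl, s10 i hi c hc]
  · rw [r4, r2 15 rfl, r1 15 rfl, h0 15 (by decide)]
  · rw [r4, r2 16 rfl, r1 16 rfl, h0 16 (by decide)]
  · rw [r4, r2 18 rfl, r1 18 rfl, h0 18 (by decide)]
  · rw [freeRank_eq_finrank]
    exact (hE.finrank_span E.coordEquiv hN hA' hz).2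
  · intro b hb x
    have hbu : ∀ u : Fin m, b * m + u < lam * m := fun u => by
      have : (b + 1) * m ≤ lam * m := Nat.mul_le_mul_right _ hb
      have := u.2
      linarith
    have key := hE.sum_smul_mem_iff E.coordEquiv hN hA' hz (fun u : Fin m => b * m + u + (n - k))
      (fun u => ⟨Nat.le_add_left _ _, by have := hbu u; omega⟩)
      (fun u => E.theta ^ (u : ℕ) * f b) (fun u c => hx b hb u u.2 c c.2)
      (fun u => E.coord x u)
    rw [mul_comm, E.mul_eq_sum, Finset.sum_range]
    refine key.trans ⟨fun hc c hcm => ?_, fun hc c => ?_⟩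
    · rw [r4]; exact hc ⟨c, hcm⟩
    · have := hc c c.2
      rwa [r4] at this

end Prog
end Stage

/-! ### The cost of the parts of the program -/

namespace RingExp

@[simp] theorem ops_delta (i j : IntExp) : (Prog.delta i j).ops = 0 := rfl

end RingExp

namespace Prog

section Parts

variable (s : ℕ → ℕ → ℕ)

theorem costBound_fill (a : ℕ) (I J O n₁ n₂ : IntExp) (e : RingExp) :
    (fill a I J O n₁ n₂ e).costBound s = n₁.eval s * (n₂.eval s * (e.ops + 1)) := rfl

theorem costBound_accumulate (a : ℕ) (N I J O n₁ n₂ : IntExp) (e : RingExp) :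
    (accumulate a N I J O n₁ n₂ e).costBound s =
      N.eval s * (n₁.eval s * (n₂.eval s * (e.ops + 2))) := by
  change N.eval s * (n₁.eval s * (n₂.eval s * (0 + e.ops + 1 + 1))) = _
  rw [zero_add]

theorem costBound_search (n₁ n₂ : IntExp) (e : RingExp) :
    (search n₁ n₂ e).costBound s = n₁.eval s * (n₂.eval s * (e.ops + 1)) := by
  simp [search, costBound]

theorem costBound_eliminate_le {N₀ N L W : IntExp} (hN : N₀.eval s ≤ N.eval s)
    (hL : L.eval s ≤ W.eval s) (hW : 0 < W.eval s) :
    (eliminate N₀ N L W).costBound s ≤ 10 * (N₀.eval s * N.eval s * W.eval s) := by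
  have e : (eliminate N₀ N L W).costBound s = N₀.eval s *
      (L.eval s * 2 + (W.eval s * 3 + (N.eval s * 2 + N.eval s * (W.eval s * 3)))) := by
    simp [eliminate, rankOne, costBound_fill, costBound_search, costBound, RingExp.ops]
  rw [e]
  rcases Nat.eq_zero_or_pos (N₀.eval s) with h0 | h0
  · rw [h0]; simp
  · have h1 : W.eval s ≤ N.eval s * W.eval s := Nat.le_mul_of_pos_left _ (by omega)
    have h2 : N.eval s ≤ N.eval s * W.eval s := Nat.le_mul_of_pos_right _ hW
    calc _ ≤ N₀.eval s * (10 * (N.eval s * W.eval s)) := Nat.mul_le_mul_left _ (by linarith)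
      _ = _ := by ring

theorem costBound_baseEliminate_le {N₀ N L W : IntExp} (hN : N₀.eval s ≤ N.eval s)
    (hN0 : 0 < N.eval s) (hW : 0 < W.eval s) :
    (baseEliminate N₀ N L W).costBound s ≤
      20 * (L.eval s * s 4 0 * N.eval s * W.eval s) := by
  have e : (baseEliminate N₀ N L W).costBound s = L.eval s * s 4 0 *
      (N.eval s * 4 + (N₀.eval s * 4 +
        (W.eval s + (N.eval s * 8 + N.eval s * (W.eval s * 3))))) := by
    simp [baseEliminate, pivotSearch, rankOne, costBound_fill, costBound, RingExp.ops]
  rw [e]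
  have h1 : W.eval s ≤ N.eval s * W.eval s := Nat.le_mul_of_pos_left _ hN0
  have h2 : N.eval s ≤ N.eval s * W.eval s := Nat.le_mul_of_pos_right _ hW
  calc _ ≤ L.eval s * s 4 0 * (20 * (N.eval s * W.eval s)) := Nat.mul_le_mul_left _ (by linarith)
    _ = _ := by ring

end Parts

/-- The bound of the theorem for one local ring, without the absolute constant. -/
def bound (n m lam g : ℕ) : ℕ := lam * m * n * max (n ^ 2) (m ^ 2) * g ^ 4

section Bound

variable {s : ℕ → ℕ → ℕ} {n m lam g l q : ℕ}

theorem mul_le_max_sq {x y : ℕ} (hx : x ≤ max n m) (hy : y ≤ max n m) :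
    x * y ≤ max (n ^ 2) (m ^ 2) := by
  have h := Nat.mul_le_mul hx hy
  rcases le_total n m with hnm | hnm
  · rw [max_eq_right hnm] at h
    exact h.trans ((pow_two m).ge.trans (le_max_right _ _))
  · rw [max_eq_left hnm] at h
    exact h.trans ((pow_two n).ge.trans (le_max_left _ _))

/-- The sizes on which the cost depends; `l` is the number `n - k` of rows of `H`. -/
structure HasSizes (s : ℕ → ℕ → ℕ) (n l m lam g : ℕ) : Prop where
  int0 : s 0 0 = n
  sub : n - s 1 0 = l
  int2 : s 2 0 = m
  int3 : s 3 0 = lam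
  int4 : s 4 0 = g
  le : l ≤ n
  pos_n : 1 ≤ n
  pos_m : 1 ≤ m
  pos_lam : 1 ≤ lam
  pos_g : 1 ≤ g
  lam_le : lam ≤ m

/-- The form in which the terms of the cost are estimated: a factor for each factor of the bound. -/
theorem HasSizes.mul_le_bound (_ : HasSizes s n l m lam g) {a b c d e : ℕ} (ha : a ≤ lam)
    (hb : b ≤ m) (hc : c ≤ n)
    (hd : d ≤ max (n ^ 2) (m ^ 2)) (he : e ≤ g ^ 4) : a * b * c * d * e ≤ bound n m lam g :=
  Nat.mul_le_mul (Nat.mul_le_mul (Nat.mul_le_mul (Nat.mul_le_mul ha hb) hc) hd) he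

variable (h : HasSizes s n l m lam g)
include h

theorem costBound_syndrome_le : syndrome.costBound s ≤ 12 * bound n m lam g := by
  have e : syndrome.costBound s = 1 + (n * m + (m - 1) * (n * (m * 3)) + (lam * m +
      (m - 1) * (lam * (m * 3)) + n * m * (l * (m * 3)))) := by
    simp [syndrome, powers, costBound_fill, costBound_accumulate, costBound, RingExp.ops,
      h.int0, ← h.sub, h.int2, h.int3]
  have hg : 1 ≤ g ^ 4 := Nat.pow_pos h.pos_g
  have hn : n ≤ max n m := le_max_left _ _
  have hm : m ≤ max n m := le_max_right _ _
  have h1 : 1 ≤ max n m := h.pos_m.trans hm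
  have b1 := h.mul_le_bound h.pos_lam h.pos_m h.pos_n (mul_le_max_sq h1 h1) hg
  have b2 := h.mul_le_bound h.pos_lam le_rfl le_rfl (mul_le_max_sq h1 h1) hg
  have b3 := h.mul_le_bound h.pos_lam (Nat.sub_le m 1) le_rfl (mul_le_max_sq hm h1) hg
  have b4 := h.mul_le_bound le_rfl le_rfl h.pos_n (mul_le_max_sq h1 h1) hg
  have b5 := h.mul_le_bound le_rfl (Nat.sub_le m 1) h.pos_n (mul_le_max_sq hm h1) hg
  have b6 := h.mul_le_bound h.pos_lam le_rfl le_rfl (mul_le_max_sq (h.le.trans hn) hm) hg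
  rw [e]
  linarith

theorem costBound_reduceSyndrome_le : reduceSyndrome.costBound s ≤ 22 * bound n m lam g := by
  have hg : 1 ≤ g ^ 4 := Nat.pow_pos h.pos_g
  have hn : n ≤ max n m := le_max_left _ _
  have hm : m ≤ max n m := le_max_right _ _
  have h1 : 1 ≤ max n m := h.pos_m.trans hm
  have k1 := costBound_eliminate_le s (N₀ := ivar 0 - ivar 1)
    (N := ivar 0 - ivar 1 + ivar 3 * ivar 2)
    (L := ivar 2) (W := ivar 2) (by simp) le_rfl (by simp [h.int2, Nat.succ_le_iff.1 h.pos_m])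
  have e : reduceSyndrome.costBound s = l * m + (lam * m * m + (eliminate (ivar 0 - ivar 1)
      (ivar 0 - ivar 1 + ivar 3 * ivar 2) (ivar 2) (ivar 2)).costBound s) := by
    simp [reduceSyndrome, costBound_fill, costBound, RingExp.ops, h.int0, ← h.sub, h.int2, h.int3]
  simp only [IntExp.eval_sub, IntExp.eval_add, IntExp.eval_mul, IntExp.eval_get,
    IntExp.eval_ofNat, h.int0, h.sub, h.int2, h.int3] at k1
  have b1 := h.mul_le_bound h.pos_lam le_rfl h.le (mul_le_max_sq h1 h1) hg
  have b2 := h.mul_le_bound le_rfl le_rfl h.pos_n (mul_le_max_sq hm h1) hg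
  have b3 := h.mul_le_bound h.pos_lam le_rfl h.le (mul_le_max_sq (h.le.trans hn) h1) hg
  have b4 := h.mul_le_bound le_rfl le_rfl h.le (mul_le_max_sq hm h1) hg
  rw [e]
  linarith

theorem costBound_reduceSupport_le : reduceSupport.costBound s ≤ 23 * bound n m lam g := by
  have hg : 1 ≤ g ^ 4 := Nat.pow_pos h.pos_g
  have hm : m ≤ max n m := le_max_right _ _
  have h1 : 1 ≤ max n m := h.pos_m.trans hm
  have k1 := costBound_eliminate_le s (N₀ := ivar 2) (N := ivar 2) (L := ivar 3 * ivar 2)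
    (W := ivar 3 * ivar 2 + ivar 2) le_rfl (by simp) (by simp [h.int2, Nat.succ_le_iff.1 h.pos_m])
  have e : reduceSupport.costBound s = lam * m * m + (m * (lam * m) + (m * m +
      (eliminate (ivar 2) (ivar 2) (ivar 3 * ivar 2) (ivar 3 * ivar 2 + ivar 2)).costBound s)) := by
    simp [reduceSupport, costBound_fill, costBound, RingExp.ops, h.int2, h.int3]
  simp only [IntExp.eval_add, IntExp.eval_mul, IntExp.eval_get, IntExp.eval_ofNat, h.int2,
    h.int3] at k1
  have b1 := h.mul_le_bound le_rfl le_rfl h.pos_n (mul_le_max_sq hm h1) hg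
  have b2 := h.mul_le_bound h.pos_lam le_rfl h.pos_n (mul_le_max_sq hm h1) hg
  have b3 := h.mul_le_bound le_rfl le_rfl h.pos_n (mul_le_max_sq hm hm) hg
  have b4 := h.mul_le_bound h.pos_lam le_rfl h.pos_n (mul_le_max_sq hm hm) hg
  rw [e]
  linarith

theorem costBound_products_le (h11 : s 11 0 = q) (hq : q ≤ m) (hqn : q * lam ≤ n) :
    products.costBound s ≤ 4 * bound n m lam g := by
  have hg : 1 ≤ g ^ 4 := Nat.pow_pos h.pos_g
  have hm : m ≤ max n m := le_max_right _ _
  have h1 : 1 ≤ max n m := h.pos_m.trans hm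
  have e : products.costBound s = q * m + m * (q * lam * (m * 3)) := by
    simp [products, costBound_fill, costBound_accumulate, costBound, RingExp.ops, h.int2,
      h.int3, h11]
  have b1 := h.mul_le_bound h.pos_lam le_rfl h.pos_n (mul_le_max_sq (hq.trans hm) h1) hg
  have b2 := h.mul_le_bound h.pos_lam le_rfl hqn (mul_le_max_sq hm h1) hg
  rw [e]
  linarith

theorem costBound_coordinates_le {N₀ N : IntExp} {x t : RingExp} {out : ℕ} {n₀ n₁ : ℕ}
    (h0 : N₀.eval s = n₀) (h1 : N.eval s = n₁) (hx : x.ops = 0) (ht : t.ops = 0) :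
    (coordinates N₀ N x t out).costBound s ≤ n₀ * m + (n₁ * m + ((n₀ + n₁) * n₀ +
      (10 * (n₀ * (n₀ + n₁) * (m + n₀)) + n₁ * n₀))) := by
  have k1 := costBound_eliminate_le s (N₀ := N₀) (N := N₀ + N) (L := ivar 2) (W := ivar 2 + N₀)
    (by simp) (by simp) (by simp [h.int2, Nat.succ_le_iff.1 h.pos_m])
  have e : (coordinates N₀ N x t out).costBound s = n₀ * m + (n₁ * m + ((n₀ + n₁) * n₀ +
      ((eliminate N₀ (N₀ + N) (ivar 2) (ivar 2 + N₀)).costBound s + n₁ * n₀))) := by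
    simp [coordinates, costBound_fill, costBound, RingExp.ops, h.int2, h0, h1,
      hx, ht]
  simp only [IntExp.eval_add, IntExp.eval_get, IntExp.eval_ofNat, h.int2, h0, h1] at k1
  rw [e]
  linarith

theorem costBound_checkCoordinates_le : checkCoordinates.costBound s ≤ 50 * bound n m lam g := by
  have hg : 1 ≤ g ^ 4 := Nat.pow_pos h.pos_g
  have hn : n ≤ max n m := le_max_left _ _
  have hm : m ≤ max n m := le_max_right _ _
  have h1 : 1 ≤ max n m := h.pos_m.trans hm
  have hl := h.lam_le.trans hm
  have k1 := costBound_coordinates_le h (N₀ := ivar 3) (N := (ivar 0 - ivar 1) * ivar 0)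
    (x := RingExp.get 2 (ivar 30) 0 (ivar 31))
    (t := RingExp.get 1 (ivar 30 / ivar 0) ((ivar 30).mod (ivar 0)) (ivar 31)) (out := 13)
    (n₀ := lam) (n₁ := l * n) h.int3 (by simp [h.int0, h.sub]) rfl rfl
  have b1 := h.mul_le_bound le_rfl le_rfl h.pos_n (mul_le_max_sq h1 h1) hg
  have b2 := h.mul_le_bound h.pos_lam le_rfl le_rfl (mul_le_max_sq (h.le.trans hn) h1) hg
  have b3 := h.mul_le_bound le_rfl h.lam_le h.pos_n (mul_le_max_sq h1 h1) hg
  have b4 := h.mul_le_bound le_rfl h.pos_m le_rfl (mul_le_max_sq (h.le.trans hn) h1) hg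
  have b5 := h.mul_le_bound le_rfl le_rfl h.pos_n (mul_le_max_sq hl h1) hg
  have b6 := h.mul_le_bound le_rfl h.lam_le h.pos_n (mul_le_max_sq hl h1) hg
  have b7 := h.mul_le_bound le_rfl le_rfl le_rfl (mul_le_max_sq (h.le.trans hn) h1) hg
  have b8 := h.mul_le_bound le_rfl h.lam_le le_rfl (mul_le_max_sq (h.le.trans hn) h1) hg
  rw [checkCoordinates]
  linarith

theorem costBound_syndromeCoordinates_le (h11 : s 11 0 = q) (hqn : q * lam ≤ n) :
    syndromeCoordinates.costBound s ≤ 50 * bound n m lam g := by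
  have hg : 1 ≤ g ^ 4 := Nat.pow_pos h.pos_g
  have hn : n ≤ max n m := le_max_left _ _
  have hm : m ≤ max n m := le_max_right _ _
  have h1 : 1 ≤ max n m := h.pos_m.trans hm
  obtain ⟨t, ht⟩ : ∃ t, t = q * lam := ⟨_, rfl⟩
  rw [← ht] at hqn
  have k1 := costBound_coordinates_le h (N₀ := ivar 11 * ivar 3) (N := ivar 0 - ivar 1)
    (x := RingExp.get 15 (ivar 30) 0 (ivar 31)) (t := RingExp.get 10 (ivar 30) 0 (ivar 31))
    (out := 14) (n₀ := t) (n₁ := l) (by simp [h.int3, h11, ht]) (by simp [h.int0, h.sub]) rfl rfl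
  have b1 := h.mul_le_bound h.pos_lam le_rfl hqn (mul_le_max_sq h1 h1) hg
  have b2 := h.mul_le_bound h.pos_lam le_rfl h.le (mul_le_max_sq h1 h1) hg
  have b3 := h.mul_le_bound h.pos_lam h.pos_m hqn (mul_le_max_sq (hqn.trans hn) h1) hg
  have b4 := h.mul_le_bound h.pos_lam h.pos_m h.le (mul_le_max_sq (hqn.trans hn) h1) hg
  have b5 := h.mul_le_bound h.pos_lam le_rfl hqn (mul_le_max_sq (hqn.trans hn) h1) hg
  have b6 := h.mul_le_bound h.pos_lam le_rfl h.le (mul_le_max_sq (hqn.trans hn) h1) hg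
  have b7 := h.mul_le_bound h.pos_lam h.pos_m hqn (mul_le_max_sq (hqn.trans hn) (hqn.trans hn)) hg
  have b8 := h.mul_le_bound h.pos_lam h.pos_m h.le (mul_le_max_sq (hqn.trans hn) (hqn.trans hn)) hg
  rw [syndromeCoordinates]
  linarith

theorem costBound_solveSystem_le (h11 : s 11 0 = q) (hqn : q ≤ n) :
    solveSystem.costBound s ≤ 100 * bound n m lam g := by
  have hg : 1 ≤ g ^ 4 := Nat.pow_pos h.pos_g
  have hg1 : g ≤ g ^ 4 := Nat.le_self_pow (by decide) g
  have hg2 : g * g ≤ g ^ 4 := by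
    rw [← pow_two]; exact Nat.pow_le_pow_right h.pos_g (by decide)
  have hn : n ≤ max n m := le_max_left _ _
  have hm : m ≤ max n m := le_max_right _ _
  have h1 : 1 ≤ max n m := h.pos_m.trans hm
  have hl := h.le.trans hn
  have k1 := costBound_baseEliminate_le s (N₀ := ivar 0 * ivar 4) (N := ivar 0 * ivar 4 + ivar 11)
    (L := (ivar 0 - ivar 1) * ivar 3) (W := (ivar 0 - ivar 1) * ivar 3 + ivar 0) (by simp)
    (by simp [h.int0, h.int4, Nat.succ_le_iff.1 h.pos_n, Nat.succ_le_iff.1 h.pos_g])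
    (by simp [h.int0, Nat.succ_le_iff.1 h.pos_n])
  have e : solveSystem.costBound s = n * g * (l * lam * 2) + (n * g * (n * 2) + (q * (l * lam) +
      (q * n + ((baseEliminate (ivar 0 * ivar 4) (ivar 0 * ivar 4 + ivar 11)
        ((ivar 0 - ivar 1) * ivar 3) ((ivar 0 - ivar 1) * ivar 3 + ivar 0)).costBound s +
        q * (l * lam))))) := by
    simp [solveSystem, costBound_fill, costBound_search, costBound, RingExp.ops, h.int0, ← h.sub,
      h.int3, h.int4, h11]
  simp only [IntExp.eval_sub, IntExp.eval_add, IntExp.eval_mul, IntExp.eval_get,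
    IntExp.eval_ofNat, h.int0, h.sub, h.int3, h.int4, h11] at k1
  have b1 := h.mul_le_bound le_rfl h.pos_m le_rfl (mul_le_max_sq hl h1) hg1
  have b2 := h.mul_le_bound h.pos_lam h.pos_m le_rfl (mul_le_max_sq hn h1) hg1
  have b3 := h.mul_le_bound le_rfl h.pos_m hqn (mul_le_max_sq hl h1) hg
  have b4 := h.mul_le_bound h.pos_lam h.pos_m le_rfl (mul_le_max_sq (hqn.trans hn) h1) hg
  have b5 := h.mul_le_bound le_rfl h.lam_le le_rfl (mul_le_max_sq hl hl) hg2
  have b6 := h.mul_le_bound le_rfl h.pos_m le_rfl (mul_le_max_sq hl hn) hg2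
  have b7 := h.mul_le_bound le_rfl h.lam_le hqn (mul_le_max_sq hl hl) hg1
  have b8 := h.mul_le_bound le_rfl h.pos_m hqn (mul_le_max_sq hl hn) hg1
  rw [e]
  linarith

theorem costBound_chooseSolution_le (h11 : s 11 0 = q) (hq : q ≤ m) (hqn : q ≤ n) :
    chooseSolution.costBound s ≤ 60 * bound n m lam g := by
  have hg : 1 ≤ g ^ 4 := Nat.pow_pos h.pos_g
  have hg1 : g ≤ g ^ 4 := Nat.le_self_pow (by decide) g
  have hn : n ≤ max n m := le_max_left _ _
  have hm : m ≤ max n m := le_max_right _ _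
  have h1 : 1 ≤ max n m := h.pos_m.trans hm
  have hqN := hqn.trans hn
  have k1 := costBound_eliminate_le s (N₀ := ivar 11) (N := ivar 11 + (ivar 0 * ivar 4 + 1))
    (L := ivar 0) (W := ivar 0) (by simp) le_rfl (by simp [h.int0, Nat.succ_le_iff.1 h.pos_n])
  have e : chooseSolution.costBound s = n * g * n + (q * (n * 2) + q * (q * n +
      ((n * g + 1) * (n * 2) + ((eliminate (ivar 11) (ivar 11 + (ivar 0 * ivar 4 + 1)) (ivar 0)
        (ivar 0)).costBound s + ((n * g + 1) * (n * 2) + n * 2))))) := by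
    simp [chooseSolution, chooseRow, costBound_fill, costBound_search, costBound, RingExp.ops,
      h.int0, h.int4, h11]
  simp only [IntExp.eval_add, IntExp.eval_mul, IntExp.eval_get,
    IntExp.eval_ofNat, h.int0, h.int4, h11] at k1
  have k2 := Nat.mul_le_mul_left q k1
  have b1 := h.mul_le_bound h.pos_lam h.pos_m le_rfl (mul_le_max_sq hn h1) hg1
  have b2 := h.mul_le_bound h.pos_lam hq le_rfl (mul_le_max_sq h1 h1) hg
  have b3 := h.mul_le_bound h.pos_lam hq le_rfl (mul_le_max_sq hqN h1) hg
  have b4 := h.mul_le_bound h.pos_lam hq le_rfl (mul_le_max_sq hn h1) hg1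
  have b5 := h.mul_le_bound h.pos_lam hq le_rfl (mul_le_max_sq hqN hqN) hg
  have b6 := h.mul_le_bound h.pos_lam hq le_rfl (mul_le_max_sq hqN hn) hg1
  rw [e]
  linarith

theorem costBound_output_le (h11 : s 11 0 = q) (hq : q ≤ m) :
    output.costBound s ≤ 5 * bound n m lam g := by
  have hg : 1 ≤ g ^ 4 := Nat.pow_pos h.pos_g
  have hm : m ≤ max n m := le_max_right _ _
  have h1 : 1 ≤ max n m := h.pos_m.trans hm
  have e : output.costBound s = n * m + q * (n * (m * 4)) := by
    simp [output, costBound_fill, costBound_accumulate, costBound, RingExp.ops, h.int0,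
      h.int2, h11]
  have b1 := h.mul_le_bound h.pos_lam le_rfl le_rfl (mul_le_max_sq h1 h1) hg
  have b2 := h.mul_le_bound h.pos_lam le_rfl le_rfl (mul_le_max_sq (hq.trans hm) h1) hg
  rw [e]
  linarith

theorem costBound_findError_le (h11 : s 11 0 = q) (hq : q ≤ m) (hqn : q * lam ≤ n) :
    findError.costBound s ≤ 269 * bound n m lam g := by
  have hqn' : q ≤ n := (Nat.le_mul_of_pos_right _ h.pos_lam).trans hqn
  have e : findError.costBound s = products.costBound s + (checkCoordinates.costBound s +
      (syndromeCoordinates.costBound s + (solveSystem.costBound s + (chooseSolution.costBound s +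
        output.costBound s)))) := rfl
  rw [e]
  linarith [costBound_products_le h h11 hq hqn, costBound_checkCoordinates_le h,
    costBound_syndromeCoordinates_le h h11 hqn, costBound_solveSystem_le h h11 hqn',
    costBound_chooseSolution_le h h11 hq hqn', costBound_output_le h h11 hq]

end Bound

end Prog

/-! ### The cost of the decoder -/

section Stage

variable {R : Type*} [CommRing R] [IsLocalRing R] (G : GaloisFrame R) {m : ℕ}
  {E : GaloisExtension R m} {n k lam : ℕ} {H : ℕ → ℕ → E.Ext} {f r : ℕ → E.Ext}

namespace Prog

theorem cost_le (P : Prog) (hP : P.static = true) (M : Memory R) :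
    (P.run G M).2 ≤ P.costBound M.int :=
  (run_snd_le_costBound G P hP M fun _ _ => rfl).2

variable (hm : 0 < m) (hlam : 0 < lam) (hn : 0 < n) (hlm : lam ≤ m)
include hm hlam hn hlm

theorem _root_.IsInput.hasSizes [Finite R] {M : Memory R} (h : IsInput G E n k lam H f r M) :
    HasSizes M.int n (n - k) m lam G.gamma :=
  ⟨h.int0, by rw [h.int1], h.int2, h.int3, h.int4, Nat.sub_le _ _, hn, hm, hlam, G.gamma_pos, hlm⟩

/-- The program is not static as a whole, because the size `11[0]`, the rank of the support of the
error, is set in between; the parts before and after this assignment are static. -/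
theorem cost_findSupport_le [Finite R] {M : Memory R} (h : IsInput G E n k lam H f r M)
    (h7 : ∀ d, M.ring 7 d 0 0 = if d = 0 then 1 else 0) :
    (findSupport.run G M).2 ≤ 293 * bound n m lam G.gamma := by
  have hs := h.hasSizes G hm hlam hn hlm
  rw [findSupport, run_seq_snd, run_seq_snd, run_seq_snd]
  obtain ⟨M1, hM1⟩ : ∃ M', M' = (reduceSupport.run G M).1 := ⟨_, rfl⟩
  rw [← hM1]
  have i1 := h.run G reduceSupport (by decide)
  rw [← hM1] at i1
  obtain ⟨A₀, hE, -, -⟩ := run_reduceSupport G h hm h7 hM1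
  have hq := hE.le
  obtain ⟨M2, hM2⟩ : ∃ M', M' = ((setInt 11 0 (ivar 38)).run G M1).1 := ⟨_, rfl⟩
  rw [← hM2]
  have i2 := i1.run G (setInt 11 0 (ivar 38)) (by decide)
  rw [← hM2] at i2
  have q2 : M2.int 11 0 = M1.int 38 0 := by rw [hM2, run_setInt]; exact Memory.setInt_int_same ..
  rw [← q2] at hq
  obtain ⟨M3, hM3⟩ : ∃ M', M' = ((searchRest (ivar 11) (ivar 3 * ivar 2)).run G M2).1 := ⟨_, rfl⟩
  rw [← hM3]
  have i3 := i2.run G (searchRest (ivar 11) (ivar 3 * ivar 2)) (by decide)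
  rw [← hM3] at i3
  have q3 : M3.int 11 0 = M2.int 11 0 := by rw [hM3, run_int G _ _ rfl]
  have c1 := (cost_le G reduceSupport rfl M).trans (costBound_reduceSupport_le hs)
  have c2 : ((setInt 11 0 (ivar 38)).run G M1).2 = 0 := rfl
  have c3 : ((searchRest (ivar 11) (ivar 3 * ivar 2)).run G M2).2 ≤ bound n m lam G.gamma := by
    refine (cost_le G _ rfl M2).trans ?_
    rw [searchRest, costBound_search]
    simp only [IntExp.eval_get, IntExp.eval_mul, IntExp.eval_ofNat, RingExp.ops_get, i2.int2,
      i2.int3]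
    have b := hs.mul_le_bound le_rfl hq hs.pos_n
      (mul_le_max_sq (le_max_right n m) (hs.pos_m.trans (le_max_right n m)))
      (Nat.pow_pos hs.pos_g)
    rw [Nat.succ_eq_add_one] at b
    linarith
  have c4 : ((branch (ivar 33) 0 (branch (ivar 11 * ivar 3) (ivar 0 - ivar 1 - ivar 10)
      (branch (ivar 0 - ivar 1 - ivar 10) (ivar 11 * ivar 3) findError skip) skip) skip).run
        G M3).2 ≤ 269 * bound n m lam G.gamma := by
    by_cases hb : (ivar 33).eval M3.int ≤ IntExp.eval M3.int 0
    swap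
    · rw [run_branch_neg G hb]; exact Nat.zero_le _
    rw [run_branch_pos G hb]
    by_cases hb : (ivar 11 * ivar 3).eval M3.int ≤ (ivar 0 - ivar 1 - ivar 10).eval M3.int
    swap
    · rw [run_branch_neg G hb]; exact Nat.zero_le _
    rw [run_branch_pos G hb]
    have hqn : M3.int 11 0 * lam ≤ n := by
      simp only [IntExp.eval_mul, IntExp.eval_sub, IntExp.eval_get, IntExp.eval_ofNat, i3.int3,
        i3.int0] at hb
      omega
    by_cases hb : (ivar 0 - ivar 1 - ivar 10).eval M3.int ≤ (ivar 11 * ivar 3).eval M3.int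
    swap
    · rw [run_branch_neg G hb]; exact Nat.zero_le _
    rw [run_branch_pos G hb]
    exact (cost_le G findError rfl M3).trans
      (costBound_findError_le (i3.hasSizes G hm hlam hn hlm) rfl (q3.trans_le hq) hqn)
  rw [c2]
  linarith

/-- As before, the parts before and after the assignment of the size `10[0]`, the number of rows
without a pivot, are treated separately. -/
theorem cost_decoder_le [Finite R] {M : Memory R} (h : IsInput G E n k lam H f r M)
    (h0 : ∀ b, 5 < b → M.ring b = 0) :
    (decoder.run G M).2 ≤ 328 * bound n m lam G.gamma := by
  have hs := h.hasSizes G hm hlam hn hlm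
  rw [decoder, run_seq_snd, run_seq_snd, run_seq_snd, run_seq_snd]
  obtain ⟨M1, hM1⟩ : ∃ M', M' = (syndrome.run G M).1 := ⟨_, rfl⟩
  rw [← hM1]
  have i1 := h.run G syndrome (by decide)
  rw [← hM1] at i1
  obtain ⟨s7, s9, s10⟩ := run_syndrome G hm h (fun d => by rw [h0 7 (by decide)]; rfl)
    (h0 8 (by decide)) (h0 9 (by decide)) (h0 10 (by decide)) hM1
  obtain ⟨M2, hM2⟩ : ∃ M', M' = (reduceSyndrome.run G M1).1 := ⟨_, rfl⟩
  rw [← hM2]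
  have i2 := i1.run G reduceSyndrome (by decide)
  rw [← hM2] at i2
  obtain ⟨A₀, hE, -, -⟩ := run_reduceSyndrome G i1 hm s7 s9 s10 hM2
  have hq := hE.le
  obtain ⟨M3, hM3⟩ : ∃ M', M' = ((setInt 10 0 (ivar 38)).run G M2).1 := ⟨_, rfl⟩
  rw [← hM3]
  have i3 := i2.run G (setInt 10 0 (ivar 38)) (by decide)
  rw [← hM3] at i3
  have q3 : M3.int 10 0 = M2.int 38 0 := by rw [hM3, run_setInt]; exact Memory.setInt_int_same ..
  rw [← q3] at hq
  obtain ⟨M4, hM4⟩ : ∃ M', M' = ((searchRest (ivar 10) (ivar 2)).run G M3).1 := ⟨_, rfl⟩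
  rw [← hM4]
  have i4 := i3.run G (searchRest (ivar 10) (ivar 2)) (by decide)
  rw [← hM4] at i4
  have r4 : ∀ d, M4.ring 7 d 0 0 = if d = 0 then 1 else 0 := fun d => by
    have e3 : M3.ring 7 = M2.ring 7 := by rw [hM3, run_ring G _ _ rfl]
    have e2 : M2.ring 7 = M1.ring 7 := by rw [hM2, run_ring G _ _ rfl]
    rw [hM4, run_ring G _ _ rfl, e3, e2, s7]
  have c1 := (cost_le G syndrome rfl M).trans (costBound_syndrome_le hs)
  have c2 := (cost_le G reduceSyndrome rfl M1).trans
    (costBound_reduceSyndrome_le (i1.hasSizes G hm hlam hn hlm))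
  have c3 : ((setInt 10 0 (ivar 38)).run G M2).2 = 0 := rfl
  have c4 : ((searchRest (ivar 10) (ivar 2)).run G M3).2 ≤ bound n m lam G.gamma := by
    refine (cost_le G _ rfl M3).trans ?_
    rw [searchRest, costBound_search]
    simp only [IntExp.eval_get, IntExp.eval_ofNat, RingExp.ops_get, i3.int2]
    have h1 := hs.pos_m.trans (le_max_right n m)
    have b := hs.mul_le_bound hs.pos_lam le_rfl (hq.trans (Nat.sub_le _ _))
      (mul_le_max_sq h1 h1) (Nat.pow_pos hs.pos_g)
    rw [Nat.succ_eq_add_one] at b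
    linarith
  have c5 : ((branch (ivar 33) 0 findSupport skip).run G M4).2 ≤
      293 * bound n m lam G.gamma := by
    by_cases hb : (ivar 33).eval M4.int ≤ IntExp.eval M4.int 0
    swap
    · rw [run_branch_neg G hb]; exact Nat.zero_le _
    rw [run_branch_pos G hb]
    exact cost_findSupport_le G hm hlam hn hlm i4 r4
  rw [c3]
  linarith

end Prog

/-! ### The local components -/

/-- The memory at the start contains the input, continued by zeros. -/
theorem isInput_inputMemory (Hm : Matrix (Fin (n - k)) (Fin n) E.Ext) (fm : Fin lam → E.Ext)
    (rm : Fin n → E.Ext) :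
    IsInput G E n k lam (fun i j => pad (fun i' => pad (Hm i') j) i) (pad fm) (pad rm)
      (inputMemory G E Hm fm rm) := by
  have h0 : ∀ c, E.coord 0 c = 0 := fun c => by simp [GaloisExtension.coord]
  have hpad : ∀ {d : ℕ} (v : Fin d → E.Ext) (i c : ℕ),
      pad (fun i' => E.coord (v i')) i c = E.coord (pad v i) c := by
    intro d v i c
    unfold pad
    split
    · rfl
    · rw [h0]; rfl
  refine ⟨rfl, rfl, rfl, rfl, rfl, fun _ => rfl, fun i j c => ?_, fun i c => hpad fm i c,
    fun i c => hpad rm i c, fun _ => rfl, fun _ => rfl⟩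
  change (pad (fun i' => pad (fun j' => E.coord (Hm i' j')) j) i : ℕ → R) c = _
  unfold pad
  split
  · split
    · rfl
    · rw [h0]; rfl
  · rw [h0]; rfl

theorem pad_fin {α : Type*} [Zero α] {d : ℕ} (v : Fin d → α) (i : Fin d) : pad v i = v i :=
  dif_pos i.2

theorem ofEntries_pad {S : Type*} [Zero S] {l n : ℕ} (Hm : Matrix (Fin l) (Fin n) S) :
    ofEntries l n (fun i j => pad (fun i' => pad (Hm i') j) i) = Hm := by
  ext i j
  change pad (fun i' => pad (Hm i') j) i = _
  rw [pad_fin, pad_fin]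

/-- The decoder is correct, and its cost is bounded. -/
theorem decoder_spec [Finite R] (hm : 0 < m) (hlam : 0 < lam) (hn : 0 < n)
    (Hm : Matrix (Fin (n - k)) (Fin n) E.Ext) (fm : Fin lam → E.Ext) (rm : Fin n → E.Ext)
    (hf : LinearIndependent R fm)
    (hspan : Submodule.span R (Set.range fm) = entrySpan R Hm)
    {A : Memory R × ℕ} (hA : A = Prog.decoder.run G (inputMemory G E Hm fm rm)) :
    ((A.1.int 5 0 = 1 ∧ (some fun i : Fin n => E.ofCoord fun c => A.1.ring 6 i 0 c) ∈
        localDecoder R Hm fm rm) ∨ (A.1.int 5 0 ≠ 1 ∧ none ∈ localDecoder R Hm fm rm)) ∧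
      A.2 ≤ 328 * Prog.bound n m lam G.gamma := by
  have hI := isInput_inputMemory G (k := k) Hm fm rm
  have ef : (fun b : Fin lam => pad fm b) = fm := funext fun b => pad_fin fm b
  have er : (fun j : Fin n => pad rm j) = rm := funext fun b => pad_fin rm b
  have eH := ofEntries_pad Hm
  have h0 : ∀ b, 5 < b → (inputMemory G E Hm fm rm).ring b = 0 := by
    intro b hb
    obtain ⟨b, rfl⟩ : ∃ b', b = b' + 6 := ⟨b - 6, by omega⟩
    rfl
  have hunit := E.isUnit_of_linearIndependent hf
  have hfin : Finite E.Ext := inferInstance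
  refine ⟨?_, ?_⟩
  · have key := Prog.isCorrect_decoder G hI hm hlam hn rfl rfl h0 (by rw [ef]; exact hf)
      (by rw [ef, eH]; exact hspan) (M' := A.1) (by rw [hA])
    rw [Prog.IsCorrect, ef, er, eH] at key
    rcases key with ⟨h1, e, he, hout⟩ | ⟨h1, h2⟩
    · refine Or.inl ⟨h1, ?_⟩
      convert he.some_mem hlam hunit using 2
      funext i
      rw [hout i, pad_fin]
      rfl
    · exact Or.inr ⟨by rw [h1]; decide, none_mem_of_forall_not_isDecodingError hlam hunit h2⟩
  · rw [hA]
    exact Prog.cost_decoder_le G hm hlam hn (E.card_le_of_linearIndependent hf) hI h0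

end Stage

/-! ### Components of codes over a product of rings -/

section Product

variable {rho : ℕ} {R S : Fin rho → Type*} [∀ j, CommRing (R j)] [∀ j, CommRing (S j)]
  [∀ j, Algebra (R j) (S j)]

theorem linearIndependent_component {lam : ℕ} {f : Fin lam → ∀ j, S j}
    (hf : LinearIndependent (∀ j, R j) f) (j : Fin rho) :
    LinearIndependent (R j) fun i => f i j := by
  rw [Fintype.linearIndependent_iff] at hf ⊢
  intro g hg i
  have h := hf (fun i => Pi.single j (g i)) ?_ i
  · have := congrFun h j
    simpa using this
  · funext j'
    rw [Finset.sum_apply]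
    by_cases hj : j' = j
    · subst hj
      simpa using hg
    · exact Finset.sum_eq_zero fun i _ => by
        change (Pi.single j (g i) : ∀ j, R j) j' • f i j' = 0
        rw [Pi.single_eq_of_ne hj, zero_smul]

theorem span_component {X : Set (∀ j, S j)} (j : Fin rho) :
    (fun x : ∀ j, S j => x j) '' (Submodule.span (∀ j, R j) X : Set (∀ j, S j)) =
      (Submodule.span (R j) ((fun x : ∀ j, S j => x j) '' X) : Set (S j)) := by
  ext y
  constructor
  · rintro ⟨x, hx, rfl⟩
    induction hx using Submodule.span_induction with
    | mem x hx => exact Submodule.subset_span ⟨x, hx, rfl⟩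
    | zero => exact Submodule.zero_mem _
    | add x y _ _ hx hy => exact Submodule.add_mem _ hx hy
    | smul a x _ hx => exact Submodule.smul_mem _ (a j) hx
  · intro hy
    induction hy using Submodule.span_induction with
    | mem y hy =>
      obtain ⟨x, hx, rfl⟩ := hy
      exact ⟨x, Submodule.subset_span hx, rfl⟩
    | zero => exact ⟨0, Submodule.zero_mem _, rfl⟩
    | add x y _ _ hx hy =>
      obtain ⟨x', hx', rfl⟩ := hx
      obtain ⟨y', hy', rfl⟩ := hy
      exact ⟨x' + y', Submodule.add_mem _ hx' hy', rfl⟩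
    | smul a x _ hx =>
      obtain ⟨x', hx', rfl⟩ := hx
      refine ⟨(Pi.single j a : ∀ j, R j) • x', Submodule.smul_mem _ _ hx', ?_⟩
      change (Pi.single j a : ∀ j, R j) j • x' j = _
      rw [Pi.single_eq_same]

theorem span_eq_entrySpan_component {l n lam : ℕ} {H : Matrix (Fin l) (Fin n) (∀ j, S j)}
    {f : Fin lam → ∀ j, S j}
    (h : Submodule.span (∀ j, R j) (Set.range f) = entrySpan (∀ j, R j) H) (j : Fin rho) :
    Submodule.span (R j) (Set.range fun i => f i j) =
      entrySpan (R j) (H.map fun x => x j) := by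
  apply SetLike.coe_injective
  have h1 := congrArg (fun N : Submodule (∀ j, R j) (∀ j, S j) =>
    (fun x : ∀ j, S j => x j) '' (N : Set (∀ j, S j))) h
  simp only [entrySpan, span_component] at h1
  have e1 : (fun x : ∀ j, S j => x j) '' Set.range f = Set.range fun i => f i j :=
    (Set.range_comp _ _).symm
  have e2 : (fun x : ∀ j, S j => x j) '' {x | ∃ i i', H i i' = x} =
      {x | ∃ i i', H.map (fun x => x j) i i' = x} := by
    ext y
    constructor
    · rintro ⟨_, ⟨i, i', rfl⟩, rfl⟩
      exact ⟨i, i', rfl⟩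
    · rintro ⟨i, i', rfl⟩
      exact ⟨_, ⟨i, i', rfl⟩, rfl⟩
  rw [e1, e2] at h1
  exact h1

end Product

theorem mainTheorem6 :
    ∃ (P : Prog) (C : ℕ), ∀ (rho m k n lam : ℕ), 0 < rho → 0 < m →
      ∀ (R : Fin rho → Type*) [∀ j, CommRing (R j)] [∀ j, Finite (R j)] [∀ j, IsLocalRing (R j)]
        (G : ∀ j, GaloisFrame (R j)) (E : ∀ j, GaloisExtension (R j) m)
        (H : Matrix (Fin (n - k)) (Fin n) (∀ j, (E j).Ext)) (f : Fin lam → ∀ j, (E j).Ext),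
        IsLRPC (∀ j, R j) H f →
        ∀ r : Fin n → ∀ j, (E j).Ext,
          productResult P G E H f r ∈ productDecoder R (fun j => (E j).Ext) H f r ∧
          productCost P G E H f r ≤
            C * (rho * lam * m * n * max (n ^ 2) (m ^ 2) *
              Finset.univ.sup fun j => (G j).gamma ^ 4) := by
  refine ⟨Prog.decoder, 328, ?_⟩
  intro rho m k n lam _ hm R _ _ _ G E H f hC r
  obtain ⟨hk, hkn, hlam, -, hf, hspan⟩ := hC
  have hn : 0 < n := hk.trans hkn
  have key := fun j => decoder_spec (G j) (E := E j) (k := k) hm hlam hn (H.map fun x => x j)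
    (fun i => f i j) (fun i => r i j) (linearIndependent_component hf j)
    (span_eq_entrySpan_component hspan j)
    (A := componentRun Prog.decoder G E H f r j) rfl
  constructor
  · rw [productResult]
    split
    · rename_i h
      refine Or.inl ⟨_, rfl, fun j => ?_⟩
      rcases (key j).1 with h1 | h1
      · exact h1.2
      · exact absurd (h j) h1.1
    · rename_i h
      push Not at h
      obtain ⟨j, hj⟩ := h
      refine Or.inr ⟨rfl, j, ?_⟩
      rcases (key j).1 with h1 | h1
      · exact absurd h1.1 hj
      · exact h1.2
  · have h1 : ∀ j ∈ Finset.univ, (componentRun Prog.decoder G E H f r j).2 ≤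
        328 * (lam * m * n * max (n ^ 2) (m ^ 2) *
          Finset.univ.sup fun j => (G j).gamma ^ 4) := fun j hj =>
      (key j).2.trans (Nat.mul_le_mul_left _ (Nat.mul_le_mul_left _
        (Finset.le_sup (f := fun j => (G j).gamma ^ 4) hj)))
    refine (Finset.sum_le_card_nsmul _ _ _ h1).trans (le_of_eq ?_)
    rw [Finset.card_univ, Fintype.card_fin, smul_eq_mul]
    ring
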